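/- **Setting.** Fix complex roots of unity $(\zeta_m)_{m\ge1}$, $\zeta_m$ of exact order $m$, with $\zeta_{mm'}=\zeta_m\zeta_{m'}$ for $(m,m')=1$ and $(\zeta_{p^{r+1}})^p=\zeta_{p^{r}}$ for $p$ prime and $r\ge 0$. Let $$R=\mathbb Z[x^{\pm1}][y^{\pm1},\tfrac1\delta]\big/\big(xy+(1-x^2y)(1-y)\big),\qquad \delta^2=x^2-2x-1-2x^{-1}+x^{-2},$$ an étale $\mathbb Z[x^{\pm1}]$-algebra, and $R_m=R[x^{1/m},\zeta_m]$, that is, $(R\otimes\mathbb Z[\zeta_m])[U]/(U^m-x)$. *Habiro ring.* For an étale $\mathbb Z[x^{\pm1}]$-algebra $R$, $\mathcal H_{R/\mathbb Z[x^{\pm1}]}$ is the set of collections $(f_m)_{m\ge1}$, $f_m\in R_m[\![q-\zeta_m]\!]$, such that for all $m\ge1$ and all primes $p$ $$f_m\big((q-\zeta_{pm})+(\zeta_{pm}-\zeta_m)\big)=\varphi_p f_{pm}(q-\zeta_{pm})\quad\text{in }(R_{pm})^\wedge_p[\![q-\zeta_{pm}]\!].$$ The left side is the $p$-adically convergent re-expansion,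 and $\varphi_p$ (applied to coefficients) is the endomorphism of $(R_{pm})^\wedge_p$ with $\varphi_p(x^{1/(pm)})=(x^{1/(pm)})^p$, $\varphi_p=\mathrm{id}$ on $\mathbb Z[\zeta_{pm}]$ and $\varphi_p(r)\equiv r^p \bmod p$ for $r\in R$. *Perturbative series.* The series $f_{X/\mathbb G_m}(q)$ arises by formal Gaussian integration from $$h_n(q)=\sum_{k}(-1)^{k+n}\frac{q^{k(k+1)/2+nk+n(2n+1)/2}}{(q;q)_k(q;q)_{k+2n}} .$$ Explicitly, let $z$ be a root of unity of order $m$, $q=ze^{\hbar}$, $X=x^{1/m}$ (in the role of $q^n$), $w^m=y$ and $H=1+\frac{y}{1-y}+\frac{x^2y}{1-x^2y}$. Put $$W_r=\frac{(-1)^rz^{r(r+1)/2}w^rX^r}{(zw;z)_r\,(zwX^2;z)_r},\qquad C=\Big(\frac{wX}{mH}\Big)^{1/2}\prod_{j=1}^m\big((1-z^jw)(1-z^jwX^2)\big)^{\frac12-\frac jm},$$ $$E_r(v,\hbar)=\exp\Big(\frac v2+\sum_{\substack{n,s\ge0\\ n-1+s/2>0}}\ \sum_{j=1}^m\frac{B_n(j/m)}{n!\,s!}(m\hbar)^{n-1}v^s\big(\mathrm{Li}_{2-n-s}(z^{j+r}w)+\mathrm{Li}_{2-n-s}(z^{j+r}wX^2)\big)\Big),$$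 and let $\langle\cdot\rangle$ denote termwise Gaussian integration in $v$, $\langle v^{2l}\rangle=(2l-1)!!\,(-\hbar/H)^l$ and $\langle v^{2l+1}\rangle=0$. The terms in the exponent have positive degree, where $\hbar$ has degree $1$ and $v$ degree $\frac12$. Then, up to the exponential factor $e^{V(x)/(m^2\hbar)}$ and constant phases, $$f_{z}(\hbar)=C\,e^{\hbar/12}\sum_{r=0}^{m-1}W_r\,\langle E_r(v,\hbar)\rangle .$$ The exponential and the phases cancel in the symmetrisation $f^{\mathrm{sym}}_{X/\mathbb G_m}(q)=f_{X/\mathbb G_m}(q)f_{X/\mathbb G_m}(q^{-1})$, whose expansion at $q=\zeta_me^{\hbar}$ is $f_{\zeta_m}(\hbar)\,f_{\zeta_m^{-1}}(-\hbar)$, with the same $X$, $w$ and the same branches of the fractional powers in both factors. **Theorem.** The symmetrised perturbative series $f^{\mathrm{sym}}_{X/\mathbb G_m}(q)$ of the $4_1$ knot is an element of the Habiro ring $\mathcal H_{R/\mathbb Z[x^{\pm1}]}$. That is, there is $(f_m)_{m\ge1}\in\mathcal H_{R/\mathbb Z[x^{\pm1}]}$ such that for every $m$ the substitution $q-\zeta_m=\zeta_m(e^{\hbar}-1)$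 turns $f_m$ into $f_{\zeta_m}(\hbar)f_{\zeta_m^{-1}}(-\hbar)$, at every ring homomorphism from $R_m$ to an algebraically closed field of characteristic $0$ and for every choice of $w$ with $w^m=y$ and of the branches. -/

import Mathlib

open scoped TensorProduct Polynomial LaurentPolynomial PowerSeries

noncomputable section

namespace HabiroKnot

/-! ### The Habiro ring of an étale algebra over `ℤ[x, x⁻¹]` -/

/-- A compatible collection of complex roots of unity: `ζ m` has order exactly `m`,
`ζ (m n) = ζ m * ζ n` for coprime `m`, `n`, and `(ζ (p ^ (r + 1))) ^ p = ζ (p ^ r)`. -/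
structure IsCompatibleRoots (ζ : ℕ+ → ℂ) : Prop where
  primitive : ∀ m : ℕ+, IsPrimitiveRoot (ζ m) m
  mul_coprime : ∀ m n : ℕ+, Nat.Coprime m n → ζ (m * n) = ζ m * ζ n
  pow_prime : ∀ (p : ℕ+) (r : ℕ), (p : ℕ).Prime → ζ (p ^ (r + 1)) ^ (p : ℕ) = ζ (p ^ r)

/-- The subring `ℤ[z]` of `ℂ`. -/
abbrev IntAdjoin (z : ℂ) : Subalgebra ℤ ℂ := Algebra.adjoin ℤ {z}

/-- The generator `z` of `ℤ[z]`. -/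
def IntAdjoin.gen (z : ℂ) : IntAdjoin z := ⟨z, Algebra.self_mem_adjoin_singleton ℤ z⟩

section Habiro

variable (R : Type) [CommRing R] [Algebra ℤ[T;T⁻¹] R]

/-- The image in `R` of the coordinate `x` of `ℤ[x, x⁻¹]`. -/
def xCoord : R := algebraMap ℤ[T;T⁻¹] R (LaurentPolynomial.T 1)

/-- The polynomial `U ^ m - x` over `R ⊗ ℤ[z]`. -/
def rootPoly (m : ℕ+) (z : ℂ) : (R ⊗[ℤ] IntAdjoin z)[X] :=
  Polynomial.X ^ (m : ℕ) - Polynomial.C (xCoord R ⊗ₜ[ℤ] 1)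

lemma eval₂_rootPoly {S : Type} [CommRing S] (m : ℕ+) (z : ℂ) (g : R ⊗[ℤ] IntAdjoin z →+* S)
    (u : S) : (rootPoly R m z).eval₂ g u = u ^ (m : ℕ) - g (xCoord R ⊗ₜ[ℤ] 1) := by
  simp [rootPoly]

/-- The ring `R[x^{1/m}, z] = (R ⊗ ℤ[z])[U] / (U ^ m - x)`. For `z = ζ m` this is `R_m`. -/
abbrev LevelRing (m : ℕ+) (z : ℂ) : Type := AdjoinRoot (rootPoly R m z)

variable {R}

namespace LevelRing

/-- The structure map `R → R[x^{1/m}, z]`. -/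
def ofBase (m : ℕ+) (z : ℂ) : R →+* LevelRing R m z :=
  (AdjoinRoot.of (rootPoly R m z)).comp
    (Algebra.TensorProduct.includeLeftRingHom : R →+* R ⊗[ℤ] IntAdjoin z)

/-- The structure map `ℤ[z] → R[x^{1/m}, z]`. -/
def ofCyc (m : ℕ+) (z : ℂ) : IntAdjoin z →+* LevelRing R m z :=
  (AdjoinRoot.of (rootPoly R m z)).comp
    (Algebra.TensorProduct.includeRight : IntAdjoin z →ₐ[ℤ] R ⊗[ℤ] IntAdjoin z).toRingHom

/-- The root of unity `z`, as an element of `R[x^{1/m}, z]`. -/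
def zeta (m : ℕ+) (z : ℂ) : LevelRing R m z := ofCyc m z (IntAdjoin.gen z)

/-- The element `x^{1/m}` of `R[x^{1/m}, z]`. -/
def xRoot (m : ℕ+) (z : ℂ) : LevelRing R m z := AdjoinRoot.root (rootPoly R m z)

end LevelRing

lemma IsCompatibleRoots.adjoin_le {ζ : ℕ+ → ℂ} (hζ : IsCompatibleRoots ζ) (k m : ℕ+) :
    IntAdjoin (ζ m) ≤ IntAdjoin (ζ (k * m)) := by
  rw [Algebra.adjoin_le_iff, Set.singleton_subset_iff]
  have h1 : ζ m ^ ((k * m : ℕ+) : ℕ) = 1 := by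
    rw [PNat.mul_coe, mul_comm, pow_mul, (hζ.primitive m).pow_eq_one, one_pow]
  obtain ⟨i, -, hi⟩ := (hζ.primitive (k * m)).eq_pow_of_pow_eq_one h1
  rw [← hi]
  exact Subalgebra.pow_mem _ (Algebra.self_mem_adjoin_singleton ℤ _) i

/-- The inclusion `R_m → R_{km}`: the identity on `R`, the inclusion `ℤ[ζ_m] ⊆ ℤ[ζ_{km}]`, and
`x^{1/m} ↦ (x^{1/(km)})^k`. -/
def levelInclusion {ζ : ℕ+ → ℂ} (hζ : IsCompatibleRoots ζ) (k m : ℕ+) :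
    LevelRing R m (ζ m) →+* LevelRing R (k * m) (ζ (k * m)) :=
  AdjoinRoot.lift
    ((AdjoinRoot.of (rootPoly R (k * m) (ζ (k * m)))).comp
      (Algebra.TensorProduct.map (AlgHom.id ℤ R)
        (Subalgebra.inclusion (hζ.adjoin_le k m))).toRingHom)
    (LevelRing.xRoot (k * m) (ζ (k * m)) ^ (k : ℕ))
    (by
      have h := AdjoinRoot.eval₂_root (rootPoly R (k * m) (ζ (k * m)))
      rw [eval₂_rootPoly, sub_eq_zero] at h
      rw [eval₂_rootPoly, ← pow_mul, ← PNat.mul_coe, sub_eq_zero]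
      refine Eq.trans h ?_
      simp)

/-- The `p`-adic completion of a commutative ring. -/
abbrev PadicCompletion (S : Type) [CommRing S] (p : ℕ) : Type :=
  AdicCompletion (Ideal.span {(p : S)}) S

/-- `φ` is the `p`-Frobenius endomorphism of the `p`-adic completion of `R[x^{1/m}, z]`: it maps
`x^{1/m}` to its `p`-th power, fixes the elements of `ℤ[z]`, and is congruent modulo `p` to the
`p`-th power map on `R`. When `R` is étale over `ℤ[x, x⁻¹]` there is exactly one such `φ`. -/
structure IsFrobenius (p m : ℕ+) (z : ℂ)
    (φ : PadicCompletion (LevelRing R m z) p →+* PadicCompletion (LevelRing R m z) p) : Prop where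
  map_xRoot : φ (algebraMap _ _ (LevelRing.xRoot m z : LevelRing R m z)) =
    algebraMap _ _ (LevelRing.xRoot m z : LevelRing R m z) ^ (p : ℕ)
  map_cyc : ∀ c : IntAdjoin z, φ (algebraMap _ _ (LevelRing.ofCyc m z c : LevelRing R m z)) =
    algebraMap _ _ (LevelRing.ofCyc m z c : LevelRing R m z)
  map_base : ∀ r : R,
    φ (algebraMap _ _ (LevelRing.ofBase m z r)) -
        algebraMap _ _ (LevelRing.ofBase m z r) ^ (p : ℕ) ∈
      Ideal.span {((p : ℕ) : PadicCompletion (LevelRing R m z) p)}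

/-- The sequence `s` converges to `l` in the `p`-adic topology of `S`. -/
def PadicTendsto {S : Type} [CommRing S] (p : ℕ) (s : ℕ → S) (l : S) : Prop :=
  ∀ N : ℕ, ∃ K₀ : ℕ, ∀ K : ℕ, K₀ ≤ K → s K - l ∈ Ideal.span {(p : S)} ^ N

/-- The power series `b`, in powers of `q - b₀`, is the `p`-adic re-expansion of the power series
`a`, in powers of `q - a₀`, where `ε = b₀ - a₀`: expanding
`(q - a₀) ^ k = ((q - b₀) + ε) ^ k`, the series for the coefficient of every `(q - b₀) ^ j`
converges `p`-adically to that of `b`. -/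
def IsReexpansion {S : Type} [CommRing S] (p : ℕ) (ε : S) (a b : S⟦X⟧) : Prop :=
  ∀ j : ℕ, PadicTendsto p
    (fun K => ∑ k ∈ Finset.range K, (k.choose j : S) * ε ^ (k - j) * PowerSeries.coeff k a)
    (PowerSeries.coeff j b)

variable (R) in
/-- The Habiro ring of an étale `ℤ[x, x⁻¹]`-algebra `R`: collections of power series
`f m ∈ R_m⟦q - ζ_m⟧`, for `m ≥ 1`, such that for every `m` and every prime `p` the `p`-adic
re-expansion of `f m` at `ζ_{pm}` is the Frobenius twist of `f (p m)`, over the `p`-adic completion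
of `R_{pm}`. -/
def HabiroRing [Algebra.Etale ℤ[T;T⁻¹] R] {ζ : ℕ+ → ℂ} (hζ : IsCompatibleRoots ζ) :
    Set (∀ m : ℕ+, (LevelRing R m (ζ m))⟦X⟧) :=
  {f | ∀ m p : ℕ+, (p : ℕ).Prime →
    ∃ φ : PadicCompletion (LevelRing R (p * m) (ζ (p * m))) p →+*
        PadicCompletion (LevelRing R (p * m) (ζ (p * m))) p,
      IsFrobenius p (p * m) (ζ (p * m)) φ ∧
      IsReexpansion (p : ℕ)
        (algebraMap (LevelRing R (p * m) (ζ (p * m)))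
          (PadicCompletion (LevelRing R (p * m) (ζ (p * m))) p)
          (LevelRing.zeta (p * m) (ζ (p * m)) - levelInclusion hζ p m (LevelRing.zeta m (ζ m))))
        (PowerSeries.map ((algebraMap (LevelRing R (p * m) (ζ (p * m)))
          (PadicCompletion (LevelRing R (p * m) (ζ (p * m))) p)).comp
            (levelInclusion hζ p m)) (f m))
        (PowerSeries.map (φ.comp (algebraMap (LevelRing R (p * m) (ζ (p * m)))
          (PadicCompletion (LevelRing R (p * m) (ζ (p * m))) p))) (f (p * m)))}

end Habiro

/-! ### The curve of the knot `4_1` -/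

/-- The polynomial `x y + (1 - x² y) (1 - y)` in the variable `y` over `ℤ[x, x⁻¹]`. -/
def curvePoly : ℤ[T;T⁻¹][X] :=
  Polynomial.C (LaurentPolynomial.T 1) * Polynomial.X +
    (1 - Polynomial.C (LaurentPolynomial.T 2) * Polynomial.X) * (1 - Polynomial.X)

/-- `δ² = x² - 2 x - 1 - 2 x⁻¹ + x⁻²`. -/
def deltaSq : ℤ[T;T⁻¹] :=
  LaurentPolynomial.T 2 - 2 * LaurentPolynomial.T 1 - 1 - 2 * LaurentPolynomial.T (-1) +
    LaurentPolynomial.T (-2)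

/-- The ring `R = ℤ[x, x⁻¹][y, y⁻¹, 1/δ] / (x y + (1 - x² y) (1 - y))`; inverting `δ` is the same
as inverting its square. -/
abbrev CurveRing : Type :=
  Localization.Away (AdjoinRoot.root curvePoly * AdjoinRoot.of curvePoly deltaSq)

/-- The coordinate `y` of the curve. -/
def yCoord : CurveRing := algebraMap (AdjoinRoot curvePoly) CurveRing (AdjoinRoot.root curvePoly)

/-- The curve as a standard étale pair, with the equation made monic in `y`. -/
def curvePair : StandardEtalePair ℤ[T;T⁻¹] where
  f := Polynomial.X ^ 2 + (Polynomial.C (LaurentPolynomial.T (-1) - LaurentPolynomial.T (-2) - 1) *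
    Polynomial.X + Polynomial.C (LaurentPolynomial.T (-2)))
  monic_f := by
    refine Polynomial.monic_X_pow_add ?_
    refine (Polynomial.degree_linear_le).trans_lt ?_
    norm_num
  g := Polynomial.X * Polynomial.C deltaSq
  cond := by
    have h1 : (LaurentPolynomial.T 1 : ℤ[T;T⁻¹]) * LaurentPolynomial.T (-1) = 1 := by
      rw [← LaurentPolynomial.T_add]; simp
    have h2 : (LaurentPolynomial.T 2 : ℤ[T;T⁻¹]) = LaurentPolynomial.T 1 ^ 2 := by
      rw [LaurentPolynomial.T_pow]; simp
    have h3 : (LaurentPolynomial.T (-2) : ℤ[T;T⁻¹]) = LaurentPolynomial.T (-1) ^ 2 := by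
      rw [LaurentPolynomial.T_pow]; simp
    have key : (LaurentPolynomial.T 2 : ℤ[T;T⁻¹]) *
        ((LaurentPolynomial.T (-1) - LaurentPolynomial.T (-2) - 1) ^ 2 -
          4 * LaurentPolynomial.T (-2)) = deltaSq := by
      rw [deltaSq, h2, h3]
      generalize (LaurentPolynomial.T 1 : ℤ[T;T⁻¹]) = a at h1
      generalize (LaurentPolynomial.T (-1) : ℤ[T;T⁻¹]) = b at h1
      grind
    refine ⟨Polynomial.C (LaurentPolynomial.T 2) * Polynomial.X *
      (2 * Polynomial.X + Polynomial.C (LaurentPolynomial.T (-1) - LaurentPolynomial.T (-2) - 1)),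
      Polynomial.C (-4 * LaurentPolynomial.T 2) * Polynomial.X, 1, ?_⟩
    rw [← key]
    simp only [map_mul, map_sub, map_pow, map_neg, map_ofNat, map_one, Polynomial.derivative_add,
      Polynomial.derivative_X_pow, Polynomial.derivative_mul, Polynomial.derivative_C,
      Polynomial.derivative_X, Polynomial.derivative_one]
    push_cast
    simp only [map_ofNat]
    ring

lemma curvePair_f_associated : Associated curvePair.f curvePoly := by
  have h1 : (LaurentPolynomial.T (-2) : ℤ[T;T⁻¹]) * LaurentPolynomial.T 2 = 1 := by
    rw [← LaurentPolynomial.T_add]; simp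
  have h2 : (LaurentPolynomial.T (-1) : ℤ[T;T⁻¹]) * LaurentPolynomial.T 2 =
      LaurentPolynomial.T 1 := by
    rw [← LaurentPolynomial.T_add]; norm_num
  have hu : IsUnit (Polynomial.C (LaurentPolynomial.T 2) : ℤ[T;T⁻¹][X]) :=
    (IsUnit.of_mul_eq_one_right _ h1).map Polynomial.C
  refine ⟨hu.unit, ?_⟩
  have h1' := congrArg (Polynomial.C : ℤ[T;T⁻¹] →+* ℤ[T;T⁻¹][X]) h1
  have h2' := congrArg (Polynomial.C : ℤ[T;T⁻¹] →+* ℤ[T;T⁻¹][X]) h2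
  simp only [map_mul, map_one] at h1' h2'
  simp only [curvePair, curvePoly, IsUnit.unit_spec, map_sub, map_one]
  linear_combination (1 - Polynomial.X) * h1' + Polynomial.X * h2'

instance etale_curveRing : Algebra.Etale ℤ[T;T⁻¹] CurveRing := by
  let e : AdjoinRoot curvePair.f ≃ₐ[ℤ[T;T⁻¹]] AdjoinRoot curvePoly :=
    AdjoinRoot.algEquivOfAssociated _ _ _ curvePair_f_associated
  have he : e (AdjoinRoot.mk curvePair.f curvePair.g) =
      AdjoinRoot.root curvePoly * AdjoinRoot.of curvePoly deltaSq := by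
    have hg : AdjoinRoot.mk curvePair.f curvePair.g =
        AdjoinRoot.root curvePair.f * algebraMap ℤ[T;T⁻¹] _ deltaSq := by
      change AdjoinRoot.mk curvePair.f (Polynomial.X * Polynomial.C deltaSq) = _
      rw [map_mul, AdjoinRoot.mk_X, AdjoinRoot.mk_C, AdjoinRoot.algebraMap_eq]
    rw [hg, map_mul, AlgEquiv.commutes, AdjoinRoot.algEquivOfAssociated_root,
      AdjoinRoot.algebraMap_eq]
  have hM : Submonoid.map e.toRingEquiv.toMonoidHom
        (Submonoid.powers (AdjoinRoot.mk curvePair.f curvePair.g)) =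
      Submonoid.powers (AdjoinRoot.root curvePoly * AdjoinRoot.of curvePoly deltaSq) := by
    rw [Submonoid.map_powers]
    exact congrArg Submonoid.powers he
  exact Algebra.Etale.of_equiv (curvePair.equivAwayAdjoinRoot.trans
    (IsLocalization.algEquivOfAlgEquiv (A := ℤ[T;T⁻¹])
      (M := Submonoid.powers (AdjoinRoot.mk curvePair.f curvePair.g))
      (T := Submonoid.powers (AdjoinRoot.root curvePoly * AdjoinRoot.of curvePoly deltaSq))
      (Localization.Away (AdjoinRoot.mk curvePair.f curvePair.g)) CurveRing e hM))

/-! ### Formal Gaussian integration at a root of unity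

Put `q = z e^ħ` with `z` a root of unity of order `m`, and consider the sum of the terms
`(-1)^k q^{k(k+1)/2 + nk} q^{n/2} / ((q;q)_k (q;q)_{k+2n})
  = (-1)^k q^{k(k+1)/2} X^k X^{1/2} (q q^k; q)_∞ (q q^k X²; q)_∞ / (q;q)_∞²`
with `X = q^n`, so that `x = X^m`. Split the sum by the residue `r` of `k` modulo `m` and put
`q^k = z^r w e^v`, where `w^m = y` is a critical point of the exponent, and use
`(q a e^v; q)_∞ = ∏_{j = 1}^m (z^j a e^{v + jħ}; e^{mħ})_∞
  ~ exp (∑_{j = 1}^m ∑_{n, s ≥ 0} B_n(j/m) / (n! s!) Li_{2-n-s}(z^j a) (mħ)^{n-1} v^s)`.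
The terms of degree `-1` in `ħ` (where `v` has degree `1/2`) give a factor `e^{V(x)/(m²ħ)}`; the
terms of degree `0` give a constant factor and the Gaussian weight `e^{H v² / (2ħ)}`; the terms of
positive degree are expanded and integrated term by term against the Gaussian weight.
The factor `e^{V(x)/(m²ħ)}` (with all constant phases) is replaced by its inverse when
`(z, ħ)` is replaced by `(z⁻¹, -ħ)`, so it does not contribute to the symmetrisation and is left
out. -/

section Gaussian

/-- The polynomial `P` with `Li_{-k}(a) = P(a / (1 - a))`, obtained from
`Li_0(a) = a / (1 - a)` and `Li_{-k-1} = a d/da Li_{-k}`; note that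
`a d/da = (u + u²) d/du` for `u = a / (1 - a)`. -/
def negPolylogPoly : ℕ → ℤ[X]
  | 0 => Polynomial.X
  | k + 1 => (Polynomial.X + Polynomial.X ^ 2) * Polynomial.derivative (negPolylogPoly k)

variable {K : Type} [Field K] [CharZero K]

/-- The polylogarithm `Li_{-k}(a) = ∑_{n ≥ 1} n^k a^n`, as a rational function of `a`. -/
def negPolylog (k : ℕ) (a : K) : K := Polynomial.aeval (a / (1 - a)) (negPolylogPoly k)

/-- The coefficient of `ħ^{n-1} v^s` in the asymptotic expansion of `log (q a e^v; q)_∞` for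
`q = z e^ħ` with `z` of order `m`, for `n + s ≥ 2`. -/
def logPochCoeff (m : ℕ) (z a : K) (n s : ℕ) : K :=
  ∑ j ∈ Finset.Icc 1 m,
    (((Polynomial.bernoulli n).eval ((j : ℚ) / (m : ℚ)) : ℚ) : K) * (m : K) ^ ((n : ℤ) - 1) /
      ((n.factorial : K) * (s.factorial : K)) * negPolylog (n + s - 2) (z ^ j * a)

/-- The terms of positive degree in the exponent of the integrand for the residue class `r`, with
`ħ = ε²` and `v = ε t`, as a power series in `ε` whose coefficients are polynomials in `t`. The
term `v / 2` comes from the factor `q^{k/2}`. -/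
def exponent (m : ℕ) (z X w : K) (r : ℕ) : K[X]⟦X⟧ :=
  PowerSeries.mk fun d =>
    if d = 0 then 0
    else
      (if d = 1 then Polynomial.C (1 / 2) * Polynomial.X else 0) +
        ∑ n ∈ Finset.range ((d + 2) / 2 + 1),
          Polynomial.C (logPochCoeff m z (z ^ r * w) n (d + 2 - 2 * n) +
            logPochCoeff m z (z ^ r * w * X ^ 2) n (d + 2 - 2 * n)) *
              Polynomial.X ^ (d + 2 - 2 * n)

/-- The Hessian `H = 1 + y / (1 - y) + x² y / (1 - x² y)`. -/
def hessian (x y : K) : K := 1 + y / (1 - y) + x ^ 2 * y / (1 - x ^ 2 * y)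

/-- The normalised Gaussian integral `∫ e^{H t²/2} P(t) dt / ∫ e^{H t²/2} dt` of a polynomial:
`t^{2l} ↦ (2l-1)!! (-1/H)^l`, and odd powers are mapped to zero. -/
def gaussianMean (H : K) (P : K[X]) : K :=
  P.sum fun l c => if Even l then c * (Nat.doubleFactorial (l - 1) : K) * (-1 / H) ^ (l / 2) else 0

/-- Termwise Gaussian integration, giving a power series in `ħ = ε²` (the odd powers of `ε` come
with odd powers of `t` and integrate to zero). -/
def gaussianIntegral (H : K) (E : K[X]⟦X⟧) : K⟦X⟧ :=
  PowerSeries.mk fun n => gaussianMean H (PowerSeries.coeff (2 * n) E)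

/-- The relative weight `(-1)^r z^{r(r+1)/2} w^r X^r / ((z w; z)_r (z w X²; z)_r)` of the residue
class `r`. -/
def classWeight (z X w : K) (r : ℕ) : K :=
  (-1) ^ r * z ^ (r * (r + 1) / 2) * (w * X) ^ r /
    ∏ j ∈ Finset.Icc 1 r, ((1 - z ^ j * w) * (1 - z ^ j * w * X ^ 2))

/-- The constant factor of the integral,
`(w X / (m H))^{1/2} ∏_{j = 1}^m ((1 - z^j w) (1 - z^j w X²))^{1/2 - j/m}`, where
`root a` is a chosen `2m`-th root of `a`, so that `a^{s/(2m)}` is `(root a)^s`. -/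
def prefactor (m : ℕ) (root : K → K) (z X w : K) : K :=
  root (w * X / (m * hessian (X ^ m) (w ^ m))) ^ m *
    ∏ j ∈ Finset.Icc 1 m,
      (root (1 - z ^ j * w) * root (1 - z ^ j * w * X ^ 2)) ^ ((m : ℤ) - 2 * (j : ℤ))

/-- The perturbative series of the knot at the root of unity `z` of order `m`, as a power series in
`ħ` where `q = z e^ħ`, without the exponential factor. The factor `e^{ħ/12}` comes
from `1 / (q;q)_∞²`. -/
def pertSeries (m : ℕ) (root : K → K) (z X w : K) : K⟦X⟧ :=
  PowerSeries.C (prefactor m root z X w) * PowerSeries.rescale (1 / 12 : K) (PowerSeries.exp K) *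
    ∑ r ∈ Finset.range m, PowerSeries.C (classWeight z X w r) *
      gaussianIntegral (hessian (X ^ m) (w ^ m))
        (PowerSeries.subst (exponent m z X w r) (PowerSeries.exp ℚ))

/-- The symmetrisation `f(q) f(q⁻¹)` at `q = z e^ħ`: the second factor is the perturbative series
at `z⁻¹` with `ħ` replaced by `-ħ`, with `X` and `w` unchanged. -/
def symSeries (m : ℕ) (root : K → K) (z X w : K) : K⟦X⟧ :=
  pertSeries m root z X w * PowerSeries.rescale (-1 : K) (pertSeries m root z⁻¹ X w)

end Gaussian

/-- The collection `f` of power series `f m ∈ R_m⟦q - ζ_m⟧` is the symmetrised perturbative series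
of the knot: for every `m`, every geometric point `ψ` of `R_m` of characteristic zero, every choice
of an `m`-th root `w` of `y` and of branches of the fractional powers, the substitution
`q = ζ_m e^ħ` turns `f m` into the symmetrisation of the formal Gaussian integral. -/
def IsSymSeries {ζ : ℕ+ → ℂ} (f : ∀ m : ℕ+, (LevelRing CurveRing m (ζ m))⟦X⟧) : Prop :=
  ∀ (m : ℕ+) (K : Type) [Field K] [CharZero K] [IsAlgClosed K]
    (ψ : LevelRing CurveRing m (ζ m) →+* K) (w : K) (root : K → K),
    w ^ (m : ℕ) = ψ (LevelRing.ofBase m (ζ m) yCoord) →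
    (∀ a : K, root a ^ (2 * (m : ℕ)) = a) →
    PowerSeries.subst
        (PowerSeries.C (ψ (LevelRing.zeta m (ζ m))) * (PowerSeries.exp K - 1) : K⟦X⟧)
        (PowerSeries.map ψ (f m)) =
      symSeries (m : ℕ) root (ψ (LevelRing.zeta m (ζ m))) (ψ (LevelRing.xRoot m (ζ m))) w

end HabiroKnot

end

noncomputable section

set_option linter.unusedSectionVars false

namespace HabiroKnot

/-! ### Sums converging in the `X`-adic topology -/

section AdicSum

variable {R S T : Type} [CommRing R] [CommRing S] [CommRing T]

/-! The integral is first studied with independent variables w₁, w₂, u in place of w, wX², wX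
(`rPsi`, `symSeries_eq_rPsi`). The critical point equation becomes u^m = -(1 - w₁^m)(1 - w₂^m), and
at the original values this is the equation of the curve.

Near w₁ = w₂ = 0 the formal integral can be evaluated exactly. Put wᵢ = ε⁴ωᵢ and ħ = ε². Up to
constants the integrand is a Gaussian of Hessian 1, times a linear exponential, times two
q-Pochhammer symbols. Euler's expansion of these in powers of e^v is integrated term by term, and
the sum over the residues r is a quadratic Gauss sum (`half_core`). In the product of the results
for q and q⁻¹ the q-binomial theorem collapses the fourfold sum (`sum_factorization`), which leaves
-∑ q^{-IJ} [I+J, I]_q² (w₁/u)^I (w₂/u)^J (`sqHom_rPsi`). Its coefficients are integral Laurent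
polynomials in q that do not depend on the root of unity. Integrality and gluing both come from
this.

The points of the curve are not near w₁ = w₂ = 0, so the formula is transported by rationality. The
coefficient of ħ^k in `rPsi` is a rational function. Twisting w₁, w₂, u by m-th roots of unity
isolates the part of the double sum with (I, J) ≡ (r, s) mod m. That part is a rational function of
c = w₁^m and d = w₂^m, with denominator a power of (1 - c)(1 - d)(1 - cd), whose expansion in a =
-c/((1 - c)(1 - d)) and b = -d/((1 - c)(1 - d)) has the known coefficients
(`exists_rational_coeff`). A rational function is determined by its expansion
(`TRing.gen_injective`), and it is defined over ℤ[ζ_m] once the expansion in powers of q - ζ_m is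
(`TRing.Represents.descend`). On the curve c = y, d = x²y, a = x⁻¹ and b = x, so the coefficients of
f_m are the sums -∑_{r,s<m} x^{(s-r)/m} τ_{r,s}(y, x²y).

For the gluing, one Laurent polynomial in q is expanded at two points that are p-adically close, and
each class mod m is split into classes mod pm. The second step replaces a, b by a^p, b^p. By
Hensel's lemma there is a unique point (c', d') near (c^p, d^p) with these values
(`exists_isFrobPoint`), and on the curve it is the image of (y, x²y) under φ_p. The resulting
identity of rational functions (`eval_shift_eq_sum`) is the Habiro condition modulo p^N. -/

lemma eq_of_forall_X_pow_dvd_sub {f g : R⟦X⟧} (h : ∀ n : ℕ, PowerSeries.X ^ n ∣ f - g) :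
    f = g := by
  ext n
  have := (PowerSeries.X_pow_dvd_iff.1 (h (n + 1))) n (Nat.lt_succ_self n)
  rwa [map_sub, sub_eq_zero] at this

/-- The sum of a sequence `g` with `X ^ k ∣ g k`. -/
def adicSum (g : ℕ → R⟦X⟧) : R⟦X⟧ :=
  PowerSeries.mk fun n => ∑ k ∈ Finset.range (n + 1), PowerSeries.coeff n (g k)

lemma coeff_adicSum (g : ℕ → R⟦X⟧) (n : ℕ) : PowerSeries.coeff n (adicSum g) =
    ∑ k ∈ Finset.range (n + 1), PowerSeries.coeff n (g k) := by
  simp [adicSum]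

lemma coeff_adicSum_of_lt {g : ℕ → R⟦X⟧} (hg : ∀ k, PowerSeries.X ^ k ∣ g k) {n N : ℕ}
    (h : n < N) : PowerSeries.coeff n (adicSum g) =
    ∑ k ∈ Finset.range N, PowerSeries.coeff n (g k) := by
  rw [coeff_adicSum]
  refine Finset.sum_subset (Finset.range_mono h) fun k _ hk => ?_
  exact PowerSeries.X_pow_dvd_iff.1 (hg k) n (by simpa using hk)

lemma X_pow_dvd_adicSum_sub {g : ℕ → R⟦X⟧} (hg : ∀ k, PowerSeries.X ^ k ∣ g k) (n : ℕ) :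
    PowerSeries.X ^ n ∣ adicSum g - ∑ k ∈ Finset.range n, g k := by
  rw [PowerSeries.X_pow_dvd_iff]
  intro m hm
  rw [map_sub, coeff_adicSum_of_lt hg hm, map_sum, sub_self]

lemma eq_adicSum {g : ℕ → R⟦X⟧} (hg : ∀ k, PowerSeries.X ^ k ∣ g k) {f : R⟦X⟧}
    (h : ∀ n, PowerSeries.X ^ n ∣ f - ∑ k ∈ Finset.range n, g k) : f = adicSum g := by
  refine eq_of_forall_X_pow_dvd_sub fun n => ?_
  have := (h n).sub (X_pow_dvd_adicSum_sub hg n)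
  rwa [sub_sub_sub_cancel_right] at this

lemma map_adicSum (L : R⟦X⟧ →+ S⟦X⟧)
    (hL : ∀ (n : ℕ) (f : R⟦X⟧), PowerSeries.X ^ n ∣ f → PowerSeries.X ^ n ∣ L f)
    {g : ℕ → R⟦X⟧} (hg : ∀ k, PowerSeries.X ^ k ∣ g k) :
    L (adicSum g) = adicSum fun k => L (g k) := by
  refine eq_adicSum (fun k => hL _ _ (hg k)) fun n => ?_
  rw [← map_sum, ← map_sub]
  exact hL _ _ (X_pow_dvd_adicSum_sub hg n)

lemma X_pow_dvd_ringHom {h : R⟦X⟧ →+* S⟦X⟧} (hX : PowerSeries.X ∣ h PowerSeries.X) (n : ℕ)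
    (f : R⟦X⟧) (hf : PowerSeries.X ^ n ∣ f) : PowerSeries.X ^ n ∣ h f := by
  obtain ⟨g, rfl⟩ := hf
  rw [map_mul, map_pow]
  exact (pow_dvd_pow_of_dvd hX n).mul_right _

lemma ringHom_adicSum (h : R⟦X⟧ →+* S⟦X⟧) (hX : PowerSeries.X ∣ h PowerSeries.X)
    {g : ℕ → R⟦X⟧} (hg : ∀ k, PowerSeries.X ^ k ∣ g k) :
    h (adicSum g) = adicSum fun k => h (g k) :=
  map_adicSum h.toAddMonoidHom (X_pow_dvd_ringHom hX) hg

lemma mul_adicSum (f : R⟦X⟧) {g : ℕ → R⟦X⟧} (hg : ∀ k, PowerSeries.X ^ k ∣ g k) :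
    f * adicSum g = adicSum fun k => f * g k :=
  map_adicSum (AddMonoidHom.mulLeft f) (fun _ _ h => h.mul_left _) hg

lemma adicSum_add (f g : ℕ → R⟦X⟧) : adicSum (fun k => f k + g k) = adicSum f + adicSum g := by
  ext n
  simp [coeff_adicSum, Finset.sum_add_distrib]

lemma adicSum_neg (f : ℕ → R⟦X⟧) : adicSum (fun k => -f k) = -adicSum f := by
  ext n
  simp [coeff_adicSum]

lemma adicSum_finset_sum {ι : Type} (s : Finset ι) (g : ι → ℕ → R⟦X⟧) :
    adicSum (fun k => ∑ i ∈ s, g i k) = ∑ i ∈ s, adicSum (g i) := by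
  ext n
  simp only [coeff_adicSum, map_sum]
  exact Finset.sum_comm

lemma adicSum_comm (g : ℕ → ℕ → R⟦X⟧) :
    adicSum (fun i => adicSum (g i)) = adicSum fun j => adicSum fun i => g i j := by
  ext n
  simp only [coeff_adicSum]
  exact Finset.sum_comm

lemma X_pow_dvd_adicSum {g : ℕ → R⟦X⟧} {n : ℕ} (hg : ∀ k, PowerSeries.X ^ n ∣ g k) :
    PowerSeries.X ^ n ∣ adicSum g := by
  rw [PowerSeries.X_pow_dvd_iff]
  intro m hm
  rw [coeff_adicSum]
  exact Finset.sum_eq_zero fun k _ => PowerSeries.X_pow_dvd_iff.1 (hg k) m hm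

lemma adicSum_eq_sum_range {g : ℕ → R⟦X⟧} (hg : ∀ k, PowerSeries.X ^ k ∣ g k) {N : ℕ}
    (h : ∀ k, N ≤ k → g k = 0) : adicSum g = ∑ k ∈ Finset.range N, g k := by
  refine (eq_adicSum hg fun n => ?_).symm
  rcases le_total n N with hn | hn
  · rw [← Finset.sum_range_add_sum_Ico _ hn, add_sub_cancel_left]
    exact Finset.dvd_sum fun k hk =>
      (pow_dvd_pow _ (Finset.mem_Ico.1 hk).1).trans (hg k)
  · rw [← Finset.sum_range_add_sum_Ico g hn, Finset.sum_eq_zero (s := Finset.Ico N n)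
      fun k hk => h k (Finset.mem_Ico.1 hk).1]
    simp

lemma adicSum_eq_add_succ {g : ℕ → R⟦X⟧} (hg : ∀ k, PowerSeries.X ^ k ∣ g k) :
    adicSum g = g 0 + adicSum fun k => g (k + 1) := by
  have hg' : ∀ k, PowerSeries.X ^ k ∣ g (k + 1) := fun k =>
    (pow_dvd_pow _ k.le_succ).trans (hg _)
  refine (eq_adicSum hg fun n => ?_).symm
  rcases n with _ | n
  · simp
  rw [Finset.sum_range_succ', add_comm (∑ k ∈ _, _), add_sub_add_left_eq_sub]
  rw [PowerSeries.X_pow_dvd_iff]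
  intro m hm
  rw [map_sub, coeff_adicSum, map_sum]
  rw [sub_eq_zero]
  rcases Nat.lt_succ_iff_lt_or_eq.1 hm with h | rfl
  · refine Finset.sum_subset (Finset.range_mono h) fun k _ hk => ?_
    exact PowerSeries.X_pow_dvd_iff.1 (hg' k) m (by simpa using hk)
  · rw [Finset.sum_range_succ, PowerSeries.X_pow_dvd_iff.1 (hg (m + 1)) m m.lt_succ_self, add_zero]

lemma adicSum_mul_adicSum {f g : ℕ → R⟦X⟧} (hf : ∀ k, PowerSeries.X ^ k ∣ f k)
    (hg : ∀ k, PowerSeries.X ^ k ∣ g k) :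
    adicSum f * adicSum g =
      adicSum fun n => ∑ p ∈ Finset.HasAntidiagonal.antidiagonal n, f p.1 * g p.2 := by
  have hfg : ∀ i j, PowerSeries.X ^ (i + j) ∣ f i * g j := fun i j => by
    rw [pow_add]; exact mul_dvd_mul (hf i) (hg j)
  refine eq_adicSum (fun k => Finset.dvd_sum fun p hp => ?_) fun n => ?_
  · rw [← Finset.HasAntidiagonal.mem_antidiagonal.1 hp]; exact hfg _ _
  · have h1 := X_pow_dvd_adicSum_sub hf n
    have h2 := X_pow_dvd_adicSum_sub hg n
    have h3 : PowerSeries.X ^ n ∣ adicSum f * adicSum g -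
        (∑ k ∈ Finset.range n, f k) * ∑ k ∈ Finset.range n, g k := by
      have : adicSum f * adicSum g -
        (∑ k ∈ Finset.range n, f k) * ∑ k ∈ Finset.range n, g k =
        (adicSum f - ∑ k ∈ Finset.range n, f k) * adicSum g +
        (∑ k ∈ Finset.range n, f k) * (adicSum g - ∑ k ∈ Finset.range n, g k) := by ring
      rw [this]
      exact (h1.mul_right _).add (h2.mul_left _)
    -- The square of pairs (a, b) with a, b < n contains the triangle a + b < n, and the remaining
    -- pairs contribute multiples of X^n.
    have h4 : PowerSeries.X ^ n ∣ (∑ k ∈ Finset.range n, f k) * (∑ k ∈ Finset.range n, g k) -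
        ∑ k ∈ Finset.range n, ∑ p ∈ Finset.HasAntidiagonal.antidiagonal k, f p.1 * g p.2 := by
      rw [Finset.sum_mul_sum, ← Finset.sum_product']
      rw [Finset.sum_sigma', ]
      rw [PowerSeries.X_pow_dvd_iff]
      intro m hm
      rw [map_sub, map_sum, map_sum, sub_eq_zero]
      symm
      refine Finset.sum_of_injOn (fun x => x.2) ?_ ?_ ?_ ?_
      · rintro ⟨a, b⟩ ha ⟨c, d⟩ hc h
        simp only [Finset.coe_sigma, Set.mem_sigma_iff, Finset.mem_coe, Finset.mem_range,
          Finset.HasAntidiagonal.mem_antidiagonal] at ha hc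
        dsimp only at h
        subst h
        have : a = c := ha.2.symm.trans hc.2
        subst this
        rfl
      · rintro ⟨a, b⟩ ha
        simp only [Finset.coe_sigma, Set.mem_sigma_iff, Finset.mem_coe, Finset.mem_range,
          Finset.HasAntidiagonal.mem_antidiagonal, Finset.coe_product, Set.mem_prod] at ha ⊢
        omega
      · rintro ⟨a, b⟩ _ hb
        refine PowerSeries.X_pow_dvd_iff.1 (hfg a b) m ?_
        by_contra hlt
        push Not at hlt
        apply hb
        refine ⟨⟨a + b, (a, b)⟩, ?_, rfl⟩
        simp only [Finset.coe_sigma, Set.mem_sigma_iff, Finset.mem_coe, Finset.mem_range,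
          Finset.HasAntidiagonal.mem_antidiagonal]
        exact ⟨by omega, trivial⟩
      · rintro ⟨a, b⟩ _
        rfl
    have := h3.add h4
    rwa [sub_add_sub_cancel] at this

/-- The ring homomorphism `A⟦X⟧ → C⟦X⟧` which is `φ` on `A` and maps `X` to `G`. -/
def evalAt (φ : R →+* S⟦X⟧) (G : S⟦X⟧) (hG : PowerSeries.X ∣ G) : R⟦X⟧ →+* S⟦X⟧ where
  toFun f := adicSum fun k => φ (PowerSeries.coeff k f) * G ^ k
  map_zero' := by ext n; simp [coeff_adicSum]
  map_one' := by
    rw [adicSum_eq_sum_range (N := 1)]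
    · simp
    · exact fun k => (pow_dvd_pow_of_dvd hG k).mul_left _
    · intro k hk
      rw [PowerSeries.coeff_one, if_neg (by omega), map_zero, zero_mul]
  map_add' f g := by
    rw [← adicSum_add]
    congr 1
    ext1 k
    rw [map_add, map_add, add_mul]
  map_mul' f g := by
    rw [adicSum_mul_adicSum (fun k => (pow_dvd_pow_of_dvd hG k).mul_left _)
      (fun k => (pow_dvd_pow_of_dvd hG k).mul_left _)]
    congr 1
    ext1 k
    rw [PowerSeries.coeff_mul, map_sum, Finset.sum_mul]
    refine Finset.sum_congr rfl fun p hp => ?_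
    rw [← Finset.HasAntidiagonal.mem_antidiagonal.1 hp, map_mul, pow_add]
    ring

section evalAt

variable (φ : R →+* S⟦X⟧) {G : S⟦X⟧} (hG : PowerSeries.X ∣ G)

lemma evalAt_apply (f : R⟦X⟧) :
    evalAt φ G hG f = adicSum fun k => φ (PowerSeries.coeff k f) * G ^ k := rfl

@[simp] lemma evalAt_C (a : R) : evalAt φ G hG (PowerSeries.C a) = φ a := by
  rw [evalAt_apply, adicSum_eq_sum_range (N := 1)]
  · simp
  · exact fun k => (pow_dvd_pow_of_dvd hG k).mul_left _
  · intro k hk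
    rw [PowerSeries.coeff_C, if_neg (by omega), map_zero, zero_mul]

@[simp] lemma evalAt_X : evalAt φ G hG PowerSeries.X = G := by
  rw [evalAt_apply, adicSum_eq_sum_range (N := 2)]
  · simp [PowerSeries.coeff_X]
  · exact fun k => (pow_dvd_pow_of_dvd hG k).mul_left _
  · intro k hk
    rw [PowerSeries.coeff_X, if_neg (by omega), map_zero, zero_mul]

lemma X_dvd_evalAt_X : PowerSeries.X ∣ evalAt φ G hG PowerSeries.X := by
  rwa [evalAt_X]

end evalAt

lemma X_dvd_map_X (f : R →+* S) : (PowerSeries.X : S⟦X⟧) ∣ PowerSeries.map f PowerSeries.X := by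
  simp

lemma X_dvd_rescale_X (r : R) :
    (PowerSeries.X : R⟦X⟧) ∣ PowerSeries.rescale r PowerSeries.X := by
  rw [PowerSeries.rescale_X]; exact dvd_mul_left _ _

end AdicSum

/-! ### Exponentials of power series -/

section Expo

variable {R S : Type} [CommRing R] [CommRing S] [Algebra ℚ R] [Algebra ℚ S]

/-- The exponential of a power series divisible by `X`. -/
def expo (f : R⟦X⟧) : R⟦X⟧ := adicSum fun k => ((k.factorial : ℚ)⁻¹) • f ^ k

lemma X_pow_dvd_expo_term {f : R⟦X⟧} (hf : PowerSeries.X ∣ f) (k : ℕ) :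
    PowerSeries.X ^ k ∣ ((k.factorial : ℚ)⁻¹) • f ^ k :=
  dvd_smul_of_dvd _ (pow_dvd_pow_of_dvd hf k)

lemma subst_exp_eq_expo {f : R⟦X⟧} (hf : PowerSeries.X ∣ f) :
    PowerSeries.subst f (PowerSeries.exp ℚ) = expo f := by
  have h0 : PowerSeries.HasSubst f :=
    PowerSeries.HasSubst.of_constantCoeff_zero' (PowerSeries.X_dvd_iff.1 hf)
  ext n
  rw [PowerSeries.coeff_subst' h0, expo, coeff_adicSum]
  rw [finsum_eq_sum_of_support_subset (s := Finset.range (n + 1))]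
  · refine Finset.sum_congr rfl fun k _ => ?_
    simp [PowerSeries.coeff_exp]
  · intro k hk
    by_contra hkn
    apply hk
    have : PowerSeries.coeff n (f ^ k) = 0 :=
      PowerSeries.X_pow_dvd_iff.1 (pow_dvd_pow_of_dvd hf k) n (by simpa using hkn)
    simp [this]

lemma expo_zero : expo (0 : R⟦X⟧) = 1 := by
  rw [expo, adicSum_eq_sum_range (N := 1)]
  · simp
  · exact X_pow_dvd_expo_term (dvd_zero _)
  · intro k hk
    rw [zero_pow (by omega), smul_zero]

lemma expo_add {f g : R⟦X⟧} (hf : PowerSeries.X ∣ f) (hg : PowerSeries.X ∣ g) :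
    expo (f + g) = expo f * expo g := by
  rw [expo, expo, expo, adicSum_mul_adicSum (X_pow_dvd_expo_term hf) (X_pow_dvd_expo_term hg)]
  congr 1
  ext1 n
  rw [(Commute.all f g).add_pow', Finset.smul_sum]
  refine Finset.sum_congr rfl fun p hp => ?_
  have hp' := Finset.HasAntidiagonal.mem_antidiagonal.1 hp
  rw [smul_mul_smul_comm, ← Nat.cast_smul_eq_nsmul ℚ, smul_smul]
  congr 1
  rw [← hp', Nat.cast_add_choose]
  have h1 : ((p.1 + p.2).factorial : ℚ) ≠ 0 := by exact_mod_cast Nat.factorial_ne_zero _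
  field_simp

lemma expo_mul_expo_neg {f : R⟦X⟧} (hf : PowerSeries.X ∣ f) : expo f * expo (-f) = 1 := by
  rw [← expo_add hf ((dvd_neg).2 hf), add_neg_cancel, expo_zero]

lemma expo_nsmul {f : R⟦X⟧} (hf : PowerSeries.X ∣ f) (n : ℕ) : expo (n • f) = expo f ^ n := by
  induction n with
  | zero => simp [expo_zero]
  | succ n ih => rw [succ_nsmul, expo_add (dvd_smul_of_dvd n hf) hf, ih, pow_succ]

lemma map_expo (h : R⟦X⟧ →+* S⟦X⟧) (hX : PowerSeries.X ∣ h PowerSeries.X) {f : R⟦X⟧}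
    (hf : PowerSeries.X ∣ f) : h (expo f) = expo (h f) := by
  rw [expo, ringHom_adicSum h hX (X_pow_dvd_expo_term hf), expo]
  congr 1
  ext1 k
  rw [map_rat_smul, map_pow]

lemma constantCoeff_expo {f : R⟦X⟧} (hf : PowerSeries.X ∣ f) :
    PowerSeries.constantCoeff (expo f) = 1 := by
  have := PowerSeries.X_pow_dvd_iff.1 (X_pow_dvd_adicSum_sub (X_pow_dvd_expo_term hf) 1) 0 one_pos
  rw [map_sub, sub_eq_zero] at this
  simpa [expo] using this

lemma expo_X_rat : expo (PowerSeries.X : ℚ⟦X⟧) = PowerSeries.exp ℚ := by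
  rw [← subst_exp_eq_expo dvd_rfl]
  exact PowerSeries.X_subst _

lemma derivative_expo_rat {f : ℚ⟦X⟧} (hf : PowerSeries.X ∣ f) :
    PowerSeries.derivative ℚ (expo f) = expo f * PowerSeries.derivative ℚ f := by
  have h0 : PowerSeries.HasSubst f :=
    PowerSeries.HasSubst.of_constantCoeff_zero' (PowerSeries.X_dvd_iff.1 hf)
  rw [← subst_exp_eq_expo hf]
  have := PowerSeries.derivative_subst (f := PowerSeries.exp ℚ) h0
  rw [PowerSeries.derivative_exp] at this
  exact this

end Expo

/-! ### The symmetrised Gaussian integral over a commutative ring -/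

section RingVersion

variable {A A' : Type} [CommRing A] [CommRing A'] [Algebra ℚ A] [Algebra ℚ A']

/-- `Ring.inverse` is 0 at non-units, so a ring homomorphism need not commute with it there. The
unit hypotheses in the naturality lemmas below come from this. -/
lemma map_ringInverse {A A' : Type} [CommRing A] [CommRing A'] (f : A →+* A') {a : A} (ha : IsUnit a) :
    f (Ring.inverse a) = Ring.inverse (f a) := by
  obtain ⟨u, rfl⟩ := ha
  rw [Ring.inverse_unit]
  have : f (u : A) = (Units.map (f : A →* A') u : A'ˣ) := rfl
  rw [this, Ring.inverse_unit]
  rfl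

/-- The polylogarithm `Li_{-k}` over a commutative ring. -/
def rnegPolylog (k : ℕ) (a : A) : A :=
  Polynomial.aeval (a * Ring.inverse (1 - a)) (negPolylogPoly k)

/-- The rational coefficient `B_n(j/m) m^{n-1} / (n! s!)`. -/
def bernCoeff (m j n s : ℕ) : ℚ :=
  (Polynomial.bernoulli n).eval ((j : ℚ) / (m : ℚ)) * (m : ℚ) ^ ((n : ℤ) - 1) /
    ((n.factorial : ℚ) * (s.factorial : ℚ))

/-- The coefficients of `log (q a e^v; q)_∞` over a commutative ring. -/
def rlogPochCoeff (m : ℕ) (z a : A) (n s : ℕ) : A :=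
  ∑ j ∈ Finset.Icc 1 m, algebraMap ℚ A (bernCoeff m j n s) * rnegPolylog (n + s - 2) (z ^ j * a)

/-- The exponent of the integrand over a commutative ring. -/
def rexponent (m : ℕ) (z w₁ w₂ : A) (r : ℕ) : A[X]⟦X⟧ :=
  PowerSeries.mk fun d =>
    if d = 0 then 0
    else
      (if d = 1 then Polynomial.C (algebraMap ℚ A (1 / 2)) * Polynomial.X else 0) +
        ∑ n ∈ Finset.range ((d + 2) / 2 + 1),
          Polynomial.C (rlogPochCoeff m z (z ^ r * w₁) n (d + 2 - 2 * n) +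
            rlogPochCoeff m z (z ^ r * w₂) n (d + 2 - 2 * n)) *
              Polynomial.X ^ (d + 2 - 2 * n)

/-- The Gaussian mean of a polynomial, where `t ^ 2` has mean `h`. -/
def rmean (h : A) (P : A[X]) : A :=
  P.sum fun l c => if Even l then c * (Nat.doubleFactorial (l - 1) : A) * h ^ (l / 2) else 0

/-- Termwise Gaussian integration. -/
def rgauss (h : A) (E : A[X]⟦X⟧) : A⟦X⟧ :=
  PowerSeries.mk fun n => rmean h (PowerSeries.coeff (2 * n) E)

/-- The relative weight of a residue class. -/
def rweight (z w₁ w₂ u : A) (r : ℕ) : A :=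
  (-1) ^ r * z ^ (r * (r + 1) / 2) * u ^ r *
    Ring.inverse (∏ j ∈ Finset.Icc 1 r, ((1 - z ^ j * w₁) * (1 - z ^ j * w₂)))

/-- The negative inverse of the Hessian. -/
def rnegHessInv (m : ℕ) (w₁ w₂ : A) : A :=
  -((1 - w₁ ^ m) * (1 - w₂ ^ m) * Ring.inverse (1 - w₁ ^ m * w₂ ^ m))

/-- The weighted sum of the Gaussian integrals over all residue classes. -/
def rPhi (m : ℕ) (z w₁ w₂ u : A) : A⟦X⟧ :=
  ∑ r ∈ Finset.range m, PowerSeries.C (rweight z w₁ w₂ u r) *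
    rgauss (rnegHessInv m w₁ w₂) (expo (rexponent m z w₁ w₂ r))

/-- The symmetrised series over a commutative ring. -/
def rPsi (m : ℕ) (z w₁ w₂ u : A) : A⟦X⟧ :=
  PowerSeries.C (-(u * rnegHessInv m w₁ w₂ * Ring.inverse (m * ((1 - w₁) * (1 - w₂))))) *
    (rPhi m z w₁ w₂ u * PowerSeries.rescale (-1) (rPhi m (z ^ (m - 1)) w₁ w₂ u))

lemma X_dvd_rexponent (m : ℕ) (z w₁ w₂ : A) (r : ℕ) :
    PowerSeries.X ∣ rexponent m z w₁ w₂ r := by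
  rw [PowerSeries.X_dvd_iff, ← PowerSeries.coeff_zero_eq_constantCoeff_apply, rexponent,
    PowerSeries.coeff_mk, if_pos rfl]

lemma map_rnegPolylog (f : A →+* A') (k : ℕ) {a : A} (ha : IsUnit (1 - a)) :
    f (rnegPolylog k a) = rnegPolylog k (f a) := by
  have h1 : f (Ring.inverse (1 - a)) = Ring.inverse (1 - f a) := by
    rw [map_ringInverse f ha, map_sub, map_one]
  rw [rnegPolylog, rnegPolylog, ← h1, ← map_mul, Polynomial.aeval_def, Polynomial.aeval_def,
    Polynomial.hom_eval₂]
  congr 1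
  exact RingHom.ext_int _ _

lemma map_rlogPochCoeff (f : A →+* A') (m : ℕ) {z a : A}
    (ha : ∀ j, IsUnit (1 - z ^ j * a)) (n s : ℕ) :
    f (rlogPochCoeff m z a n s) = rlogPochCoeff m (f z) (f a) n s := by
  rw [rlogPochCoeff, map_sum]
  refine Finset.sum_congr rfl fun j _ => ?_
  rw [map_mul, map_rnegPolylog f _ (ha j), map_mul, map_pow]
  congr 1
  exact RingHom.congr_fun (Subsingleton.elim (f.comp (algebraMap ℚ A)) (algebraMap ℚ A')) _

lemma map_rexponent (f : A →+* A') (m : ℕ) {z w₁ w₂ : A}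
    (h₁ : ∀ j, IsUnit (1 - z ^ j * w₁)) (h₂ : ∀ j, IsUnit (1 - z ^ j * w₂)) (r : ℕ) :
    PowerSeries.map (Polynomial.mapRingHom f) (rexponent m z w₁ w₂ r) =
      rexponent m (f z) (f w₁) (f w₂) r := by
  have h₁' : ∀ j, IsUnit (1 - z ^ j * (z ^ r * w₁)) := fun j => by
    rw [← mul_assoc, ← pow_add]; exact h₁ _
  have h₂' : ∀ j, IsUnit (1 - z ^ j * (z ^ r * w₂)) := fun j => by
    rw [← mul_assoc, ← pow_add]; exact h₂ _
  have hq : ∀ q : ℚ, f (algebraMap ℚ A q) = algebraMap ℚ A' q := fun q =>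
    RingHom.congr_fun (Subsingleton.elim (f.comp (algebraMap ℚ A)) (algebraMap ℚ A')) q
  ext1 d
  simp only [rexponent, PowerSeries.coeff_map, PowerSeries.coeff_mk]
  by_cases hd : d = 0
  · simp [hd]
  rw [if_neg hd, if_neg hd, map_add, map_sum]
  congr 1
  · split_ifs
    · simp only [map_mul, Polynomial.coe_mapRingHom, Polynomial.map_C, hq, Polynomial.map_X]
    · simp
  · refine Finset.sum_congr rfl fun n _ => ?_
    simp only [map_mul, map_pow, Polynomial.coe_mapRingHom, Polynomial.map_C, map_add,
      map_rlogPochCoeff f m h₁', map_rlogPochCoeff f m h₂', Polynomial.map_X]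

lemma map_rmean (f : A →+* A') (h : A) (P : A[X]) :
    f (rmean h P) = rmean (f h) (P.map f) := by
  have hz : ∀ (B : Type) [CommRing B] (h : B) (n : ℕ),
      (if Even n then (0 : B) * (Nat.doubleFactorial (n - 1) : B) * h ^ (n / 2) else 0) = 0 := by
    intro B _ h n; simp
  rw [rmean, rmean, Polynomial.sum_over_range (f := fun l c => if Even l then
      c * (Nat.doubleFactorial (l - 1) : A) * h ^ (l / 2) else 0) _ (hz A h),
    Polynomial.sum_over_range' (f := fun l c => if Even l then
      c * (Nat.doubleFactorial (l - 1) : A') * f h ^ (l / 2) else 0) _ (hz A' (f h))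
      (P.natDegree + 1) (Nat.lt_succ_of_le Polynomial.natDegree_map_le), map_sum]
  refine Finset.sum_congr rfl fun n _ => ?_
  split_ifs <;> simp

lemma map_rgauss (f : A →+* A') (h : A) (E : A[X]⟦X⟧) :
    PowerSeries.map f (rgauss h E) =
      rgauss (f h) (PowerSeries.map (Polynomial.mapRingHom f) E) := by
  ext n
  simp [rgauss, map_rmean]

lemma map_rweight (f : A →+* A') {z w₁ w₂ : A}
    (h₁ : ∀ j, IsUnit (1 - z ^ j * w₁)) (h₂ : ∀ j, IsUnit (1 - z ^ j * w₂)) (u : A) (r : ℕ) :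
    f (rweight z w₁ w₂ u r) = rweight (f z) (f w₁) (f w₂) (f u) r := by
  rw [rweight, map_mul, map_ringInverse]
  · simp [rweight, map_prod]
  · exact (IsUnit.prod_iff).2 fun j _ => (h₁ j).mul (h₂ j)

lemma map_rnegHessInv (f : A →+* A') (m : ℕ) {w₁ w₂ : A} (h : IsUnit (1 - w₁ ^ m * w₂ ^ m)) :
    f (rnegHessInv m w₁ w₂) = rnegHessInv m (f w₁) (f w₂) := by
  simp [rnegHessInv, map_ringInverse f h]

lemma map_rPhi (f : A →+* A') (m : ℕ) {z w₁ w₂ : A}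
    (h₁ : ∀ j, IsUnit (1 - z ^ j * w₁)) (h₂ : ∀ j, IsUnit (1 - z ^ j * w₂))
    (h : IsUnit (1 - w₁ ^ m * w₂ ^ m)) (u : A) :
    PowerSeries.map f (rPhi m z w₁ w₂ u) = rPhi m (f z) (f w₁) (f w₂) (f u) := by
  rw [rPhi, map_sum]
  refine Finset.sum_congr rfl fun r _ => ?_
  rw [map_mul, PowerSeries.map_C, map_rweight f h₁ h₂, map_rgauss, map_rnegHessInv f m h,
    map_expo _ (X_dvd_map_X _) (X_dvd_rexponent _ _ _ _ _), map_rexponent f m h₁ h₂]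

lemma map_rescale_neg_one (f : A →+* A') (g : A⟦X⟧) :
    PowerSeries.map f (PowerSeries.rescale (-1) g) =
      PowerSeries.rescale (-1) (PowerSeries.map f g) := by
  ext n
  simp [PowerSeries.coeff_rescale]

/-- Naturality allows the integral to be computed at a generic point and specialised afterwards, and
it transports the grading used to separate the powers of ħ. -/
lemma map_rPsi (f : A →+* A') {m : ℕ} (hm : m ≠ 0) {z w₁ w₂ : A}
    (h₁ : ∀ j, IsUnit (1 - z ^ j * w₁)) (h₂ : ∀ j, IsUnit (1 - z ^ j * w₂))
    (h : IsUnit (1 - w₁ ^ m * w₂ ^ m)) (u : A) :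
    PowerSeries.map f (rPsi m z w₁ w₂ u) = rPsi m (f z) (f w₁) (f w₂) (f u) := by
  have h₁' : ∀ j, IsUnit (1 - (z ^ (m - 1)) ^ j * w₁) := fun j => by rw [← pow_mul]; exact h₁ _
  have h₂' : ∀ j, IsUnit (1 - (z ^ (m - 1)) ^ j * w₂) := fun j => by rw [← pow_mul]; exact h₂ _
  have hmu : IsUnit (m : A) := by
    have := (isUnit_iff_ne_zero.2 (Nat.cast_ne_zero (R := ℚ).2 hm)).map (algebraMap ℚ A)
    rwa [map_natCast] at this
  have hu : IsUnit ((m : A) * ((1 - w₁) * (1 - w₂))) :=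
    hmu.mul ((by simpa using h₁ 0 : IsUnit (1 - w₁)).mul (by simpa using h₂ 0))
  rw [rPsi, map_mul, map_mul, map_rescale_neg_one, map_rPhi f m h₁ h₂ h, map_rPhi f m h₁' h₂' h,
    PowerSeries.map_C, map_neg, map_mul, map_mul, map_rnegHessInv f m h, map_ringInverse f hu]
  simp [rPsi]

end RingVersion

/-! ### The symmetrised series over a field as a value of `rPsi` -/

section Field

variable {K : Type} [Field K] [CharZero K]

lemma exponent_eq_rexponent (m : ℕ) (z X w : K) (r : ℕ) :
    exponent m z X w r = rexponent m z w (w * X ^ 2) r := by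
  have hl : ∀ a n s, logPochCoeff m z a n s = rlogPochCoeff m z a n s := by
    intro a n s
    refine Finset.sum_congr rfl fun j _ => ?_
    rw [negPolylog, rnegPolylog, Ring.inverse_eq_inv, div_eq_mul_inv (z ^ j * a), bernCoeff,
      eq_ratCast]
    push_cast
    rfl
  ext1 d
  simp only [exponent, rexponent, hl, PowerSeries.coeff_mk, mul_assoc]
  simp

lemma gaussianIntegral_eq_rgauss (H : K) (E : K[X]⟦X⟧) :
    gaussianIntegral H E = rgauss (-1 / H) E := rfl

lemma classWeight_eq_rweight (z X w : K) (r : ℕ) :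
    classWeight z X w r = rweight z w (w * X ^ 2) (w * X) r := by
  rw [classWeight, rweight, Ring.inverse_eq_inv, div_eq_mul_inv]
  simp only [mul_assoc]

lemma neg_one_div_hessian (m : ℕ) {X w : K} (h₁ : 1 - w ^ m ≠ 0)
    (h₂ : 1 - (w * X ^ 2) ^ m ≠ 0) :
    -1 / hessian (X ^ m) (w ^ m) = rnegHessInv m w (w * X ^ 2) := by
  have e : (X ^ m) ^ 2 * w ^ m = (w * X ^ 2) ^ m := by rw [mul_pow, ← pow_mul, ← pow_mul]; ring
  rw [hessian, rnegHessInv, Ring.inverse_eq_inv, e]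
  have : 1 + w ^ m / (1 - w ^ m) + (w * X ^ 2) ^ m / (1 - (w * X ^ 2) ^ m) =
      (1 - w ^ m * (w * X ^ 2) ^ m) / ((1 - w ^ m) * (1 - (w * X ^ 2) ^ m)) := by
    field_simp
    ring
  rw [this, neg_div, one_div_div, div_eq_mul_inv]

/-- Passing to z⁻¹ amounts to j ↦ m - j, which reverses the sign of the exponent m - 2j. All factors
cancel except those at j = m, which occur twice with exponent -m. -/
lemma prod_root_mul_prod_root_inv {m : ℕ} (hm : m ≠ 0) (F : K → K) {z : K} (hz : z ^ m = 1)
    (hF : ∀ j : ℕ, F (z ^ j) ≠ 0) :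
    (∏ j ∈ Finset.Icc 1 m, F (z ^ j) ^ ((m : ℤ) - 2 * (j : ℤ))) *
      ∏ j ∈ Finset.Icc 1 m, F (z⁻¹ ^ j) ^ ((m : ℤ) - 2 * (j : ℤ)) =
    (F 1 ^ (2 * m))⁻¹ := by
  obtain ⟨n, rfl⟩ := Nat.exists_eq_succ_of_ne_zero hm
  have hz0 : z ≠ 0 := by rintro rfl; simp at hz
  have hI : Finset.Icc 1 (n + 1) = insert (n + 1) (Finset.Icc 1 n) := by
    ext; simp only [Finset.mem_Icc, Finset.mem_insert]; omega
  have hnot : n + 1 ∉ Finset.Icc 1 n := by simp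
  simp only [Nat.succ_eq_add_one] at hz ⊢
  rw [hI, Finset.prod_insert hnot, Finset.prod_insert hnot, inv_pow, hz, inv_one]
  have key : (∏ j ∈ Finset.Icc 1 n, F (z⁻¹ ^ j) ^ (((n + 1 : ℕ) : ℤ) - 2 * (j : ℤ))) =
      ∏ j ∈ Finset.Icc 1 n, (F (z ^ j) ^ (((n + 1 : ℕ) : ℤ) - 2 * (j : ℤ)))⁻¹ := by
    refine Finset.prod_bij' (fun j _ => n + 1 - j) (fun j _ => n + 1 - j) ?_ ?_ ?_ ?_ ?_
    · intro j hj; simp only [Finset.mem_Icc] at hj ⊢; omega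
    · intro j hj; simp only [Finset.mem_Icc] at hj ⊢; omega
    · intro j hj; simp only [Finset.mem_Icc] at hj; omega
    · intro j hj; simp only [Finset.mem_Icc] at hj; omega
    · intro j hj
      simp only [Finset.mem_Icc] at hj
      have : z⁻¹ ^ j = z ^ (n + 1 - j) := by
        rw [inv_pow]
        refine inv_eq_of_mul_eq_one_right ?_
        rw [← pow_add, Nat.add_sub_cancel' (by omega), hz]
      rw [this, ← zpow_neg]
      congr 1
      push_cast [Nat.cast_sub (show j ≤ n + 1 by omega)]
      ring
  rw [key, mul_mul_mul_comm, ← Finset.prod_mul_distrib, Finset.prod_eq_one, mul_one]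
  · have h1 := hF 0
    rw [pow_zero] at h1
    rw [← zpow_add₀ h1, ← zpow_natCast, ← zpow_neg]
    congr 1
    push_cast
    ring
  · intro j _
    exact mul_inv_cancel₀ (zpow_ne_zero _ (hF j))

/-- The factors e^{ħ/12} and e^{-ħ/12} cancel. In the product of the two prefactors every chosen
root occurs to a multiple of the 2m-th power, so no branch is left, and the product is wX / (mH(1 -
w)(1 - wX²)). -/
lemma symSeries_eq_rPsi {m : ℕ} (hm : m ≠ 0) (root : K → K)
    (hroot : ∀ a : K, root a ^ (2 * m) = a) {z X w : K} (hz : z ^ m = 1)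
    (h₁ : ∀ j : ℕ, 1 - z ^ j * w ≠ 0) (h₂ : ∀ j : ℕ, 1 - z ^ j * (w * X ^ 2) ≠ 0)
    (h₁' : 1 - w ^ m ≠ 0) (h₂' : 1 - (w * X ^ 2) ^ m ≠ 0) :
    symSeries m root z X w = rPsi m z w (w * X ^ 2) (w * X) := by
  have hz0 : z ≠ 0 := by rintro rfl; simp [hm] at hz
  have hzi : z⁻¹ = z ^ (m - 1) := by
    refine inv_eq_of_mul_eq_one_right ?_
    rw [← pow_succ', Nat.sub_add_cancel (Nat.one_le_iff_ne_zero.2 hm), hz]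
  have hr0 : ∀ {a : K}, a ≠ 0 → root a ≠ 0 := fun {a} ha h => ha <| by
    rw [← hroot a, h, zero_pow (by omega)]
  have hpert : ∀ z' : K, pertSeries m root z' X w = PowerSeries.C (prefactor m root z' X w) *
      PowerSeries.rescale (1 / 12 : K) (PowerSeries.exp K) * rPhi m z' w (w * X ^ 2) (w * X) := by
    intro z'
    rw [pertSeries, rPhi]
    congr 1
    refine Finset.sum_congr rfl fun r _ => ?_
    rw [classWeight_eq_rweight, gaussianIntegral_eq_rgauss, neg_one_div_hessian m h₁' h₂',
      exponent_eq_rexponent]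
    rw [← subst_exp_eq_expo (X_dvd_rexponent _ _ _ _ _)]
  have hexp : PowerSeries.rescale (1 / 12 : K) (PowerSeries.exp K) *
      PowerSeries.rescale (-1) (PowerSeries.rescale (1 / 12 : K) (PowerSeries.exp K)) = 1 := by
    rw [PowerSeries.rescale_rescale, PowerSeries.exp_mul_exp_eq_exp_add]
    norm_num
  have hpre : prefactor m root z X w * prefactor m root z⁻¹ X w =
      -(w * X * rnegHessInv m w (w * X ^ 2) *
        Ring.inverse (m * ((1 - w) * (1 - w * X ^ 2)))) := by
    rw [prefactor, prefactor, mul_mul_mul_comm, ← pow_add, ← two_mul, hroot]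
    have := prod_root_mul_prod_root_inv hm
      (fun y => root (1 - y * w) * root (1 - y * w * X ^ 2)) hz fun j =>
        mul_ne_zero (hr0 (h₁ j)) (hr0 (by rw [mul_assoc]; exact h₂ j))
    rw [this]
    simp only [one_mul, mul_pow, hroot]
    rw [Ring.inverse_eq_inv, ← neg_one_div_hessian m h₁' h₂', mul_inv]
    simp only [div_eq_mul_inv, mul_inv]
    ring
  rw [symSeries, hpert, hpert, rPsi, ← hpre, map_mul, map_mul, ← hzi, map_mul]
  have hC : PowerSeries.rescale (-1 : K) (PowerSeries.C (prefactor m root z⁻¹ X w)) =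
      PowerSeries.C (prefactor m root z⁻¹ X w) := by
    ext n; cases n <;> simp [PowerSeries.coeff_C]
  rw [hC]
  linear_combination (PowerSeries.C (prefactor m root z X w) *
    PowerSeries.C (prefactor m root z⁻¹ X w) * rPhi m z w (w * X ^ 2) (w * X) *
    PowerSeries.rescale (-1) (rPhi m z⁻¹ w (w * X ^ 2) (w * X))) * hexp

end Field

/-! ### Gaussian functionals on power series with polynomial coefficients -/

section Gauss

variable {B : Type} [CommRing B] [Algebra ℚ B]

lemma rmean_add (h : B) (P Q : B[X]) : rmean h (P + Q) = rmean h P + rmean h Q := by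
  rw [rmean, rmean, rmean]
  refine Polynomial.sum_add_index _ _ _ (fun i => ?_) (fun i a b => ?_)
  · simp
  · split_ifs <;> ring

lemma rmean_monomial (h : B) (n : ℕ) (a : B) : rmean h (Polynomial.monomial n a) =
    if Even n then a * (Nat.doubleFactorial (n - 1) : B) * h ^ (n / 2) else 0 := by
  rw [rmean]
  exact Polynomial.sum_monomial_index _ _ (by simp)

lemma rmean_C_mul (h a : B) (P : B[X]) : rmean h (Polynomial.C a * P) = a * rmean h P := by
  induction P using Polynomial.induction_on' with
  | add p q hp hq => rw [mul_add, rmean_add, rmean_add, hp, hq, mul_add]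
  | monomial n b =>
    rw [Polynomial.C_mul_monomial, rmean_monomial, rmean_monomial]
    split_ifs <;> ring

/-- The moment of order `n` of the Gaussian functional of variance `h`. -/
def gmoment (h : B) (n : ℕ) : B :=
  if Even n then (Nat.doubleFactorial (n - 1) : B) * h ^ (n / 2) else 0

/-- Integration by parts for the Gaussian of variance h. -/
lemma gmoment_add_two (h : B) (n : ℕ) : gmoment h (n + 2) = (n + 1) * h * gmoment h n := by
  rw [gmoment, gmoment]
  by_cases hn : Even n
  · have h2 : Even (n + 2) := hn.add even_two
    rw [if_pos hn, if_pos h2, Nat.add_div_right _ two_pos, pow_succ]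
    -- For n = 0 the truncated difference n - 1 is 0, and 0‼ = 1 is the value wanted for (-1)‼.
    rcases n with _ | n
    · simp
    · rw [show n + 1 + 2 - 1 = n + 2 by omega, Nat.doubleFactorial_add_two,
        show n + 1 - 1 = n by omega]
      push_cast
      ring
  · have h2 : ¬ Even (n + 2) := fun h => hn (by simpa [Nat.even_add] using h)
    rw [if_neg hn, if_neg h2, mul_zero]

lemma rmean_X_pow (h : B) (n : ℕ) : rmean h (Polynomial.X ^ n) = gmoment h n := by
  rw [← Polynomial.monomial_one_right_eq_X_pow, rmean_monomial, gmoment]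
  simp

/-- Series in `ε`, as series in `ε` with coefficients polynomials in `t`. -/
def liftT : B⟦X⟧ →+* B[X]⟦X⟧ := PowerSeries.map Polynomial.C

/-- The integration variable `t`. -/
def varT : B[X]⟦X⟧ := PowerSeries.C Polynomial.X

lemma X_dvd_liftT {f : B⟦X⟧} (hf : PowerSeries.X ∣ f) : PowerSeries.X ∣ liftT f := by
  obtain ⟨g, rfl⟩ := hf
  rw [map_mul, liftT, PowerSeries.map_X]
  exact dvd_mul_right _ _

lemma liftT_X : liftT (PowerSeries.X : B⟦X⟧) = PowerSeries.X := PowerSeries.map_X _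

/-- The Gaussian functional of variance `h`, on series in `ε` with polynomial coefficients. -/
def gMean (h : B⟦X⟧) : B[X]⟦X⟧ →+ B⟦X⟧ where
  toFun f := adicSum fun k =>
    rmean h ((PowerSeries.coeff k f).map PowerSeries.C) * PowerSeries.X ^ k
  map_zero' := by ext n; simp [coeff_adicSum, rmean]
  map_add' f g := by
    rw [← adicSum_add]
    congr 1
    ext1 k
    rw [map_add, Polynomial.map_add, rmean_add, add_mul]

lemma gMean_apply (h : B⟦X⟧) (f : B[X]⟦X⟧) : gMean h f = adicSum fun k =>
    rmean h ((PowerSeries.coeff k f).map PowerSeries.C) * PowerSeries.X ^ k := rfl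

lemma gMean_X_pow_mul (h : B⟦X⟧) (n : ℕ) (f : B[X]⟦X⟧) :
    gMean h (PowerSeries.X ^ n * f) = PowerSeries.X ^ n * gMean h f := by
  induction n with
  | zero => simp
  | succ n ih =>
    rw [pow_succ', mul_assoc, pow_succ', mul_assoc, ← ih]
    generalize PowerSeries.X ^ n * f = f
    rw [gMean_apply, gMean_apply, adicSum_eq_add_succ fun k => dvd_mul_left _ _,
      mul_adicSum _ fun k => dvd_mul_left _ _]
    have h0 : PowerSeries.coeff 0 (PowerSeries.X * f) = 0 := by simp
    rw [h0, Polynomial.map_zero]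
    have h1 : rmean h (0 : B⟦X⟧[X]) = 0 := by simp [rmean]
    rw [h1, zero_mul, zero_add]
    congr 1
    ext1 k
    rw [PowerSeries.coeff_succ_X_mul, pow_succ]
    ring

lemma X_pow_dvd_gMean (h : B⟦X⟧) (n : ℕ) (f : B[X]⟦X⟧) (hf : PowerSeries.X ^ n ∣ f) :
    PowerSeries.X ^ n ∣ gMean h f := by
  obtain ⟨g, rfl⟩ := hf
  rw [gMean_X_pow_mul]
  exact dvd_mul_right _ _

lemma gMean_adicSum (h : B⟦X⟧) {g : ℕ → B[X]⟦X⟧} (hg : ∀ k, PowerSeries.X ^ k ∣ g k) :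
    gMean h (adicSum g) = adicSum fun k => gMean h (g k) :=
  map_adicSum (gMean h) (X_pow_dvd_gMean h) hg

lemma powerSeries_eq_adicSum {R : Type} [CommRing R] (f : R⟦X⟧) :
    f = adicSum fun k => PowerSeries.C (PowerSeries.coeff k f) * PowerSeries.X ^ k := by
  ext n
  rw [coeff_adicSum, Finset.sum_eq_single n]
  · simp [PowerSeries.coeff_C_mul, PowerSeries.coeff_X_pow]
  · intro k _ hk
    simp [PowerSeries.coeff_C_mul, PowerSeries.coeff_X_pow, hk.symm]
  · simp

lemma gMean_C_mul (h : B⟦X⟧) (b : B) (f : B[X]⟦X⟧) :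
    gMean h (PowerSeries.C (Polynomial.C b) * f) = PowerSeries.C b * gMean h f := by
  rw [gMean_apply, gMean_apply, mul_adicSum _ fun k => dvd_mul_left _ _]
  congr 1
  ext1 k
  rw [PowerSeries.coeff_C_mul, Polynomial.map_mul, Polynomial.map_C, rmean_C_mul, mul_assoc]

lemma gMean_liftT_mul (h g : B⟦X⟧) (f : B[X]⟦X⟧) : gMean h (liftT g * f) = g * gMean h f := by
  have hd : ∀ k, PowerSeries.X ^ k ∣ liftT (PowerSeries.C (PowerSeries.coeff k g)) *
      (PowerSeries.X : B[X]⟦X⟧) ^ k := fun k => dvd_mul_left _ _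
  have e : liftT g = adicSum fun k => liftT (PowerSeries.C (PowerSeries.coeff k g)) *
      (PowerSeries.X : B[X]⟦X⟧) ^ k := by
    conv_lhs => rw [powerSeries_eq_adicSum g]
    rw [ringHom_adicSum liftT (X_dvd_map_X _) fun k => dvd_mul_left _ _]
    simp only [map_mul, map_pow, liftT_X]
  rw [e, mul_comm, mul_adicSum _ hd, gMean_adicSum _ fun k => (hd k).mul_left _]
  conv_rhs => rw [powerSeries_eq_adicSum g, mul_comm, mul_adicSum _ fun k => dvd_mul_left _ _]
  congr 1
  ext1 k
  have : f * (liftT (PowerSeries.C (PowerSeries.coeff k g)) * PowerSeries.X ^ k) =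
      PowerSeries.C (Polynomial.C (PowerSeries.coeff k g)) * (PowerSeries.X ^ k * f) := by
    rw [liftT, PowerSeries.map_C]; ring
  rw [this, gMean_C_mul, gMean_X_pow_mul]
  ring

lemma gMean_varT_pow (h : B⟦X⟧) (n : ℕ) : gMean h (varT ^ n) = gmoment h n := by
  rw [gMean_apply, adicSum_eq_sum_range (N := 1) fun k => dvd_mul_left _ _]
  · rw [varT, ← map_pow]
    simp [rmean_X_pow]
  · intro k hk
    rw [varT, ← map_pow, PowerSeries.coeff_C, if_neg (by omega)]
    simp [rmean]

/-- Polynomials in `t` with coefficients series in `ε`, as series in `ε`. -/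
def polyLift : B⟦X⟧[X] →+* B[X]⟦X⟧ := Polynomial.eval₂RingHom liftT varT

lemma gMean_polyLift (h : B⟦X⟧) (P : B⟦X⟧[X]) : gMean h (polyLift P) = rmean h P := by
  induction P using Polynomial.induction_on' with
  | add p q hp hq => rw [map_add, map_add, hp, hq, rmean_add]
  | monomial n b =>
    rw [polyLift, Polynomial.coe_eval₂RingHom, Polynomial.eval₂_monomial, gMean_liftT_mul,
      gMean_varT_pow, rmean_monomial, gmoment]
    split_ifs <;> ring

/-- Identify the two variables. -/
def diagHom : B⟦X⟧⟦X⟧ →+* B⟦X⟧ := evalAt (RingHom.id _) PowerSeries.X dvd_rfl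

/-- The comparison map for series whose coefficients are polynomials in `t` over `B⟦ε⟧`. -/
def diagLift : B⟦X⟧[X]⟦X⟧ →+* B[X]⟦X⟧ := evalAt polyLift PowerSeries.X dvd_rfl

/-- When w₁ and w₂ are themselves series in ε, the exponent of the integrand involves ε twice: as
the expansion variable and inside the coefficients. Coefficientwise integration is compatible with
identifying the two. -/
lemma gMean_diagLift (h : B⟦X⟧) (E : B⟦X⟧[X]⟦X⟧) : gMean h (diagLift E) =
    diagHom (PowerSeries.mk fun k => rmean h (PowerSeries.coeff k E)) := by
  rw [diagLift, diagHom, evalAt_apply, evalAt_apply, gMean_adicSum _ fun k => dvd_mul_left _ _]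
  congr 1
  ext1 k
  rw [mul_comm, gMean_X_pow_mul, gMean_polyLift, PowerSeries.coeff_mk, mul_comm]
  rfl

/-- Completing the square for variance -1: the mean of e^{yt} is e^{-y²/2}. It is checked on
moments, since the odd ones vanish and the moment of order 2n is (-1)^n (2n)!/(2^n n!). -/
lemma gMean_neg_one_expo_linear (c : B⟦X⟧) :
    gMean (-1) (expo (liftT (c * PowerSeries.X) * varT)) =
      expo (-((1 / 2 : ℚ) • (c * PowerSeries.X) ^ 2)) := by
  set y := c * PowerSeries.X with hy
  have hyX : PowerSeries.X ∣ y := dvd_mul_left _ _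
  have h1 : PowerSeries.X ∣ liftT y * varT := (X_dvd_liftT hyX).mul_right _
  have hterm : ∀ k : ℕ, gMean (-1) (((k.factorial : ℚ)⁻¹) • (liftT y * varT) ^ k) =
      ((k.factorial : ℚ)⁻¹) • (y ^ k * gmoment (-1) k) := by
    intro k
    rw [map_rat_smul (gMean _), mul_pow, ← map_pow, gMean_liftT_mul, gMean_varT_pow]
  have hd : ∀ k : ℕ, PowerSeries.X ^ k ∣ ((k.factorial : ℚ)⁻¹) • (y ^ k * gmoment (-1) k) :=
    fun k => dvd_smul_of_dvd _ ((pow_dvd_pow_of_dvd hyX k).mul_right _)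
  have h2 : PowerSeries.X ∣ -((1 / 2 : ℚ) • y ^ 2) :=
    (dvd_neg).2 (dvd_smul_of_dvd _ (hyX.trans (dvd_pow_self _ two_ne_zero)))
  rw [expo, gMean_adicSum _ (X_pow_dvd_expo_term h1)]
  simp only [hterm]
  symm
  refine eq_adicSum hd fun n => ?_
  -- The first 2n terms on the left match the first n on the right, because the odd moments are
  -- zero.
  have h3 : ∑ k ∈ Finset.range (2 * n), ((k.factorial : ℚ)⁻¹) • (y ^ k * gmoment (-1) k) =
      ∑ k ∈ Finset.range n, ((k.factorial : ℚ)⁻¹) • (-((1 / 2 : ℚ) • y ^ 2)) ^ k := by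
    induction n with
    | zero => simp
    | succ n ih =>
      rw [show 2 * (n + 1) = 2 * n + 1 + 1 by ring, Finset.sum_range_succ, Finset.sum_range_succ,
        ih, Finset.sum_range_succ _ n, add_assoc]
      congr 1
      have ho : gmoment (-1 : B⟦X⟧) (2 * n + 1) = 0 := by
        rw [gmoment, if_neg (by simp)]
      have he : ∀ n : ℕ, gmoment (-1 : B⟦X⟧) (2 * n) =
          ((-1) ^ n * ((2 * n).factorial / (2 ^ n * n.factorial) : ℚ)) • (1 : B⟦X⟧) := by
        intro n
        induction n with
        | zero => simp [gmoment]
        | succ n ihn =>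
          have h4 : ((2 * n : ℕ) : B⟦X⟧) + 1 = ((2 * n + 1 : ℕ) : ℚ) • (1 : B⟦X⟧) := by
            rw [Nat.cast_smul_eq_nsmul, nsmul_eq_mul, mul_one]; push_cast; ring
          rw [show 2 * (n + 1) = 2 * n + 2 by ring, gmoment_add_two, ihn, h4]
          rw [mul_neg_one, ← neg_smul, smul_mul_smul_comm, mul_one]
          congr 1
          rw [show 2 * n + 2 = (2 * n + 1) + 1 by ring, Nat.factorial_succ, Nat.factorial_succ,
            Nat.factorial_succ]
          push_cast
          field_simp
          ring
      rw [ho, mul_zero, smul_zero, add_zero, he, ← neg_smul, smul_pow, ← pow_mul, mul_smul_comm,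
        mul_one, smul_smul, smul_smul]
      congr 1
      have : ((2 * n).factorial : ℚ) ≠ 0 := by exact_mod_cast Nat.factorial_ne_zero _
      field_simp
      rw [← mul_pow]
      norm_num
  have h4 := X_pow_dvd_adicSum_sub (X_pow_dvd_expo_term h2) n
  have h5 : PowerSeries.X ^ n ∣
      ∑ k ∈ Finset.range (2 * n), ((k.factorial : ℚ)⁻¹) • (y ^ k * gmoment (-1) k) -
      ∑ k ∈ Finset.range n, ((k.factorial : ℚ)⁻¹) • (y ^ k * gmoment (-1) k) := by
    rw [← Finset.sum_range_add_sum_Ico _ (show n ≤ 2 * n by omega), add_sub_cancel_left]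
    exact Finset.dvd_sum fun k hk => (pow_dvd_pow _ (Finset.mem_Ico.1 hk).1).trans (hd k)
  rw [h3] at h5
  have := h4.add h5
  rwa [sub_add_sub_cancel] at this

/-! #### Change of the Hessian -/

/-- The series `(1 + X)^{-1/2}`. -/
def invSqrtSeries : ℚ⟦X⟧ :=
  PowerSeries.mk fun k => ((k.factorial : ℚ)⁻¹ * (1 / 2) ^ k) * gmoment (-1) (2 * k)

/-- The recursion of the Gaussian moments says that S = `invSqrtSeries` satisfies 2(1 + X)S' = -S.
Hence S²(1 + X) has derivative zero and constant term 1. -/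
lemma invSqrtSeries_sq : invSqrtSeries ^ 2 * (1 + PowerSeries.X) = 1 := by
  have hrec : 2 * (1 + PowerSeries.X) * PowerSeries.derivative ℚ invSqrtSeries =
      -invSqrtSeries := by
    have hc : ∀ k : ℕ, 2 * ((k : ℚ) + 1) * PowerSeries.coeff (k + 1) invSqrtSeries =
        -(2 * k + 1) * PowerSeries.coeff k invSqrtSeries := by
      intro k
      simp only [invSqrtSeries, PowerSeries.coeff_mk]
      rw [show 2 * (k + 1) = 2 * k + 2 by ring, gmoment_add_two, Nat.factorial_succ]
      have : ((k : ℚ) + 1) ≠ 0 := by positivity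
      push_cast
      rw [pow_succ]
      field_simp
    ext k
    rw [mul_assoc, add_mul, one_mul, two_mul]
    have e1 : PowerSeries.coeff k (PowerSeries.derivative ℚ invSqrtSeries +
        PowerSeries.X * PowerSeries.derivative ℚ invSqrtSeries) =
        (k + 1) * PowerSeries.coeff (k + 1) invSqrtSeries +
          k * PowerSeries.coeff k invSqrtSeries := by
      rw [map_add, PowerSeries.coeff_derivative]
      rcases k with _ | k
      · simp
      · rw [PowerSeries.coeff_succ_X_mul, PowerSeries.coeff_derivative]
        push_cast
        ring
    rw [map_add, e1, map_neg]
    linear_combination hc k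
  refine PowerSeries.derivative.ext ?_ ?_
  · rw [Derivation.leibniz, Derivation.leibniz_pow, map_add]
    simp only [PowerSeries.derivative_one, PowerSeries.derivative_X, smul_eq_mul, nsmul_eq_mul]
    push_cast
    linear_combination invSqrtSeries * hrec
  · simp [invSqrtSeries, gmoment]

/-- The Gaussian integral of `e^{κ t² / 2}`. -/
def hessFactor (κ : B⟦X⟧) : B⟦X⟧ :=
  gMean (-1) (expo (liftT κ * ((1 / 2 : ℚ) • varT ^ 2)))

lemma gMean_expo_hess_mul_pow {κ : B⟦X⟧} (hκ : PowerSeries.X ∣ κ) (n : ℕ) :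
    gMean (-1) (expo (liftT κ * ((1 / 2 : ℚ) • varT ^ 2)) * varT ^ n) =
      adicSum fun k => ((k.factorial : ℚ)⁻¹ * (1 / 2) ^ k) • (κ ^ k * gmoment (-1) (n + 2 * k)) := by
  have h1 : PowerSeries.X ∣ liftT κ * ((1 / 2 : ℚ) • varT ^ 2) := (X_dvd_liftT hκ).mul_right _
  rw [mul_comm, expo, mul_adicSum _ (X_pow_dvd_expo_term h1),
    gMean_adicSum _ fun k => (X_pow_dvd_expo_term h1 k).mul_left _]
  congr 1
  ext1 k
  rw [mul_smul_comm, map_rat_smul (gMean _), mul_pow, smul_pow, ← map_pow, mul_smul_comm,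
    mul_smul_comm, map_rat_smul (gMean _), mul_left_comm, ← pow_mul, ← pow_add, gMean_liftT_mul,
    gMean_varT_pow, smul_smul]

/-- Integration by parts for the weight of Hessian 1 + κ, carried out on the expansion in κ.
Multiplication by κ shifts the index k, and what remains is the recursion of the moments of variance
-1. -/
lemma gMean_expo_hess_mul_pow_add_two {κ : B⟦X⟧} (hκ : PowerSeries.X ∣ κ) (n : ℕ) :
    (1 + κ) * gMean (-1) (expo (liftT κ * ((1 / 2 : ℚ) • varT ^ 2)) * varT ^ (n + 2)) =
      -((n : B⟦X⟧) + 1) * gMean (-1) (expo (liftT κ * ((1 / 2 : ℚ) • varT ^ 2)) * varT ^ n) := by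
  have hd : ∀ (n k : ℕ), PowerSeries.X ^ k ∣
      ((k.factorial : ℚ)⁻¹ * (1 / 2) ^ k) • (κ ^ k * gmoment (-1) (n + 2 * k)) :=
    fun n k => dvd_smul_of_dvd _ ((pow_dvd_pow_of_dvd hκ k).mul_right _)
  have hd' : ∀ k : ℕ, PowerSeries.X ^ k ∣
      ((k : ℚ) * 2 * ((k.factorial : ℚ)⁻¹ * (1 / 2) ^ k)) • (κ ^ k * gmoment (-1) (n + 2 * k)) :=
    fun k => dvd_smul_of_dvd _ ((pow_dvd_pow_of_dvd hκ k).mul_right _)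
  rw [gMean_expo_hess_mul_pow hκ, gMean_expo_hess_mul_pow hκ, mul_adicSum _ (hd n), add_mul,
    one_mul]
  have h1 : κ * adicSum (fun k => ((k.factorial : ℚ)⁻¹ * (1 / 2) ^ k) •
      (κ ^ k * gmoment (-1) (n + 2 + 2 * k))) = adicSum fun k =>
      ((k : ℚ) * 2 * ((k.factorial : ℚ)⁻¹ * (1 / 2) ^ k)) •
        (κ ^ k * gmoment (-1) (n + 2 * k)) := by
    rw [adicSum_eq_add_succ hd', mul_adicSum _ (hd _)]
    simp only [Nat.cast_zero, zero_mul, zero_smul, zero_add]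
    congr 1
    ext1 k
    rw [mul_smul_comm, show n + 2 * (k + 1) = n + 2 + 2 * k by ring, pow_succ' κ, mul_assoc κ]
    congr 1
    rw [Nat.factorial_succ, pow_succ]
    have : ((k : ℚ) + 1) ≠ 0 := by positivity
    push_cast
    field_simp
  rw [h1, ← adicSum_add]
  congr 1
  ext1 k
  rw [show n + 2 + 2 * k = n + 2 * k + 2 by ring, gmoment_add_two, mul_assoc (k : ℚ), mul_smul]
  simp only [mul_smul, Nat.cast_smul_eq_nsmul, nsmul_eq_mul]
  have h2 : (2 : ℚ) • ((k.factorial : ℚ)⁻¹ • ((1 / 2 : ℚ) ^ k •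
      (κ ^ k * gmoment (-1 : B⟦X⟧) (n + 2 * k)))) = 2 * ((k.factorial : ℚ)⁻¹ •
      ((1 / 2 : ℚ) ^ k • (κ ^ k * gmoment (-1) (n + 2 * k)))) := by
    rw [show (2 : ℚ) = ((2 : ℕ) : ℚ) by norm_num, Nat.cast_smul_eq_nsmul, nsmul_eq_mul]
    norm_num
  have h3 : ∀ g : B⟦X⟧, (k.factorial : ℚ)⁻¹ • ((1 / 2 : ℚ) ^ k •
      (κ ^ k * (g * gmoment (-1 : B⟦X⟧) (n + 2 * k)))) = g * ((k.factorial : ℚ)⁻¹ •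
      ((1 / 2 : ℚ) ^ k • (κ ^ k * gmoment (-1) (n + 2 * k)))) := by
    intro g
    rw [mul_left_comm, mul_smul_comm, mul_smul_comm]
  rw [h2, h3]
  push_cast
  ring

/-- The weight e^{κt²/2} turns variance -1 into h = -1/(1 + κ), up to the total mass `hessFactor`:
both sides satisfy the same two-step recursion in n. -/
lemma gMean_expo_hess_mul_varT_pow {κ h : B⟦X⟧} (hκ : PowerSeries.X ∣ κ)
    (hh : h * (1 + κ) = -1) (n : ℕ) :
    gMean (-1) (expo (liftT κ * ((1 / 2 : ℚ) • varT ^ 2)) * varT ^ n) =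
      hessFactor κ * gmoment h n := by
  induction n using Nat.twoStepInduction with
  | zero => simp [hessFactor, gmoment]
  | one =>
    rw [gMean_expo_hess_mul_pow hκ]
    have : ∀ k : ℕ, gmoment (-1 : B⟦X⟧) (1 + 2 * k) = 0 := fun k => by
      rw [gmoment, if_neg (by simp [Nat.even_add])]
    simp only [this, mul_zero, smul_zero]
    ext n
    simp [coeff_adicSum, gmoment]
  | more n ih _ =>
    have h1 := gMean_expo_hess_mul_pow_add_two hκ n
    rw [ih] at h1
    rw [gmoment_add_two]
    linear_combination (-h) * h1 + gMean (-1) (expo (liftT κ * ((1 / 2 : ℚ) • varT ^ 2)) *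
      varT ^ (n + 2)) * hh

/-- Changing the Hessian of the Gaussian functional. -/
lemma gMean_expo_hess_mul {κ h : B⟦X⟧} (hκ : PowerSeries.X ∣ κ)
    (hh : h * (1 + κ) = -1) (f : B[X]⟦X⟧) :
    gMean (-1) (expo (liftT κ * ((1 / 2 : ℚ) • varT ^ 2)) * f) = hessFactor κ * gMean h f := by
  set e := expo (liftT κ * ((1 / 2 : ℚ) • (varT : B[X]⟦X⟧) ^ 2)) with he
  have hP : ∀ P : B[X], gMean (-1) (e * PowerSeries.C P) =
      hessFactor κ * gMean h (PowerSeries.C P) := by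
    intro P
    induction P using Polynomial.induction_on' with
    | add p q hp hq => simp only [map_add, mul_add, hp, hq]
    | monomial n b =>
      have : (PowerSeries.C (Polynomial.monomial n b) : B[X]⟦X⟧) =
          PowerSeries.C (Polynomial.C b) * varT ^ n := by
        rw [varT, ← map_pow, ← map_mul, Polynomial.C_mul_X_pow_eq_monomial]
      rw [this, mul_left_comm, gMean_C_mul, gMean_C_mul, he, gMean_expo_hess_mul_varT_pow hκ hh,
        gMean_varT_pow]
      ring
  rw [powerSeries_eq_adicSum f, mul_adicSum _ fun k => dvd_mul_left _ _,
    gMean_adicSum _ fun k => (dvd_mul_left _ _).mul_left _,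
    gMean_adicSum _ fun k => dvd_mul_left _ _,
    mul_adicSum _ fun k => X_pow_dvd_gMean _ _ _ (dvd_mul_left _ _)]
  congr 1
  ext1 k
  rw [mul_comm (PowerSeries.C _), mul_left_comm, gMean_X_pow_mul, gMean_X_pow_mul, hP]
  ring

/-- The total mass is (1 + κ)^{-1/2}. Only its square is needed, since the mass enters the
symmetrised product once from each factor. -/
lemma hessFactor_sq {κ : B⟦X⟧} (hκ : PowerSeries.X ∣ κ) :
    hessFactor κ ^ 2 * (1 + κ) = 1 := by
  have h1 : hessFactor κ =
      evalAt ((PowerSeries.C : B →+* B⟦X⟧).comp (algebraMap ℚ B)) κ hκ invSqrtSeries := by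
    have := gMean_expo_hess_mul_pow hκ 0
    rw [pow_zero, mul_one, ← hessFactor] at this
    rw [this, evalAt_apply]
    congr 1
    ext1 k
    have hg : gmoment (-1 : B⟦X⟧) (2 * k) = PowerSeries.C (algebraMap ℚ B (gmoment (-1) (2 * k))) := by
      rw [gmoment, gmoment]
      split_ifs <;> simp
    have hc : ∀ c : ℚ, (PowerSeries.C : B →+* B⟦X⟧) (algebraMap ℚ B c) = algebraMap ℚ B⟦X⟧ c :=
      fun c => (PowerSeries.algebraMap_apply ..).symm
    simp only [invSqrtSeries, PowerSeries.coeff_mk, RingHom.comp_apply, zero_add]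
    rw [map_mul, map_mul, ← hg, hc, Algebra.smul_def]
    ring
  rw [h1]
  have := congrArg (evalAt ((PowerSeries.C : B →+* B⟦X⟧).comp (algebraMap ℚ B)) κ hκ)
    invSqrtSeries_sq
  rwa [map_mul, map_pow, map_add, map_one, evalAt_X] at this

end Gauss

/-! ### The `q`-Pochhammer symbol at `q = z e^{ε²}` -/

section LogSeries

variable {R : Type} [CommRing R] [Algebra ℚ R]

/-- Evaluation of a rational power series. -/
def ratEval (G : R⟦X⟧) (hG : PowerSeries.X ∣ G) : ℚ⟦X⟧ →+* R⟦X⟧ :=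
  evalAt ((PowerSeries.C : R →+* R⟦X⟧).comp (algebraMap ℚ R)) G hG

lemma ratEval_apply (G : R⟦X⟧) (hG : PowerSeries.X ∣ G) (f : ℚ⟦X⟧) :
    ratEval G hG f = adicSum fun k => (PowerSeries.coeff k f) • G ^ k := by
  rw [ratEval, evalAt_apply]
  congr 1
  ext1 k
  rw [Algebra.smul_def, PowerSeries.algebraMap_apply]
  rfl

lemma ratEval_X (G : R⟦X⟧) (hG : PowerSeries.X ∣ G) : ratEval G hG PowerSeries.X = G :=
  evalAt_X _ hG

lemma map_expo_ratEval (G : R⟦X⟧) (hG : PowerSeries.X ∣ G) {f : ℚ⟦X⟧} (hf : PowerSeries.X ∣ f) :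
    ratEval G hG (expo f) = expo (ratEval G hG f) :=
  map_expo (ratEval G hG) (by rwa [ratEval_X]) hf

lemma ratEval_exp (G : R⟦X⟧) (hG : PowerSeries.X ∣ G) :
    ratEval G hG (PowerSeries.exp ℚ) = expo G := by
  rw [← expo_X_rat, map_expo_ratEval _ _ dvd_rfl, ratEval_X]

lemma ratEval_smul_X (G : R⟦X⟧) (hG : PowerSeries.X ∣ G) (c : ℚ) :
    ratEval G hG (c • PowerSeries.X) = c • G := by
  rw [map_rat_smul, ratEval_X]

lemma rescale_exp_rat (c : ℚ) :
    PowerSeries.rescale c (PowerSeries.exp ℚ) = expo (c • PowerSeries.X) := by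
  rw [← expo_X_rat, map_expo _ (X_dvd_rescale_X c) dvd_rfl, PowerSeries.rescale_X,
    PowerSeries.smul_eq_C_mul]

lemma mk_one_mul_one_sub : (PowerSeries.mk fun _ => (1 : ℚ)) * (1 - PowerSeries.X) = 1 :=
  PowerSeries.mk_one_mul_one_sub_eq_one ℚ

lemma expo_neg_log_rat :
    expo (PowerSeries.mk fun k : ℕ => -((k : ℚ)⁻¹)) = 1 - PowerSeries.X := by
  -- The coefficient at k = 0 is zero because 0⁻¹ = 0. The proof shows that e^L times the geometric
  -- series has derivative zero.
  set L : ℚ⟦X⟧ := PowerSeries.mk fun k : ℕ => -((k : ℚ)⁻¹) with hL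
  have hX : PowerSeries.X ∣ L := by
    rw [PowerSeries.X_dvd_iff, ← PowerSeries.coeff_zero_eq_constantCoeff_apply]
    simp [hL]
  have hd : (1 - PowerSeries.X) * PowerSeries.derivative ℚ L = -1 := by
    have : PowerSeries.derivative ℚ L = -PowerSeries.mk fun _ => 1 := by
      ext k
      rw [PowerSeries.coeff_derivative, hL, PowerSeries.coeff_mk, map_neg, PowerSeries.coeff_mk]
      have : ((k : ℚ) + 1) ≠ 0 := by positivity
      push_cast
      field_simp
    rw [this, mul_neg, mul_comm, mk_one_mul_one_sub]
  have hd2 := derivative_expo_rat (hf := hX)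
  have hc := constantCoeff_expo hX
  have h1 : (1 - PowerSeries.X) * PowerSeries.derivative ℚ (expo L) = -expo L := by
    rw [hd2, mul_left_comm, hd, mul_neg_one]
  have key : PowerSeries.derivative ℚ (expo L * (PowerSeries.mk fun _ => (1 : ℚ))) = 0 := by
    have hg : (1 - PowerSeries.X) * PowerSeries.derivative ℚ (PowerSeries.mk fun _ => (1 : ℚ)) =
        PowerSeries.mk fun _ => (1 : ℚ) := by
      have h2 := congrArg (PowerSeries.derivative ℚ) mk_one_mul_one_sub
      rw [Derivation.leibniz, map_sub, PowerSeries.derivative_X, PowerSeries.derivative_one] at h2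
      simp only [smul_eq_mul, zero_sub] at h2
      linear_combination h2
    have hu : (1 - PowerSeries.X : ℚ⟦X⟧) ≠ 0 := fun h => by
      have := congrArg (PowerSeries.coeff 0) h
      simp at this
    refine mul_left_cancel₀ hu ?_
    rw [Derivation.leibniz, mul_zero, smul_eq_mul, smul_eq_mul]
    linear_combination (PowerSeries.mk fun _ => (1 : ℚ)) * h1 + expo L * hg
  have h3 : expo L * (PowerSeries.mk fun _ => (1 : ℚ)) = 1 := by
    refine PowerSeries.derivative.ext ?_ ?_
    · rw [key, PowerSeries.derivative_one]
    · rw [map_mul, hc, map_one, one_mul]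
      simp [← PowerSeries.coeff_zero_eq_constantCoeff_apply]
  calc expo L = expo L * ((PowerSeries.mk fun _ => (1 : ℚ)) * (1 - PowerSeries.X)) := by
        rw [mk_one_mul_one_sub, mul_one]
    _ = _ := by rw [← mul_assoc, h3, one_mul]

/-- `exp (-∑ s ^ k Y ^ k / k) = 1 - s Y`. -/
lemma expo_neg_log (s : R) :
    expo (PowerSeries.mk fun k : ℕ => -(((k : ℚ)⁻¹) • s ^ k)) =
      1 - PowerSeries.C s * PowerSeries.X := by
  have hX : PowerSeries.X ∣ (PowerSeries.mk fun k : ℕ => -((k : ℚ)⁻¹) : ℚ⟦X⟧) := by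
    rw [PowerSeries.X_dvd_iff, ← PowerSeries.coeff_zero_eq_constantCoeff_apply]
    simp
  have := congrArg ((PowerSeries.rescale s).comp (PowerSeries.map (algebraMap ℚ R)))
    expo_neg_log_rat
  rw [map_expo _ ?_ hX] at this
  · convert this using 1
    · congr 1
      ext k
      simp only [PowerSeries.coeff_mk, RingHom.comp_apply, PowerSeries.coeff_rescale,
        PowerSeries.coeff_map, map_neg, Algebra.smul_def]
      ring
    · simp [PowerSeries.rescale_X]
  · rw [RingHom.comp_apply, PowerSeries.map_X]
    exact X_dvd_rescale_X s

/-- The series `Li_1(a) = -log (1 - a)`. -/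
def liOne (a : R⟦X⟧) : R⟦X⟧ := adicSum fun k => ((k : ℚ)⁻¹) • a ^ k

lemma X_dvd_liOne {a : R⟦X⟧} (ha : PowerSeries.X ∣ a) : PowerSeries.X ∣ liOne a := by
  rw [← pow_one (PowerSeries.X : R⟦X⟧)]
  refine X_pow_dvd_adicSum fun k => ?_
  rcases k with _ | k
  · simp
  · rw [pow_one]
    exact dvd_smul_of_dvd _ (ha.trans (dvd_pow_self _ k.succ_ne_zero))

lemma expo_neg_liOne {a : R⟦X⟧} (ha : PowerSeries.X ∣ a) : expo (-liOne a) = 1 - a := by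
  have hX : PowerSeries.X ∣ (PowerSeries.mk fun k : ℕ => -((k : ℚ)⁻¹) : ℚ⟦X⟧) := by
    rw [PowerSeries.X_dvd_iff, ← PowerSeries.coeff_zero_eq_constantCoeff_apply]
    simp
  have := congrArg (ratEval a ha) expo_neg_log_rat
  rw [map_expo_ratEval _ _ hX, ratEval_apply, map_sub, map_one, ratEval_X] at this
  rw [← this, liOne, ← adicSum_neg]
  congr 2
  ext1 k
  rw [PowerSeries.coeff_mk, neg_smul]

end LogSeries

/-! ### Euler's expansion of the infinite q-Pochhammer symbol -/

section Pochhammer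

variable {B : Type} [CommRing B] [Algebra ℚ B]

/-- `q = z e^{ε²}`. -/
def qSer (z : B) : B⟦X⟧ := PowerSeries.C z * expo (PowerSeries.X ^ 2)

lemma X_dvd_X_sq : (PowerSeries.X : B⟦X⟧) ∣ PowerSeries.X ^ 2 := dvd_pow_self _ two_ne_zero

lemma qSer_pow (z : B) (k : ℕ) :
    qSer z ^ k = PowerSeries.C (z ^ k) * expo ((k : ℚ) • PowerSeries.X ^ 2) := by
  rw [qSer, mul_pow, ← map_pow, ← expo_nsmul X_dvd_X_sq, Nat.cast_smul_eq_nsmul]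

/-- The generating series of the values of the Bernoulli polynomials at `j / m`. -/
def bernSer (m j : ℕ) : ℚ⟦X⟧ :=
  PowerSeries.mk fun n => (Polynomial.bernoulli n).eval ((j : ℚ) / (m : ℚ)) / (n.factorial : ℚ)

lemma bernSer_mul (m j : ℕ) : bernSer m j * (PowerSeries.exp ℚ - 1) =
    PowerSeries.X * PowerSeries.rescale ((j : ℚ) / (m : ℚ)) (PowerSeries.exp ℚ) := by
  rw [← Polynomial.bernoulli_generating_function]
  congr 1
  ext n
  simp only [bernSer, PowerSeries.coeff_mk, map_smul, smul_eq_mul, Polynomial.coe_aeval_eq_eval]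
  ring

/-- `ε^{3k-2} / (m k²) ∑_j z^{jk} ∑_n B_n(j/m) (m k ε²)^n / n!`: the coefficient of `Y^k` in the
logarithm of the `q`-Pochhammer symbol `(q ε³ Y; q)_∞`. -/
def logCoeff (m : ℕ) (z : B) (k : ℕ) : B⟦X⟧ :=
  ((m * k ^ 2 : ℚ)⁻¹) • (PowerSeries.X ^ (3 * k - 2) *
    ∑ j ∈ Finset.Icc 1 m, PowerSeries.C (z ^ (j * k)) *
      ratEval (((m * k : ℕ) : ℚ) • PowerSeries.X ^ 2) (dvd_smul_of_dvd _ X_dvd_X_sq) (bernSer m j))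

/-- The logarithm of `(q ε³ Y; q)_∞`. -/
def logPoch (m : ℕ) (z : B) : B⟦X⟧⟦X⟧ := PowerSeries.mk (logCoeff m z)

lemma X_dvd_logPoch (m : ℕ) (z : B) : PowerSeries.X ∣ logPoch m z := by
  rw [PowerSeries.X_dvd_iff, ← PowerSeries.coeff_zero_eq_constantCoeff_apply]
  -- At k = 0 the factor (m k²)⁻¹ is zero.
  simp [logPoch, logCoeff]

/-- The coefficients of `(q ε³ Y; q)_∞`. -/
def pochCoeff (m : ℕ) (z : B) (n : ℕ) : B⟦X⟧ := PowerSeries.coeff n (expo (logPoch m z))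

lemma pochCoeff_zero (m : ℕ) (z : B) : pochCoeff m z 0 = 1 := by
  rw [pochCoeff, PowerSeries.coeff_zero_eq_constantCoeff_apply,
    constantCoeff_expo (X_dvd_logPoch m z)]

variable [IsDomain B]

lemma expo_smul_X_sq_ne_one {c : ℚ} (hc : c ≠ 0) :
    expo (c • (PowerSeries.X : B⟦X⟧) ^ 2) - 1 ≠ 0 := by
  intro h
  have h1 : PowerSeries.X ∣ c • (PowerSeries.X : B⟦X⟧) ^ 2 := dvd_smul_of_dvd _ X_dvd_X_sq
  have h2 := congrArg (PowerSeries.coeff 2) h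
  rw [map_zero, map_sub, expo, coeff_adicSum_of_lt (X_pow_dvd_expo_term h1) (N := 3) (by omega),
    Finset.sum_range_succ, Finset.sum_range_succ, Finset.sum_range_one] at h2
  have h3 : PowerSeries.coeff 2 ((c • (PowerSeries.X : B⟦X⟧) ^ 2) ^ 2) = 0 := by
    rw [smul_pow, ← pow_mul, map_rat_smul, PowerSeries.coeff_X_pow]
    simp
  simp only [Nat.factorial, pow_zero, pow_one, map_rat_smul, h3] at h2
  simp only [PowerSeries.coeff_one, PowerSeries.coeff_X_pow] at h2
  norm_num at h2
  exact hc h2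

/-- This is the coefficient form of L(Y) - L(qY) = log(1 - q ε³ Y). With p = q^k one has p^m =
e^{mkε²}, so the Bernoulli generating function turns the sum over j into a geometric sum in p. The
factor ε³ in the argument absorbs the pole ε⁻² of the logarithm. -/
lemma logCoeff_mul {m : ℕ} (hm : m ≠ 0) {z : B} (hz : z ^ m = 1) {k : ℕ} (hk : k ≠ 0) :
    (k : B⟦X⟧) * logCoeff m z k * (1 - qSer z ^ k) = -(qSer z ^ k * PowerSeries.X ^ (3 * k)) := by
  set G : B⟦X⟧ := ((m * k : ℕ) : ℚ) • PowerSeries.X ^ 2 with hG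
  have hGX : PowerSeries.X ∣ G := dvd_smul_of_dvd _ X_dvd_X_sq
  set p := qSer z ^ k with hp
  have hpm : p ^ m = expo G := by
    rw [hp, ← pow_mul, qSer_pow, mul_comm k m, pow_mul z, hz, one_pow, map_one, one_mul]
  have hj : ∀ j : ℕ, PowerSeries.C (z ^ (j * k)) * ratEval G hGX (bernSer m j) * (expo G - 1) =
      G * p ^ j := by
    intro j
    have h1 := congrArg (ratEval G hGX) (bernSer_mul m j)
    have h2 : ratEval G hGX (PowerSeries.rescale ((j : ℚ) / (m : ℚ)) (PowerSeries.exp ℚ)) =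
        expo ((((j * k : ℕ) : ℚ)) • PowerSeries.X ^ 2) := by
      rw [rescale_exp_rat, map_expo_ratEval _ _ (dvd_smul_of_dvd _ dvd_rfl : (PowerSeries.X : ℚ⟦X⟧) ∣ ((j : ℚ) / (m : ℚ)) • PowerSeries.X),
        ratEval_smul_X, hG, smul_smul]
      congr 2
      have : (m : ℚ) ≠ 0 := by exact_mod_cast hm
      push_cast
      field_simp
    rw [map_mul, map_sub, map_one, ratEval_exp, map_mul, h2] at h1
    rw [ratEval_X] at h1
    rw [mul_assoc, h1, hp, ← pow_mul, qSer_pow, mul_comm k j]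
    ring
  -- The series e^{mkε²} - 1 is divisible by ε², hence not invertible, but it can be cancelled in a
  -- domain.
  have hQ : expo G - 1 ≠ 0 := expo_smul_X_sq_ne_one (by
    exact_mod_cast mul_ne_zero hm hk)
  set S := ∑ j ∈ Finset.Icc 1 m, PowerSeries.C (z ^ (j * k)) * ratEval G hGX (bernSer m j) with hS
  have hS1 : S * (expo G - 1) = G * ∑ j ∈ Finset.Icc 1 m, p ^ j := by
    rw [hS, Finset.sum_mul, Finset.mul_sum]
    exact Finset.sum_congr rfl fun j _ => hj j
  have hgeom : (∑ j ∈ Finset.Icc 1 m, p ^ j) * (1 - p) = p * (1 - p ^ m) := by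
    have e : ∑ j ∈ Finset.Icc 1 m, p ^ j = p * ∑ j ∈ Finset.range m, p ^ j := by
      rw [Finset.mul_sum, Finset.range_eq_Ico, Finset.sum_Ico_eq_sum_range,
        ← Finset.Ico_add_one_right_eq_Icc, Finset.sum_Ico_eq_sum_range]
      simp [pow_add]
    rw [e, mul_assoc, geom_sum_mul_neg]
  have hS2 : S * (1 - p) = -(G * p) := by
    refine mul_right_cancel₀ hQ ?_
    rw [hpm] at hgeom
    linear_combination (1 - p) * hS1 + G * hgeom
  have hX : (PowerSeries.X : B⟦X⟧) ^ (3 * k) = PowerSeries.X ^ (3 * k - 2) * PowerSeries.X ^ 2 := by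
    rw [← pow_add]; congr 1; omega
  rw [logCoeff, ← hS, mul_smul_comm, smul_mul_assoc]
  have e2 : (k : B⟦X⟧) * (PowerSeries.X ^ (3 * k - 2) * S) * (1 - p) =
      -((k : B⟦X⟧) * (PowerSeries.X ^ (3 * k - 2) * (G * p))) := by
    linear_combination (k : B⟦X⟧) * PowerSeries.X ^ (3 * k - 2) * hS2
  rw [e2, hX, hG, smul_neg, smul_mul_assoc, mul_smul_comm, mul_smul_comm, smul_smul]
  have e3 : (k : B⟦X⟧) * (PowerSeries.X ^ (3 * k - 2) * (PowerSeries.X ^ 2 * p)) =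
      (k : ℚ) • (p * (PowerSeries.X ^ (3 * k - 2) * PowerSeries.X ^ 2)) := by
    rw [Nat.cast_smul_eq_nsmul, nsmul_eq_mul]; ring
  rw [e3, smul_smul]
  have : ((m : ℚ) * (k : ℚ) ^ 2)⁻¹ * ((m * k : ℕ) : ℚ) * (k : ℚ) = 1 := by
    have : (m : ℚ) ≠ 0 := by exact_mod_cast hm
    have : (k : ℚ) ≠ 0 := by exact_mod_cast hk
    push_cast
    field_simp
  rw [this, one_smul]

/-- Compare coefficients of Y^{n+1} in the functional equation P(Y) = (1 - q ε³ Y) P(qY). -/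
lemma pochCoeff_succ {m : ℕ} (hm : m ≠ 0) {z : B} (hz : z ^ m = 1) (n : ℕ) :
    pochCoeff m z (n + 1) * (1 - qSer z ^ (n + 1)) =
      -(qSer z ^ (n + 1) * PowerSeries.X ^ 3 * pochCoeff m z n) := by
  set q := qSer z with hq
  set L := logPoch m z with hL
  have hLX : PowerSeries.X ∣ L := X_dvd_logPoch m z
  have hRX : PowerSeries.X ∣ PowerSeries.rescale q L := by
    simpa only [pow_one] using X_pow_dvd_ringHom (X_dvd_rescale_X q) 1 L (by simpa only [pow_one])
  have h1 : L - PowerSeries.rescale q L =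
      PowerSeries.mk fun k : ℕ => -(((k : ℚ)⁻¹) • (q * PowerSeries.X ^ 3) ^ k) := by
    ext1 k
    rw [map_sub, PowerSeries.coeff_rescale, hL, logPoch, PowerSeries.coeff_mk, PowerSeries.coeff_mk]
    rcases Nat.eq_zero_or_pos k with rfl | hk
    · simp
    · have h2 := logCoeff_mul hm hz hk.ne'
      have h3 : ((k : ℚ)⁻¹) • ((k : B⟦X⟧) * logCoeff m z k * (1 - qSer z ^ k)) =
          logCoeff m z k * (1 - qSer z ^ k) := by
        rw [mul_assoc, ← nsmul_eq_mul, ← Nat.cast_smul_eq_nsmul ℚ, smul_smul, inv_mul_cancel₀,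
          one_smul]
        exact_mod_cast hk.ne'
      rw [h2] at h3
      rw [mul_pow, ← pow_mul, ← smul_neg, h3]
      ring
  have h4 : expo L = (1 - PowerSeries.C (q * PowerSeries.X ^ 3) * PowerSeries.X) *
      PowerSeries.rescale q (expo L) := by
    rw [map_expo _ (X_dvd_rescale_X q) hLX, ← expo_neg_log, ← h1,
      ← expo_add (hLX.sub hRX) hRX, sub_add_cancel]
  have h5 := congrArg (PowerSeries.coeff (n + 1)) h4
  rw [sub_mul, one_mul, map_sub, PowerSeries.coeff_rescale, mul_assoc, PowerSeries.coeff_C_mul,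
    PowerSeries.coeff_succ_X_mul, PowerSeries.coeff_rescale] at h5
  rw [pochCoeff, pochCoeff]
  linear_combination h5

/-- The triangular numbers. -/
def tri (n : ℕ) : ℕ := n * (n + 1) / 2

lemma two_mul_tri (n : ℕ) : 2 * tri n = n * (n + 1) :=
  Nat.mul_div_cancel' (Nat.even_mul_succ_self n).two_dvd

lemma tri_succ (n : ℕ) : tri (n + 1) = tri n + (n + 1) := by
  have h1 := two_mul_tri n
  have h2 := two_mul_tri (n + 1)
  nlinarith

lemma tri_add (i j : ℕ) : tri (i + j) = tri i + tri j + i * j := by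
  have h1 := two_mul_tri i
  have h2 := two_mul_tri j
  have h3 := two_mul_tri (i + j)
  nlinarith

/-- The `q`-factorial `(q; q)_n`. -/
def qPoch {R : Type} [CommRing R] (q : R) (n : ℕ) : R := ∏ i ∈ Finset.range n, (1 - q ^ (i + 1))

lemma qPoch_succ {R : Type} [CommRing R] (q : R) (n : ℕ) :
    qPoch q (n + 1) = qPoch q n * (1 - q ^ (n + 1)) := Finset.prod_range_succ _ _

/-- Euler's formula for the expansion of the symbol. The factor (q; q)_n stays on the left because
it is not invertible at a root of unity once n ≥ m. -/
lemma pochCoeff_mul_qPoch {m : ℕ} (hm : m ≠ 0) {z : B} (hz : z ^ m = 1) (n : ℕ) :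
    pochCoeff m z n * qPoch (qSer z) n =
      (-1) ^ n * qSer z ^ tri n * PowerSeries.X ^ (3 * n) := by
  induction n with
  | zero => simp [pochCoeff_zero, qPoch, tri]
  | succ n ih =>
    rw [qPoch_succ, tri_succ, pow_add, mul_add, pow_add, pow_succ (-1)]
    linear_combination qPoch (qSer z) n * pochCoeff_succ hm hz n +
      (-(qSer z ^ (n + 1) * PowerSeries.X ^ 3)) * ih

end Pochhammer

/-! ### Quadratic Gauss sums -/

section GaussSum

variable {B : Type} [CommRing B]

/-- The summand of the Gauss sum. -/
def gaussTerm (u₀ z : B) (r : ℕ) : B := (-u₀) ^ r * z ^ tri r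

/-- The quadratic Gauss sum. -/
def gaussTotal (m : ℕ) (u₀ z : B) : B := ∑ r ∈ Finset.range m, gaussTerm u₀ z r

lemma gaussTerm_add (u₀ z : B) (r n : ℕ) :
    gaussTerm u₀ z (r + n) = gaussTerm u₀ z r * gaussTerm u₀ z n * z ^ (r * n) := by
  simp only [gaussTerm, tri_add, pow_add]
  ring

lemma sum_range_add_of_periodic {m : ℕ} {f : ℕ → B} (hf : ∀ r, f (r + m) = f r) (n : ℕ) :
    ∑ r ∈ Finset.range m, f (r + n) = ∑ r ∈ Finset.range m, f r := by
  induction n with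
  | zero => rfl
  | succ n ih =>
    rw [← ih]
    have h1 := Finset.sum_range_succ (fun r => f (r + n)) m
    rw [Finset.sum_range_succ', show m + n = 0 + n + m by ring, hf] at h1
    have h2 := add_right_cancel h1
    rw [← h2]
    exact Finset.sum_congr rfl fun r _ => by rw [show r + (n + 1) = r + 1 + n by ring]

variable [IsDomain B] {m : ℕ} {u₀ z : B}

lemma primitiveRoot_pow_tri (hm : m ≠ 0) (hz : IsPrimitiveRoot z m) :
    z ^ tri m = (-1) ^ (m + 1) := by
  have h2 := two_mul_tri m
  rcases Nat.even_or_odd' m with ⟨k, hk | hk⟩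
  · have h3 : tri m = k * (m + 1) := by nlinarith
    have h4 : z ^ k = -1 := by
      have h5 : (z ^ k) ^ 2 = 1 := by rw [← pow_mul, mul_comm, ← hk, hz.pow_eq_one]
      have h7 : (z ^ k - 1) * (z ^ k + 1) = 0 := by linear_combination h5
      rcases mul_eq_zero.1 h7 with h6 | h6
      · exact absurd (sub_eq_zero.1 h6) (hz.pow_ne_one_of_pos_of_lt (by omega) (by omega))
      · exact eq_neg_of_add_eq_zero_left h6
    rw [h3, pow_mul, h4]
  · have h3 : tri m = m * (k + 1) := by nlinarith
    rw [h3, pow_mul, hz.pow_eq_one, one_pow, hk, show 2 * k + 1 + 1 = 2 * (k + 1) by ring, pow_mul]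
    simp

/-- A shift by m multiplies the summand by (-u₀)^m z^{m(m+1)/2}. The normalisation u₀^m = -1 makes
this 1 for every parity of m. -/
lemma gaussTerm_periodic (hm : m ≠ 0) (hz : IsPrimitiveRoot z m) (hu : u₀ ^ m = -1) (r : ℕ) :
    gaussTerm u₀ z (r + m) = gaussTerm u₀ z r := by
  rw [gaussTerm_add, mul_comm r m, pow_mul, hz.pow_eq_one, one_pow, mul_one]
  rw [gaussTerm, gaussTerm, primitiveRoot_pow_tri hm hz, neg_pow u₀ m, hu, pow_succ]
  have : ((-1 : B) ^ m) * (-1) ^ m = 1 := by rw [← mul_pow]; simp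
  linear_combination (-u₀) ^ r * z ^ tri r * this

/-- Completing the square over ℤ/m: the factor z^{rN} is absorbed by the shift r ↦ r + N. -/
lemma gaussTerm_sum_mul (hm : m ≠ 0) (hz : IsPrimitiveRoot z m) (hu : u₀ ^ m = -1) (N : ℕ) :
    gaussTerm u₀ z N * ∑ r ∈ Finset.range m, gaussTerm u₀ z r * z ^ (r * N) =
      gaussTotal m u₀ z := by
  rw [gaussTotal, ← sum_range_add_of_periodic (gaussTerm_periodic hm hz hu) N, Finset.mul_sum]
  exact Finset.sum_congr rfl fun r _ => by rw [gaussTerm_add]; ring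

/-- The analogue of |G|² = m. The term of index m - 1 - s for z⁻¹, times -u₀, inverts the term of
index s for z. By `gaussTerm_sum_mul` the product becomes ∑_n g(n) ∑_s z^{ns}, in which only n = 0
survives. -/
lemma gaussTotal_mul (hm : m ≠ 0) (hz : IsPrimitiveRoot z m) (hu : u₀ ^ m = -1) {z' : B}
    (hzz : z * z' = 1) :
    -u₀ * (gaussTotal m u₀ z * gaussTotal m u₀ z') = m := by
  -- With s + t + 1 = m the triangular numbers satisfy tri m + tri t = tri s + m(t + 1), so z^{tri
  -- s} and z^{tri t} differ only by the sign z^{tri m}.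
  have h1 : ∀ s t : ℕ, s + t + 1 = m → gaussTerm u₀ z s * (-u₀ * gaussTerm u₀ z' t) = 1 := by
    intro s t h
    have h2 := two_mul_tri m
    have h3 := two_mul_tri s
    have h4 := two_mul_tri t
    have h5 : tri m + tri t = tri s + m * (t + 1) := by
      subst h
      nlinarith
    have h6 : z ^ tri s = (-1) ^ (m + 1) * z ^ tri t := by
      rw [← primitiveRoot_pow_tri hm hz, ← pow_add, h5, pow_add, pow_mul, hz.pow_eq_one, one_pow,
        mul_one]
    have h7 : z ^ tri t * z' ^ tri t = 1 := by rw [← mul_pow, hzz, one_pow]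
    have h8 : (-u₀) ^ m = (-1) ^ (m + 1) := by rw [neg_pow, hu, pow_succ]
    have h9 : (-u₀) ^ s * (-u₀) ^ t * (-u₀) = (-1) ^ (m + 1) := by
      rw [← h8, ← h, pow_succ, pow_add]
    have h10 : ((-1 : B) ^ (m + 1)) * (-1) ^ (m + 1) = 1 := by rw [← mul_pow]; simp
    rw [gaussTerm, gaussTerm, h6]
    linear_combination (-1) ^ (m + 1) * z ^ tri t * z' ^ tri t * h9 +
      (-1) ^ (m + 1) * (-1) ^ (m + 1) * h7 + h10
  have h2 : -u₀ * gaussTotal m u₀ z' =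
      ∑ s ∈ Finset.range m, -u₀ * gaussTerm u₀ z' (m - 1 - s) := by
    rw [gaussTotal, ← Finset.mul_sum, Finset.sum_range_reflect]
  have h3 : ∀ s ∈ Finset.range m, gaussTotal m u₀ z * (-u₀ * gaussTerm u₀ z' (m - 1 - s)) =
      ∑ n ∈ Finset.range m, gaussTerm u₀ z n * z ^ (n * s) := by
    intro s hs
    rw [← gaussTerm_sum_mul hm hz hu s]
    have := h1 s (m - 1 - s) (by have := Finset.mem_range.1 hs; omega)
    linear_combination (∑ n ∈ Finset.range m, gaussTerm u₀ z n * z ^ (n * s)) * this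
  rw [mul_left_comm, h2, Finset.mul_sum, Finset.sum_congr rfl h3, Finset.sum_comm,
    Finset.sum_eq_single 0]
  · simp [gaussTerm, tri]
  · intro n hn hn0
    rw [← Finset.mul_sum]
    have h4 : (z ^ n - 1) * ∑ s ∈ Finset.range m, z ^ (n * s) = 0 := by
      simp only [pow_mul]
      rw [mul_geom_sum, ← pow_mul, mul_comm, pow_mul, hz.pow_eq_one, one_pow, sub_self]
    rcases mul_eq_zero.1 h4 with h5 | h5
    · exact absurd (sub_eq_zero.1 h5)
        (hz.pow_ne_one_of_pos_of_lt hn0 (Finset.mem_range.1 hn))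
    · rw [h5, mul_zero]
  · intro h
    simp at h
    exact absurd h hm

end GaussSum

/-! ### The Gaussian integral of a product of two Pochhammer symbols -/

section Integrand

variable {B : Type} [CommRing B] [Algebra ℚ B]

/-- `e^v` with `v = ε t`. -/
def expV : B[X]⟦X⟧ := expo (PowerSeries.X * varT)

/-- The argument `ε ω e^v`. -/
def pochArg (ω : B) : B[X]⟦X⟧ := PowerSeries.X * (liftT (PowerSeries.C ω) * expV)

lemma X_dvd_pochArg (ω : B) : PowerSeries.X ∣ pochArg ω := dvd_mul_right _ _

/-- The logarithm of `(q a e^v; q)_∞` for `a = ε⁴ ω`. -/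
def logIntegrand (m : ℕ) (z ω : B) : B[X]⟦X⟧ :=
  evalAt liftT (pochArg ω) (X_dvd_pochArg ω) (logPoch m z)

lemma X_dvd_logIntegrand (m : ℕ) (z ω : B) : PowerSeries.X ∣ logIntegrand m z ω := by
  have := X_pow_dvd_ringHom (X_dvd_evalAt_X liftT (X_dvd_pochArg ω)) 1 (logPoch m z)
    (by simpa only [pow_one] using X_dvd_logPoch m z)
  rwa [pow_one] at this

lemma expo_logIntegrand (m : ℕ) (z ω : B) : expo (logIntegrand m z ω) =
    adicSum fun n => liftT (pochCoeff m z n) * pochArg ω ^ n := by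
  rw [logIntegrand, ← map_expo (evalAt liftT (pochArg ω) (X_dvd_pochArg ω))
    (X_dvd_evalAt_X _ _) (X_dvd_logPoch m z), evalAt_apply]
  rfl

/-- The coefficients of the product of two Pochhammer symbols. -/
def prodCoeff (m : ℕ) (z ω₁ ω₂ : B) (N : ℕ) : B⟦X⟧ :=
  ∑ p ∈ Finset.HasAntidiagonal.antidiagonal N,
    pochCoeff m z p.1 * pochCoeff m z p.2 * PowerSeries.C (ω₁ ^ p.1 * ω₂ ^ p.2)

lemma expo_logIntegrand_mul (m : ℕ) (z ω₁ ω₂ y : B) :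
    expo (logIntegrand m z (ω₁ * y)) * expo (logIntegrand m z (ω₂ * y)) =
      adicSum fun N => liftT (PowerSeries.C (y ^ N) * prodCoeff m z ω₁ ω₂ N * PowerSeries.X ^ N) *
        expV ^ N := by
  have hd : ∀ ω : B, ∀ n, PowerSeries.X ^ n ∣ liftT (pochCoeff m z n) * pochArg ω ^ n :=
    fun ω n => (pow_dvd_pow_of_dvd (X_dvd_pochArg ω) n).mul_left _
  rw [expo_logIntegrand, expo_logIntegrand, adicSum_mul_adicSum (hd _) (hd _)]
  congr 1
  ext1 N
  rw [prodCoeff, Finset.mul_sum, Finset.sum_mul, map_sum, Finset.sum_mul]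
  refine Finset.sum_congr rfl fun p hp => ?_
  rw [← Finset.HasAntidiagonal.mem_antidiagonal.1 hp]
  simp only [pochArg, map_mul, map_pow, mul_pow, liftT_X, pow_add]
  ring

/-- The product of the two symbols is a power series in e^v, so each term is a linear exponential in
t and is integrated by `gMean_neg_one_expo_linear`. -/
lemma gMean_neg_one_expo_mul_prod (m : ℕ) (z ω₁ ω₂ y : B) (b : B⟦X⟧) :
    gMean (-1) (expo (liftT (b * PowerSeries.X) * varT) *
        (expo (logIntegrand m z (ω₁ * y)) * expo (logIntegrand m z (ω₂ * y)))) =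
      adicSum fun N => PowerSeries.C (y ^ N) * prodCoeff m z ω₁ ω₂ N * PowerSeries.X ^ N *
        expo (-((1 / 2 : ℚ) • ((b + (N : B⟦X⟧)) * PowerSeries.X) ^ 2)) := by
  have hd : ∀ N, PowerSeries.X ^ N ∣ liftT (PowerSeries.C (y ^ N) * prodCoeff m z ω₁ ω₂ N *
      PowerSeries.X ^ N) * expV ^ N := fun N => by
    rw [map_mul liftT _ (PowerSeries.X ^ N), map_pow liftT, liftT_X]
    exact (dvd_mul_left _ _).mul_right _
  rw [expo_logIntegrand_mul, mul_adicSum _ hd, gMean_adicSum _ fun k => (hd k).mul_left _]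
  congr 1
  ext1 N
  have h1 : PowerSeries.X ∣ liftT (b * PowerSeries.X) * varT :=
    (X_dvd_liftT (dvd_mul_left _ _)).mul_right _
  rw [mul_left_comm, gMean_liftT_mul, expV, ← expo_nsmul (dvd_mul_right _ _),
    ← expo_add h1 (dvd_smul_of_dvd _ (dvd_mul_right _ _)), ← gMean_neg_one_expo_linear]
  congr 3
  rw [map_mul, map_mul, map_add, map_natCast, liftT_X, nsmul_eq_mul]
  ring

/-- `q⁻¹` for `q = z e^{ε²}` with `z z' = 1`. -/
def qInv (z' : B) : B⟦X⟧ := PowerSeries.C z' * expo (-PowerSeries.X ^ 2)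

/-- The series `∑ q^{-N(N+1)/2} (-u)^{-N} y_N ε^N`, where `u⁻¹ = u'₀ e^{-a}`. -/
def halfSum (m : ℕ) (z z' ω₁ ω₂ u' : B) (a : B⟦X⟧) : B⟦X⟧ :=
  adicSum fun N => prodCoeff m z ω₁ ω₂ N * PowerSeries.X ^ N *
    (-(PowerSeries.C u' * expo (-a))) ^ N * qInv z' ^ tri N

/-- Expand (1/2 + ah + N)². The summand 1/2, which comes from the factor q^{k/2}, completes N²/2 to
the triangular number N(N + 1)/2. -/
lemma expo_neg_half_sq {ah : B⟦X⟧} (N : ℕ) :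
    expo (-((1 / 2 : ℚ) • ((PowerSeries.C (algebraMap ℚ B (1 / 2)) + ah + (N : B⟦X⟧)) *
        PowerSeries.X) ^ 2)) =
      expo (-((1 / 2 : ℚ) • ((PowerSeries.C (algebraMap ℚ B (1 / 2)) + ah) *
        PowerSeries.X) ^ 2)) *
        (expo (-(ah * PowerSeries.X ^ 2)) ^ N * expo (-PowerSeries.X ^ 2) ^ tri N) := by
  have h1 : PowerSeries.X ∣ -(ah * PowerSeries.X ^ 2) := (dvd_neg).2 (X_dvd_X_sq.mul_left _)
  have h2 : (PowerSeries.X : B⟦X⟧) ∣ -PowerSeries.X ^ 2 := (dvd_neg).2 X_dvd_X_sq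
  have h3 : (PowerSeries.X : B⟦X⟧) ∣ -((1 / 2 : ℚ) • ((PowerSeries.C (algebraMap ℚ B (1 / 2)) + ah) *
        PowerSeries.X) ^ 2) := (dvd_neg).2 (dvd_smul_of_dvd _ (by
          rw [mul_pow]; exact X_dvd_X_sq.mul_left _))
  rw [← expo_nsmul h1, ← expo_nsmul h2, ← expo_add (dvd_smul_of_dvd _ h1) (dvd_smul_of_dvd _ h2),
    ← expo_add h3 ((dvd_smul_of_dvd _ h1).add (dvd_smul_of_dvd _ h2))]
  congr 1
  have h4 : ((2 * tri N : ℕ) : B⟦X⟧) = N * (N + 1) := by rw [two_mul_tri]; push_cast; ring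
  have h5 : (PowerSeries.C (algebraMap ℚ B (1 / 2)) : B⟦X⟧) =
      algebraMap ℚ B⟦X⟧ (1 / 2) := by rw [PowerSeries.algebraMap_apply]
  have h6 : algebraMap ℚ B⟦X⟧ (1 / 2) * 2 = 1 := by
    rw [show (2 : B⟦X⟧) = algebraMap ℚ B⟦X⟧ 2 by rw [map_ofNat], ← map_mul]; norm_num
  simp only [Algebra.smul_def, h5, nsmul_eq_mul]
  push_cast at h4
  generalize algebraMap ℚ B⟦X⟧ (1 / 2) = c at h6 ⊢
  generalize (tri N : B⟦X⟧) = T at h4 ⊢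
  linear_combination (PowerSeries.X ^ 2 * c) * h4 -
    (N * PowerSeries.X ^ 2 * ah + T * PowerSeries.X ^ 2 + N * PowerSeries.X ^ 2 * c) * h6

/-- In the term of degree N the class r enters only through z^{rN}. The Gauss sum replaces it by
z^{-N(N+1)/2} (-u₀)^{-N}, and together with e^{-N(N+1)ε²/2} this gives the power q^{-N(N+1)/2}. -/
lemma sum_gaussTerm_gMean [IsDomain B] {m : ℕ} (hm : m ≠ 0) {z z' u₀ u' : B}
    (hz : IsPrimitiveRoot z m) (hzz : z * z' = 1) (hu : u₀ ^ m = -1) (huu : u₀ * u' = 1)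
    (ω₁ ω₂ : B) (ah : B⟦X⟧) :
    ∑ r ∈ Finset.range m, PowerSeries.C (gaussTerm u₀ z r) *
      gMean (-1) (expo (liftT ((PowerSeries.C (algebraMap ℚ B (1 / 2)) + ah) * PowerSeries.X) *
        varT) * (expo (logIntegrand m z (ω₁ * z ^ r)) * expo (logIntegrand m z (ω₂ * z ^ r)))) =
    PowerSeries.C (gaussTotal m u₀ z) *
      expo (-((1 / 2 : ℚ) • ((PowerSeries.C (algebraMap ℚ B (1 / 2)) + ah) *
        PowerSeries.X) ^ 2)) * halfSum m z z' ω₁ ω₂ u' (ah * PowerSeries.X ^ 2) := by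
  have hd : ∀ (y : B) (b : ℕ → B⟦X⟧) (N : ℕ), PowerSeries.X ^ N ∣ PowerSeries.C (y ^ N) *
      prodCoeff m z ω₁ ω₂ N * PowerSeries.X ^ N * b N := fun y b N =>
    (dvd_mul_left _ _).mul_right _
  have hd' : ∀ N : ℕ, PowerSeries.X ^ N ∣ prodCoeff m z ω₁ ω₂ N * PowerSeries.X ^ N *
      (-(PowerSeries.C u' * expo (-(ah * PowerSeries.X ^ 2)))) ^ N * qInv z' ^ tri N := fun N =>
    ((dvd_mul_left _ _).mul_right _).mul_right _
  simp only [gMean_neg_one_expo_mul_prod]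
  rw [halfSum, mul_adicSum _ hd']
  have : ∀ r ∈ Finset.range m, PowerSeries.C (gaussTerm u₀ z r) * adicSum (fun N =>
      PowerSeries.C ((z ^ r) ^ N) * prodCoeff m z ω₁ ω₂ N * PowerSeries.X ^ N *
        expo (-((1 / 2 : ℚ) • ((PowerSeries.C (algebraMap ℚ B (1 / 2)) + ah + (N : B⟦X⟧)) *
        PowerSeries.X) ^ 2))) = adicSum fun N => PowerSeries.C (gaussTerm u₀ z r) *
      (PowerSeries.C ((z ^ r) ^ N) * prodCoeff m z ω₁ ω₂ N * PowerSeries.X ^ N *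
        expo (-((1 / 2 : ℚ) • ((PowerSeries.C (algebraMap ℚ B (1 / 2)) + ah + (N : B⟦X⟧)) *
        PowerSeries.X) ^ 2))) := fun r _ => mul_adicSum _ (hd _ _)
  rw [Finset.sum_congr rfl this, ← adicSum_finset_sum]
  congr 1
  ext1 N
  have h1 : PowerSeries.C (∑ r ∈ Finset.range m, gaussTerm u₀ z r * z ^ (r * N)) =
      PowerSeries.C (gaussTotal m u₀ z) * PowerSeries.C ((-u') ^ N * z' ^ tri N) := by
    rw [← gaussTerm_sum_mul hm hz hu N, ← map_mul]
    congr 1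
    have h2 : gaussTerm u₀ z N * ((-u') ^ N * z' ^ tri N) = 1 := by
      rw [gaussTerm, mul_mul_mul_comm, ← mul_pow, ← mul_pow, hzz, neg_mul_neg, huu, one_pow,
        one_pow, one_mul]
    linear_combination -(∑ r ∈ Finset.range m, gaussTerm u₀ z r * z ^ (r * N)) * h2
  rw [map_sum] at h1
  rw [expo_neg_half_sq, qInv, mul_pow (PowerSeries.C z'), neg_mul_eq_neg_mul (PowerSeries.C u'), mul_pow (-PowerSeries.C u')]
  simp only [map_mul, map_pow, map_neg] at h1
  simp only [← pow_mul, map_pow]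
  rw [← sub_eq_zero]
  have h3 : ∀ c : B⟦X⟧, ∑ r ∈ Finset.range m, PowerSeries.C (gaussTerm u₀ z r) *
      (PowerSeries.C z ^ (r * N) * prodCoeff m z ω₁ ω₂ N * PowerSeries.X ^ N * c) =
      (∑ r ∈ Finset.range m, PowerSeries.C (gaussTerm u₀ z r) * PowerSeries.C z ^ (r * N)) *
        (prodCoeff m z ω₁ ω₂ N * PowerSeries.X ^ N * c) := fun c => by
    rw [Finset.sum_mul]
    exact Finset.sum_congr rfl fun r _ => by ring
  rw [h3, h1]
  ring

end Integrand

section AdicSum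

variable {R : Type} [CommRing R]

lemma adicSum_mul {g : ℕ → R⟦X⟧} (hg : ∀ k, PowerSeries.X ^ k ∣ g k) (f : R⟦X⟧) :
    adicSum g * f = adicSum fun k => g k * f := by
  rw [mul_comm, mul_adicSum _ hg]
  simp only [mul_comm]

lemma smul_adicSum [Algebra ℚ R] (c : ℚ) (g : ℕ → R⟦X⟧) :
    c • adicSum g = adicSum fun k => c • g k := by
  ext n
  simp [coeff_adicSum, Finset.smul_sum]

end AdicSum

/-! ### Polylogarithm series -/

section Polylog

variable {R : Type} [CommRing R] [Algebra ℚ R]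

/-- The series `Li_{2-E}(a) = ∑ k^{E-2} a^k`. -/
def polylogSeries (E : ℕ) (a : R⟦X⟧) : R⟦X⟧ :=
  adicSum fun k => (((k + 1 : ℕ) : ℚ) ^ ((E : ℤ) - 2)) • a ^ (k + 1)

lemma X_pow_dvd_polylogSeries_term (E : ℕ) {a : R⟦X⟧} (ha : PowerSeries.X ∣ a) (k : ℕ) :
    PowerSeries.X ^ k ∣ (((k + 1 : ℕ) : ℚ) ^ ((E : ℤ) - 2)) • a ^ (k + 1) :=
  dvd_smul_of_dvd _ ((pow_dvd_pow _ k.le_succ).trans (pow_dvd_pow_of_dvd ha _))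

lemma polylogSeries_one {a : R⟦X⟧} (ha : PowerSeries.X ∣ a) : polylogSeries 1 a = liOne a := by
  rw [liOne, adicSum_eq_add_succ]
  · simp [polylogSeries]
  · exact fun k => dvd_smul_of_dvd _ (pow_dvd_pow_of_dvd ha k)

lemma one_sub_mul_polylogSeries_two {a : R⟦X⟧} (ha : PowerSeries.X ∣ a) :
    (1 - a) * polylogSeries 2 a = a := by
  have hd : ∀ k, PowerSeries.X ^ k ∣ a ^ (k + 1) := fun k =>
    (pow_dvd_pow _ k.le_succ).trans (pow_dvd_pow_of_dvd ha _)
  have hd' : ∀ k, PowerSeries.X ^ k ∣ a * a ^ (k + 1) := fun k => (hd k).mul_left _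
  have h0 : polylogSeries 2 a = adicSum fun k => a ^ (k + 1) := by simp [polylogSeries]
  rw [sub_mul, one_mul, h0, mul_adicSum _ hd, adicSum_eq_add_succ hd]
  simp only [pow_succ' a (_ + 1)]
  simp

/-- `X / (1 - X)`. -/
def geomSer : ℚ⟦X⟧ := PowerSeries.X * PowerSeries.mk fun _ => 1

lemma isUnit_one_sub {R : Type} [CommRing R] {a : R⟦X⟧} (ha : PowerSeries.X ∣ a) : IsUnit (1 - a) := by
  rw [PowerSeries.isUnit_iff_constantCoeff, map_sub, PowerSeries.X_dvd_iff.1 ha]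
  simp

lemma geomSer_mul_one_sub : geomSer * (1 - PowerSeries.X) = PowerSeries.X := by
  rw [geomSer, mul_assoc, mk_one_mul_one_sub, mul_one]

/-- Under u = X/(1 - X) the operator (u + u²) d/du is X d/dX, which multiplies the n-th coefficient
by n. The constant term is treated apart because 0^0 = 1. -/
lemma aeval_geomSer (e : ℕ) : Polynomial.aeval geomSer (negPolylogPoly e) =
    PowerSeries.mk fun n => if n = 0 then (0 : ℚ) else (n : ℚ) ^ e := by
  induction e with
  | zero =>
    rw [negPolylogPoly, Polynomial.aeval_X, geomSer]
    ext n
    rcases n with _ | n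
    · simp
    · rw [PowerSeries.coeff_succ_X_mul]
      simp
  | succ e ih =>
    set D := (PowerSeries.derivative ℚ).restrictScalars ℤ with hD
    have h1 : PowerSeries.X * D geomSer = geomSer + geomSer ^ 2 := by
      have hu : (1 - PowerSeries.X : ℚ⟦X⟧) ≠ 0 := fun h => by
        have := congrArg (PowerSeries.coeff 0) h
        simp at this
      have h2 := congrArg D geomSer_mul_one_sub
      have h3 : D PowerSeries.X = 1 := PowerSeries.derivative_X
      rw [Derivation.leibniz, map_sub, h3, Derivation.map_one_eq_zero, smul_eq_mul,
        smul_eq_mul] at h2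
      refine mul_left_cancel₀ hu ?_
      linear_combination PowerSeries.X * h2 - (1 + geomSer) * geomSer_mul_one_sub
    have h4 := Derivation.map_aeval D (negPolylogPoly e) geomSer
    rw [ih, smul_eq_mul] at h4
    rw [negPolylogPoly, map_mul, map_add, map_pow, Polynomial.aeval_X, ← h1]
    have h5 : PowerSeries.X * D geomSer * Polynomial.aeval geomSer
        (Polynomial.derivative (negPolylogPoly e)) = PowerSeries.X *
        PowerSeries.derivative ℚ (PowerSeries.mk fun n => if n = 0 then (0 : ℚ) else (n : ℚ) ^ e) := by
      rw [mul_assoc, mul_comm (D geomSer), ← h4]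
      rfl
    rw [h5]
    ext n
    rcases n with _ | n
    · simp
    · rw [PowerSeries.coeff_succ_X_mul, PowerSeries.coeff_derivative, PowerSeries.coeff_mk,
        PowerSeries.coeff_mk, if_neg n.succ_ne_zero, if_neg n.succ_ne_zero, pow_succ]
      push_cast
      rfl

lemma rnegPolylog_eq_eval₂ {A : Type} [CommRing A] (e : ℕ) (a : A) : rnegPolylog e a =
    (negPolylogPoly e).eval₂ (Int.castRingHom A) (a * Ring.inverse (1 - a)) := by
  rw [rnegPolylog, Polynomial.aeval_def]
  congr 1

lemma rnegPolylog_eq {a : R⟦X⟧} (ha : PowerSeries.X ∣ a) (e : ℕ) :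
    rnegPolylog e a = polylogSeries (e + 2) a := by
  have hu := isUnit_one_sub ha
  have h1 : ratEval a ha geomSer = a * Ring.inverse (1 - a) := by
    have h2 := congrArg (ratEval a ha) geomSer_mul_one_sub
    rw [map_mul, map_sub, map_one, ratEval_X] at h2
    rw [Ring.eq_mul_inverse_iff_mul_eq _ _ _ hu, h2]
  have h3 := congrArg (ratEval a ha) (aeval_geomSer e)
  rw [Polynomial.aeval_def, Polynomial.hom_eval₂, h1] at h3
  have h4 : ∀ g : ℤ →+* R⟦X⟧, g = Int.castRingHom _ := fun g => RingHom.ext_int _ _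
  rw [h4 (RingHom.comp _ _)] at h3
  rw [rnegPolylog_eq_eval₂, h3, ratEval_apply, adicSum_eq_add_succ]
  · simp only [PowerSeries.coeff_mk, if_pos, zero_smul, zero_add, Nat.succ_ne_zero, if_false]
    rw [polylogSeries]
    congr 1
    ext1 k
    congr 1
    push_cast
    rw [show (e : ℤ) + 2 - 2 = e by ring, zpow_natCast]
  · exact fun k => dvd_smul_of_dvd _ (pow_dvd_pow_of_dvd ha k)

lemma X_dvd_polylogSeries (E : ℕ) {a : R⟦X⟧} {n : ℕ} (ha : PowerSeries.X ^ n ∣ a) :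
    PowerSeries.X ^ n ∣ polylogSeries E a :=
  X_pow_dvd_adicSum fun k => dvd_smul_of_dvd _ (ha.trans (dvd_pow_self _ k.succ_ne_zero))

lemma adicSum_of_support_multiples {m : ℕ} (hm : m ≠ 0) {g : ℕ → R⟦X⟧}
    (hg : ∀ k, PowerSeries.X ^ k ∣ g (k + 1)) (h : ∀ k, ¬ m ∣ k → g k = 0) :
    adicSum (fun k => g (k + 1)) = adicSum fun k => g (m * (k + 1)) := by
  obtain ⟨l, rfl⟩ := Nat.exists_eq_succ_of_ne_zero hm
  have hd : ∀ k, PowerSeries.X ^ k ∣ g ((l + 1) * (k + 1)) := fun k => by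
    have h1 : (l + 1) * (k + 1) = ((l + 1) * k + l) + 1 := by ring
    rw [h1]
    exact (pow_dvd_pow _ (by nlinarith)).trans (hg _)
  refine eq_adicSum hd fun n => ?_
  have h1 : ∑ k ∈ Finset.range n, g ((l + 1) * (k + 1)) =
      ∑ k ∈ Finset.range ((l + 1) * n), g (k + 1) := by
    induction n with
    | zero => simp
    | succ n ih =>
      rw [Finset.sum_range_succ, ih, mul_add, mul_one, Finset.sum_range_add,
        Finset.sum_range_succ _ l, Finset.sum_eq_zero (s := Finset.range l), zero_add]
      · rfl
      · intro x hx
        refine h _ fun hdvd => ?_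
        have h2 : l + 1 ∣ x + 1 := by
          have := (Nat.dvd_add_right (Dvd.intro n rfl : l + 1 ∣ (l + 1) * n)).1 (by
            rw [← add_assoc]; exact hdvd)
          exact this
        have := Nat.le_of_dvd (Nat.succ_pos _) h2
        have := Finset.mem_range.1 hx
        omega
  rw [h1]
  exact (pow_dvd_pow _ (by nlinarith)).trans (X_pow_dvd_adicSum_sub hg ((l + 1) * n))

lemma sum_Icc_primitiveRoot_pow {B : Type} [CommRing B] [IsDomain B] {m : ℕ} {z : B}
    (hz : IsPrimitiveRoot z m) (k : ℕ) :
    ∑ j ∈ Finset.Icc 1 m, z ^ (j * k) = if m ∣ k then (m : B) else 0 := by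
  split_ifs with h
  · obtain ⟨c, rfl⟩ := h
    have : ∀ j ∈ Finset.Icc 1 m, z ^ (j * (m * c)) = 1 := fun j _ => by
      rw [mul_left_comm, pow_mul, hz.pow_eq_one, one_pow]
    rw [Finset.sum_congr rfl this]
    simp
  · have h1 : (z ^ k - 1) * ∑ j ∈ Finset.range m, z ^ (k * j) = 0 := by
      simp only [pow_mul]
      rw [mul_geom_sum, ← pow_mul, mul_comm, pow_mul, hz.pow_eq_one, one_pow, sub_self]
    have h2 : z ^ k - 1 ≠ 0 := fun h2 => h ((hz.pow_eq_one_iff_dvd k).1 (sub_eq_zero.1 h2))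
    have h3 := (mul_eq_zero.1 h1).resolve_left h2
    have e : ∑ j ∈ Finset.Icc 1 m, z ^ (j * k) = z ^ k * ∑ j ∈ Finset.range m, z ^ (k * j) := by
      rw [Finset.mul_sum, Finset.range_eq_Ico, ← Finset.Ico_add_one_right_eq_Icc,
        Finset.sum_Ico_eq_sum_range, Finset.sum_Ico_eq_sum_range]
      refine Finset.sum_congr (by simp) fun j _ => ?_
      rw [← pow_add]
      congr 1
      ring
    rw [e, h3, mul_zero]

/-- The distribution relation of polylogarithms: averaging over the m-th roots of unity keeps the
exponents divisible by m. -/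
lemma sum_polylogSeries {B : Type} [CommRing B] [IsDomain B] [Algebra ℚ B] {m : ℕ} (hm : m ≠ 0)
    {z y : B} (hz : IsPrimitiveRoot z m) (hy : y ^ m = 1) (E : ℕ) {w : B⟦X⟧}
    (hw : PowerSeries.X ∣ w) :
    ((m : ℚ)⁻¹) • ∑ j ∈ Finset.Icc 1 m, polylogSeries E (PowerSeries.C (z ^ j * y) * w) =
      ((m : ℚ) ^ ((E : ℤ) - 2)) • polylogSeries E (w ^ m) := by
  have hm' : (m : ℚ) ≠ 0 := by exact_mod_cast hm
  have hwm : PowerSeries.X ∣ w ^ m := hw.trans (dvd_pow_self _ hm)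
  set g : ℕ → B⟦X⟧ := fun k => ((k : ℚ) ^ ((E : ℤ) - 2)) •
    (PowerSeries.C ((∑ j ∈ Finset.Icc 1 m, z ^ (j * k)) * y ^ k) * w ^ k) with hg
  have h1 : ∑ j ∈ Finset.Icc 1 m, polylogSeries E (PowerSeries.C (z ^ j * y) * w) =
      adicSum fun k => g (k + 1) := by
    simp only [polylogSeries]
    rw [← adicSum_finset_sum]
    congr 1
    ext1 k
    rw [← Finset.smul_sum, hg]
    dsimp only
    rw [map_mul, map_sum, Finset.sum_mul, Finset.sum_mul]
    congr 1
    refine Finset.sum_congr rfl fun j _ => ?_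
    rw [mul_pow, ← map_pow, mul_pow, ← pow_mul, map_mul]
  have h2 : ∀ k, g k = if m ∣ k then ((m : ℚ) * (k : ℚ) ^ ((E : ℤ) - 2)) • w ^ k else 0 := by
    intro k
    rw [hg]
    dsimp only
    rw [sum_Icc_primitiveRoot_pow hz]
    split_ifs with h
    · obtain ⟨c, rfl⟩ := h
      rw [pow_mul y, hy, one_pow, mul_one, map_natCast, ← nsmul_eq_mul, ← Nat.cast_smul_eq_nsmul ℚ,
        smul_smul, mul_comm]
    · simp
  rw [h1, adicSum_of_support_multiples hm _ fun k hk => by rw [h2, if_neg hk]]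
  · rw [polylogSeries, smul_adicSum, smul_adicSum]
    congr 1
    ext1 k
    rw [h2, if_pos (dvd_mul_right _ _), smul_smul, smul_smul, ← pow_mul]
    congr 1
    push_cast
    rw [mul_zpow, ← mul_assoc, ← mul_assoc, inv_mul_cancel₀ hm', one_mul]
  · exact fun k => dvd_smul_of_dvd _ (((pow_dvd_pow _ k.le_succ).trans
      (pow_dvd_pow_of_dvd hw _)).mul_left _)

end Polylog

/-! ### The expansion of the logarithm of the integrand -/

section Expansion

variable {B : Type} [CommRing B] [Algebra ℚ B]

lemma coeff_liftT_ratEval (c : ℚ) (f : ℚ⟦X⟧) (e : ℕ) :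
    PowerSeries.coeff e (liftT (ratEval (c • (PowerSeries.X : B⟦X⟧) ^ 2)
      (dvd_smul_of_dvd _ X_dvd_X_sq) f)) =
    if Even e then Polynomial.C (algebraMap ℚ B (PowerSeries.coeff (e / 2) f * c ^ (e / 2)))
      else 0 := by
  have h1 : PowerSeries.coeff e (ratEval (c • (PowerSeries.X : B⟦X⟧) ^ 2)
      (dvd_smul_of_dvd _ X_dvd_X_sq) f) =
      if Even e then algebraMap ℚ B (PowerSeries.coeff (e / 2) f * c ^ (e / 2)) else 0 := by
    have h2 : ∀ k : ℕ, PowerSeries.coeff e ((PowerSeries.coeff k f) •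
        (c • (PowerSeries.X : B⟦X⟧) ^ 2) ^ k) =
        if e = 2 * k then algebraMap ℚ B (PowerSeries.coeff k f * c ^ k) else 0 := by
      intro k
      rw [smul_pow, ← pow_mul, smul_smul, map_rat_smul, PowerSeries.coeff_X_pow]
      split_ifs
      · rw [Algebra.smul_def, mul_one]
      · rw [smul_zero]
    rw [ratEval_apply, coeff_adicSum]
    simp only [h2]
    split_ifs with he
    · obtain ⟨k, rfl⟩ := he
      rw [Finset.sum_eq_single k]
      · rw [if_pos (by ring), show (k + k) / 2 = k by omega]
      · intro b _ hb
        rw [if_neg (by omega)]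
      · exact fun hk => absurd (Finset.mem_range.2 (by omega)) hk
    · refine Finset.sum_eq_zero fun k _ => if_neg fun h => he ⟨k, by omega⟩
  rw [liftT, PowerSeries.coeff_map, h1]
  split_ifs
  · rfl
  · exact map_zero _

lemma coeff_expV_pow (K s : ℕ) : PowerSeries.coeff s (expV ^ K : B[X]⟦X⟧) =
    Polynomial.C (algebraMap ℚ B ((s.factorial : ℚ)⁻¹ * (K : ℚ) ^ s)) * Polynomial.X ^ s := by
  have hX : (PowerSeries.X : B[X]⟦X⟧) ∣ PowerSeries.X * varT := dvd_mul_right _ _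
  rw [expV, ← expo_nsmul hX, expo, coeff_adicSum, Finset.sum_eq_single s]
  · rw [← Nat.cast_smul_eq_nsmul ℚ, smul_pow, smul_smul, map_rat_smul, mul_pow, varT, ← map_pow,
      mul_comm (PowerSeries.X ^ s), PowerSeries.coeff_C_mul, PowerSeries.coeff_X_pow, if_pos rfl,
      mul_one, Algebra.smul_def]
    rfl
  · intro b _ hb
    rw [← Nat.cast_smul_eq_nsmul ℚ, smul_pow, smul_smul, map_rat_smul, mul_pow, varT, ← map_pow,
      mul_comm (PowerSeries.X ^ b), PowerSeries.coeff_C_mul, PowerSeries.coeff_X_pow,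
      if_neg hb.symm, mul_zero, smul_zero]
  · simp

lemma liftT_ratEval_mul_expV_pow (c : ℚ) (f : ℚ⟦X⟧) (K : ℕ) :
    liftT (ratEval (c • (PowerSeries.X : B⟦X⟧) ^ 2) (dvd_smul_of_dvd _ X_dvd_X_sq) f) *
      expV ^ K = adicSum fun e => (∑ n ∈ Finset.range (e / 2 + 1),
        (PowerSeries.coeff n f * c ^ n * (((e - 2 * n).factorial : ℚ)⁻¹ * (K : ℚ) ^ (e - 2 * n))) •
          varT ^ (e - 2 * n)) * PowerSeries.X ^ e := by
  have h0 : ∀ (q : ℚ) (s : ℕ), (q • varT ^ s : B[X]⟦X⟧) =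
      PowerSeries.C (Polynomial.C (algebraMap ℚ B q) * Polynomial.X ^ s) := by
    intro q s
    have h1 : algebraMap ℚ B[X]⟦X⟧ q = PowerSeries.C (Polynomial.C (algebraMap ℚ B q)) :=
      RingHom.congr_fun (Subsingleton.elim (algebraMap ℚ B[X]⟦X⟧)
        ((PowerSeries.C).comp (Polynomial.C.comp (algebraMap ℚ B)))) q
    rw [varT, ← map_pow, map_mul, Algebra.smul_def, h1]
  conv_lhs => rw [powerSeries_eq_adicSum (liftT (ratEval _ _ f) * expV ^ K)]
  congr 1
  ext1 e
  congr 1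
  simp only [h0]
  rw [← map_sum, PowerSeries.coeff_mul]
  congr 1
  symm
  refine Finset.sum_of_injOn (fun n => (2 * n, e - 2 * n)) ?_ ?_ ?_ ?_
  · intro a _ b _ h
    simp only [Prod.mk.injEq] at h
    omega
  · intro n hn
    simp only [Finset.coe_range, Set.mem_Iio] at hn
    simp only [Finset.mem_coe, Finset.HasAntidiagonal.mem_antidiagonal]
    omega
  · rintro ⟨i, s⟩ hp hn
    rw [Finset.HasAntidiagonal.mem_antidiagonal] at hp
    dsimp only at hp ⊢
    rw [coeff_liftT_ratEval, if_neg, zero_mul]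
    rintro ⟨k, rfl⟩
    refine hn ⟨k, ?_, ?_⟩
    · simp only [Finset.coe_range, Set.mem_Iio]; omega
    · simp only [Prod.mk.injEq]; omega
  · intro n _
    dsimp only
    rw [coeff_liftT_ratEval, if_pos (even_two_mul n), coeff_expV_pow,
      Nat.mul_div_cancel_left _ two_pos]
    simp only [map_mul]
    ring

/-- The coefficients of the expansion of the logarithm of a Pochhammer symbol, multiplied by
`ε²`. -/
def logTerm (m : ℕ) (z : B) (a : B⟦X⟧) (e : ℕ) : B[X]⟦X⟧ :=
  ∑ n ∈ Finset.range (e / 2 + 1), ∑ j ∈ Finset.Icc 1 m, bernCoeff m j n (e - 2 * n) •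
    (liftT (polylogSeries (n + (e - 2 * n)) (PowerSeries.C (z ^ j) * a)) * varT ^ (e - 2 * n))

/-- A single power of the argument, rearranged by degree in ε. The factor ε² clears the pole 1/ħ,
and the powers of k + 1 are those of the series Li_{2-n-s} with n + s = e - n. -/
lemma X_sq_mul_logCoeff_mul {m : ℕ} (hm : m ≠ 0) (z ω : B) (k : ℕ) :
    PowerSeries.X ^ 2 * (liftT (logCoeff m z (k + 1)) * pochArg ω ^ (k + 1)) =
      adicSum fun e => (∑ n ∈ Finset.range (e / 2 + 1), ∑ j ∈ Finset.Icc 1 m,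
        bernCoeff m j n (e - 2 * n) • (liftT ((((k + 1 : ℕ) : ℚ) ^ (((n + (e - 2 * n) : ℕ) : ℤ) - 2)) •
          (PowerSeries.C (z ^ j) * (PowerSeries.C ω * PowerSeries.X ^ 4)) ^ (k + 1)) *
            varT ^ (e - 2 * n))) * PowerSeries.X ^ e := by
  have hm' : (m : ℚ) ≠ 0 := by exact_mod_cast hm
  have hk : ((k + 1 : ℕ) : ℚ) ≠ 0 := by exact_mod_cast k.succ_ne_zero
  set W : B⟦X⟧ := (PowerSeries.C ω * PowerSeries.X ^ 4) ^ (k + 1) with hW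
  have hd : ∀ (j : ℕ) (e : ℕ), PowerSeries.X ^ e ∣ (∑ n ∈ Finset.range (e / 2 + 1),
        (PowerSeries.coeff n (bernSer m j) * ((m * (k + 1) : ℕ) : ℚ) ^ n *
          (((e - 2 * n).factorial : ℚ)⁻¹ * ((k + 1 : ℕ) : ℚ) ^ (e - 2 * n))) •
          (varT : B[X]⟦X⟧) ^ (e - 2 * n)) * PowerSeries.X ^ e := fun j e => dvd_mul_left _ _
  have h1 : PowerSeries.X ^ 2 * (liftT (logCoeff m z (k + 1)) * pochArg ω ^ (k + 1)) =
      ∑ j ∈ Finset.Icc 1 m, (((m : ℚ) * ((k + 1 : ℕ) : ℚ) ^ 2)⁻¹ • liftT (PowerSeries.C (z ^ (j * (k + 1))) * W)) *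
        (liftT (ratEval (((m * (k + 1) : ℕ) : ℚ) • (PowerSeries.X : B⟦X⟧) ^ 2)
          (dvd_smul_of_dvd _ X_dvd_X_sq) (bernSer m j)) * expV ^ (k + 1)) := by
    rw [logCoeff, map_rat_smul, map_mul, map_sum, pochArg, Finset.mul_sum, Finset.smul_sum,
      Finset.sum_mul, Finset.mul_sum]
    refine Finset.sum_congr rfl fun j _ => ?_
    have hX : (PowerSeries.X : B⟦X⟧) ^ 2 * (PowerSeries.X ^ (3 * (k + 1) - 2) *
        PowerSeries.X ^ (k + 1)) = (PowerSeries.X ^ 4) ^ (k + 1) := by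
      rw [← pow_add, ← pow_add, ← pow_mul]; congr 1; omega
    have key : ∀ {A : Type} [CommRing A] {x₂ x₃ xk x₄ o e y r : A}, x₂ * (x₃ * xk) = x₄ →
        x₂ * (x₃ * (y * r) * (xk * (o * e))) = y * (o * x₄) * (r * e) := by
      intro A _ x₂ x₃ xk x₄ o e y r h
      linear_combination y * r * o * e * h
    have hX' := key (e := expV ^ (k + 1)) (o := liftT (PowerSeries.C ω) ^ (k + 1))
      (y := liftT (PowerSeries.C (z ^ (j * (k + 1)))))
      (r := liftT (ratEval (((m * (k + 1) : ℕ) : ℚ) • (PowerSeries.X : B⟦X⟧) ^ 2)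
          (dvd_smul_of_dvd _ X_dvd_X_sq) (bernSer m j)))
      (((congrArg liftT hX).symm.trans (by rw [map_mul, map_mul])).symm)
    rw [smul_mul_assoc, smul_mul_assoc, mul_smul_comm, mul_pow PowerSeries.X, mul_pow (liftT _), hW,
      mul_pow (PowerSeries.C ω)]
    simp only [map_mul, map_pow, liftT_X] at hX' ⊢
    rw [← hX']
  have h2 : ∀ j ∈ Finset.Icc 1 m, (((m : ℚ) * ((k + 1 : ℕ) : ℚ) ^ 2)⁻¹ • liftT (PowerSeries.C (z ^ (j * (k + 1))) * W)) *
        (liftT (ratEval (((m * (k + 1) : ℕ) : ℚ) • (PowerSeries.X : B⟦X⟧) ^ 2)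
          (dvd_smul_of_dvd _ X_dvd_X_sq) (bernSer m j)) * expV ^ (k + 1)) = adicSum fun e =>
      (∑ n ∈ Finset.range (e / 2 + 1), bernCoeff m j n (e - 2 * n) •
        (liftT ((((k + 1 : ℕ) : ℚ) ^ (((n + (e - 2 * n) : ℕ) : ℤ) - 2)) •
          (PowerSeries.C (z ^ j) * (PowerSeries.C ω * PowerSeries.X ^ 4)) ^ (k + 1)) *
            varT ^ (e - 2 * n))) * PowerSeries.X ^ e := by
    intro j _
    rw [liftT_ratEval_mul_expV_pow, mul_adicSum _ (hd j)]
    congr 1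
    ext1 e
    rw [← mul_assoc, Finset.mul_sum]
    congr 1
    refine Finset.sum_congr rfl fun n _ => ?_
    rw [smul_mul_smul_comm, mul_pow (PowerSeries.C (z ^ j)), ← map_pow, ← pow_mul, ← hW,
      map_rat_smul, smul_mul_assoc, smul_smul]
    congr 1
    have hn : (n.factorial : ℚ) ≠ 0 := by exact_mod_cast n.factorial_ne_zero
    have hs : ((e - 2 * n).factorial : ℚ) ≠ 0 := by exact_mod_cast (e - 2 * n).factorial_ne_zero
    rw [bernSer, PowerSeries.coeff_mk, bernCoeff]
    rw [show (((n + (e - 2 * n) : ℕ) : ℤ) - 2) = (n : ℤ) + ((e - 2 * n : ℕ) : ℤ) - 2 by push_cast; ring,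
      zpow_sub₀ hk, zpow_add₀ hk, zpow_sub₀ hm', zpow_natCast, zpow_natCast, zpow_natCast]
    rw [show ((m * (k + 1) : ℕ) : ℚ) = (m : ℚ) * ((k + 1 : ℕ) : ℚ) by push_cast; ring]
    generalize (e - 2 * n) = s at hs ⊢
    generalize ((k + 1 : ℕ) : ℚ) = K at hk ⊢
    generalize Polynomial.eval ((j : ℚ) / m) (Polynomial.bernoulli n) = β
    rw [mul_pow]
    field_simp
  rw [h1, Finset.sum_congr rfl h2, ← adicSum_finset_sum]
  congr 1
  ext1 e
  rw [← Finset.sum_mul, Finset.sum_comm]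

/-- Interchange the sums over the powers of the argument and over the degree in ε; the inner sums
are then polylogarithms. -/
lemma X_sq_mul_logIntegrand {m : ℕ} (hm : m ≠ 0) (z ω : B) :
    PowerSeries.X ^ 2 * logIntegrand m z ω = adicSum fun e =>
      logTerm m z (PowerSeries.C ω * PowerSeries.X ^ 4) e * PowerSeries.X ^ e := by
  have hd : ∀ k, PowerSeries.X ^ k ∣ liftT (PowerSeries.coeff k (logPoch m z)) * pochArg ω ^ k :=
    fun k => (pow_dvd_pow_of_dvd (X_dvd_pochArg ω) k).mul_left _
  have hw : (PowerSeries.X : B⟦X⟧) ∣ PowerSeries.C ω * PowerSeries.X ^ 4 :=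
    (dvd_pow_self _ (by norm_num)).mul_left _
  rw [logIntegrand, evalAt_apply, adicSum_eq_add_succ hd]
  have h0 : PowerSeries.coeff 0 (logPoch m z) = 0 := by
    rw [PowerSeries.coeff_zero_eq_constantCoeff_apply, PowerSeries.X_dvd_iff.1 (X_dvd_logPoch m z)]
  rw [h0, map_zero, zero_mul, zero_add, mul_adicSum _ fun k => (pow_dvd_pow _ k.le_succ).trans (hd _)]
  simp only [logPoch, PowerSeries.coeff_mk, X_sq_mul_logCoeff_mul hm]
  rw [adicSum_comm]
  congr 1
  ext1 e
  have hd' : ∀ (E j k : ℕ), PowerSeries.X ^ k ∣ (((k + 1 : ℕ) : ℚ) ^ ((E : ℤ) - 2)) •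
          (PowerSeries.C (z ^ j) * (PowerSeries.C ω * PowerSeries.X ^ 4)) ^ (k + 1) :=
    fun E j k => X_pow_dvd_polylogSeries_term E (hw.mul_left _) k
  have hd'' : ∀ (E j k : ℕ), PowerSeries.X ^ k ∣ liftT ((((k + 1 : ℕ) : ℚ) ^ ((E : ℤ) - 2)) •
          (PowerSeries.C (z ^ j) * (PowerSeries.C ω * PowerSeries.X ^ 4)) ^ (k + 1)) := by
    intro E j k
    exact X_pow_dvd_ringHom (h := liftT) (by rw [liftT_X]) k _ (hd' E j k)
  have h3 : ∀ n j : ℕ, bernCoeff m j n (e - 2 * n) • (liftT (polylogSeries (n + (e - 2 * n))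
      (PowerSeries.C (z ^ j) * (PowerSeries.C ω * PowerSeries.X ^ 4))) * varT ^ (e - 2 * n)) =
      adicSum fun k => bernCoeff m j n (e - 2 * n) •
        (liftT ((((k + 1 : ℕ) : ℚ) ^ (((n + (e - 2 * n) : ℕ) : ℤ) - 2)) •
          (PowerSeries.C (z ^ j) * (PowerSeries.C ω * PowerSeries.X ^ 4)) ^ (k + 1)) *
            varT ^ (e - 2 * n)) := by
    intro n j
    rw [polylogSeries, ringHom_adicSum liftT (by rw [liftT_X]) (hd' _ j),
      adicSum_mul (hd'' _ j), smul_adicSum]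
  rw [logTerm]
  simp only [h3]
  simp only [← adicSum_finset_sum]
  rw [adicSum_mul]
  · intro k
    exact Finset.dvd_sum fun n _ => Finset.dvd_sum fun j _ =>
      dvd_smul_of_dvd _ ((hd'' _ j k).mul_right _)

end Expansion

/-! ### The exponent of the integrand -/

section ExponentIdentity

variable {B : Type} [CommRing B] [Algebra ℚ B]

/-- The variable `ε⁴ ω`. -/
def wSer (ω : B) : B⟦X⟧ := PowerSeries.C ω * PowerSeries.X ^ 4

lemma X_pow_four_dvd_wSer (ω : B) : PowerSeries.X ^ 4 ∣ wSer ω := dvd_mul_left _ _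

lemma X_dvd_wSer (ω : B) : PowerSeries.X ∣ wSer ω :=
  (dvd_pow_self _ (by norm_num)).trans (X_pow_four_dvd_wSer ω)

lemma wSer_mul (ω y : B) : wSer (ω * y) = PowerSeries.C y * wSer ω := by
  rw [wSer, wSer, map_mul]; ring

/-- The constant term of the exponent. -/
def constExponent (m : ℕ) (z : B) (a : B⟦X⟧) : B⟦X⟧ :=
  ∑ j ∈ Finset.Icc 1 m, ((j : ℚ) / m - 1 / 2) • liOne (PowerSeries.C (z ^ j) * a)

lemma X_dvd_constExponent (m : ℕ) (z : B) {a : B⟦X⟧} (ha : PowerSeries.X ∣ a) :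
    PowerSeries.X ∣ constExponent m z a :=
  Finset.dvd_sum fun _ _ => dvd_smul_of_dvd _ (X_dvd_liOne (ha.mul_left _))

lemma polyLift_C_mul_X_pow (b : B⟦X⟧) (s : ℕ) :
    polyLift (Polynomial.C b * Polynomial.X ^ s) = liftT b * varT ^ s := by
  simp [polyLift]

variable [IsDomain B]

lemma sum_smul_liftT_polylogSeries {m : ℕ} (hm : m ≠ 0) {z y : B} (hz : IsPrimitiveRoot z m)
    (hy : y ^ m = 1) (E : ℕ) (ω : B) (T : B[X]⟦X⟧) :
    ∑ j ∈ Finset.Icc 1 m, ((m : ℚ)⁻¹) •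
      (liftT (polylogSeries E (PowerSeries.C (z ^ j) * wSer (ω * y))) * T) =
      liftT (((m : ℚ) ^ ((E : ℤ) - 2)) • polylogSeries E (wSer ω ^ m)) * T := by
  rw [← sum_polylogSeries hm hz hy E (X_dvd_wSer ω), map_rat_smul, map_sum, smul_mul_assoc,
    Finset.sum_mul, Finset.smul_sum]
  refine Finset.sum_congr rfl fun j _ => ?_
  rw [wSer_mul, map_mul (PowerSeries.C), mul_assoc]

lemma bernCoeff_zero (m j s : ℕ) :
    bernCoeff m j 0 s = (s.factorial : ℚ)⁻¹ * (m : ℚ)⁻¹ := by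
  simp [bernCoeff]
  ring

lemma bernCoeff_one_zero (m j : ℕ) : bernCoeff m j 1 0 = (j : ℚ) / m - 1 / 2 := by
  simp [bernCoeff, Polynomial.bernoulli_one]

/-- After division by ε² the terms with e = 0, 1, 2 give the potential, the linear term, and the
Hessian with the constant term; those with e ≥ 3 have positive degree. The distribution relation
removes the twist y from everything of degree at most 0 except the part with B₁(j/m), which is
`constExponent`. -/
lemma X_sq_mul_logIntegrand_split {m : ℕ} (hm : m ≠ 0) {z y : B} (hz : IsPrimitiveRoot z m)
    (hy : y ^ m = 1) (ω : B) :
    PowerSeries.X ^ 2 * logIntegrand m z (ω * y) =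
      liftT (((m : ℚ) ^ (-2 : ℤ)) • polylogSeries 0 (wSer ω ^ m)) +
      liftT (((m : ℚ)⁻¹) • liOne (wSer ω ^ m)) * varT * PowerSeries.X +
      ((1 / 2 : ℚ) • (liftT (polylogSeries 2 (wSer ω ^ m)) * varT ^ 2) +
        liftT (constExponent m z (PowerSeries.C y * wSer ω))) * PowerSeries.X ^ 2 +
      adicSum fun d => logTerm m z (PowerSeries.C y * wSer ω) (d + 3) *
        PowerSeries.X ^ (d + 3) := by
  have hd : ∀ e k, PowerSeries.X ^ k ∣ logTerm m z (wSer (ω * y)) (k + e) *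
      PowerSeries.X ^ (k + e) := fun e k => (pow_dvd_pow _ (by omega)).trans (dvd_mul_left _ _)
  have hwm : PowerSeries.X ∣ wSer ω ^ m := (X_dvd_wSer ω).trans (dvd_pow_self _ hm)
  rw [X_sq_mul_logIntegrand hm]
  change adicSum (fun e => logTerm m z (wSer (ω * y)) (e + 0) * PowerSeries.X ^ (e + 0)) = _
  rw [adicSum_eq_add_succ (hd 0)]
  change _ + adicSum (fun e => logTerm m z (wSer (ω * y)) (e + 1) * PowerSeries.X ^ (e + 1)) = _
  rw [adicSum_eq_add_succ (hd 1)]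
  change _ + (_ + adicSum (fun e => logTerm m z (wSer (ω * y)) (e + 2) *
    PowerSeries.X ^ (e + 2))) = _
  rw [adicSum_eq_add_succ (hd 2)]
  have h0 : logTerm m z (wSer (ω * y)) 0 =
      liftT (((m : ℚ) ^ (-2 : ℤ)) • polylogSeries 0 (wSer ω ^ m)) := by
    have := sum_smul_liftT_polylogSeries hm hz hy 0 ω 1
    rw [mul_one] at this
    simpa [logTerm, bernCoeff_zero] using this
  have h1 : logTerm m z (wSer (ω * y)) 1 =
      liftT (((m : ℚ)⁻¹) • liOne (wSer ω ^ m)) * varT := by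
    have := sum_smul_liftT_polylogSeries hm hz hy 1 ω varT
    rw [polylogSeries_one hwm] at this
    simpa [logTerm, bernCoeff_zero] using this
  have h2 : logTerm m z (wSer (ω * y)) 2 =
      (1 / 2 : ℚ) • (liftT (polylogSeries 2 (wSer ω ^ m)) * varT ^ 2) +
        liftT (constExponent m z (PowerSeries.C y * wSer ω)) := by
    have h3 := sum_smul_liftT_polylogSeries hm hz hy 2 ω (varT ^ 2)
    rw [logTerm, show 2 / 2 + 1 = 2 by norm_num, Finset.sum_range_succ, Finset.sum_range_one]
    congr 1
    · have h4 : ∀ j, bernCoeff m j 0 (2 - 2 * 0) = (1 / 2 : ℚ) * (m : ℚ)⁻¹ := fun j => by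
        rw [bernCoeff_zero]; norm_num
      simp only [h4, mul_smul]
      rw [← Finset.smul_sum]
      congr 1
      refine h3.trans ?_
      simp
    · rw [constExponent, map_sum]
      refine Finset.sum_congr rfl fun j _ => ?_
      have hp : PowerSeries.X ∣ PowerSeries.C (z ^ j) * wSer (ω * y) := (X_dvd_wSer _).mul_left _
      have hn : 1 + (2 - 2 * 1) = 1 := rfl
      rw [hn, polylogSeries_one hp, show 2 - 2 * 1 = 0 from rfl, bernCoeff_one_zero, pow_zero,
        mul_one, map_rat_smul, wSer_mul]
  rw [h0, h1, h2, wSer_mul]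
  simp only [zero_add, pow_zero, mul_one, pow_one]
  ring

lemma polyLift_C_rlogPochCoeff {m : ℕ} (z y : B) (ω : B) {n s : ℕ} (h : 2 ≤ n + s) :
    polyLift (Polynomial.C (rlogPochCoeff m (PowerSeries.C z) (PowerSeries.C y * wSer ω) n s) *
      Polynomial.X ^ s) = ∑ j ∈ Finset.Icc 1 m, bernCoeff m j n s •
        (liftT (polylogSeries (n + s) (PowerSeries.C (z ^ j) * (PowerSeries.C y * wSer ω))) *
          varT ^ s) := by
  rw [polyLift_C_mul_X_pow, rlogPochCoeff, map_sum, Finset.sum_mul]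
  refine Finset.sum_congr rfl fun j _ => ?_
  have hX : PowerSeries.X ∣ PowerSeries.C z ^ j * (PowerSeries.C y * wSer ω) :=
    ((X_dvd_wSer ω).mul_left _).mul_left _
  rw [rnegPolylog_eq hX, Nat.sub_add_cancel h, ← smul_mul_assoc, ← map_rat_smul liftT,
    Algebra.smul_def, map_pow]

lemma X_sq_mul_adicSum {R : Type} [CommRing R] (e : ℕ → R⟦X⟧) :
    PowerSeries.X ^ 2 * adicSum (fun k => e k * PowerSeries.X ^ (k + 1)) =
      adicSum fun k => e k * PowerSeries.X ^ (k + 3) := by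
  rw [mul_adicSum _ fun k => (pow_dvd_pow _ k.le_succ).trans (dvd_mul_left _ _)]
  congr 1
  ext1 k
  ring

lemma X_sq_mul_diagLift_rexponent (m : ℕ) (z ω₁ ω₂ : B) (r : ℕ) :
    PowerSeries.X ^ 2 * diagLift (rexponent m (PowerSeries.C z) (wSer ω₁) (wSer ω₂) r) =
      (1 / 2 : ℚ) • varT * PowerSeries.X ^ 3 +
      (adicSum fun d => logTerm m z (PowerSeries.C (z ^ r) * wSer ω₁) (d + 3) *
        PowerSeries.X ^ (d + 3)) +
      adicSum fun d => logTerm m z (PowerSeries.C (z ^ r) * wSer ω₂) (d + 3) *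
        PowerSeries.X ^ (d + 3) := by
  have hd : ∀ k, PowerSeries.X ^ k ∣ polyLift (PowerSeries.coeff k
      (rexponent m (PowerSeries.C z) (wSer ω₁) (wSer ω₂) r)) * PowerSeries.X ^ k :=
    fun k => dvd_mul_left _ _
  rw [diagLift, evalAt_apply, adicSum_eq_add_succ hd]
  have h0 : PowerSeries.coeff 0 (rexponent m (PowerSeries.C z) (wSer ω₁) (wSer ω₂) r) = 0 := by
    rw [rexponent, PowerSeries.coeff_mk, if_pos rfl]
  -- Degree d + 1 in the exponent corresponds to index d + 3 of `logTerm`, because of the factor ε².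
  -- The summand t/2 occurs only in degree 1.
  have h1 : ∀ d, polyLift (PowerSeries.coeff (d + 1)
      (rexponent m (PowerSeries.C z) (wSer ω₁) (wSer ω₂) r)) =
      (if d = 0 then (1 / 2 : ℚ) • varT else 0) +
        (logTerm m z (PowerSeries.C (z ^ r) * wSer ω₁) (d + 3) +
          logTerm m z (PowerSeries.C (z ^ r) * wSer ω₂) (d + 3)) := by
    intro d
    rw [rexponent, PowerSeries.coeff_mk, if_neg d.succ_ne_zero, map_add]
    congr 1
    · by_cases hd0 : d = 0
      · rw [if_pos (by omega), if_pos hd0]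
        have := polyLift_C_mul_X_pow (algebraMap ℚ B⟦X⟧ (1 / 2)) 1
        rw [pow_one, pow_one] at this
        rw [this, Algebra.smul_def]
        rw [← RingHom.congr_fun (Subsingleton.elim (liftT.comp (algebraMap ℚ B⟦X⟧))
          (algebraMap ℚ B[X]⟦X⟧)) (1 / 2)]
        rfl
      · rw [if_neg (by omega), if_neg hd0, map_zero]
    · rw [logTerm, logTerm, ← Finset.sum_add_distrib, map_sum]
      refine Finset.sum_congr (by rw [show d + 1 + 2 = d + 3 by ring]) fun n hn => ?_
      have hn' := Finset.mem_range.1 hn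
      have h2 : 2 ≤ n + (d + 3 - 2 * n) := by omega
      rw [map_add, add_mul, map_add, show d + 1 + 2 - 2 * n = d + 3 - 2 * n by omega, ← map_pow,
        polyLift_C_rlogPochCoeff _ _ _ h2, polyLift_C_rlogPochCoeff _ _ _ h2]
  rw [h0, map_zero, zero_mul, zero_add]
  simp only [h1, add_mul]
  rw [adicSum_add, adicSum_add, mul_add, mul_add]
  rw [X_sq_mul_adicSum, X_sq_mul_adicSum, X_sq_mul_adicSum, ← add_assoc]
  congr 2
  rw [adicSum_eq_sum_range (N := 1)]
  · simp
  · exact fun k => (pow_dvd_pow _ (by omega)).trans (dvd_mul_left _ _)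
  · intro k hk
    rw [if_neg (by omega), zero_mul]

/-- The series `ah` is chosen so that ah·ε·t cancels the linear term Li₁/(mε)·t of the logarithms;
this expresses that w₁, w₂ and u form a critical point. The potential V and the class constants, the
change κ of the Hessian, and the positive-degree exponent of `rPsi` remain. -/
lemma exponent_identity {m : ℕ} (hm : m ≠ 0) {z : B} (hz : IsPrimitiveRoot z m) (ω₁ ω₂ : B)
    (r : ℕ) {ah V : B⟦X⟧}
    (hah : ah * PowerSeries.X ^ 2 =
      -(((m : ℚ)⁻¹) • (liOne (wSer ω₁ ^ m) + liOne (wSer ω₂ ^ m))))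
    (hV : V * PowerSeries.X ^ 2 = ((m : ℚ) ^ (-2 : ℤ)) •
      (polylogSeries 0 (wSer ω₁ ^ m) + polylogSeries 0 (wSer ω₂ ^ m))) :
    liftT ((PowerSeries.C (algebraMap ℚ B (1 / 2)) + ah) * PowerSeries.X) * varT +
        (logIntegrand m z (ω₁ * z ^ r) + logIntegrand m z (ω₂ * z ^ r)) =
      liftT (V + constExponent m z (PowerSeries.C (z ^ r) * wSer ω₁) +
        constExponent m z (PowerSeries.C (z ^ r) * wSer ω₂)) +
      liftT (polylogSeries 2 (wSer ω₁ ^ m) + polylogSeries 2 (wSer ω₂ ^ m)) *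
        ((1 / 2 : ℚ) • varT ^ 2) +
      diagLift (rexponent m (PowerSeries.C z) (wSer ω₁) (wSer ω₂) r) := by
  have hy : (z ^ r) ^ m = 1 := by rw [← pow_mul, mul_comm, pow_mul, hz.pow_eq_one, one_pow]
  have h1 := X_sq_mul_logIntegrand_split hm hz hy ω₁
  have h2 := X_sq_mul_logIntegrand_split hm hz hy ω₂
  have h3 := X_sq_mul_diagLift_rexponent m z ω₁ ω₂ r
  have h4 := congrArg liftT hah
  have h5 := congrArg liftT hV
  have hX : (PowerSeries.X : B[X]⟦X⟧) ^ 2 ≠ 0 := pow_ne_zero _ PowerSeries.X_ne_zero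
  have hh : liftT (PowerSeries.C (algebraMap ℚ B (1 / 2))) = algebraMap ℚ B[X]⟦X⟧ (1 / 2) :=
    RingHom.congr_fun (Subsingleton.elim ((liftT.comp PowerSeries.C).comp (algebraMap ℚ B))
          (algebraMap ℚ B[X]⟦X⟧)) _
  refine mul_left_cancel₀ hX ?_
  simp only [map_add, map_mul, map_pow, liftT_X, map_neg, map_rat_smul, smul_add, hh] at h1 h2 h4 h5 ⊢
  simp only [map_pow] at h3
  simp only [Algebra.smul_def] at h1 h2 h3 h4 h5 ⊢
  linear_combination h1 + h2 - h3 + (varT * PowerSeries.X) * h4 - h5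

end ExponentIdentity

/-! ### Parity -/

section Parity

variable {A : Type} [CommRing A] [Algebra ℚ A]

/-- The involution `ε ↦ -ε`, `t ↦ -t`. -/
def parityHom : A[X]⟦X⟧ →+* A[X]⟦X⟧ :=
  (PowerSeries.rescale (-1)).comp (PowerSeries.map (Polynomial.compRingHom (-Polynomial.X)))

lemma coeff_parityHom (f : A[X]⟦X⟧) (d : ℕ) : PowerSeries.coeff d (parityHom f) =
    (-1) ^ d * (PowerSeries.coeff d f).comp (-Polynomial.X) := by
  simp [parityHom, PowerSeries.coeff_rescale]

/-- In the coefficient of ε^d every power of t has the parity of d. -/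
lemma parityHom_rexponent (m : ℕ) (z w₁ w₂ : A) (r : ℕ) :
    parityHom (rexponent m z w₁ w₂ r) = rexponent m z w₁ w₂ r := by
  have hs : ∀ d : ℕ, ((-1 : A[X]) ^ d) * (-1) ^ d = 1 := fun d => by rw [← mul_pow]; simp
  ext1 d
  rw [coeff_parityHom, rexponent, PowerSeries.coeff_mk]
  by_cases hd : d = 0
  · simp [hd]
  rw [if_neg hd, Polynomial.add_comp, Polynomial.sum_comp, mul_add, Finset.mul_sum]
  congr 1
  · split_ifs with h
    · subst h
      rw [Polynomial.mul_comp, Polynomial.C_comp, Polynomial.X_comp]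
      ring
    · simp
  · refine Finset.sum_congr rfl fun n hn => ?_
    have hn' := Finset.mem_range.1 hn
    rw [Polynomial.mul_comp, Polynomial.C_comp, Polynomial.pow_comp, Polynomial.X_comp,
      neg_pow (Polynomial.X : A[X])]
    have h1 : (-1 : A[X]) ^ d * (-1) ^ (d + 2 - 2 * n) = 1 := by
      rw [← pow_add, show d + (d + 2 - 2 * n) = 2 * (d + 1 - n) by omega, pow_mul]
      simp
    linear_combination (Polynomial.C (rlogPochCoeff m z (z ^ r * w₁) n (d + 2 - 2 * n) +
            rlogPochCoeff m z (z ^ r * w₂) n (d + 2 - 2 * n)) *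
              Polynomial.X ^ (d + 2 - 2 * n)) * h1

lemma rmean_comp_neg (h : A) (P : A[X]) : rmean h (P.comp (-Polynomial.X)) = rmean h P := by
  induction P using Polynomial.induction_on' with
  | add p q hp hq => rw [Polynomial.add_comp, rmean_add, rmean_add, hp, hq]
  | monomial n a =>
    rw [Polynomial.monomial_comp, neg_pow, ← mul_assoc]
    have : Polynomial.C a * (-1) ^ n * Polynomial.X ^ n = Polynomial.monomial n (a * (-1) ^ n) := by
      rw [← Polynomial.C_mul_X_pow_eq_monomial]; simp
    rw [this, rmean_monomial, rmean_monomial]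
    split_ifs with hn
    · rw [hn.neg_one_pow, mul_one]
    · rfl

lemma rmean_coeff_expo_rexponent_of_odd (h : A) (m : ℕ) (z w₁ w₂ : A) (r : ℕ) {d : ℕ}
    (hd : Odd d) : rmean h (PowerSeries.coeff d (expo (rexponent m z w₁ w₂ r))) = 0 := by
  have hX : PowerSeries.X ∣ parityHom (PowerSeries.X : A[X]⟦X⟧) := by
    rw [parityHom, RingHom.comp_apply, PowerSeries.map_X]
    exact X_dvd_rescale_X _
  have h1 : parityHom (expo (rexponent m z w₁ w₂ r)) = expo (rexponent m z w₁ w₂ r) := by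
    rw [map_expo parityHom hX (X_dvd_rexponent _ _ _ _ _), parityHom_rexponent]
  have h2 := congrArg (fun f => rmean h (PowerSeries.coeff d f)) h1
  simp only [coeff_parityHom, hd.neg_one_pow] at h2
  rw [show (-1 : A[X]) = Polynomial.C (-1) by simp, rmean_C_mul, rmean_comp_neg] at h2
  have h3 : (2 : ℚ) • rmean h (PowerSeries.coeff d (expo (rexponent m z w₁ w₂ r))) = 0 := by
    rw [two_smul]
    linear_combination -h2
  have h4 := congrArg (fun x => (2 : ℚ)⁻¹ • x) h3
  simpa [smul_smul] using h4

end Parity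

/-! ### The integral of the exponential -/

section HalfCore

variable {B : Type} [CommRing B] [Algebra ℚ B]

/-- The substitution `ħ = ε²`. -/
def sqHom : B⟦X⟧⟦X⟧ →+* B⟦X⟧ := evalAt (RingHom.id _) (PowerSeries.X ^ 2) X_dvd_X_sq

lemma sqHom_C (b : B⟦X⟧) : sqHom (PowerSeries.C b) = b := evalAt_C _ _ _

/-- Odd powers of ε carry odd polynomials in t and integrate to zero, so the result is a series in ħ
= ε², which is what `rgauss` records. -/
lemma gMean_diagLift_expo_rexponent (h : B⟦X⟧) (m : ℕ) (z w₁ w₂ : B⟦X⟧) (r : ℕ) :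
    gMean h (diagLift (expo (rexponent m z w₁ w₂ r))) =
      sqHom (rgauss h (expo (rexponent m z w₁ w₂ r))) := by
  rw [gMean_diagLift, diagHom, sqHom, evalAt_apply, evalAt_apply]
  set g : ℕ → B⟦X⟧ := fun k => rmean h (PowerSeries.coeff k (expo (rexponent m z w₁ w₂ r))) with hg
  have hodd : ∀ k, Odd k → g k = 0 := fun k hk => rmean_coeff_expo_rexponent_of_odd h m z w₁ w₂ r hk
  have hd : ∀ k, PowerSeries.X ^ k ∣ g (2 * k) * (PowerSeries.X ^ 2) ^ k := fun k => by
    rw [← pow_mul]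
    exact (pow_dvd_pow _ (by omega)).trans (dvd_mul_left _ _)
  have hd' : ∀ k, PowerSeries.X ^ k ∣ g k * PowerSeries.X ^ k := fun k => dvd_mul_left _ _
  simp only [PowerSeries.coeff_mk, RingHom.id_apply, rgauss]
  refine eq_adicSum hd fun n => ?_
  have h1 : ∑ k ∈ Finset.range n, g (2 * k) * (PowerSeries.X ^ 2) ^ k =
      ∑ k ∈ Finset.range (2 * n), g k * PowerSeries.X ^ k := by
    induction n with
    | zero => simp
    | succ n ih =>
      rw [Finset.sum_range_succ, ih, show 2 * (n + 1) = 2 * n + 1 + 1 by ring,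
        Finset.sum_range_succ, Finset.sum_range_succ, hodd (2 * n + 1) (odd_two_mul_add_one n),
        zero_mul, add_zero, ← pow_mul]
  rw [h1]
  exact (pow_dvd_pow _ (by omega)).trans (X_pow_dvd_adicSum_sub hd' (2 * n))

variable [IsDomain B]

lemma rnegHessInv_mul {m : ℕ} (hm : m ≠ 0) (ω₁ ω₂ : B) :
    rnegHessInv m (wSer ω₁) (wSer ω₂) *
      (1 + (polylogSeries 2 (wSer ω₁ ^ m) + polylogSeries 2 (wSer ω₂ ^ m))) = -1 := by
  have h1 := one_sub_mul_polylogSeries_two ((X_dvd_wSer ω₁).trans (dvd_pow_self _ hm))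
  have h2 := one_sub_mul_polylogSeries_two ((X_dvd_wSer ω₂).trans (dvd_pow_self _ hm))
  have hX : PowerSeries.X ∣ wSer ω₁ ^ m * wSer ω₂ ^ m :=
    ((X_dvd_wSer ω₁).trans (dvd_pow_self _ hm)).mul_right _
  have h3 := Ring.inverse_mul_cancel _ (isUnit_one_sub hX)
  rw [rnegHessInv]
  generalize wSer ω₁ ^ m = c at *
  generalize wSer ω₂ ^ m = d at *
  linear_combination -Ring.inverse (1 - c * d) * ((1 - d) * h1 + (1 - c) * h2) - h3

/-- Summation by parts over j. The weights j/m - 1/2 drop by 1/m at each step, which produces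
Li₁(w^m)/m, and the jump at the end of the period produces Li₁(z^{r+1}w) = -log(1 - z^{r+1}w). -/
lemma expo_constExponent_succ {m : ℕ} (hm : m ≠ 0) {z : B} (hz : IsPrimitiveRoot z m) {w : B⟦X⟧}
    (hw : PowerSeries.X ∣ w) (r : ℕ) :
    expo (constExponent m z (PowerSeries.C (z ^ (r + 1)) * w)) *
        (1 - PowerSeries.C z ^ (r + 1) * w) =
      expo (constExponent m z (PowerSeries.C (z ^ r) * w)) *
        expo (-(((m : ℚ)⁻¹) • liOne (w ^ m))) := by
  have hX : ∀ b : B, PowerSeries.X ∣ PowerSeries.C b * w := fun b => hw.mul_left _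
  have hm' : (m : ℚ) ≠ 0 := by exact_mod_cast hm
  have hwm : PowerSeries.X ∣ w ^ m := hw.trans (dvd_pow_self _ hm)
  have hl : PowerSeries.X ∣ -(((m : ℚ)⁻¹) • liOne (w ^ m)) :=
    (dvd_neg).2 (dvd_smul_of_dvd _ (X_dvd_liOne hwm))
  have hl' : PowerSeries.X ∣ -liOne (PowerSeries.C (z ^ (r + 1)) * w) :=
    (dvd_neg).2 (X_dvd_liOne (hX _))
  rw [← map_pow, ← expo_neg_liOne (hX _), ← expo_add (X_dvd_constExponent m z (hX _)) hl',
    ← expo_add (X_dvd_constExponent m z (hX _)) hl]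
  congr 1
  set f : ℕ → B⟦X⟧ := fun j => liOne (PowerSeries.C (z ^ (j + r)) * w) with hf
  have hper : f (m + 1) = f 1 := by
    simp only [hf]
    rw [show m + 1 + r = m + (1 + r) by ring, pow_add z m, hz.pow_eq_one, one_mul]
  have h1 : constExponent m z (PowerSeries.C (z ^ (r + 1)) * w) =
      ∑ j ∈ Finset.Icc 1 m, ((j : ℚ) / m - 1 / 2) • f (j + 1) := by
    refine Finset.sum_congr rfl fun j _ => ?_
    rw [hf, ← mul_assoc, ← map_mul, ← pow_add]
    dsimp only
    rw [show j + 1 + r = j + (r + 1) by ring]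
  have h2 : constExponent m z (PowerSeries.C (z ^ r) * w) =
      ∑ j ∈ Finset.Icc 1 m, ((j : ℚ) / m - 1 / 2) • f j := by
    refine Finset.sum_congr rfl fun j _ => ?_
    rw [hf, ← mul_assoc, ← map_mul, ← pow_add]
  have h3 : ((m : ℚ)⁻¹) • liOne (w ^ m) = ((m : ℚ)⁻¹) • ∑ j ∈ Finset.Icc 1 m, f j := by
    have hy : (z ^ r) ^ m = 1 := by rw [← pow_mul, mul_comm, pow_mul, hz.pow_eq_one, one_pow]
    have h4 := sum_polylogSeries hm hz hy 1 hw
    rw [polylogSeries_one hwm] at h4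
    rw [show ((m : ℚ)⁻¹) = (m : ℚ) ^ (((1 : ℕ) : ℤ) - 2) by norm_num, ← h4]
    norm_num
    congr 1
    refine Finset.sum_congr rfl fun j _ => ?_
    rw [hf, ← map_pow, ← map_pow, ← map_mul, polylogSeries_one (hX _), ← pow_add]
  -- The boundary terms at n and at 0 have weights n/m - 1/2 and 1/2; for n = m, by periodicity of
  -- f, they add up to f 1.
  have habel : ∀ n : ℕ, ∑ j ∈ Finset.Icc 1 n, ((j : ℚ) / m - 1 / 2) • f (j + 1) =
      ∑ j ∈ Finset.Icc 1 n, ((j : ℚ) / m - 1 / 2) • f j - ((m : ℚ)⁻¹) • ∑ j ∈ Finset.Icc 1 n, f j +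
        ((n : ℚ) / m - 1 / 2) • f (n + 1) + (1 / 2 : ℚ) • f 1 := by
    intro n
    induction n with
    | zero =>
      simp only [Finset.Icc_eq_empty (show ¬ 1 ≤ 0 by norm_num), Finset.sum_empty]
      norm_num
    | succ n ih =>
      rw [Finset.sum_Icc_succ_top (by omega), Finset.sum_Icc_succ_top (by omega),
        Finset.sum_Icc_succ_top (by omega), ih]
      have h5 : ((n + 1 : ℕ) : ℚ) / m = (n : ℚ) / m + (m : ℚ)⁻¹ := by
        push_cast; field_simp
      rw [h5]
      simp only [smul_add, sub_smul, add_smul]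
      abel
  rw [h1, h2, h3, habel, hper]
  have h6 : ((m : ℚ) / m - 1 / 2) • f 1 + (1 / 2 : ℚ) • f 1 = f 1 := by
    rw [← add_smul, div_self hm']; norm_num
  have h7 : f 1 = liOne (PowerSeries.C (z ^ (r + 1)) * w) := by
    simp only [hf]; rw [add_comm 1 r]
  rw [← h7]
  linear_combination h6

/-- Both sides satisfy the same recursion in r. The factors exp(-Li₁(wᵢ^m)/m) given by
`expo_constExponent_succ` multiply to e^a, which turns u₀ into u = u₀e^a. -/
lemma gaussTerm_mul_expo_constExponent {m : ℕ} (hm : m ≠ 0) {z : B} (hz : IsPrimitiveRoot z m)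
    (u₀ : B) {w₁ w₂ a : B⟦X⟧} (hw₁ : PowerSeries.X ∣ w₁) (hw₂ : PowerSeries.X ∣ w₂)
    (ha : a = -(((m : ℚ)⁻¹) • (liOne (w₁ ^ m) + liOne (w₂ ^ m)))) (r : ℕ) :
    PowerSeries.C (gaussTerm u₀ z r) * (expo (constExponent m z (PowerSeries.C (z ^ r) * w₁)) *
        expo (constExponent m z (PowerSeries.C (z ^ r) * w₂))) =
      expo (constExponent m z w₁) * expo (constExponent m z w₂) *
        rweight (PowerSeries.C z) w₁ w₂ (PowerSeries.C u₀ * expo a) r := by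
  have hl : ∀ {w : B⟦X⟧}, PowerSeries.X ∣ w → PowerSeries.X ∣ -(((m : ℚ)⁻¹) • liOne (w ^ m)) :=
    fun hw => (dvd_neg).2 (dvd_smul_of_dvd _ (X_dvd_liOne (hw.trans (dvd_pow_self _ hm))))
  have hea : expo a = expo (-(((m : ℚ)⁻¹) • liOne (w₁ ^ m))) *
      expo (-(((m : ℚ)⁻¹) • liOne (w₂ ^ m))) := by
    rw [← expo_add (hl hw₁) (hl hw₂), ha, smul_add, neg_add]
  have hu : IsUnit (∏ j ∈ Finset.Icc 1 r, ((1 - PowerSeries.C z ^ j * w₁) *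
      (1 - PowerSeries.C z ^ j * w₂))) :=
    IsUnit.prod_iff.2 fun j _ => (isUnit_one_sub (hw₁.mul_left _)).mul
      (isUnit_one_sub (hw₂.mul_left _))
  rw [rweight, ← mul_assoc (_ * _) (_ * _) (Ring.inverse _), Ring.eq_mul_inverse_iff_mul_eq _ _ _ hu]
  induction r with
  | zero => simp [gaussTerm, tri]
  | succ r ih =>
    have hu' : IsUnit (∏ j ∈ Finset.Icc 1 r, ((1 - PowerSeries.C z ^ j * w₁) *
      (1 - PowerSeries.C z ^ j * w₂))) :=
      IsUnit.prod_iff.2 fun j _ => (isUnit_one_sub (hw₁.mul_left _)).mul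
        (isUnit_one_sub (hw₂.mul_left _))
    have ih' := ih hu'
    have h1 := expo_constExponent_succ hm hz hw₁ r
    have h2 := expo_constExponent_succ hm hz hw₂ r
    change _ = _ * (_ * PowerSeries.C z ^ tri (r + 1) * _)
    change _ = _ * (_ * PowerSeries.C z ^ tri r * _) at ih'
    rw [Finset.prod_Icc_succ_top (by omega), tri_succ, pow_add (PowerSeries.C z), pow_succ (-1),
      pow_succ (PowerSeries.C u₀ * expo a)]
    rw [gaussTerm, tri_succ, pow_add z, pow_succ (-u₀)]
    rw [gaussTerm] at ih'
    simp only [map_mul, map_pow, map_neg] at ih' h1 h2 ⊢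
    rw [hea] at ih' ⊢
    generalize expo (constExponent m z (PowerSeries.C z ^ (r + 1) * w₁)) = e₁ at *
    generalize expo (constExponent m z (PowerSeries.C z ^ (r + 1) * w₂)) = e₂ at *
    generalize expo (constExponent m z (PowerSeries.C z ^ r * w₁)) = f₁ at *
    generalize expo (constExponent m z (PowerSeries.C z ^ r * w₂)) = f₂ at *
    generalize expo (-((m : ℚ)⁻¹ • liOne (w₁ ^ m))) = a₁ at *
    generalize expo (-((m : ℚ)⁻¹ • liOne (w₂ ^ m))) = a₂ at *
    generalize (∏ j ∈ Finset.Icc 1 r, ((1 - PowerSeries.C z ^ j * w₁) *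
      (1 - PowerSeries.C z ^ j * w₂))) = P at *
    linear_combination (-PowerSeries.C u₀) ^ r * (-PowerSeries.C u₀) * PowerSeries.C z ^ tri r *
      PowerSeries.C z ^ (r + 1) * P * (e₂ * (1 - PowerSeries.C z ^ (r + 1) * w₂) * h1 + f₁ * a₁ * h2) +
      (-PowerSeries.C u₀) * PowerSeries.C z ^ (r + 1) * a₁ * a₂ * ih'

/-- The evaluation of one factor. The exponent is rearranged by `exponent_identity`, constants are
pulled out, and the Gaussian of Hessian 1 + κ is exchanged for that of Hessian 1 by
`gMean_expo_hess_mul`. The latter integral is known from `sum_gaussTerm_gMean`. -/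
lemma half_core {m : ℕ} (hm : m ≠ 0) {z z' u₀ u' : B} (hz : IsPrimitiveRoot z m)
    (hzz : z * z' = 1) (hu : u₀ ^ m = -1) (huu : u₀ * u' = 1) (ω₁ ω₂ : B) {ah V : B⟦X⟧}
    (hah : ah * PowerSeries.X ^ 2 =
      -(((m : ℚ)⁻¹) • (liOne (wSer ω₁ ^ m) + liOne (wSer ω₂ ^ m))))
    (hVX : PowerSeries.X ∣ V)
    (hV : V * PowerSeries.X ^ 2 = ((m : ℚ) ^ (-2 : ℤ)) •
      (polylogSeries 0 (wSer ω₁ ^ m) + polylogSeries 0 (wSer ω₂ ^ m))) :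
    expo V * (expo (constExponent m z (wSer ω₁)) * expo (constExponent m z (wSer ω₂))) *
        hessFactor (polylogSeries 2 (wSer ω₁ ^ m) + polylogSeries 2 (wSer ω₂ ^ m)) *
        sqHom (rPhi m (PowerSeries.C z) (wSer ω₁) (wSer ω₂)
          (PowerSeries.C u₀ * expo (ah * PowerSeries.X ^ 2))) =
      PowerSeries.C (gaussTotal m u₀ z) *
      expo (-((1 / 2 : ℚ) • ((PowerSeries.C (algebraMap ℚ B (1 / 2)) + ah) *
        PowerSeries.X) ^ 2)) * halfSum m z z' ω₁ ω₂ u' (ah * PowerSeries.X ^ 2) := by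
  rw [← sum_gaussTerm_gMean hm hz hzz hu huu, rPhi, map_sum, Finset.mul_sum]
  refine Finset.sum_congr rfl fun r _ => ?_
  have hX : ∀ ω b : B, PowerSeries.X ∣ PowerSeries.C b * wSer ω := fun ω b =>
    (X_dvd_wSer ω).mul_left _
  have hwm : ∀ ω : B, PowerSeries.X ∣ wSer ω ^ m := fun ω =>
    (X_dvd_wSer ω).trans (dvd_pow_self _ hm)
  set κ := polylogSeries 2 (wSer ω₁ ^ m) + polylogSeries 2 (wSer ω₂ ^ m) with hκ
  have hκX : PowerSeries.X ∣ κ := by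
    have h : ∀ ω : B, PowerSeries.X ∣ polylogSeries 2 (wSer ω ^ m) := fun ω => by
      have := X_dvd_polylogSeries 2 (n := 1) (a := wSer ω ^ m) (by rw [pow_one]; exact hwm ω)
      rwa [pow_one] at this
    exact (h ω₁).add (h ω₂)
  set K₁ := constExponent m z (PowerSeries.C (z ^ r) * wSer ω₁) with hK₁
  set K₂ := constExponent m z (PowerSeries.C (z ^ r) * wSer ω₂) with hK₂
  have hK₁X : PowerSeries.X ∣ K₁ := X_dvd_constExponent _ _ (hX _ _)
  have hK₂X : PowerSeries.X ∣ K₂ := X_dvd_constExponent _ _ (hX _ _)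
  have hb : PowerSeries.X ∣ liftT ((PowerSeries.C (algebraMap ℚ B (1 / 2)) + ah) *
      PowerSeries.X) * varT := (X_dvd_liftT (dvd_mul_left _ _)).mul_right _
  set R := rexponent m (PowerSeries.C z) (wSer ω₁) (wSer ω₂) r with hR
  have hRX : PowerSeries.X ∣ R := X_dvd_rexponent _ _ _ _ _
  have hdiag : PowerSeries.X ∣ diagLift (PowerSeries.X : B⟦X⟧[X]⟦X⟧) := X_dvd_evalAt_X _ _
  have hRX' : PowerSeries.X ∣ diagLift R := by
    have := X_pow_dvd_ringHom hdiag 1 R (by rwa [pow_one])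
    rwa [pow_one] at this
  have hq : PowerSeries.X ∣ liftT κ * ((1 / 2 : ℚ) • varT ^ 2) := (X_dvd_liftT hκX).mul_right _
  have hconst : PowerSeries.X ∣ V + K₁ + K₂ := (hVX.add hK₁X).add hK₂X
  have e1 : expo (liftT (V + K₁ + K₂)) = liftT (expo V * expo K₁ * expo K₂) := by
    rw [← map_expo liftT (by rw [liftT_X]) hconst, expo_add (hVX.add hK₁X) hK₂X, expo_add hVX hK₁X]
  rw [← expo_add (X_dvd_logIntegrand _ _ _) (X_dvd_logIntegrand _ _ _),
    ← expo_add hb ((X_dvd_logIntegrand _ _ _).add (X_dvd_logIntegrand _ _ _)),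
    exponent_identity hm hz ω₁ ω₂ r hah hV, expo_add ((X_dvd_liftT hconst).add hq) hRX',
    expo_add (X_dvd_liftT hconst) hq, e1, mul_assoc (liftT _), gMean_liftT_mul,
    gMean_expo_hess_mul hκX (rnegHessInv_mul hm ω₁ ω₂),
    ← map_expo diagLift hdiag hRX, gMean_diagLift_expo_rexponent, map_mul, sqHom_C]
  have h1 := gaussTerm_mul_expo_constExponent hm hz u₀ (X_dvd_wSer ω₁) (X_dvd_wSer ω₂) hah r
  linear_combination -expo V * hessFactor κ * sqHom (rgauss (rnegHessInv m (wSer ω₁) (wSer ω₂))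
    (expo R)) * h1

end HalfCore

/-! ### Gaussian binomial coefficients -/

section QBinomial

/-- The Gaussian binomial coefficient `[I + J, I]_q`. -/
def qBinom {R : Type} [CommRing R] (q : R) : ℕ → ℕ → R
  | 0, _ => 1
  | _ + 1, 0 => 1
  | I + 1, J + 1 => qBinom q I (J + 1) + q ^ (I + 1) * qBinom q (I + 1) J

/-- The summand `q^{-IJ} [I + J, I]_q ^ 2`, where `q' = q⁻¹`. -/
def qSummand {R : Type} [CommRing R] (q q' : R) (I J : ℕ) : R := q' ^ (I * J) * qBinom q I J ^ 2

lemma map_qBinom {R S : Type} [CommRing R] [CommRing S] (f : R →+* S) (q : R) (I J : ℕ) :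
    f (qBinom q I J) = qBinom (f q) I J := by
  fun_induction qBinom q I J with
  | case1 => simp [qBinom]
  | case2 => simp [qBinom]
  | case3 I J h1 h2 => rw [map_add, map_mul, map_pow, h1, h2, ← qBinom]

lemma map_qSummand {R S : Type} [CommRing R] [CommRing S] (f : R →+* S) (q q' : R) (I J : ℕ) :
    f (qSummand q q' I J) = qSummand (f q) (f q') I J := by
  rw [qSummand, map_mul, map_pow, map_pow, map_qBinom, qSummand]

lemma map_qPoch {R S : Type} [CommRing R] [CommRing S] (f : R →+* S) (q : R) (n : ℕ) :
    f (qPoch q n) = qPoch (f q) n := by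
  simp [qPoch, map_prod]

lemma qBinom_mul_qPoch {R : Type} [CommRing R] (q : R) (I J : ℕ) :
    qBinom q I J * (qPoch q I * qPoch q J) = qPoch q (I + J) := by
  fun_induction qBinom q I J with
  | case1 => simp [qPoch]
  | case2 => simp [qPoch]
  | case3 I J h1 h2 =>
    rw [show I + 1 + (J + 1) = I + J + 1 + 1 by ring, qPoch_succ q (I + J + 1)]
    rw [show I + (J + 1) = I + J + 1 by ring, ] at h1
    rw [show I + 1 + J = I + J + 1 by ring] at h2
    rw [qPoch_succ q I] at h2 ⊢
    rw [qPoch_succ q J] at h1 ⊢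
    linear_combination (1 - q ^ (I + 1)) * h1 + q ^ (I + 1) * (1 - q ^ (J + 1)) * h2

lemma qPoch_add {R : Type} [CommRing R] (q : R) (I J : ℕ) :
    qPoch q (J + I) = qPoch q J * ∏ t ∈ Finset.range I, (1 - q ^ J * q ^ (t + 1)) := by
  rw [qPoch, Finset.prod_range_add, ← qPoch]
  congr 1
  refine Finset.prod_congr rfl fun t _ => ?_
  rw [← pow_add, add_assoc]

lemma qPoch_inv {R : Type} [CommRing R] {q q' : R} (h : q * q' = 1) (n : ℕ) :
    qPoch q' n * q ^ tri n = (-1) ^ n * qPoch q n := by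
  induction n with
  | zero => simp [qPoch, tri]
  | succ n ih =>
    have h1 : (1 - q' ^ (n + 1)) * q ^ (n + 1) = -(1 - q ^ (n + 1)) := by
      have : q ^ (n + 1) * q' ^ (n + 1) = 1 := by rw [← mul_pow, h, one_pow]
      linear_combination -this
    rw [qPoch_succ, qPoch_succ, tri_succ, pow_add q, pow_succ (-1)]
    linear_combination (1 - q' ^ (n + 1)) * q ^ (n + 1) * ih + (-1) ^ n * qPoch q n * h1

variable {L : Type} [Field L]

/-- The finite `q`-binomial theorem. -/
lemma qBinomial_theorem {q : L} (hq : ∀ n, qPoch q n ≠ 0) (y : L) (n : ℕ) :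
    ∑ p ∈ Finset.HasAntidiagonal.antidiagonal n, (qPoch q p.1)⁻¹ *
      ((-1) ^ p.2 * q ^ tri p.2 * y ^ p.2 * (qPoch q p.2)⁻¹) =
      (qPoch q n)⁻¹ * ∏ t ∈ Finset.range n, (1 - y * q ^ (t + 1)) := by
  set a : L⟦X⟧ := PowerSeries.mk fun n => (qPoch q n)⁻¹ with ha
  set b : L⟦X⟧ := PowerSeries.mk fun n => (-1) ^ n * q ^ tri n * y ^ n * (qPoch q n)⁻¹ with hb
  have hf : ∀ n, 1 - q ^ (n + 1) ≠ 0 := fun n h => hq (n + 1) (by rw [qPoch_succ, h, mul_zero])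
  -- The generating series satisfy a(qX) = (1 - X)a(X) and b(X) = (1 - qyX)b(qX). This gives a
  -- first-order recursion for the coefficients of ab, which the right-hand side satisfies too.
  have h1 : PowerSeries.rescale q a = (1 - PowerSeries.X) * a := by
    ext n
    rw [PowerSeries.coeff_rescale, sub_mul, one_mul, map_sub]
    rcases n with _ | n
    · simp
    · rw [PowerSeries.coeff_succ_X_mul, ha, PowerSeries.coeff_mk, PowerSeries.coeff_mk, qPoch_succ]
      have := hf n
      have := hq n
      field_simp
      ring
  have h2 : b = (1 - PowerSeries.C (q * y) * PowerSeries.X) * PowerSeries.rescale q b := by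
    ext n
    rw [sub_mul, one_mul, map_sub, PowerSeries.coeff_rescale, mul_assoc, PowerSeries.coeff_C_mul]
    rcases n with _ | n
    · simp
    · rw [PowerSeries.coeff_succ_X_mul, PowerSeries.coeff_rescale, hb, PowerSeries.coeff_mk,
        PowerSeries.coeff_mk, qPoch_succ, tri_succ]
      have := hf n
      have := hq n
      field_simp
      ring
  have h3 : a * b * (1 - PowerSeries.X) = (1 - PowerSeries.C (q * y) * PowerSeries.X) *
      PowerSeries.rescale q (a * b) := by
    rw [map_mul (PowerSeries.rescale q), h1]
    linear_combination (a * (1 - PowerSeries.X)) * h2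
  have h4 : ∀ n, PowerSeries.coeff (n + 1) (a * b) * (1 - q ^ (n + 1)) =
      PowerSeries.coeff n (a * b) * (1 - y * q ^ (n + 1)) := by
    intro n
    have h5 := congrArg (PowerSeries.coeff (n + 1)) h3
    rw [mul_sub, mul_one, map_sub, PowerSeries.coeff_succ_mul_X, sub_mul, one_mul, map_sub,
      mul_assoc, PowerSeries.coeff_C_mul, PowerSeries.coeff_succ_X_mul, PowerSeries.coeff_rescale,
      PowerSeries.coeff_rescale] at h5
    linear_combination h5
  have h6 : PowerSeries.coeff n (a * b) =
      (qPoch q n)⁻¹ * ∏ t ∈ Finset.range n, (1 - y * q ^ (t + 1)) := by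
    induction n with
    | zero => simp [ha, hb, qPoch, tri]
    | succ n ih =>
      refine mul_right_cancel₀ (hf n) ?_
      rw [h4, ih, Finset.prod_range_succ, qPoch_succ]
      have := hf n
      have := hq n
      field_simp
  rw [← h6, PowerSeries.coeff_mul]
  simp [ha, hb]

end QBinomial

/-! ### The product of the sums at q and at q⁻¹ -/

section Factorization

lemma sum_antidiagonal_antidiagonal {M : Type} [AddCommMonoid M] (f : ℕ → ℕ → ℕ → ℕ → M) (N : ℕ) :
    ∑ p ∈ Finset.HasAntidiagonal.antidiagonal N, ∑ a ∈ Finset.HasAntidiagonal.antidiagonal p.1,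
        ∑ b ∈ Finset.HasAntidiagonal.antidiagonal p.2, f a.1 a.2 b.1 b.2 =
      ∑ p ∈ Finset.HasAntidiagonal.antidiagonal N, ∑ a ∈ Finset.HasAntidiagonal.antidiagonal p.1,
        ∑ b ∈ Finset.HasAntidiagonal.antidiagonal p.2, f a.1 b.1 a.2 b.2 := by
  simp only [Finset.sum_sigma']
  refine Finset.sum_nbij'
    (fun x => ⟨(x.2.1.1 + x.2.2.1, x.2.1.2 + x.2.2.2), ⟨(x.2.1.1, x.2.2.1), (x.2.1.2, x.2.2.2)⟩⟩)
    (fun x => ⟨(x.2.1.1 + x.2.2.1, x.2.1.2 + x.2.2.2), ⟨(x.2.1.1, x.2.2.1), (x.2.1.2, x.2.2.2)⟩⟩)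
    ?_ ?_ ?_ ?_ ?_
  · rintro ⟨⟨p, p'⟩, ⟨⟨a, a'⟩, ⟨b, b'⟩⟩⟩ h
    simp only [Finset.mem_sigma, Finset.HasAntidiagonal.mem_antidiagonal] at h ⊢
    refine ⟨?_, trivial, trivial⟩
    omega
  · rintro ⟨⟨p, p'⟩, ⟨⟨a, a'⟩, ⟨b, b'⟩⟩⟩ h
    simp only [Finset.mem_sigma, Finset.HasAntidiagonal.mem_antidiagonal] at h ⊢
    refine ⟨?_, trivial, trivial⟩
    omega
  · rintro ⟨⟨p, p'⟩, ⟨⟨a, a'⟩, ⟨b, b'⟩⟩⟩ h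
    simp only [Finset.mem_sigma, Finset.HasAntidiagonal.mem_antidiagonal] at h ⊢
    obtain ⟨-, rfl, rfl⟩ := h
    rfl
  · rintro ⟨⟨p, p'⟩, ⟨⟨a, a'⟩, ⟨b, b'⟩⟩⟩ h
    simp only [Finset.mem_sigma, Finset.HasAntidiagonal.mem_antidiagonal] at h ⊢
    obtain ⟨-, rfl, rfl⟩ := h
    rfl
  · rintro ⟨⟨p, p'⟩, ⟨⟨a, a'⟩, ⟨b, b'⟩⟩⟩ h
    rfl

/-- Regroup (i, j, k, l) by I = i + k and J = j + l. Since kl - ij = -IJ + Jk + Il, the sums over k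
and l decouple. Rewriting (q⁻¹; q⁻¹)_k in terms of (q; q)_k supplies the sign and the power
q^{k(k+1)/2} that the finite q-binomial theorem needs, and each sum yields one binomial coefficient.
-/
lemma sum_factorization_field {L : Type} [Field L] {q q' : L} (hqq : q * q' = 1)
    (hq : ∀ n, qPoch q n ≠ 0) (α β : L) {T T' : ℕ → ℕ → L}
    (hT : ∀ i j, T i j * (qPoch q i * qPoch q j) = q' ^ (i * j) * (α ^ i * β ^ j))
    (hT' : ∀ k l, T' k l * (qPoch q' k * qPoch q' l) = q ^ (k * l) * (α ^ k * β ^ l)) (N : ℕ) :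
    ∑ p ∈ Finset.HasAntidiagonal.antidiagonal N,
      (∑ a ∈ Finset.HasAntidiagonal.antidiagonal p.1, T a.1 a.2) *
        (∑ b ∈ Finset.HasAntidiagonal.antidiagonal p.2, T' b.1 b.2) =
    ∑ p ∈ Finset.HasAntidiagonal.antidiagonal N,
      qSummand q q' p.1 p.2 * (α ^ p.1 * β ^ p.2) := by
  have hq0 : q ≠ 0 := left_ne_zero_of_mul_eq_one hqq
  have hq'0 : q' ≠ 0 := right_ne_zero_of_mul_eq_one hqq
  have hs : ∀ n : ℕ, ((-1 : L) ^ n) * (-1) ^ n = 1 := fun n => by rw [← mul_pow]; simp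
  have hT1 : ∀ i j, T i j = q' ^ (i * j) * (α ^ i * β ^ j) * ((qPoch q i)⁻¹ * (qPoch q j)⁻¹) := by
    intro i j
    rw [← hT]
    have := hq i
    have := hq j
    field_simp
  have hT2 : ∀ k l, T' k l = q ^ (k * l) * (α ^ k * β ^ l) *
      (((-1) ^ k * q ^ tri k * (qPoch q k)⁻¹) * ((-1) ^ l * q ^ tri l * (qPoch q l)⁻¹)) := by
    intro k l
    rw [← hT']
    have e : ∀ n, qPoch q' n * ((-1) ^ n * q ^ tri n * (qPoch q n)⁻¹) = 1 := by
      intro n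
      have h1 := qPoch_inv hqq n
      have h2 := mul_inv_cancel₀ (hq n)
      linear_combination (-1) ^ n * (qPoch q n)⁻¹ * h1 + qPoch q n * (qPoch q n)⁻¹ * hs n + h2
    linear_combination -T' k l * (qPoch q' l * ((-1) ^ l * q ^ tri l * (qPoch q l)⁻¹)) * e k -
      T' k l * e l
  simp only [Finset.sum_mul_sum]
  rw [sum_antidiagonal_antidiagonal fun a b c d => T a b * T' c d]
  refine Finset.sum_congr rfl fun p _ => ?_
  obtain ⟨I, J⟩ := p
  dsimp only
  have h1 : ∀ a ∈ Finset.HasAntidiagonal.antidiagonal I,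
      ∀ b ∈ Finset.HasAntidiagonal.antidiagonal J, T a.1 b.1 * T' a.2 b.2 =
      q' ^ (I * J) * (α ^ I * β ^ J) *
        ((qPoch q a.1)⁻¹ * ((-1) ^ a.2 * q ^ tri a.2 * (q ^ J) ^ a.2 * (qPoch q a.2)⁻¹)) *
        ((qPoch q b.1)⁻¹ * ((-1) ^ b.2 * q ^ tri b.2 * (q ^ I) ^ b.2 * (qPoch q b.2)⁻¹)) := by
    rintro ⟨i, k⟩ ha ⟨j, l⟩ hb
    rw [Finset.HasAntidiagonal.mem_antidiagonal] at ha hb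
    dsimp only at ha hb ⊢
    rw [hT1, hT2]
    have h2 : q' ^ (i * j) * q ^ (k * l) = q' ^ (I * J) * (q ^ J) ^ k * (q ^ I) ^ l := by
      have h3 : q' ^ (I * J) = q' ^ (i * j) * q' ^ (i * l + k * j + k * l) := by
        rw [← pow_add, ← ha, ← hb]; congr 1; ring
      have h4 : (q ^ J) ^ k * (q ^ I) ^ l = q ^ (k * l) * q ^ (i * l + k * j + k * l) := by
        rw [← pow_mul, ← pow_mul, ← pow_add, ← pow_add, ← ha, ← hb]; congr 1; ring
      have h5 : q ^ (i * l + k * j + k * l) * q' ^ (i * l + k * j + k * l) = 1 := by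
        rw [← mul_pow, hqq, one_pow]
      rw [mul_assoc, h4, h3]
      linear_combination -q' ^ (i * j) * q ^ (k * l) * h5
    have h6 : α ^ I = α ^ i * α ^ k := by rw [← pow_add, ha]
    have h7 : β ^ J = β ^ j * β ^ l := by rw [← pow_add, hb]
    rw [h6, h7]
    linear_combination (α ^ i * β ^ j) * (α ^ k * β ^ l) * ((qPoch q i)⁻¹ * (qPoch q j)⁻¹) *
      (((-1) ^ k * q ^ tri k * (qPoch q k)⁻¹) * ((-1) ^ l * q ^ tri l * (qPoch q l)⁻¹)) * h2
  rw [Finset.sum_congr rfl fun a ha => Finset.sum_congr rfl fun b hb => h1 a ha b hb]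
  have h2 : qBinom q I J = qPoch q (I + J) * ((qPoch q I)⁻¹ * (qPoch q J)⁻¹) := by
    rw [← qBinom_mul_qPoch]
    have := hq I
    have := hq J
    field_simp
  have h3 := qPoch_add q I J
  have h4 := qPoch_add q J I
  rw [add_comm J I] at h3
  simp only [← Finset.mul_sum]
  rw [qBinomial_theorem hq]
  rw [← Finset.sum_mul, ← Finset.mul_sum, qBinomial_theorem hq, qSummand, h2]
  have e1 := mul_inv_cancel₀ (hq I)
  have e2 := mul_inv_cancel₀ (hq J)
  generalize ∏ t ∈ Finset.range I, (1 - q ^ J * q ^ (t + 1)) = P at *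
  generalize ∏ t ∈ Finset.range J, (1 - q ^ I * q ^ (t + 1)) = Q at *
  have e3 : qPoch q (I + J) ^ 2 = qPoch q J * P * (qPoch q I * Q) := by
    rw [sq]; nth_rewrite 1 [h3]; rw [h4]
  rw [mul_pow, e3]
  have := hq I
  have := hq J
  field_simp

/-- The q-factorials need only be nonzero, so the identity can be checked in the fraction field. -/
lemma sum_factorization {D : Type} [CommRing D] [IsDomain D] {q q' : D} (hqq : q * q' = 1)
    (hq : ∀ n, qPoch q n ≠ 0) (α β : D) {T T' : ℕ → ℕ → D}
    (hT : ∀ i j, T i j * (qPoch q i * qPoch q j) = q' ^ (i * j) * (α ^ i * β ^ j))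
    (hT' : ∀ k l, T' k l * (qPoch q' k * qPoch q' l) = q ^ (k * l) * (α ^ k * β ^ l)) (N : ℕ) :
    ∑ p ∈ Finset.HasAntidiagonal.antidiagonal N,
      (∑ a ∈ Finset.HasAntidiagonal.antidiagonal p.1, T a.1 a.2) *
        (∑ b ∈ Finset.HasAntidiagonal.antidiagonal p.2, T' b.1 b.2) =
    ∑ p ∈ Finset.HasAntidiagonal.antidiagonal N,
      qSummand q q' p.1 p.2 * (α ^ p.1 * β ^ p.2) := by
  set f := algebraMap D (FractionRing D) with hf
  have hinj : Function.Injective f := IsFractionRing.injective D (FractionRing D)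
  apply hinj
  have := sum_factorization_field (q := f q) (q' := f q') (by rw [← map_mul, hqq, map_one])
    (fun n => by rw [← map_qPoch]; exact (map_ne_zero_iff f hinj).2 (hq n)) (f α) (f β)
    (T := fun i j => f (T i j)) (T' := fun i j => f (T' i j))
    (fun i j => by simpa only [map_mul, map_pow, map_qPoch] using congrArg f (hT i j))
    (fun i j => by simpa only [map_mul, map_pow, map_qPoch] using congrArg f (hT' i j)) N
  simpa only [map_sum, map_mul, map_pow, map_qSummand] using this

end Factorization

/-! ### The symmetrised integral as a `q`-series -/

section Core

variable {B : Type} [CommRing B] [Algebra ℚ B]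

lemma rescale_C (i b : B) : PowerSeries.rescale i (PowerSeries.C b) = PowerSeries.C b := by
  ext n; cases n <;> simp [PowerSeries.coeff_C]

lemma rescale_expo (i : B) {f : B⟦X⟧} (hf : PowerSeries.X ∣ f) :
    PowerSeries.rescale i (expo f) = expo (PowerSeries.rescale i f) :=
  map_expo _ (X_dvd_rescale_X i) hf

lemma rescale_liOne (i : B) {a : B⟦X⟧} (ha : PowerSeries.X ∣ a) :
    PowerSeries.rescale i (liOne a) = liOne (PowerSeries.rescale i a) := by
  rw [liOne, ringHom_adicSum _ (X_dvd_rescale_X i)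
    fun k => dvd_smul_of_dvd _ (pow_dvd_pow_of_dvd ha k), liOne]
  simp only [map_rat_smul, map_pow]

lemma rescale_polylogSeries (i : B) (E : ℕ) {a : B⟦X⟧} (ha : PowerSeries.X ∣ a) :
    PowerSeries.rescale i (polylogSeries E a) = polylogSeries E (PowerSeries.rescale i a) := by
  rw [polylogSeries, ringHom_adicSum _ (X_dvd_rescale_X i) (X_pow_dvd_polylogSeries_term E ha),
    polylogSeries]
  simp only [map_rat_smul, map_pow]

/-- For z and z⁻¹ the terms j and m - j have opposite weights. Only j = m survives, with weight 1/2
in each sum. -/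
lemma constExponent_add_inv {m : ℕ} (hm : m ≠ 0) {z : B} (hz : z ^ m = 1) (a : B⟦X⟧) :
    constExponent m z a + constExponent m (z ^ (m - 1)) a = liOne a := by
  obtain ⟨n, rfl⟩ := Nat.exists_eq_succ_of_ne_zero hm
  simp only [Nat.succ_eq_add_one, Nat.add_sub_cancel] at *
  have hz' : ∀ j, j ≤ n → (z ^ n) ^ (j + 1) = z ^ (n - j) := by
    intro j hj
    rw [← pow_mul, show n * (j + 1) = (n - j) + (n + 1) * j by
      obtain ⟨k, rfl⟩ := Nat.exists_eq_add_of_le hj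
      rw [Nat.add_sub_cancel_left]; ring, pow_add, pow_mul z (n + 1), hz, one_pow, mul_one]
  have hI : ∀ f : ℕ → B⟦X⟧, ∑ j ∈ Finset.Icc 1 (n + 1), f j =
      ∑ j ∈ Finset.range n, f (j + 1) + f (n + 1) := by
    intro f
    rw [← Finset.sum_range_succ (fun j => f (j + 1)), Finset.range_eq_Ico,
      ← Finset.Ico_add_one_right_eq_Icc, Finset.sum_Ico_eq_sum_range, Finset.sum_Ico_eq_sum_range]
    refine Finset.sum_congr (by simp) fun j _ => ?_
    rw [zero_add, add_comm]
  rw [constExponent, constExponent, hI, hI, hz' n le_rfl, hz, Nat.sub_self, pow_zero, map_one,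
    one_mul]
  have h1 : ∑ j ∈ Finset.range n, ((((j + 1 : ℕ) : ℚ) / ((n + 1 : ℕ) : ℚ) - 1 / 2) •
        liOne (PowerSeries.C ((z ^ n) ^ (j + 1)) * a)) =
      -∑ j ∈ Finset.range n, ((((j + 1 : ℕ) : ℚ) / ((n + 1 : ℕ) : ℚ) - 1 / 2) •
        liOne (PowerSeries.C (z ^ (j + 1)) * a)) := by
    rw [← Finset.sum_range_reflect, ← Finset.sum_neg_distrib]
    refine Finset.sum_congr rfl fun j hj => ?_
    have hj' := Finset.mem_range.1 hj
    rw [hz' _ (by omega), show n - (n - 1 - j) = j + 1 by omega, ← neg_smul]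
    congr 1
    rw [show n - 1 - j + 1 = n - j by omega, Nat.cast_sub hj'.le]
    have : ((n : ℚ) + 1) ≠ 0 := by positivity
    push_cast
    field_simp
    ring
  have h2 : ∀ x y : B⟦X⟧, ((((n + 1 : ℕ) : ℚ) / ((n + 1 : ℕ) : ℚ) - 1 / 2) • y) +
      ((((n + 1 : ℕ) : ℚ) / ((n + 1 : ℕ) : ℚ) - 1 / 2) • y) = y := by
    intro x y
    have : ((n + 1 : ℕ) : ℚ) ≠ 0 := by exact_mod_cast n.succ_ne_zero
    rw [← add_smul, div_self this]
    norm_num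
  rw [h1, add_add_add_comm, add_neg_cancel, zero_add, h2 0]

/-- The substitution ε ↦ iε realises ħ ↦ -ħ. Powers of ε⁴ are fixed by it, so w₁ and w₂ are the same
for q and q⁻¹. -/
lemma rescale_wSer {i : B} (hi : i ^ 2 = -1) (ω : B) :
    PowerSeries.rescale i (wSer ω) = wSer ω := by
  rw [wSer, map_mul, map_pow, rescale_C, PowerSeries.rescale_X, mul_pow, ← map_pow,
    show i ^ 4 = (i ^ 2) ^ 2 by ring, hi]
  simp

lemma rescale_sqHom {i : B} (hi : i ^ 2 = -1) (f : B⟦X⟧⟦X⟧) :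
    PowerSeries.rescale i (sqHom f) =
      sqHom (PowerSeries.rescale (-1) (PowerSeries.map (PowerSeries.rescale i) f)) := by
  rw [sqHom, evalAt_apply, evalAt_apply, ringHom_adicSum _ (X_dvd_rescale_X i)
    fun k => (pow_dvd_pow_of_dvd X_dvd_X_sq k).mul_left _]
  congr 1
  ext1 k
  have : PowerSeries.rescale i ((PowerSeries.X : B⟦X⟧) ^ 2) = -PowerSeries.X ^ 2 := by
    rw [map_pow, PowerSeries.rescale_X, mul_pow, ← map_pow, hi]
    simp
  rw [map_mul, map_pow, this, PowerSeries.coeff_rescale, PowerSeries.coeff_map, neg_pow]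
  simp only [RingHom.id_apply]
  ring

variable [IsDomain B]

lemma one_sub_qSer_pow_ne_zero {z : B} (k : ℕ) : 1 - qSer z ^ (k + 1) ≠ 0 := by
  intro h
  rw [qSer_pow] at h
  have hX : PowerSeries.X ∣ (((k + 1 : ℕ) : ℚ) • (PowerSeries.X : B⟦X⟧) ^ 2) :=
    dvd_smul_of_dvd _ X_dvd_X_sq
  have h1 := congrArg PowerSeries.constantCoeff h
  rw [map_sub, map_mul, constantCoeff_expo hX, PowerSeries.constantCoeff_C, map_one, map_zero,
    mul_one, sub_eq_zero] at h1
  rw [← h1, map_one, one_mul] at h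
  refine expo_smul_X_sq_ne_one (B := B) (c := ((k + 1 : ℕ) : ℚ))
    (by exact_mod_cast k.succ_ne_zero) ?_
  linear_combination -h

lemma qPoch_qSer_ne_zero (z : B) (n : ℕ) : qPoch (qSer z) n ≠ 0 :=
  Finset.prod_ne_zero_iff.2 fun _ _ => one_sub_qSer_pow_ne_zero _

lemma qSer_mul_qInv {z z' : B} (hzz : z * z' = 1) : qSer z * qInv z' = 1 := by
  rw [qSer, qInv, mul_mul_mul_comm, ← map_mul, hzz, expo_mul_expo_neg X_dvd_X_sq, map_one, one_mul]

lemma rescale_qSer {i : B} (hi : i ^ 2 = -1) (z : B) :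
    PowerSeries.rescale i (qSer z) = qInv z ∧ PowerSeries.rescale i (qInv z) = qSer z := by
  have h : PowerSeries.rescale i ((PowerSeries.X : B⟦X⟧) ^ 2) = -PowerSeries.X ^ 2 := by
    rw [map_pow, PowerSeries.rescale_X, mul_pow, ← map_pow, hi]
    simp
  constructor
  · rw [qSer, map_mul, rescale_C, rescale_expo _ X_dvd_X_sq, h, qInv]
  · rw [qInv, map_mul, rescale_C, rescale_expo _ ((dvd_neg).2 X_dvd_X_sq), map_neg, h, neg_neg,
      qSer]

/-- The summand of `halfSum`. -/
def halfTerm (m : ℕ) (z z' ω₁ ω₂ : B) (v : B⟦X⟧) (i j : ℕ) : B⟦X⟧ :=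
  pochCoeff m z i * pochCoeff m z j * PowerSeries.C (ω₁ ^ i * ω₂ ^ j) * PowerSeries.X ^ (i + j) *
    (-v) ^ (i + j) * qInv z' ^ tri (i + j)

lemma halfSum_eq (m : ℕ) (z z' ω₁ ω₂ u' : B) (a : B⟦X⟧) : halfSum m z z' ω₁ ω₂ u' a =
    adicSum fun N => ∑ p ∈ Finset.HasAntidiagonal.antidiagonal N,
      halfTerm m z z' ω₁ ω₂ (PowerSeries.C u' * expo (-a)) p.1 p.2 := by
  rw [halfSum]
  congr 1
  ext1 N
  rw [prodCoeff, Finset.sum_mul, Finset.sum_mul, Finset.sum_mul]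
  refine Finset.sum_congr rfl fun p hp => ?_
  rw [halfTerm, Finset.HasAntidiagonal.mem_antidiagonal.1 hp]

lemma X_pow_dvd_sum_halfTerm (m : ℕ) (z z' ω₁ ω₂ : B) (v : B⟦X⟧) (N : ℕ) : PowerSeries.X ^ N ∣
    ∑ p ∈ Finset.HasAntidiagonal.antidiagonal N, halfTerm m z z' ω₁ ω₂ v p.1 p.2 := by
  refine Finset.dvd_sum fun p hp => ?_
  rw [halfTerm, Finset.HasAntidiagonal.mem_antidiagonal.1 hp]
  exact ((dvd_mul_left _ _).mul_right _).mul_right _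

lemma halfTerm_mul {m : ℕ} (hm : m ≠ 0) {z z' : B} (hz : z ^ m = 1) (hzz : z * z' = 1)
    (ω₁ ω₂ : B) (v : B⟦X⟧) (i j : ℕ) :
    halfTerm m z z' ω₁ ω₂ v i j * (qPoch (qSer z) i * qPoch (qSer z) j) =
      qInv z' ^ (i * j) * ((wSer ω₁ * v) ^ i * (wSer ω₂ * v) ^ j) := by
  have h1 := pochCoeff_mul_qPoch hm hz i
  have h2 := pochCoeff_mul_qPoch hm hz j
  have h3 : ∀ n, qSer z ^ n * qInv z' ^ n = 1 := fun n => by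
    rw [← mul_pow, qSer_mul_qInv hzz, one_pow]
  have hs : ∀ n : ℕ, ((-1 : B⟦X⟧) ^ n) * (-1) ^ n = 1 := fun n => by rw [← mul_pow]; simp
  have h4 := h3 (tri i)
  have h5 := h3 (tri j)
  have h6 := hs i
  have h7 := hs j
  rw [halfTerm, tri_add, pow_add, pow_add, pow_add, pow_add, neg_pow v i, neg_pow v j, map_mul,
    map_pow, map_pow]
  rw [wSer, wSer]
  calc _ = (pochCoeff m z i * qPoch (qSer z) i) * (pochCoeff m z j * qPoch (qSer z) j) *
      (PowerSeries.C ω₁ ^ i * PowerSeries.C ω₂ ^ j * (PowerSeries.X ^ i * PowerSeries.X ^ j) *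
        ((-1) ^ i * v ^ i * ((-1) ^ j * v ^ j)) *
        (qInv z' ^ tri i * qInv z' ^ tri j * qInv z' ^ (i * j))) := by ring
    _ = ((-1) ^ i * (-1) ^ i) * ((-1) ^ j * (-1) ^ j) * (qSer z ^ tri i * qInv z' ^ tri i) *
      (qSer z ^ tri j * qInv z' ^ tri j) * (qInv z' ^ (i * j) *
        ((PowerSeries.C ω₁ * PowerSeries.X ^ 4 * v) ^ i *
          (PowerSeries.C ω₂ * PowerSeries.X ^ 4 * v) ^ j)) := by rw [h1, h2]; ring
    _ = _ := by rw [h4, h5, h6, h7]; ring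

/-- After ε ↦ iε the sum built from z⁻¹ has q and q⁻¹ exchanged, while its other arguments are
unchanged, so `sum_factorization` applies in each total degree. -/
lemma halfSum_mul_rescale_halfSum {m : ℕ} (hm : m ≠ 0) {z z' i : B} (hz : z ^ m = 1)
    (hzz : z * z' = 1) (hi : i ^ 2 = -1) (ω₁ ω₂ u' : B) {a : B⟦X⟧} (ha : PowerSeries.X ∣ a)
    (hai : PowerSeries.rescale i a = a) :
    halfSum m z z' ω₁ ω₂ u' a * PowerSeries.rescale i (halfSum m z' z ω₁ ω₂ u' a) =
      adicSum fun N => ∑ p ∈ Finset.HasAntidiagonal.antidiagonal N,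
        qSummand (qSer z) (qInv z') p.1 p.2 * ((wSer ω₁ * (PowerSeries.C u' * expo (-a))) ^ p.1 *
          (wSer ω₂ * (PowerSeries.C u' * expo (-a))) ^ p.2) := by
  have hz' : z' ^ m = 1 := by
    have : (z * z') ^ m = 1 := by rw [hzz, one_pow]
    rwa [mul_pow, hz, one_mul] at this
  set v := PowerSeries.C u' * expo (-a) with hv
  have hvi : PowerSeries.rescale i v = v := by
    rw [hv, map_mul, rescale_C, rescale_expo _ ((dvd_neg).2 ha), map_neg, hai]
  rw [halfSum_eq, halfSum_eq, ringHom_adicSum _ (X_dvd_rescale_X i)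
    (X_pow_dvd_sum_halfTerm _ _ _ _ _ _), adicSum_mul_adicSum (X_pow_dvd_sum_halfTerm _ _ _ _ _ _)
    fun k => X_pow_dvd_ringHom (X_dvd_rescale_X i) k _ (X_pow_dvd_sum_halfTerm _ _ _ _ _ _ k)]
  congr 1
  ext1 N
  simp only [map_sum]
  refine sum_factorization (qSer_mul_qInv hzz) (qPoch_qSer_ne_zero z) _ _
    (halfTerm_mul hm hz hzz ω₁ ω₂ v)
    (T' := fun k l => PowerSeries.rescale i (halfTerm m z' z ω₁ ω₂ v k l)) ?_ N
  intro k l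
  have := congrArg (PowerSeries.rescale i) (halfTerm_mul hm hz' (by rw [mul_comm, hzz]) ω₁ ω₂ v k l)
  simpa only [map_mul, map_pow, map_qPoch, (rescale_qSer hi _).1, (rescale_qSer hi _).2,
    rescale_wSer hi, hvi] using this

/-- Both series are square roots of the same element, so they agree up to sign; the nonzero constant
term excludes the sign -1. -/
lemma rescale_hessFactor {i : B} {κ : B⟦X⟧} (hκ : PowerSeries.X ∣ κ)
    (hκi : PowerSeries.rescale i κ = κ) :
    PowerSeries.rescale i (hessFactor κ) = hessFactor κ := by
  have h1 := hessFactor_sq hκ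
  have h2 := congrArg (PowerSeries.rescale i) h1
  rw [map_mul, map_pow, map_add, map_one, hκi] at h2
  set S := hessFactor κ with hS
  have hu : 1 + κ ≠ 0 := fun h => by rw [h, mul_zero] at h1; exact zero_ne_one h1
  have h3 : (PowerSeries.rescale i S - S) * (PowerSeries.rescale i S + S) = 0 := by
    refine mul_right_cancel₀ hu ?_
    linear_combination h2 - h1
  rcases mul_eq_zero.1 h3 with h4 | h4
  · exact sub_eq_zero.1 h4
  · exfalso
    have h5 := congrArg (PowerSeries.coeff 0) h4
    rw [map_add, PowerSeries.coeff_rescale, pow_zero, one_mul, map_zero, ← two_mul] at h5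
    have h6 : (2 : B) ≠ 0 := by
      have : algebraMap ℚ B 2 ≠ 0 := by
        rw [Ne, map_eq_zero_iff _ (algebraMap ℚ B).injective]; norm_num
      rwa [map_ofNat] at this
    have h7 := (mul_eq_zero.1 h5).resolve_left h6
    have h8 := congrArg (PowerSeries.constantCoeff) h1
    rw [PowerSeries.coeff_zero_eq_constantCoeff_apply] at h7
    rw [map_mul, map_pow, h7, map_one] at h8
    simp at h8

/-- The symmetrised Gaussian integral is a `q`-series. -/
theorem sqHom_rPsi {m : ℕ} (hm : m ≠ 0) {z i u₀ u' : B} (hz : IsPrimitiveRoot z m)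
    (hi : i ^ 2 = -1) (hu : u₀ ^ m = -1) (huu : u₀ * u' = 1) (ω₁ ω₂ : B) {a : B⟦X⟧}
    (ha : a = -(((m : ℚ)⁻¹) • (liOne (wSer ω₁ ^ m) + liOne (wSer ω₂ ^ m)))) :
    sqHom (rPsi m (PowerSeries.C z) (wSer ω₁) (wSer ω₂) (PowerSeries.C u₀ * expo a)) =
      -adicSum fun N => ∑ p ∈ Finset.HasAntidiagonal.antidiagonal N,
        qSummand (qSer z) (qInv (z ^ (m - 1))) p.1 p.2 *
          ((wSer ω₁ * (PowerSeries.C u' * expo (-a))) ^ p.1 *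
          (wSer ω₂ * (PowerSeries.C u' * expo (-a))) ^ p.2) := by
  set z' := z ^ (m - 1) with hz'
  have hzz : z * z' = 1 := by
    rw [hz', ← pow_succ', Nat.sub_add_cancel (Nat.one_le_iff_ne_zero.2 hm), hz.pow_eq_one]
  have hpz' : IsPrimitiveRoot z' m := hz.pow_of_coprime _ (by
    have : (m - 1 + 1).Coprime (m - 1) := by simp
    rw [Nat.sub_add_cancel (Nat.one_le_iff_ne_zero.2 hm)] at this
    exact this.symm)
  have hwm : ∀ ω : B, PowerSeries.X ∣ wSer ω ^ m := fun ω =>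
    (X_dvd_wSer ω).trans (dvd_pow_self _ hm)
  have hwm4 : ∀ ω : B, PowerSeries.X ^ 4 ∣ wSer ω ^ m := fun ω =>
    (X_pow_four_dvd_wSer ω).trans (dvd_pow_self _ hm)
  have hl4 : ∀ ω : B, PowerSeries.X ^ 4 ∣ liOne (wSer ω ^ m) := fun ω => by
    rw [← polylogSeries_one (hwm ω)]; exact X_dvd_polylogSeries 1 (hwm4 ω)
  have hτw : ∀ ω : B, PowerSeries.rescale i (wSer ω ^ m) = wSer ω ^ m := fun ω => by
    rw [map_pow, rescale_wSer hi]
  have hai : PowerSeries.rescale i a = a := by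
    rw [ha, map_neg, map_rat_smul, map_add, rescale_liOne _ (hwm _), rescale_liOne _ (hwm _), hτw,
      hτw]
  have ha4 : PowerSeries.X ^ 4 ∣ a := by
    rw [ha, dvd_neg]
    exact dvd_smul_of_dvd _ ((hl4 _).add (hl4 _))
  -- Division by ħ = ε² is possible because wᵢ is divisible by ε⁴. The same holds for the potential,
  -- where a factor ε is left over as required for its exponential.
  obtain ⟨ah, hah⟩ : ∃ ah, ah * PowerSeries.X ^ 2 = a := by
    obtain ⟨g, hg⟩ := ha4
    exact ⟨PowerSeries.X ^ 2 * g, by rw [hg]; ring⟩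
  set v := ((m : ℚ) ^ (-2 : ℤ)) •
      (polylogSeries 0 (wSer ω₁ ^ m) + polylogSeries 0 (wSer ω₂ ^ m)) with hv
  have hvi : PowerSeries.rescale i v = v := by
    rw [hv, map_rat_smul, map_add, rescale_polylogSeries _ _ (hwm _),
      rescale_polylogSeries _ _ (hwm _), hτw, hτw]
  obtain ⟨V, hVX, hV⟩ : ∃ V, PowerSeries.X ∣ V ∧ V * PowerSeries.X ^ 2 = v := by
    obtain ⟨g, hg⟩ : PowerSeries.X ^ 4 ∣ v := dvd_smul_of_dvd _
      ((X_dvd_polylogSeries 0 (hwm4 _)).add (X_dvd_polylogSeries 0 (hwm4 _)))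
    exact ⟨PowerSeries.X ^ 2 * g, X_dvd_X_sq.mul_right _, by rw [hg]; ring⟩
  have hX2 : (PowerSeries.X : B⟦X⟧) ^ 2 ≠ 0 := pow_ne_zero _ PowerSeries.X_ne_zero
  have hτX : PowerSeries.rescale i ((PowerSeries.X : B⟦X⟧) ^ 2) = -PowerSeries.X ^ 2 := by
    rw [map_pow, PowerSeries.rescale_X, mul_pow, ← map_pow, hi]
    simp
  have hτV : PowerSeries.rescale i V = -V := by
    have := congrArg (PowerSeries.rescale i) hV
    rw [map_mul, hτX, hvi, ← hV] at this
    exact mul_right_cancel₀ hX2 (by linear_combination -this)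
  have hτah : PowerSeries.rescale i ah = -ah := by
    have := congrArg (PowerSeries.rescale i) hah
    rw [map_mul, hτX, hai, ← hah] at this
    exact mul_right_cancel₀ hX2 (by linear_combination -this)
  set κ := polylogSeries 2 (wSer ω₁ ^ m) + polylogSeries 2 (wSer ω₂ ^ m) with hκ
  have hκX : PowerSeries.X ∣ κ := by
    have h : ∀ ω : B, PowerSeries.X ∣ polylogSeries 2 (wSer ω ^ m) := fun ω => by
      have := X_dvd_polylogSeries 2 (n := 1) (a := wSer ω ^ m) (by rw [pow_one]; exact hwm ω)
      rwa [pow_one] at this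
    exact (h ω₁).add (h ω₂)
  have hκi : PowerSeries.rescale i κ = κ := by
    rw [hκ, map_add, rescale_polylogSeries _ _ (hwm _),
      rescale_polylogSeries _ _ (hwm _), hτw, hτw]
  set S := hessFactor κ with hS
  have hSi : PowerSeries.rescale i S = S := rescale_hessFactor hκX hκi
  have hS2 : S ^ 2 * (1 + κ) = 1 := hessFactor_sq hκX
  have hah' : ah * PowerSeries.X ^ 2 =
    -(((m : ℚ)⁻¹) • (liOne (wSer ω₁ ^ m) + liOne (wSer ω₂ ^ m))) := by rw [hah, ha]
  -- `half_core` is used at z and, after ε ↦ iε, at z⁻¹. The substitution changes the signs of V and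
  -- ah and fixes the class constants and the Hessian factor.
  have c1 := half_core hm hz hzz hu huu ω₁ ω₂ hah' hVX hV
  have c2 := congrArg (PowerSeries.rescale i)
    (half_core hm hpz' (by rw [mul_comm, hzz] : z' * z = 1) hu huu ω₁ ω₂ hah' hVX hV)
  rw [hah] at c1 c2
  have haX : PowerSeries.X ∣ a := (dvd_pow_self _ (by norm_num)).trans ha4
  set u := PowerSeries.C u₀ * expo a with hu_def
  have hui : PowerSeries.rescale i u = u := by
    rw [hu_def, map_mul, rescale_C, rescale_expo _ haX, hai]
  have hunit : ∀ (y ω : B) (j : ℕ), IsUnit (1 - PowerSeries.C y ^ j * wSer ω) := fun y ω j =>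
    isUnit_one_sub ((X_dvd_wSer ω).mul_left _)
  have hunit' : IsUnit (1 - wSer ω₁ ^ m * wSer ω₂ ^ m) := isUnit_one_sub ((hwm ω₁).mul_right _)
  have hΦ : PowerSeries.rescale i (sqHom (rPhi m (PowerSeries.C z') (wSer ω₁) (wSer ω₂) u)) =
      sqHom (PowerSeries.rescale (-1) (rPhi m (PowerSeries.C z') (wSer ω₁) (wSer ω₂) u)) := by
    rw [rescale_sqHom hi, map_rPhi _ m (hunit _ _) (hunit _ _) hunit', rescale_C, rescale_wSer hi,
      rescale_wSer hi, hui]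
  set h₂ := PowerSeries.C (algebraMap ℚ B (1 / 2)) with hh₂
  have hq : ∀ f : B⟦X⟧, PowerSeries.X ∣ -((1 / 2 : ℚ) • (f * PowerSeries.X) ^ 2) := fun f =>
    (dvd_neg).2 (dvd_smul_of_dvd _ ((dvd_mul_left _ _).trans (dvd_pow_self _ two_ne_zero)))
  have hcX : ∀ (y ω : B), PowerSeries.X ∣ constExponent m y (wSer ω) := fun y ω =>
    X_dvd_constExponent _ _ (X_dvd_wSer ω)
  have hci : ∀ y ω : B, PowerSeries.rescale i (constExponent m y (wSer ω)) =
      constExponent m y (wSer ω) := by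
    intro y ω
    rw [constExponent, map_sum]
    refine Finset.sum_congr rfl fun j _ => ?_
    rw [map_rat_smul, rescale_liOne _ ((X_dvd_wSer ω).mul_left _), map_mul, rescale_C,
      rescale_wSer hi]
  have hqi : PowerSeries.rescale i (-((1 / 2 : ℚ) • ((h₂ + ah) * PowerSeries.X) ^ 2)) =
      -(-((1 / 2 : ℚ) • ((h₂ - ah) * PowerSeries.X) ^ 2)) := by
    rw [map_neg, map_rat_smul, mul_pow, map_mul, hτX, map_pow, map_add, hτah, hh₂, rescale_C,
      mul_pow, mul_neg, smul_neg, sub_eq_add_neg]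
  simp only [map_mul] at c2
  rw [rescale_expo _ hVX, hτV, rescale_expo _ (hcX _ _), rescale_expo _ (hcX _ _), hci, hci, hSi, hΦ,
    rescale_C, rescale_expo _ (hq _), hqi] at c2
  have hG := halfSum_mul_rescale_halfSum hm hz.pow_eq_one hzz hi ω₁ ω₂ u' haX hai
  rw [← hG]
  have e1 := expo_mul_expo_neg hVX
  have e2 : ∀ ω : B, expo (constExponent m z (wSer ω)) * expo (constExponent m z' (wSer ω)) *
      (1 - wSer ω) = 1 := by
    intro ω
    rw [← expo_add (hcX _ _) (hcX _ _), hz', constExponent_add_inv hm hz.pow_eq_one,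
      ← expo_neg_liOne (X_dvd_wSer ω), expo_mul_expo_neg (X_dvd_liOne (X_dvd_wSer ω))]
  -- Here -(1/2 + ah)²ε²/2 + (1/2 - ah)²ε²/2 = -ah ε² = -a.
  have e3 : expo (-((1 / 2 : ℚ) • ((h₂ + ah) * PowerSeries.X) ^ 2)) *
      expo (-(-((1 / 2 : ℚ) • ((h₂ - ah) * PowerSeries.X) ^ 2))) = expo (-a) := by
    rw [← expo_add (hq _) ((dvd_neg).2 (hq _))]
    congr 1
    have h5 : h₂ = algebraMap ℚ B⟦X⟧ (1 / 2) := by rw [PowerSeries.algebraMap_apply]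
    have h6 : algebraMap ℚ B⟦X⟧ (1 / 2) * 2 = 1 := by
      rw [show (2 : B⟦X⟧) = algebraMap ℚ B⟦X⟧ 2 by rw [map_ofNat], ← map_mul]; norm_num
    simp only [Algebra.smul_def, h5]
    generalize algebraMap ℚ B⟦X⟧ (1 / 2) = c at h6 ⊢
    linear_combination -hah - ah * PowerSeries.X ^ 2 * (c * 2 + 1) * h6
  have e4 := expo_mul_expo_neg haX
  have e5 := gaussTotal_mul hm hz hu hzz
  have e5' := congrArg (PowerSeries.C : B →+* B⟦X⟧) e5
  have e6 := rnegHessInv_mul hm ω₁ ω₂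
  rw [← hκ] at e6
  have e7 : rnegHessInv m (wSer ω₁) (wSer ω₂) = -S ^ 2 := by
    linear_combination S ^ 2 * e6 - rnegHessInv m (wSer ω₁) (wSer ω₂) * hS2
  have hmu : IsUnit (m : B⟦X⟧) := by
    have := (isUnit_iff_ne_zero.2 (Nat.cast_ne_zero (R := ℚ).2 hm)).map (algebraMap ℚ B⟦X⟧)
    rwa [map_natCast] at this
  have hden : IsUnit ((m : B⟦X⟧) * ((1 - wSer ω₁) * (1 - wSer ω₂))) :=
    hmu.mul ((isUnit_one_sub (X_dvd_wSer _)).mul (isUnit_one_sub (X_dvd_wSer _)))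
  have e8 := Ring.inverse_mul_cancel _ hden
  rw [rPsi, map_mul, sqHom_C, map_mul, ← map_pow PowerSeries.C, ← hz', e7]
  simp only [map_mul, map_neg, map_natCast] at e5'
  generalize Ring.inverse ((m : B⟦X⟧) * ((1 - wSer ω₁) * (1 - wSer ω₂))) = D at *
  generalize sqHom (rPhi m (PowerSeries.C z) (wSer ω₁) (wSer ω₂) u) = Φ at *
  generalize sqHom (PowerSeries.rescale (-1) (rPhi m (PowerSeries.C z') (wSer ω₁) (wSer ω₂) u)) =
    Φ' at *
  generalize halfSum m z z' ω₁ ω₂ u' a = G at *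
  generalize PowerSeries.rescale i (halfSum m z' z ω₁ ω₂ u' a) = G' at *
  have f1 := e2 ω₁
  have f2 := e2 ω₂
  generalize expo (constExponent m z (wSer ω₁)) = k₁ at *
  generalize expo (constExponent m z (wSer ω₂)) = k₂ at *
  generalize expo (constExponent m z' (wSer ω₁)) = l₁ at *
  generalize expo (constExponent m z' (wSer ω₂)) = l₂ at *
  generalize expo V = eV at *
  generalize expo (-V) = eV' at *
  generalize expo (-((1 / 2 : ℚ) • ((h₂ + ah) * PowerSeries.X) ^ 2)) = g at *
  generalize expo (-(-((1 / 2 : ℚ) • ((h₂ - ah) * PowerSeries.X) ^ 2))) = g' at *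
  generalize PowerSeries.C (gaussTotal m u₀ z) = t at *
  generalize PowerSeries.C (gaussTotal m u₀ z') = t' at *
  -- In the product the potentials cancel, the class constants give 1/((1 - w₁)(1 - w₂)), and the
  -- square of the Hessian factor is the inverse Hessian of the prefactor.
  have key : S ^ 2 * (Φ * Φ') = t * t' * (g * g') * (G * G') * ((1 - wSer ω₁) * (1 - wSer ω₂)) := by
    calc S ^ 2 * (Φ * Φ') = (eV * eV') * (k₁ * l₁ * (1 - wSer ω₁)) * (k₂ * l₂ * (1 - wSer ω₂)) *
          (S ^ 2 * (Φ * Φ')) := by rw [e1, f1, f2]; ring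
      _ = (eV * (k₁ * k₂) * S * Φ) * (eV' * (l₁ * l₂) * S * Φ') *
          ((1 - wSer ω₁) * (1 - wSer ω₂)) := by ring
      _ = _ := by rw [c1, c2]; ring
  calc -(u * -S ^ 2 * D) * (Φ * Φ') = u * D * (S ^ 2 * (Φ * Φ')) := by ring
    _ = PowerSeries.C u₀ * (t * t') * (expo a * expo (-a)) * (G * G') *
        (D * ((1 - wSer ω₁) * (1 - wSer ω₂))) := by rw [key, e3, hu_def]; ring
    _ = -((-PowerSeries.C u₀ * (t * t')) * (G * G') * (D * ((1 - wSer ω₁) * (1 - wSer ω₂)))) := by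
        rw [e4]; ring
    _ = -(D * (m * ((1 - wSer ω₁) * (1 - wSer ω₂)))) * (G * G') := by rw [e5']; ring
    _ = -(G * G') := by rw [e8]; ring

end Core

/-! ### Extracting the coefficients of the powers of `ħ` -/

section ArraySum

variable {B B' : Type} [CommRing B] [CommRing B']

/-- The double series `∑ g I J a ^ I b ^ J`, summed by total degree. -/
def arraySum (g : ℕ → ℕ → B⟦X⟧) (a b : B⟦X⟧) : B⟦X⟧ :=
  adicSum fun N => ∑ p ∈ Finset.HasAntidiagonal.antidiagonal N, g p.1 p.2 * (a ^ p.1 * b ^ p.2)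

lemma X_pow_dvd_pow_mul_pow {a b : B⟦X⟧} (ha : PowerSeries.X ∣ a) (hb : PowerSeries.X ∣ b)
    (i j : ℕ) : PowerSeries.X ^ (i + j) ∣ a ^ i * b ^ j := by
  rw [pow_add]; exact mul_dvd_mul (pow_dvd_pow_of_dvd ha i) (pow_dvd_pow_of_dvd hb j)

lemma X_pow_dvd_arraySum_term (g : ℕ → ℕ → B⟦X⟧) {a b : B⟦X⟧} (ha : PowerSeries.X ∣ a)
    (hb : PowerSeries.X ∣ b) (N : ℕ) : PowerSeries.X ^ N ∣
      ∑ p ∈ Finset.HasAntidiagonal.antidiagonal N, g p.1 p.2 * (a ^ p.1 * b ^ p.2) := by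
  refine Finset.dvd_sum fun p hp => ?_
  rw [← Finset.HasAntidiagonal.mem_antidiagonal.1 hp]
  exact (X_pow_dvd_pow_mul_pow ha hb _ _).mul_left _

lemma ringHom_arraySum (h : B⟦X⟧ →+* B'⟦X⟧) (hX : PowerSeries.X ∣ h PowerSeries.X)
    (g : ℕ → ℕ → B⟦X⟧) {a b : B⟦X⟧} (ha : PowerSeries.X ∣ a) (hb : PowerSeries.X ∣ b) :
    h (arraySum g a b) = arraySum (fun i j => h (g i j)) (h a) (h b) := by
  rw [arraySum, ringHom_adicSum h hX (X_pow_dvd_arraySum_term g ha hb), arraySum]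
  simp only [map_sum, map_mul, map_pow]

lemma arraySum_finset_sum {ι : Type} (s : Finset ι) (g : ι → ℕ → ℕ → B⟦X⟧) (a b : B⟦X⟧) :
    arraySum (fun i j => ∑ t ∈ s, g t i j) a b = ∑ t ∈ s, arraySum (g t) a b := by
  simp only [arraySum, ← adicSum_finset_sum, Finset.sum_mul]
  congr 1
  ext1 N
  exact Finset.sum_comm

lemma mul_arraySum (f : B⟦X⟧) (g : ℕ → ℕ → B⟦X⟧) {a b : B⟦X⟧} (ha : PowerSeries.X ∣ a)
    (hb : PowerSeries.X ∣ b) :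
    f * arraySum g a b = arraySum (fun i j => f * g i j) a b := by
  rw [arraySum, mul_adicSum f (X_pow_dvd_arraySum_term g ha hb), arraySum]
  simp only [Finset.mul_sum, mul_assoc]

lemma adicSum_arraySum (g : ℕ → ℕ → ℕ → B⟦X⟧) {a b : B⟦X⟧} :
    adicSum (fun k => arraySum (g k) a b) =
      adicSum fun N => adicSum fun k =>
        ∑ p ∈ Finset.HasAntidiagonal.antidiagonal N, g k p.1 p.2 * (a ^ p.1 * b ^ p.2) :=
  adicSum_comm _

end ArraySum

/-! ### Separating the powers of ħ by homogeneity -/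

section Extraction

variable {B : Type} [CommRing B] [Algebra ℚ B]

lemma sqHom_mk_arraySum (g : ℕ → ℕ → B⟦X⟧) {a b : B⟦X⟧} (ha : PowerSeries.X ∣ a)
    (hb : PowerSeries.X ∣ b) :
    sqHom (PowerSeries.mk fun k =>
        arraySum (fun i j => PowerSeries.C (PowerSeries.coeff k (g i j))) a b) =
      arraySum (fun i j => evalAt PowerSeries.C (PowerSeries.X ^ 2) X_dvd_X_sq (g i j)) a b := by
  rw [sqHom, evalAt_apply]
  simp only [PowerSeries.coeff_mk, RingHom.id_apply]
  have h1 : ∀ k, arraySum (fun i j => PowerSeries.C (PowerSeries.coeff k (g i j))) a b *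
      (PowerSeries.X ^ 2) ^ k = arraySum (fun i j => (PowerSeries.X ^ 2) ^ k *
        PowerSeries.C (PowerSeries.coeff k (g i j))) a b := fun k => by
    rw [mul_comm, mul_arraySum _ _ ha hb]
  simp only [h1]
  rw [adicSum_arraySum fun k i j => (PowerSeries.X ^ 2) ^ k *
        PowerSeries.C (PowerSeries.coeff k (g i j)), arraySum]
  congr 1
  ext1 N
  rw [adicSum_finset_sum]
  refine Finset.sum_congr rfl fun p _ => ?_
  rw [evalAt_apply, mul_comm (adicSum _),
    mul_adicSum _ fun k => (pow_dvd_pow_of_dvd X_dvd_X_sq k).mul_left _]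
  congr 1
  ext1 k
  ring

/-- Series that are homogeneous for a weight with `ħ = ε ^ 2` of weight `0` are determined by the
sum of their products with the powers of `ħ`. -/
lemma eq_zero_of_sqHom_mk_eq_zero (σ : B →+* B[X]) {f : ℕ → B⟦X⟧}
    (hf : ∀ k, PowerSeries.map σ (f k) =
      PowerSeries.rescale (Polynomial.X : B[X]) (PowerSeries.map Polynomial.C (f k)))
    (h : sqHom (PowerSeries.mk f) = 0) (k : ℕ) : f k = 0 := by
  have hσ : ∀ k n, σ (PowerSeries.coeff n (f k)) =
      Polynomial.X ^ n * Polynomial.C (PowerSeries.coeff n (f k)) := by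
    intro k n
    have := congrArg (PowerSeries.coeff n) (hf k)
    rwa [PowerSeries.coeff_map, PowerSeries.coeff_rescale, PowerSeries.coeff_map] at this
  ext j
  rw [map_zero]
  -- The contribution of f k' to ε^{j+2k} has weight j + 2k - 2k', so the part of weight j comes
  -- from k' = k alone.
  have h1 := congrArg (PowerSeries.coeff (j + 2 * k)) h
  rw [sqHom, evalAt_apply, map_zero, coeff_adicSum] at h1
  simp only [PowerSeries.coeff_mk, RingHom.id_apply, ← pow_mul, PowerSeries.coeff_mul_X_pow'] at h1
  have h2 := congrArg (Polynomial.coeff · j) (congrArg σ h1)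
  simp only [map_sum, map_zero, Polynomial.finsetSum_coeff, Polynomial.coeff_zero] at h2
  rw [Finset.sum_eq_single k] at h2
  · rwa [if_pos (by omega), hσ, show j + 2 * k - 2 * k = j by omega, Polynomial.coeff_X_pow_mul',
      if_pos le_rfl, Nat.sub_self, Polynomial.coeff_C_zero] at h2
  · intro k' _ hk
    split_ifs with h3
    · rw [hσ, Polynomial.coeff_X_pow_mul']
      split_ifs with h4
      · exact Polynomial.coeff_C_of_ne_zero (by omega)
      · rfl
    · simp
  · intro h3
    exact absurd (Finset.mem_range.2 (by omega)) h3

lemma ringHom_liOne {R S : Type} [CommRing R] [CommRing S] [Algebra ℚ R] [Algebra ℚ S]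
    (h : R⟦X⟧ →+* S⟦X⟧) (hX : PowerSeries.X ∣ h PowerSeries.X) {a : R⟦X⟧}
    (ha : PowerSeries.X ∣ a) : h (liOne a) = liOne (h a) := by
  rw [liOne, ringHom_adicSum h hX fun k => dvd_smul_of_dvd _ (pow_dvd_pow_of_dvd ha k), liOne]
  simp only [map_rat_smul, map_pow]

variable {K : Type} [Field K] [CharZero K]

/-- The power series `z e^ħ`. -/
def expSer (z : K) : K⟦X⟧ := PowerSeries.C z * PowerSeries.exp K

/-- The power series `z e^{-ħ}`. -/
def expNegSer (z : K) : K⟦X⟧ := PowerSeries.C z * PowerSeries.rescale (-1) (PowerSeries.exp K)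

end Extraction

/-! ### The coefficient formula at a graded point -/

section Generic

variable {K : Type} [Field K] [CharZero K]

lemma exp_eq_expo : PowerSeries.exp K = expo PowerSeries.X := by
  rw [← subst_exp_eq_expo dvd_rfl, ← PowerSeries.map_exp (algebraMap ℚ K)]
  ext n
  rw [PowerSeries.coeff_map, PowerSeries.coeff_subst' (PowerSeries.HasSubst.of_constantCoeff_zero' (by simp))]
  rw [finsum_eq_single _ n]
  · simp [Algebra.smul_def]
  · intro k hk
    rw [PowerSeries.coeff_X_pow, if_neg hk.symm, smul_zero]

lemma evalAt_expSer {B : Type} [CommRing B] [Algebra ℚ B] (f : K →+* B) (z : K) :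
    evalAt (PowerSeries.C.comp f) (PowerSeries.X ^ 2) X_dvd_X_sq (expSer z) = qSer (f z) ∧
    evalAt (PowerSeries.C.comp f) (PowerSeries.X ^ 2) X_dvd_X_sq (expNegSer z) = qInv (f z) := by
  have hX := X_dvd_evalAt_X (PowerSeries.C.comp f) (X_dvd_X_sq (B := B))
  constructor
  · rw [expSer, exp_eq_expo, map_mul, map_expo _ hX dvd_rfl, evalAt_C, evalAt_X, qSer]
    rfl
  · rw [expNegSer, exp_eq_expo, map_mul, rescale_expo _ dvd_rfl, PowerSeries.rescale_X, map_expo _ hX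
      (dvd_mul_left _ _), evalAt_C, map_mul, evalAt_C, evalAt_X, qInv]
    simp

/-- The series `Li_1(w₁ ^ m) + Li_1(w₂ ^ m)`, divided by `-m`. -/
def logRoot {B : Type} [CommRing B] [Algebra ℚ B] (m : ℕ) (w₁ w₂ : B⟦X⟧) : B⟦X⟧ :=
  -(((m : ℚ)⁻¹) • (liOne (w₁ ^ m) + liOne (w₂ ^ m)))

lemma X_dvd_logRoot {B : Type} [CommRing B] [Algebra ℚ B] {m : ℕ} (hm : m ≠ 0) {w₁ w₂ : B⟦X⟧}
    (h₁ : PowerSeries.X ∣ w₁) (h₂ : PowerSeries.X ∣ w₂) : PowerSeries.X ∣ logRoot m w₁ w₂ :=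
  (dvd_neg).2 (dvd_smul_of_dvd _ ((X_dvd_liOne (h₁.trans (dvd_pow_self _ hm))).add
    (X_dvd_liOne (h₂.trans (dvd_pow_self _ hm)))))

lemma ringHom_logRoot {R S : Type} [CommRing R] [CommRing S] [Algebra ℚ R] [Algebra ℚ S]
    (h : R⟦X⟧ →+* S⟦X⟧) (hX : PowerSeries.X ∣ h PowerSeries.X) {m : ℕ} (hm : m ≠ 0) {w₁ w₂ : R⟦X⟧}
    (h₁ : PowerSeries.X ∣ w₁) (h₂ : PowerSeries.X ∣ w₂) :
    h (logRoot m w₁ w₂) = logRoot m (h w₁) (h w₂) := by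
  rw [logRoot, map_neg, map_rat_smul, map_add,
    ringHom_liOne h hX (h₁.trans (dvd_pow_self _ hm)),
    ringHom_liOne h hX (h₂.trans (dvd_pow_self _ hm)), map_pow, map_pow, logRoot]

lemma expo_logRoot_pow {B : Type} [CommRing B] [Algebra ℚ B] {m : ℕ} (hm : m ≠ 0) {w₁ w₂ : B⟦X⟧}
    (h₁ : PowerSeries.X ∣ w₁) (h₂ : PowerSeries.X ∣ w₂) :
    expo (logRoot m w₁ w₂) ^ m = (1 - w₁ ^ m) * (1 - w₂ ^ m) := by
  have h₁' := h₁.trans (dvd_pow_self _ hm)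
  have h₂' := h₂.trans (dvd_pow_self _ hm)
  have e : m • logRoot m w₁ w₂ = -liOne (w₁ ^ m) + -liOne (w₂ ^ m) := by
    rw [logRoot, smul_neg, ← Nat.cast_smul_eq_nsmul ℚ, smul_smul, mul_inv_cancel₀
      (Nat.cast_ne_zero.2 hm), one_smul, neg_add]
  rw [← expo_nsmul (X_dvd_logRoot hm h₁ h₂), e, expo_add ((dvd_neg).2 (X_dvd_liOne h₁'))
    ((dvd_neg).2 (X_dvd_liOne h₂')), expo_neg_liOne h₁', expo_neg_liOne h₂']

/-- The coefficients of the symmetrised Gaussian integral, as series of the coefficients of the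
summands `q^{-IJ} [I + J, I]_q ^ 2` at `q = z e^ħ`, over a domain where `ω₁`, `ω₂` have weight `4`
for a grading `σ`. -/
theorem coeff_rPsi_wSer {B : Type} [CommRing B] [IsDomain B] [Algebra ℚ B] (f : K →+* B)
    {m : ℕ} (hm : m ≠ 0) {z i u₀ u' : K} (hz : IsPrimitiveRoot z m)
    (hi : i ^ 2 = -1) (hu : u₀ ^ m = -1) (huu : u₀ * u' = 1) {ω₁ ω₂ : B} (σ : B →+* B[X])
    (hσ : ∀ x, σ (f x) = Polynomial.C (f x)) (h₁ : σ ω₁ = Polynomial.C ω₁ * Polynomial.X ^ 4)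
    (h₂ : σ ω₂ = Polynomial.C ω₂ * Polynomial.X ^ 4) {a : B⟦X⟧}
    (ha : a = logRoot m (wSer ω₁) (wSer ω₂)) (k : ℕ) :
    PowerSeries.coeff k (rPsi m (PowerSeries.C (f z)) (wSer ω₁) (wSer ω₂)
        (PowerSeries.C (f u₀) * expo a)) =
      -arraySum (fun I J => PowerSeries.C (f (PowerSeries.coeff k
          (qSummand (expSer z) (expNegSer (z ^ (m - 1))) I J))))
        (wSer ω₁ * (PowerSeries.C (f u') * expo (-a)))
        (wSer ω₂ * (PowerSeries.C (f u') * expo (-a))) := by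
  have haX : PowerSeries.X ∣ a := ha ▸ X_dvd_logRoot hm (X_dvd_wSer _) (X_dvd_wSer _)
  set α := wSer ω₁ * (PowerSeries.C (f u') * expo (-a)) with hα
  set β := wSer ω₂ * (PowerSeries.C (f u') * expo (-a)) with hβ
  set U := PowerSeries.C (f u₀) * expo a with hU
  set g := qSummand (expSer z) (expNegSer (z ^ (m - 1))) with hg
  have hαX : PowerSeries.X ∣ α := (X_dvd_wSer _).mul_right _
  have hβX : PowerSeries.X ∣ β := (X_dvd_wSer _).mul_right _
  -- Homogeneity is the equality of two homomorphisms: θ records the weight of the coefficients and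
  -- θ' the power of ε. They agree on wᵢ = ωᵢε⁴ and on constants, hence on everything built from
  -- these.
  set θ : B⟦X⟧ →+* B[X]⟦X⟧ := PowerSeries.map σ with hθ
  set θ' : B⟦X⟧ →+* B[X]⟦X⟧ :=
    (PowerSeries.rescale (Polynomial.X : B[X])).comp (PowerSeries.map Polynomial.C) with hθ'
  have hX : PowerSeries.X ∣ θ PowerSeries.X := X_dvd_map_X σ
  have hX' : PowerSeries.X ∣ θ' PowerSeries.X := by
    rw [hθ', RingHom.comp_apply, PowerSeries.map_X]; exact X_dvd_rescale_X _
  have tC : ∀ x : K, θ (PowerSeries.C (f x)) = θ' (PowerSeries.C (f x)) := by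
    intro x
    rw [hθ', RingHom.comp_apply, hθ, PowerSeries.map_C, PowerSeries.map_C, rescale_C, hσ]
  have tw : ∀ ω : B, σ ω = Polynomial.C ω * Polynomial.X ^ 4 → θ (wSer ω) = θ' (wSer ω) := by
    intro ω hω
    rw [wSer, map_mul, map_mul, hθ', RingHom.comp_apply, RingHom.comp_apply, hθ, PowerSeries.map_C,
      PowerSeries.map_C, rescale_C, map_pow, map_pow, map_pow,
      PowerSeries.map_X, PowerSeries.map_X, PowerSeries.rescale_X, hω, map_mul, map_pow]
    ring
  replace h₁ := tw _ h₁
  replace h₂ := tw _ h₂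
  have ta : θ a = θ' a := by
    rw [ha, ringHom_logRoot θ hX hm (X_dvd_wSer _) (X_dvd_wSer _),
      ringHom_logRoot θ' hX' hm (X_dvd_wSer _) (X_dvd_wSer _), h₁, h₂]
  have te : θ (expo (-a)) = θ' (expo (-a)) := by
    rw [map_expo θ hX ((dvd_neg).2 haX), map_expo θ' hX' ((dvd_neg).2 haX), map_neg, map_neg, ta]
  have tU : θ U = θ' U := by
    rw [hU, map_mul, map_mul, map_expo θ hX haX, map_expo θ' hX' haX, ta, tC]
  have tα : θ α = θ' α := by rw [hα, map_mul, map_mul, map_mul, map_mul, te, tC, h₁]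
  have tβ : θ β = θ' β := by rw [hβ, map_mul, map_mul, map_mul, map_mul, te, tC, h₂]
  have hunit : ∀ (y ω : B) (j : ℕ), IsUnit (1 - PowerSeries.C y ^ j * wSer ω) := fun y ω j =>
    isUnit_one_sub ((X_dvd_wSer ω).mul_left _)
  have hunit' : ∀ ω₁ ω₂ : B, IsUnit (1 - wSer ω₁ ^ m * wSer ω₂ ^ m) := fun ω₁ ω₂ =>
    isUnit_one_sub (((X_dvd_wSer ω₁).trans (dvd_pow_self _ hm)).mul_right _)
  have key := eq_zero_of_sqHom_mk_eq_zero σ (f := fun k =>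
    PowerSeries.coeff k (rPsi m (PowerSeries.C (f z)) (wSer ω₁) (wSer ω₂) U) +
      arraySum (fun I J => PowerSeries.C (f (PowerSeries.coeff k (g I J)))) α β)
    ?_ ?_ k
  · exact eq_neg_of_add_eq_zero_left key
  · intro k
    change θ _ = θ' _
    rw [map_add, map_add, ringHom_arraySum θ hX _ hαX hβX, ringHom_arraySum θ' hX' _ hαX hβX, tα, tβ,
      ← PowerSeries.coeff_map, ← PowerSeries.coeff_map, map_rPsi θ hm (hunit _ _) (hunit _ _)
        (hunit' _ _), map_rPsi θ' hm (hunit _ _) (hunit _ _) (hunit' _ _), tC, h₁, h₂, tU]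
    simp only [tC]
  · have h1 := sqHom_rPsi hm (hz.map_of_injective f.injective)
      (by rw [← map_pow, hi, map_neg, map_one] : f i ^ 2 = -1)
      (by rw [← map_pow, hu, map_neg, map_one] : f u₀ ^ m = -1)
      (by rw [← map_mul, huu, map_one] : f u₀ * f u' = 1)
      ω₁ ω₂ ha
    have h2 := sqHom_mk_arraySum (fun I J => PowerSeries.map f (g I J))
      hαX hβX
    have h3 : (PowerSeries.mk fun k => PowerSeries.coeff k (rPsi m (PowerSeries.C (f z))
          (wSer ω₁) (wSer ω₂) U) + arraySum (fun I J => PowerSeries.C (f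
            (PowerSeries.coeff k (g I J)))) α β) =
        rPsi m (PowerSeries.C (f z)) (wSer ω₁) (wSer ω₂) U +
        PowerSeries.mk fun k => arraySum (fun I J => PowerSeries.C (PowerSeries.coeff k
          (PowerSeries.map f (g I J)))) α β := by
      ext1 n
      simp only [PowerSeries.coeff_mk, map_add, PowerSeries.coeff_map]
    rw [h3, map_add, h1, h2, neg_add_eq_zero]
    have h4 : ∀ y : K⟦X⟧, evalAt PowerSeries.C (PowerSeries.X ^ 2) X_dvd_X_sq
        (PowerSeries.map f y) =
        evalAt (PowerSeries.C.comp f) (PowerSeries.X ^ 2) X_dvd_X_sq y := by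
      intro y
      rw [evalAt_apply, evalAt_apply]
      simp only [PowerSeries.coeff_map, RingHom.comp_apply]
    rw [arraySum]
    congr 1
    ext1 N
    refine Finset.sum_congr rfl fun p _ => ?_
    rw [h4, hg, map_qSummand, (evalAt_expSer _ _).1, (evalAt_expSer _ _).2, map_pow]

end Generic

/-! ### Interleaving of double series -/

section Interleave

variable {B : Type} [CommRing B]

lemma coeff_arraySum (g : ℕ → ℕ → B⟦X⟧) {a b : B⟦X⟧} (ha : PowerSeries.X ∣ a)
    (hb : PowerSeries.X ∣ b) {n M : ℕ} (h : n < M) :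
    PowerSeries.coeff n (arraySum g a b) = ∑ i ∈ Finset.range M, ∑ j ∈ Finset.range M,
      PowerSeries.coeff n (g i j * (a ^ i * b ^ j)) := by
  have h0 : ∀ p : ℕ × ℕ, n < p.1 + p.2 →
      PowerSeries.coeff n (g p.1 p.2 * (a ^ p.1 * b ^ p.2)) = 0 := fun p hp =>
    PowerSeries.X_pow_dvd_iff.1 ((X_pow_dvd_pow_mul_pow ha hb p.1 p.2).mul_left _) n hp
  rw [arraySum, coeff_adicSum_of_lt (X_pow_dvd_arraySum_term g ha hb)
    (show n < 2 * M by omega), ← Finset.sum_product',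
    ← Finset.sum_fiberwise_of_maps_to (t := Finset.range (2 * M)) (g := fun p : ℕ × ℕ => p.1 + p.2)]
  · refine Finset.sum_congr rfl fun k _ => ?_
    rw [map_sum]
    rcases lt_or_ge n k with hk | hk
    · rw [Finset.sum_eq_zero, Finset.sum_eq_zero]
      · intro p hp
        exact h0 p ((Finset.mem_filter.1 hp).2 ▸ hk)
      · intro p hp
        exact h0 p (Finset.HasAntidiagonal.mem_antidiagonal.1 hp ▸ hk)
    · refine Finset.sum_congr ?_ fun _ _ => rfl
      ext p
      simp only [Finset.HasAntidiagonal.mem_antidiagonal, Finset.mem_filter, Finset.mem_product,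
        Finset.mem_range]
      omega
  · intro p hp
    simp only [Finset.mem_product, Finset.mem_range] at hp ⊢
    omega

lemma sum_range_mul {M : Type} [AddCommMonoid M] (f : ℕ → M) (p n : ℕ) :
    ∑ k ∈ Finset.range (p * n), f k =
      ∑ r ∈ Finset.range p, ∑ i ∈ Finset.range n, f (p * i + r) := by
  induction n with
  | zero => simp
  | succ n ih =>
    rw [Nat.mul_succ, Finset.sum_range_add, ih, ← Finset.sum_add_distrib]
    exact Finset.sum_congr rfl fun r _ => (Finset.sum_range_succ _ _).symm

/-- Sorting the exponents by residue class. It is used with the modulus m to isolate the classes of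
the integral, and with a prime to pass from a, b to a^p, b^p. -/
lemma arraySum_interleave (g : ℕ → ℕ → B⟦X⟧) {a b : B⟦X⟧} (ha : PowerSeries.X ∣ a)
    (hb : PowerSeries.X ∣ b) {p : ℕ} (hp : p ≠ 0) :
    arraySum g a b = ∑ r ∈ Finset.range p, ∑ s ∈ Finset.range p,
      a ^ r * b ^ s * arraySum (fun i j => g (p * i + r) (p * j + s)) (a ^ p) (b ^ p) := by
  have ha' : PowerSeries.X ∣ a ^ p := ha.trans (dvd_pow_self _ hp)
  have hb' : PowerSeries.X ∣ b ^ p := hb.trans (dvd_pow_self _ hp)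
  ext n
  have hn : n < p * (n + 1) := Nat.lt_of_lt_of_le n.lt_succ_self
    (Nat.le_mul_of_pos_left _ (Nat.pos_of_ne_zero hp))
  rw [coeff_arraySum g ha hb hn, sum_range_mul, map_sum]
  refine Finset.sum_congr rfl fun r _ => ?_
  simp only [sum_range_mul]
  rw [Finset.sum_comm, map_sum]
  refine Finset.sum_congr rfl fun s _ => ?_
  rw [mul_arraySum _ _ ha' hb', coeff_arraySum _ ha' hb' n.lt_succ_self]
  refine Finset.sum_congr rfl fun i _ => Finset.sum_congr rfl fun j _ => ?_
  congr 1
  ring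

end Interleave

/-! ### Rational functions with denominator `(1 - c) (1 - d) (1 - c d)` -/

section TRing

/-- The denominator `(1 - c) (1 - d) (1 - c d)`. -/
def disc {S : Type} [CommRing S] (c d : S) : S := (1 - c) * (1 - d) * (1 - c * d)

/-- The ring `A[c, d, 1 / ((1 - c) (1 - d) (1 - c d))]`. -/
abbrev TRing (A : Type) [CommRing A] : Type :=
  Localization.Away (disc (MvPolynomial.X 0 : MvPolynomial (Fin 2) A) (MvPolynomial.X 1))

variable {A A' S S' : Type} [CommRing A] [CommRing A'] [CommRing S] [CommRing S']

lemma map_disc (f : S →+* S') (c d : S) : f (disc c d) = disc (f c) (f d) := by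
  simp [disc]

/-- The function `-c / ((1 - c) (1 - d))`. -/
def ratA (c d : S) : S := -(c * Ring.inverse ((1 - c) * (1 - d)))

lemma isUnit_of_disc {c d : S} (h : IsUnit (disc c d)) : IsUnit ((1 - c) * (1 - d)) :=
  isUnit_of_mul_isUnit_left h

lemma disc_comm (c d : S) : disc c d = disc d c := by simp only [disc]; ring

lemma map_ratA (f : S →+* S') {c d : S} (h : IsUnit ((1 - c) * (1 - d))) :
    f (ratA c d) = ratA (f c) (f d) := by
  rw [ratA, map_neg, map_mul, map_ringInverse f h, ratA]
  simp

lemma ratA_mul {c d : S} (h : IsUnit ((1 - c) * (1 - d))) :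
    ratA c d * ((1 - c) * (1 - d)) = -c := by
  rw [ratA, neg_mul, mul_assoc, Ring.inverse_mul_cancel _ h, mul_one]

namespace TRing

/-- The inclusion of the constants. -/
def const (A : Type) [CommRing A] : A →+* TRing A :=
  (algebraMap (MvPolynomial (Fin 2) A) (TRing A)).comp MvPolynomial.C

/-- The coordinates `c` and `d`. -/
def coord (A : Type) [CommRing A] (t : Fin 2) : TRing A :=
  algebraMap (MvPolynomial (Fin 2) A) (TRing A) (MvPolynomial.X t)

lemma isUnit_disc : IsUnit (disc (coord A 0) (coord A 1)) := by
  rw [coord, coord, ← map_disc]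
  exact IsLocalization.Away.algebraMap_isUnit _

/-- Evaluation of rational functions. -/
def eval (f : A →+* S) (c d : S) (h : IsUnit (disc c d)) : TRing A →+* S :=
  IsLocalization.Away.lift (disc (MvPolynomial.X 0 : MvPolynomial (Fin 2) A) (MvPolynomial.X 1))
    (g := MvPolynomial.eval₂Hom f ![c, d]) (by rw [map_disc]; simpa using h)

variable (f : A →+* S) (c d : S) (h : IsUnit (disc c d))

lemma eval_algebraMap (P : MvPolynomial (Fin 2) A) :
    eval f c d h (algebraMap _ _ P) = MvPolynomial.eval₂Hom f ![c, d] P :=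
  IsLocalization.Away.lift_eq _ _ _

lemma eval_const (x : A) : eval f c d h (const A x) = f x := by
  rw [const, RingHom.comp_apply, eval_algebraMap]; simp

lemma eval_coord_zero : eval f c d h (coord A 0) = c := by
  rw [coord, eval_algebraMap]; simp

lemma eval_coord_one : eval f c d h (coord A 1) = d := by
  rw [coord, eval_algebraMap]; simp

lemma hom_ext {f g : TRing A →+* S} (hC : ∀ x, f (const A x) = g (const A x))
    (h : ∀ t, f (coord A t) = g (coord A t)) : f = g := by
  refine IsLocalization.ringHom_ext (Submonoid.powers
    (disc (MvPolynomial.X 0 : MvPolynomial (Fin 2) A) (MvPolynomial.X 1))) ?_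
  exact MvPolynomial.ringHom_ext hC h

lemma comp_eval (g : S →+* S') (h' : IsUnit (disc (g c) (g d))) :
    g.comp (eval f c d h) = eval (g.comp f) (g c) (g d) h' := by
  refine hom_ext (fun x => ?_) fun t => ?_
  · rw [RingHom.comp_apply, eval_const, eval_const, RingHom.comp_apply]
  · fin_cases t
    · exact (congrArg g (eval_coord_zero f c d h)).trans (eval_coord_zero _ _ _ h').symm
    · exact (congrArg g (eval_coord_one f c d h)).trans (eval_coord_one _ _ _ h').symm

lemma map_eval (g : S →+* S') (τ : TRing A) :
    g (eval f c d h τ) = eval (g.comp f) (g c) (g d) (by rw [← map_disc]; exact h.map g) τ := by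
  rw [← comp_eval, RingHom.comp_apply]

lemma exists_mul_disc_pow (τ : TRing A) : ∃ (P : MvPolynomial (Fin 2) A) (e : ℕ),
    τ * disc (coord A 0) (coord A 1) ^ e = algebraMap _ _ P := by
  obtain ⟨e, P, h⟩ := IsLocalization.Away.surj
    (disc (MvPolynomial.X 0 : MvPolynomial (Fin 2) A) (MvPolynomial.X 1)) τ
  exact ⟨P, e, by rw [coord, coord, ← map_disc]; exact h⟩

/-- Change of constants. -/
def map (f : A →+* A') : TRing A →+* TRing A' :=
  eval ((const A').comp f) (coord A' 0) (coord A' 1) isUnit_disc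

lemma eval_map (f : A →+* A') (g : A' →+* S) (τ : TRing A) :
    eval g c d h (map f τ) = eval (g.comp f) c d h τ := by
  rw [← RingHom.comp_apply]
  refine RingHom.congr_fun (hom_ext (fun x => ?_) fun t => ?_) τ
  · rw [RingHom.comp_apply, map, eval_const, RingHom.comp_apply, eval_const, eval_const]; rfl
  · fin_cases t
    · change eval g c d h (eval _ _ _ _ (coord A 0)) = eval _ _ _ _ (coord A 0)
      rw [eval_coord_zero, eval_coord_zero, eval_coord_zero]
    · change eval g c d h (eval _ _ _ _ (coord A 1)) = eval _ _ _ _ (coord A 1)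
      rw [eval_coord_one, eval_coord_one, eval_coord_one]

lemma isUnit_disc_of_X_dvd {c d : S⟦X⟧} (hc : PowerSeries.X ∣ c) (hd : PowerSeries.X ∣ d) :
    IsUnit (disc c d) :=
  ((isUnit_one_sub hc).mul (isUnit_one_sub hd)).mul (isUnit_one_sub (hc.mul_right _))

/-- The generic point: expansion in the total degree in `c` and `d`. -/
def genSer (A : Type) [CommRing A] (t : Fin 2) : (MvPolynomial (Fin 2) A)⟦X⟧ :=
  PowerSeries.C (MvPolynomial.X t) * PowerSeries.X

lemma X_dvd_genSer (t : Fin 2) : PowerSeries.X ∣ genSer A t := dvd_mul_left _ _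

/-- Expansion of rational functions at the generic point. -/
def gen (A : Type) [CommRing A] : TRing A →+* (MvPolynomial (Fin 2) A)⟦X⟧ :=
  eval (PowerSeries.C.comp MvPolynomial.C) (genSer A 0) (genSer A 1)
    (isUnit_disc_of_X_dvd (X_dvd_genSer 0) (X_dvd_genSer 1))

/-- The expansion at the generic point splits P into homogeneous parts, so P is recovered by setting
the grading variable to 1. -/
lemma exists_eq_sum_coeff (P : MvPolynomial (Fin 2) A) : ∃ N : ℕ,
    P = ∑ n ∈ Finset.range N, PowerSeries.coeff n (MvPolynomial.eval₂Hom
      (PowerSeries.C.comp MvPolynomial.C) ![genSer A 0, genSer A 1] P) := by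
  let F : MvPolynomial (Fin 2) A →+* (MvPolynomial (Fin 2) A)[X] :=
    MvPolynomial.eval₂Hom (Polynomial.C.comp MvPolynomial.C)
      fun t => Polynomial.C (MvPolynomial.X t) * Polynomial.X
  have h1 : MvPolynomial.eval₂Hom (PowerSeries.C.comp MvPolynomial.C)
      ![genSer A 0, genSer A 1] = Polynomial.coeToPowerSeries.ringHom.comp F := by
    refine MvPolynomial.ringHom_ext (fun x => ?_) fun t => ?_
    · simp [F]
    · fin_cases t <;> simp [F, genSer]
  have h2 : ∀ P, (F P).eval 1 = P := by
    intro P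
    have : (Polynomial.evalRingHom 1).comp F = RingHom.id _ :=
      MvPolynomial.ringHom_ext (fun x => by simp [F]) fun t => by simp [F]
    exact RingHom.congr_fun this P
  refine ⟨(F P).natDegree + 1, ?_⟩
  rw [h1]
  conv_lhs => rw [← h2 P, Polynomial.eval_eq_sum_range]
  refine Finset.sum_congr rfl fun n _ => ?_
  rw [one_pow, mul_one, RingHom.comp_apply]
  exact (Polynomial.coeff_coe _ _).symm

lemma eval₂Hom_mul_X_injective :
    Function.Injective (MvPolynomial.eval₂Hom (PowerSeries.C.comp MvPolynomial.C)
      ![genSer A 0, genSer A 1]) := by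
  rw [injective_iff_map_eq_zero]
  intro P hP
  obtain ⟨N, h⟩ := exists_eq_sum_coeff P
  rw [h, hP]
  simp

/-- The discriminant is a unit in `TRing A`, so only numerators matter. Identities of rational
functions can thus be checked on expansions at c = d = 0, over any commutative ring of constants. -/
lemma gen_injective : Function.Injective (gen A) := by
  rw [injective_iff_map_eq_zero]
  intro τ hτ
  obtain ⟨P, e, h⟩ := exists_mul_disc_pow τ
  have h1 := congrArg (gen A) h
  rw [map_mul, hτ, zero_mul, gen, eval_algebraMap] at h1
  have h2 : P = 0 := eval₂Hom_mul_X_injective (by rw [← h1, map_zero])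
  rw [h2, map_zero] at h
  exact (isUnit_disc.pow e).mul_left_eq_zero.1 h

/-- The rational function `τ` is the sum of the double series with coefficients `g` in
`a = -c / ((1 - c) (1 - d))` and `b = -d / ((1 - c) (1 - d))`. -/
def Represents (τ : TRing A) (g : ℕ → ℕ → A) : Prop :=
  gen A τ = arraySum (fun i j => PowerSeries.C (MvPolynomial.C (g i j)))
    (ratA (genSer A 0) (genSer A 1)) (ratA (genSer A 1) (genSer A 0))

lemma X_dvd_ratA {c d : S⟦X⟧} (hc : PowerSeries.X ∣ c) : PowerSeries.X ∣ ratA c d :=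
  (dvd_neg).2 (hc.mul_right _)

lemma isUnit_of_X_dvd {c d : S⟦X⟧} (hc : PowerSeries.X ∣ c) (hd : PowerSeries.X ∣ d) :
    IsUnit ((1 - c) * (1 - d)) :=
  (isUnit_one_sub hc).mul (isUnit_one_sub hd)

/-- A point whose coordinates c = Xc' and d = Xd' are divisible by X is a specialisation of the
generic point, obtained by sending the polynomial variables to c' and d'. -/
lemma Represents.eval_eq {τ : TRing A} {g : ℕ → ℕ → A} (hτ : Represents τ g) (F : A →+* S⟦X⟧)
    {c d : S⟦X⟧} (hc : PowerSeries.X ∣ c) (hd : PowerSeries.X ∣ d) (h : IsUnit (disc c d)) :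
    eval F c d h τ = arraySum (fun i j => F (g i j)) (ratA c d) (ratA d c) := by
  obtain ⟨c', hc'⟩ := hc
  obtain ⟨d', hd'⟩ := hd
  set H := evalAt (MvPolynomial.eval₂Hom F ![c', d']) PowerSeries.X dvd_rfl with hH
  have hX : PowerSeries.X ∣ H PowerSeries.X := X_dvd_evalAt_X _ _
  have hC : ∀ x : A, H (PowerSeries.C (MvPolynomial.C x)) = F x := fun x => by
    rw [hH, evalAt_C]; simp
  have h0 : H (genSer A 0) = c := by
    rw [genSer, map_mul, hH, evalAt_C, evalAt_X, hc']; simp [mul_comm]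
  have h1 : H (genSer A 1) = d := by
    rw [genSer, map_mul, hH, evalAt_C, evalAt_X, hd']; simp [mul_comm]
  have h2 : ∀ s t : Fin 2, IsUnit ((1 - genSer A s) * (1 - genSer A t)) := fun s t =>
    isUnit_of_X_dvd (X_dvd_genSer s) (X_dvd_genSer t)
  have key := congrArg H hτ
  rw [ringHom_arraySum H hX _ (X_dvd_ratA (X_dvd_genSer _)) (X_dvd_ratA (X_dvd_genSer _)),
    map_ratA H (h2 _ _), map_ratA H (h2 _ _), h0, h1] at key
  simp only [hC] at key
  rw [← key, gen, ← RingHom.comp_apply, comp_eval _ _ _ _ H (by rw [h0, h1]; exact h)]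
  refine RingHom.congr_fun (hom_ext (fun x => ?_) fun t => ?_) τ
  · rw [eval_const, eval_const, RingHom.comp_apply, RingHom.comp_apply, hC]
  · fin_cases t
    · exact (eval_coord_zero F c d h).trans (h0.symm.trans (eval_coord_zero _ _ _ _).symm)
    · exact (eval_coord_one F c d h).trans (h1.symm.trans (eval_coord_one _ _ _ _).symm)

lemma Represents.unique {τ τ' : TRing A} {g : ℕ → ℕ → A} (h : Represents τ g)
    (h' : Represents τ' g) : τ = τ' :=
  gen_injective (h.trans h'.symm)

lemma Represents.sum {ι : Type} {s : Finset ι} {τ : ι → TRing A} {g : ι → ℕ → ℕ → A} (x : ι → A)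
    (h : ∀ i ∈ s, Represents (τ i) (g i)) :
    Represents (∑ i ∈ s, const A (x i) * τ i) fun I J => ∑ i ∈ s, x i * g i I J := by
  have hx : ∀ x, gen A (const A x) = PowerSeries.C (MvPolynomial.C x) := fun x =>
    eval_const _ _ _ _ x
  rw [Represents, map_sum]
  simp only [map_sum, map_mul]
  rw [arraySum_finset_sum]
  refine Finset.sum_congr rfl fun i hi => ?_
  rw [h i hi, hx, mul_arraySum _ _ (X_dvd_ratA (X_dvd_genSer _)) (X_dvd_ratA (X_dvd_genSer _))]

lemma Represents.map (f : A →+* A') {τ : TRing A} {g : ℕ → ℕ → A} (h : Represents τ g) :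
    Represents (TRing.map f τ) fun i j => f (g i j) := by
  rw [Represents, gen, eval_map, h.eval_eq _ (X_dvd_genSer _) (X_dvd_genSer _)]
  rfl

end TRing

end TRing

/-! ### The coefficients of the integral as rational functions -/

section Decomposition

variable {K : Type} [Field K] [CharZero K]

/-- Each 1 - z^j w divides 1 - w^m. Inverting the discriminant at the m-th powers therefore inverts
the denominators that occur in `rPsi`. -/
lemma isUnit_one_sub_mul_of_pow {S : Type} [CommRing S] {m : ℕ} {z w : S} (hz : z ^ m = 1)
    (h : IsUnit (1 - w ^ m)) (j : ℕ) : IsUnit (1 - z ^ j * w) := by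
  refine isUnit_of_dvd_unit ?_ h
  have := one_sub_dvd_one_sub_pow (z ^ j * w) m
  rwa [mul_pow, ← pow_mul, mul_comm j, pow_mul, hz, one_pow, one_mul] at this

/-- The coefficient is computed once in the localisation of K[w₁, w₂, u] at the discriminant, where
it has a numerator N. Naturality carries the identity to all other points. -/
lemma exists_coeff_rPsi_mul_disc {m : ℕ} (hm : m ≠ 0) {z : K} (hz : z ^ m = 1) (k : ℕ) :
    ∃ (N : MvPolynomial (Fin 3) K) (e : ℕ), ∀ (S : Type) [CommRing S] [Algebra ℚ S] (f : K →+* S)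
      (w₁ w₂ u : S), IsUnit (disc (w₁ ^ m) (w₂ ^ m)) →
      PowerSeries.coeff k (rPsi m (f z) w₁ w₂ u) * disc (w₁ ^ m) (w₂ ^ m) ^ e =
        MvPolynomial.eval₂Hom f ![w₁, w₂, u] N := by
  set P := MvPolynomial (Fin 3) K with hP
  set D : P := disc (MvPolynomial.X 0 ^ m) (MvPolynomial.X 1 ^ m) with hD
  set L := Localization.Away D with hL
  set ι : P →+* L := algebraMap P L with hι
  -- `rPsi` needs a ℚ-algebra; the structure comes from the constants K.
  let _ : Algebra ℚ L := ((ι.comp MvPolynomial.C).comp (algebraMap ℚ K)).toAlgebra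
  have hu : IsUnit (disc (ι (MvPolynomial.X 0) ^ m) (ι (MvPolynomial.X 1) ^ m)) := by
    rw [← map_pow, ← map_pow, ← map_disc]
    exact IsLocalization.Away.algebraMap_isUnit D
  have hz' : ι (MvPolynomial.C z) ^ m = 1 := by rw [← map_pow, ← map_pow, hz, map_one, map_one]
  have h1 := isUnit_one_sub_mul_of_pow hz' (isUnit_of_mul_isUnit_left (isUnit_of_disc hu))
  have h2 := isUnit_one_sub_mul_of_pow hz' (isUnit_of_mul_isUnit_right (isUnit_of_disc hu))
  have h3 := isUnit_of_mul_isUnit_right hu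
  set x := PowerSeries.coeff k (rPsi m (ι (MvPolynomial.C z)) (ι (MvPolynomial.X 0))
    (ι (MvPolynomial.X 1)) (ι (MvPolynomial.X 2))) with hx
  obtain ⟨e, N, h⟩ := IsLocalization.Away.surj D x
  refine ⟨N, e, fun S _ _ f w₁ w₂ u hS => ?_⟩
  set F : P →+* S := MvPolynomial.eval₂Hom f ![w₁, w₂, u] with hF
  have hF0 : F (MvPolynomial.X 0) = w₁ := MvPolynomial.eval₂Hom_X' f _ 0
  have hF1 : F (MvPolynomial.X 1) = w₂ := MvPolynomial.eval₂Hom_X' f _ 1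
  have hF2 : F (MvPolynomial.X 2) = u := MvPolynomial.eval₂Hom_X' f _ 2
  have hFC : F (MvPolynomial.C z) = f z := MvPolynomial.eval₂Hom_C f _ z
  have hFD : F D = disc (w₁ ^ m) (w₂ ^ m) := by
    rw [hD, map_disc, map_pow, map_pow, hF0, hF1]
  set G : L →+* S := IsLocalization.Away.lift D (g := F) (by rw [hFD]; exact hS) with hG
  have hGι : ∀ y, G (ι y) = F y := fun y => IsLocalization.Away.lift_eq _ _ _
  have h4 := congrArg G h
  rw [map_mul, map_pow, hGι, hGι, hFD, hx, ← PowerSeries.coeff_map, map_rPsi G hm h1 h2 h3, hGι, hGι,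
    hGι, hGι, hF0, hF1, hF2, hFC] at h4
  exact h4

/-- The function `-(1 - c) (1 - d)`. -/
def negProd {S : Type} [CommRing S] (c d : S) : S := -((1 - c) * (1 - d))

/-- Divide the exponents of each monomial by m and use u^m = -(1 - c)(1 - d) to eliminate the m-th
powers of u. -/
lemma exists_residue_decomposition {m : ℕ} (hm : m ≠ 0) (N : MvPolynomial (Fin 3) K) :
    ∃ Q : ℕ → ℕ → ℕ → MvPolynomial (Fin 2) K, ∀ (S : Type) [CommRing S] (f : K →+* S)
      (w₁ w₂ u : S), u ^ m = negProd (w₁ ^ m) (w₂ ^ m) →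
      MvPolynomial.eval₂Hom f ![w₁, w₂, u] N = ∑ r ∈ Finset.range m, ∑ s ∈ Finset.range m,
        ∑ t ∈ Finset.range m, w₁ ^ r * w₂ ^ s * u ^ t *
          MvPolynomial.eval₂Hom f ![w₁ ^ m, w₂ ^ m] (Q r s t) := by
  induction N using MvPolynomial.induction_on' with
  | monomial n x =>
    refine ⟨fun r s t => if r = n 0 % m then if s = n 1 % m then if t = n 2 % m then
      MvPolynomial.C x * MvPolynomial.X 0 ^ (n 0 / m) * MvPolynomial.X 1 ^ (n 1 / m) *
        negProd (MvPolynomial.X 0) (MvPolynomial.X 1) ^ (n 2 / m) else 0 else 0 else 0, ?_⟩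
    intro S _ f w₁ w₂ u hu
    have hlt : ∀ t, n t % m ∈ Finset.range m := fun t =>
      Finset.mem_range.2 (Nat.mod_lt _ (Nat.pos_of_ne_zero hm))
    rw [Finset.sum_eq_single_of_mem _ (hlt 0), Finset.sum_eq_single_of_mem _ (hlt 1),
      Finset.sum_eq_single_of_mem _ (hlt 2)]
    · simp only [if_true]
      rw [MvPolynomial.coe_eval₂Hom, MvPolynomial.eval₂_monomial, Finsupp.prod_fintype _ _ (by simp)]
      simp only [Fin.prod_univ_three, map_mul, map_pow, negProd, map_neg, map_sub, map_one,
        MvPolynomial.coe_eval₂Hom, MvPolynomial.eval₂_C, MvPolynomial.eval₂_X]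
      simp only [Matrix.cons_val_zero, Matrix.cons_val_one, Matrix.cons_val]
      rw [negProd] at hu
      rw [← hu, ← pow_mul, ← pow_mul, ← pow_mul]
      have e : ∀ (y : S) (l : ℕ), y ^ l = y ^ (l % m) * y ^ (m * (l / m)) := fun y l => by
        rw [← pow_add, Nat.mod_add_div]
      rw [e w₁ (n 0), e w₂ (n 1), e u (n 2)]
      ring
    · intro t _ ht
      simp [ht]
    · intro s _ hs
      simp [hs]
    · intro r _ hr
      simp [hr]
  | add p q hp hq =>
    obtain ⟨Q, hQ⟩ := hp
    obtain ⟨Q', hQ'⟩ := hq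
    refine ⟨fun r s t => Q r s t + Q' r s t, fun S _ f w₁ w₂ u hu => ?_⟩
    rw [map_add, hQ S f w₁ w₂ u hu, hQ' S f w₁ w₂ u hu]
    simp only [map_add, mul_add, Finset.sum_add_distrib]

end Decomposition

/-! ### Separating residue classes by roots of unity -/

section Orthogonality

variable {S : Type} [CommRing S] [IsDomain S]

/-- A Vandermonde argument: the powers ζ^l with l < m are distinct. -/
lemma eq_zero_of_forall_sum_pow_mul {m : ℕ} {ζ : S} (hζ : IsPrimitiveRoot ζ m) {v : ℕ → S}
    (h : ∀ l < m, ∑ r ∈ Finset.range m, ζ ^ (l * r) * v r = 0) : ∀ r < m, v r = 0 := by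
  intro r hr
  have hinj : Function.Injective fun l : Fin m => ζ ^ (l : ℕ) := fun l l' hl =>
    Fin.ext (hζ.pow_inj l.2 l'.2 hl)
  have := Matrix.eq_zero_of_forall_index_sum_pow_mul_eq_zero hinj (v := fun r : Fin m => v r) ?_
  · exact congrFun this ⟨r, hr⟩
  · intro l
    rw [← h l l.2, Finset.sum_range]
    simp only [pow_mul]

lemma eq_zero_of_forall_triple_sum {m : ℕ} {ζ : S} (hζ : IsPrimitiveRoot ζ m)
    {v : ℕ → ℕ → ℕ → S}
    (h : ∀ l₁ < m, ∀ l₂ < m, ∀ l₃ < m, ∑ r ∈ Finset.range m, ∑ s ∈ Finset.range m,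
      ∑ t ∈ Finset.range m, ζ ^ (l₁ * r) * (ζ ^ (l₂ * s) * (ζ ^ (l₃ * t) * v r s t)) = 0) :
    ∀ r < m, ∀ s < m, ∀ t < m, v r s t = 0 := by
  intro r hr s hs
  refine eq_zero_of_forall_sum_pow_mul hζ fun l₃ h₃ => ?_
  refine eq_zero_of_forall_sum_pow_mul hζ (v := fun s => ∑ t ∈ Finset.range m,
    ζ ^ (l₃ * t) * v r s t) (fun l₂ h₂ => ?_) s hs
  refine eq_zero_of_forall_sum_pow_mul hζ (v := fun r => ∑ s ∈ Finset.range m, ζ ^ (l₂ * s) *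
    ∑ t ∈ Finset.range m, ζ ^ (l₃ * t) * v r s t) (fun l₁ h₁ => ?_) r hr
  rw [← h l₁ h₁ l₂ h₂ l₃ h₃]
  simp only [Finset.mul_sum]

/-- The residue `t` modulo `m` with `m ∣ r + s + t`. -/
def complResidue (m r s : ℕ) : ℕ := ((m - 1) * (r + s)) % m

lemma dvd_add_iff_eq_complResidue {m : ℕ} (hm : m ≠ 0) {r s t : ℕ} (ht : t < m) :
    m ∣ r + s + t ↔ t = complResidue m r s := by
  have h1 : m ∣ r + s + complResidue m r s := by
    rw [complResidue, Nat.dvd_iff_mod_eq_zero, Nat.add_mod_mod]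
    obtain ⟨n, rfl⟩ := Nat.exists_eq_succ_of_ne_zero hm
    rw [show r + s + (n.succ - 1) * (r + s) = n.succ * (r + s) by
      simp only [Nat.succ_eq_add_one, Nat.add_sub_cancel]; ring]
    exact Nat.mul_mod_right _ _
  refine ⟨fun h2 => ?_, fun h => h ▸ h1⟩
  have h3 : r + s + t ≡ r + s + complResidue m r s [MOD m] :=
    ((Nat.modEq_zero_iff_dvd.2 h2).trans (Nat.modEq_zero_iff_dvd.2 h1).symm)
  exact Nat.ModEq.eq_of_lt_of_lt (Nat.ModEq.add_left_cancel' _ h3) ht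
    (Nat.mod_lt _ (Nat.pos_of_ne_zero hm))

end Orthogonality

/-! ### Expansion at m-th powers of the variables -/

section Expansion

variable {A : Type} [CommRing A]

lemma evalAt_X_pow_injective {R S : Type} [CommRing R] [CommRing S] {φ : R →+* S}
    (hφ : Function.Injective φ) {e : ℕ} (he : e ≠ 0) :
    Function.Injective (evalAt (PowerSeries.C.comp φ) ((PowerSeries.X : S⟦X⟧) ^ e)
      (dvd_pow_self _ he)) := by
  rw [injective_iff_map_eq_zero]
  intro f hf
  ext n
  have h := congrArg (PowerSeries.coeff (e * n)) hf
  rw [evalAt_apply, coeff_adicSum, map_zero, Finset.sum_eq_single n] at h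
  · rw [← pow_mul, RingHom.comp_apply, PowerSeries.coeff_C_mul, PowerSeries.coeff_X_pow_self,
      mul_one] at h
    rw [map_zero]
    exact hφ (h.trans (map_zero φ).symm)
  · intro k _ hk
    rw [← pow_mul, RingHom.comp_apply, PowerSeries.coeff_C_mul, PowerSeries.coeff_X_pow,
      if_neg (fun h' => hk (Nat.eq_of_mul_eq_mul_left (Nat.pos_of_ne_zero he) h'.symm)), mul_zero]
  · intro h'
    exact absurd (Finset.mem_range.2 (Nat.lt_succ_of_le
      (Nat.le_mul_of_pos_left n (Nat.pos_of_ne_zero he)))) h'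

/-- The substitution `c ↦ c ^ m`, `d ↦ d ^ m`, with `ε` replaced by `ε ^ (4 m)`. -/
def powHom (A : Type) [CommRing A] {m : ℕ} (hm : m ≠ 0) :
    (MvPolynomial (Fin 2) A)⟦X⟧ →+* (MvPolynomial (Fin 2) A)⟦X⟧ :=
  evalAt (PowerSeries.C.comp (MvPolynomial.expand m).toRingHom) (PowerSeries.X ^ (4 * m))
    (dvd_pow_self _ (mul_ne_zero four_ne_zero hm))

lemma powHom_injective {m : ℕ} (hm : m ≠ 0) : Function.Injective (powHom A hm) :=
  evalAt_X_pow_injective (MvPolynomial.expand_injective (Nat.pos_of_ne_zero hm))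
    (mul_ne_zero four_ne_zero hm)

lemma powHom_C {m : ℕ} (hm : m ≠ 0) (x : A) :
    powHom A hm (PowerSeries.C (MvPolynomial.C x)) = PowerSeries.C (MvPolynomial.C x) := by
  rw [powHom, evalAt_C, RingHom.comp_apply]
  exact congrArg _ (MvPolynomial.expand_C _ _)

lemma powHom_genSer {m : ℕ} (hm : m ≠ 0) (t : Fin 2) :
    powHom A hm (TRing.genSer A t) = wSer (MvPolynomial.X t) ^ m := by
  rw [powHom, TRing.genSer, map_mul, evalAt_C, evalAt_X, RingHom.comp_apply, wSer, mul_pow, ← pow_mul]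
  congr 1
  rw [← map_pow]
  exact congrArg _ (MvPolynomial.expand_X _ _)

lemma X_dvd_powHom_X {m : ℕ} (hm : m ≠ 0) : PowerSeries.X ∣ powHom A hm PowerSeries.X :=
  X_dvd_evalAt_X _ _

/-- The ring of rational functions, evaluated at `c = w₁ ^ m`, `d = w₂ ^ m`. -/
lemma powHom_gen {m : ℕ} (hm : m ≠ 0) (τ : TRing A) (h : IsUnit
      (disc (wSer (MvPolynomial.X 0 : MvPolynomial (Fin 2) A) ^ m) (wSer (MvPolynomial.X 1) ^ m))) :
    powHom A hm (TRing.gen A τ) = TRing.eval (PowerSeries.C.comp MvPolynomial.C)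
      (wSer (MvPolynomial.X 0) ^ m) (wSer (MvPolynomial.X 1) ^ m) h τ := by
  rw [TRing.gen, TRing.map_eval]
  refine RingHom.congr_fun (TRing.hom_ext (fun x => ?_) fun t => ?_) τ
  · rw [TRing.eval_const, TRing.eval_const, RingHom.comp_apply, RingHom.comp_apply, powHom_C]
  · fin_cases t
    · exact (TRing.eval_coord_zero _ _ _ _).trans ((powHom_genSer hm 0).trans
        (TRing.eval_coord_zero _ _ _ h).symm)
    · exact (TRing.eval_coord_one _ _ _ _).trans ((powHom_genSer hm 1).trans
        (TRing.eval_coord_one _ _ _ h).symm)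

/-- The substitution `powHom` carries the generic point to (w₁^m, w₂^m) and is injective, so it
suffices to compare the expansions there. -/
lemma represents_of_eval_wSer {m : ℕ} (hm : m ≠ 0) {τ : TRing A} {g : ℕ → ℕ → A} (h : IsUnit
      (disc (wSer (MvPolynomial.X 0 : MvPolynomial (Fin 2) A) ^ m) (wSer (MvPolynomial.X 1) ^ m)))
    (hτ : TRing.eval (PowerSeries.C.comp MvPolynomial.C)
      (wSer (MvPolynomial.X 0) ^ m) (wSer (MvPolynomial.X 1) ^ m) h τ =
      arraySum (fun i j => PowerSeries.C (MvPolynomial.C (g i j)))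
        (ratA (wSer (MvPolynomial.X 0) ^ m) (wSer (MvPolynomial.X 1) ^ m))
        (ratA (wSer (MvPolynomial.X 1) ^ m) (wSer (MvPolynomial.X 0) ^ m))) :
    TRing.Represents τ g := by
  refine powHom_injective hm ?_
  have h2 : ∀ s t : Fin 2, IsUnit ((1 - TRing.genSer A s) * (1 - TRing.genSer A t)) := fun s t =>
    TRing.isUnit_of_X_dvd (TRing.X_dvd_genSer s) (TRing.X_dvd_genSer t)
  rw [powHom_gen hm τ h, hτ, ringHom_arraySum _ (X_dvd_powHom_X hm) _
    (TRing.X_dvd_ratA (TRing.X_dvd_genSer _)) (TRing.X_dvd_ratA (TRing.X_dvd_genSer _)),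
    map_ratA _ (h2 _ _), map_ratA _ (h2 _ _), powHom_genSer, powHom_genSer]
  simp only [powHom_C]

lemma eval₂Hom_wSer_pow_injective {m : ℕ} (hm : m ≠ 0) :
    Function.Injective (MvPolynomial.eval₂Hom (PowerSeries.C.comp MvPolynomial.C)
      ![wSer (MvPolynomial.X 0 : MvPolynomial (Fin 2) A) ^ m, wSer (MvPolynomial.X 1) ^ m]) := by
  have h := (powHom_injective hm).comp (TRing.eval₂Hom_mul_X_injective (A := A))
  rw [← RingHom.coe_comp] at h
  convert h using 2
  refine MvPolynomial.ringHom_ext (fun x => ?_) fun t => ?_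
  · rw [RingHom.comp_apply, MvPolynomial.coe_eval₂Hom, MvPolynomial.eval₂_C,
      MvPolynomial.coe_eval₂Hom, MvPolynomial.eval₂_C, RingHom.comp_apply, powHom_C]
  · rw [RingHom.comp_apply, MvPolynomial.coe_eval₂Hom, MvPolynomial.eval₂_X,
      MvPolynomial.coe_eval₂Hom, MvPolynomial.eval₂_X]
    fin_cases t
    · exact (powHom_genSer hm 0).symm
    · exact (powHom_genSer hm 1).symm

end Expansion

/-! ### Rationality of each residue class -/

section Residues

variable {K : Type} [Field K] [CharZero K]

lemma ratA_eq_mul_pow {S : Type} [CommRing S] {m : ℕ} {u u' c d : S} (huu : u * u' = 1)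
    (hu : u ^ m = negProd c d) (h : IsUnit ((1 - c) * (1 - d))) : ratA c d = c * u' ^ m := by
  have h1 := ratA_mul h
  have h2 : u ^ m * u' ^ m = 1 := by rw [← mul_pow, huu, one_pow]
  rw [hu, negProd] at h2
  linear_combination ratA c d * (-h2) - u' ^ m * h1

lemma negProd_comm {S : Type} [CommRing S] (c d : S) : negProd c d = negProd d c := by
  rw [negProd, negProd, mul_comm]

/-- Multiplying w₁, w₂, u by m-th roots of unity changes neither c, d nor u^m, so the closed formula
holds at all m³ twisted points and orthogonality isolates each class (r, s, t). On the series side u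
occurs as u^{-(I+J)}, so only the classes with m ∣ r + s + t receive a contribution. -/
lemma residue_identity {B : Type} [CommRing B] [IsDomain B] [Algebra ℚ B] (f : K →+* B)
    {m : ℕ} (hm : m ≠ 0) {z i u₀ u₀' : K} (hz : IsPrimitiveRoot z m)
    (hi : i ^ 2 = -1) (hu : u₀ ^ m = -1) (huu : u₀ * u₀' = 1) {x₁ x₂ : B} (σ : B →+* B[X])
    (hσ : ∀ x, σ (f x) = Polynomial.C (f x)) (h₁ : σ x₁ = Polynomial.C x₁ * Polynomial.X ^ 4)
    (h₂ : σ x₂ = Polynomial.C x₂ * Polynomial.X ^ 4) (k : ℕ)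
    {N : MvPolynomial (Fin 3) K} {e : ℕ}
    (hN : ∀ (S : Type) [CommRing S] [Algebra ℚ S] (f : K →+* S)
      (w₁ w₂ u : S), IsUnit (disc (w₁ ^ m) (w₂ ^ m)) →
      PowerSeries.coeff k (rPsi m (f z) w₁ w₂ u) * disc (w₁ ^ m) (w₂ ^ m) ^ e =
        MvPolynomial.eval₂Hom f ![w₁, w₂, u] N)
    {Q : ℕ → ℕ → ℕ → MvPolynomial (Fin 2) K}
    (hQ : ∀ (S : Type) [CommRing S] (f : K →+* S)
      (w₁ w₂ u : S), u ^ m = negProd (w₁ ^ m) (w₂ ^ m) →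
      MvPolynomial.eval₂Hom f ![w₁, w₂, u] N = ∑ r ∈ Finset.range m, ∑ s ∈ Finset.range m,
        ∑ t ∈ Finset.range m, w₁ ^ r * w₂ ^ s * u ^ t *
          MvPolynomial.eval₂Hom f ![w₁ ^ m, w₂ ^ m] (Q r s t)) {W₁ W₂ : B⟦X⟧}
    (hW₁ : W₁ = wSer x₁) (hW₂ : W₂ = wSer x₂) :
    ∃ U U' : B⟦X⟧, U * U' = 1 ∧ U ^ m = negProd (W₁ ^ m) (W₂ ^ m) ∧
      ∀ r < m, ∀ s < m, ∀ t < m,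
        W₁ ^ r * W₂ ^ s * U ^ t *
          MvPolynomial.eval₂Hom (PowerSeries.C.comp f) ![W₁ ^ m, W₂ ^ m] (Q r s t) +
        (if m ∣ r + s + t then disc (W₁ ^ m) (W₂ ^ m) ^ e * ((W₁ * U') ^ r * (W₂ * U') ^ s *
          arraySum (fun I J => PowerSeries.C (f (PowerSeries.coeff k
            (qSummand (expSer z) (expNegSer (z ^ (m - 1))) (m * I + r) (m * J + s)))))
            (ratA (W₁ ^ m) (W₂ ^ m)) (ratA (W₂ ^ m) (W₁ ^ m))) else 0) = 0 := by
  have hX₁ : PowerSeries.X ∣ W₁ := hW₁ ▸ X_dvd_wSer x₁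
  have hX₂ : PowerSeries.X ∣ W₂ := hW₂ ▸ X_dvd_wSer x₂
  have hc := hX₁.trans (dvd_pow_self _ hm)
  have hd := hX₂.trans (dvd_pow_self _ hm)
  set a := logRoot m W₁ W₂ with ha
  have haX : PowerSeries.X ∣ a := X_dvd_logRoot hm hX₁ hX₂
  set U := PowerSeries.C (f u₀) * expo a with hU
  set U' := PowerSeries.C (f u₀') * expo (-a) with hU'
  have hUU : U * U' = 1 := by
    rw [hU, hU', mul_mul_mul_comm, ← map_mul, ← map_mul, huu, expo_mul_expo_neg haX, map_one, map_one,
      one_mul]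
  have hUm : U ^ m = negProd (W₁ ^ m) (W₂ ^ m) := by
    rw [hU, mul_pow, expo_logRoot_pow hm hX₁ hX₂, ← map_pow, ← map_pow, hu, map_neg, map_neg, map_one,
      map_one, negProd, neg_one_mul]
  refine ⟨U, U', hUU, hUm, ?_⟩
  set ζ : B⟦X⟧ := PowerSeries.C (f z) with hζ
  have hζp : IsPrimitiveRoot ζ m :=
    (hz.map_of_injective f.injective).map_of_injective PowerSeries.C_injective
  have hζm : ζ ^ m = 1 := hζp.pow_eq_one
  have hζl : ∀ l : ℕ, (ζ ^ l) ^ m = 1 := fun l => by rw [← pow_mul, mul_comm, pow_mul, hζm, one_pow]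
  have hzl : ∀ l : ℕ, (z ^ l) ^ m = 1 := fun l => by
    rw [← pow_mul, mul_comm, pow_mul, hz.pow_eq_one, one_pow]
  refine eq_zero_of_forall_triple_sum hζp fun l₁ _ l₂ _ l₃ _ => ?_
  have hw₁ : wSer (f (z ^ l₁) * x₁) = ζ ^ l₁ * W₁ := by
    rw [mul_comm, wSer_mul, hW₁, hζ, ← map_pow, ← map_pow]
  have hw₂ : wSer (f (z ^ l₂) * x₂) = ζ ^ l₂ * W₂ := by
    rw [mul_comm, wSer_mul, hW₂, hζ, ← map_pow, ← map_pow]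
  have hp₁ : (ζ ^ l₁ * W₁) ^ m = W₁ ^ m := by rw [mul_pow, hζl, one_mul]
  have hp₂ : (ζ ^ l₂ * W₂) ^ m = W₂ ^ m := by rw [mul_pow, hζl, one_mul]
  have hp₃ : (ζ ^ l₃ * U) ^ m = U ^ m := by rw [mul_pow, hζl, one_mul]
  -- The power ζ^n is the inverse of ζ^{l₃}, and is used to twist u⁻¹.
  set n := (m - 1) * l₃ with hn
  have hnl : l₃ + n = m * l₃ := by
    rw [hn]
    obtain ⟨m', rfl⟩ := Nat.exists_eq_succ_of_ne_zero hm
    simp only [Nat.succ_eq_add_one, Nat.add_sub_cancel]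
    ring
  have hα : ∀ W : B⟦X⟧, ∀ l : ℕ, (ζ ^ l * W * (ζ ^ n * U')) ^ m = W ^ m * U' ^ m := fun W l => by
    rw [mul_pow, mul_pow, mul_pow, hζl, hζl, one_mul, one_mul]
  have key := coeff_rPsi_wSer f hm hz hi (u₀ := z ^ l₃ * u₀) (u' := z ^ n * u₀')
    (by rw [mul_pow, hzl, one_mul, hu])
    (by rw [mul_mul_mul_comm, huu, ← pow_add, hnl, pow_mul, hz.pow_eq_one, one_pow, mul_one])
    (ω₁ := f (z ^ l₁) * x₁) (ω₂ := f (z ^ l₂) * x₂) σ hσ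
    (by rw [map_mul, hσ, h₁, map_mul, mul_assoc]) (by rw [map_mul, hσ, h₂, map_mul, mul_assoc])
    (a := a) (by rw [ha, logRoot, logRoot, hw₁, hw₂, hp₁, hp₂]) k
  have e1 : PowerSeries.C (f (z ^ l₃ * u₀)) * expo a = ζ ^ l₃ * U := by
    rw [map_mul, map_mul, mul_assoc, ← hU, map_pow, map_pow]
  have e2 : PowerSeries.C (f (z ^ n * u₀')) * expo (-a) = ζ ^ n * U' := by
    rw [map_mul, map_mul, mul_assoc, ← hU', map_pow, map_pow]
  rw [hw₁, hw₂, e1, e2, ← hζ, arraySum_interleave _ ((hX₁.mul_left _).mul_right _)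
    ((hX₂.mul_left _).mul_right _) hm, hα, hα] at key
  have hdu : IsUnit (disc (W₁ ^ m) (W₂ ^ m)) := TRing.isUnit_disc_of_X_dvd hc hd
  have k1 := hN B⟦X⟧ (PowerSeries.C.comp f) (ζ ^ l₁ * W₁) (ζ ^ l₂ * W₂) (ζ ^ l₃ * U)
    (by rw [hp₁, hp₂]; exact hdu)
  rw [hQ _ _ _ _ _ (by rw [hp₁, hp₂, hp₃, hUm]), hp₁, hp₂, RingHom.comp_apply, ← hζ, key] at k1
  rw [ratA_eq_mul_pow hUU hUm (isUnit_of_disc hdu),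
    ratA_eq_mul_pow hUU (hUm.trans (negProd_comm _ _)) (by rw [mul_comm]; exact isUnit_of_disc hdu)]
  simp only [mul_add, Finset.sum_add_distrib]
  have k2 : ∀ r s : ℕ, ∀ Y : B⟦X⟧, ∑ t ∈ Finset.range m, ζ ^ (l₁ * r) * (ζ ^ (l₂ * s) * (ζ ^ (l₃ * t) *
      if m ∣ r + s + t then Y else 0)) = ζ ^ (l₁ * r) * ζ ^ (l₂ * s) * (ζ ^ n) ^ (r + s) * Y := by
    intro r s Y
    have ht : complResidue m r s < m := Nat.mod_lt _ (Nat.pos_of_ne_zero hm)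
    rw [Finset.sum_eq_single_of_mem _ (Finset.mem_range.2 ht),
      if_pos ((dvd_add_iff_eq_complResidue hm ht).2 rfl)]
    · rw [mul_comm l₃, pow_mul ζ _ l₃, complResidue, ← pow_eq_pow_mod _ hζm, ← pow_mul, hn]
      ring
    · intro t ht' htne
      rw [if_neg fun h => htne ((dvd_add_iff_eq_complResidue hm (Finset.mem_range.1 ht')).1 h),
        mul_zero, mul_zero, mul_zero]
  simp only [k2]
  have k3 : ∀ r s t : ℕ, ζ ^ (l₁ * r) * (ζ ^ (l₂ * s) * (ζ ^ (l₃ * t) * (W₁ ^ r * W₂ ^ s * U ^ t *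
      MvPolynomial.eval₂Hom (PowerSeries.C.comp f) ![W₁ ^ m, W₂ ^ m] (Q r s t)))) =
      (ζ ^ l₁ * W₁) ^ r * (ζ ^ l₂ * W₂) ^ s * (ζ ^ l₃ * U) ^ t *
      MvPolynomial.eval₂Hom (PowerSeries.C.comp f) ![W₁ ^ m, W₂ ^ m] (Q r s t) := by
    intro r s t
    rw [mul_pow (ζ ^ l₁), mul_pow (ζ ^ l₂), mul_pow (ζ ^ l₃), ← pow_mul, ← pow_mul, ← pow_mul]
    ring
  simp only [k3]
  rw [← k1, neg_mul, neg_add_eq_zero, Finset.sum_mul]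
  refine Finset.sum_congr rfl fun r _ => ?_
  rw [Finset.sum_mul]
  refine Finset.sum_congr rfl fun s _ => ?_
  rw [pow_mul ζ l₁, pow_mul ζ l₂]
  ring

/-- The coefficients of the symmetrised integral are, residue class by residue class, rational
functions whose expansions in `a` and `b` have the coefficients of `q^{-IJ} [I + J, I]_q ^ 2`. -/
theorem exists_rational_coeff {m : ℕ} (hm : m ≠ 0) {z i u₀ : K} (hz : IsPrimitiveRoot z m)
    (hi : i ^ 2 = -1) (hu : u₀ ^ m = -1) (k : ℕ) :
    ∃ τ : ℕ → ℕ → TRing K,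
      (∀ r < m, ∀ s < m, TRing.Represents (τ r s) fun I J => PowerSeries.coeff k
        (qSummand (expSer z) (expNegSer (z ^ (m - 1))) (m * I + r) (m * J + s))) ∧
      ∀ (w₁ w₂ u u' : K) (h : IsUnit (disc (w₁ ^ m) (w₂ ^ m))), u * u' = 1 →
        u ^ m = negProd (w₁ ^ m) (w₂ ^ m) →
        PowerSeries.coeff k (rPsi m z w₁ w₂ u) = -∑ r ∈ Finset.range m, ∑ s ∈ Finset.range m,
          (w₁ * u') ^ r * (w₂ * u') ^ s *
            TRing.eval (RingHom.id K) (w₁ ^ m) (w₂ ^ m) h (τ r s) := by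
  obtain ⟨N, e, hN⟩ := exists_coeff_rPsi_mul_disc hm hz.pow_eq_one k
  obtain ⟨Q, hQ⟩ := exists_residue_decomposition hm N
  have huu : u₀ * u₀⁻¹ = 1 := mul_inv_cancel₀ fun h => by
    rw [h, zero_pow hm] at hu
    exact neg_ne_zero.2 one_ne_zero hu.symm
  obtain ⟨U, U', hUU, hUm, hv⟩ := residue_identity (MvPolynomial.C : K →+* MvPolynomial (Fin 2) K)
    hm hz hi hu huu (x₁ := MvPolynomial.X 0) (x₂ := MvPolynomial.X 1)
    (MvPolynomial.eval₂Hom (Polynomial.C.comp MvPolynomial.C)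
      (fun t => Polynomial.C (MvPolynomial.X t) * Polynomial.X ^ 4))
    (fun x => MvPolynomial.eval₂Hom_C _ _ x) (MvPolynomial.eval₂Hom_X' _ _ 0)
    (MvPolynomial.eval₂Hom_X' _ _ 1) k hN hQ rfl rfl
  set W₁ : (MvPolynomial (Fin 2) K)⟦X⟧ := wSer (MvPolynomial.X 0) with hW₁
  set W₂ : (MvPolynomial (Fin 2) K)⟦X⟧ := wSer (MvPolynomial.X 1) with hW₂
  have hne : ∀ t : Fin 2, wSer (MvPolynomial.X t : MvPolynomial (Fin 2) K) ≠ 0 := fun t =>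
    mul_ne_zero ((map_ne_zero_iff _ PowerSeries.C_injective).2 (MvPolynomial.X_ne_zero t))
      (pow_ne_zero _ PowerSeries.X_ne_zero)
  have hU0 : U ≠ 0 := left_ne_zero_of_mul_eq_one hUU
  have hdu : IsUnit (disc (W₁ ^ m) (W₂ ^ m)) := TRing.isUnit_disc_of_X_dvd
    ((X_dvd_wSer _).trans (dvd_pow_self _ hm)) ((X_dvd_wSer _).trans (dvd_pow_self _ hm))
  have ht : ∀ r s, complResidue m r s < m := fun r s => Nat.mod_lt _ (Nat.pos_of_ne_zero hm)
  have hdvd : ∀ r s, m ∣ r + s + complResidue m r s := fun r s =>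
    (dvd_add_iff_eq_complResidue hm (ht r s)).2 rfl
  -- For a given (r, s) exactly one class t meets the series side; for the others the polynomial
  -- vanishes identically.
  have hQ0 : ∀ r < m, ∀ s < m, ∀ t < m, t ≠ complResidue m r s → Q r s t = 0 := by
    intro r hr s hs t htm hne'
    have h := hv r hr s hs t htm
    rw [if_neg fun h => hne' ((dvd_add_iff_eq_complResidue hm htm).1 h), add_zero] at h
    have h' := (mul_eq_zero.1 h).resolve_left (mul_ne_zero (mul_ne_zero
      (pow_ne_zero _ (hne 0)) (pow_ne_zero _ (hne 1))) (pow_ne_zero _ hU0))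
    exact eval₂Hom_wSer_pow_injective hm (h'.trans (map_zero _).symm)
  have hD1 : ∀ {S : Type} [CommRing S] {c d : S}, IsUnit (disc c d) →
      Ring.inverse (disc c d) ^ e * disc c d ^ e = 1 := fun {S} _ c d h => by
    rw [← mul_pow, Ring.inverse_mul_cancel _ h, one_pow]
  -- Dividing by (w₁/u)^r (w₂/u)^s leaves u^{r+s+t}, which is a power of u^m because m ∣ r + s + t,
  -- hence a polynomial in c and d.
  let τ : ℕ → ℕ → TRing K := fun r s =>
    -(negProd (TRing.coord K 0) (TRing.coord K 1) ^ ((r + s + complResidue m r s) / m) *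
      algebraMap _ _ (Q r s (complResidue m r s)) *
        Ring.inverse (disc (TRing.coord K 0) (TRing.coord K 1)) ^ e)
  have hτ : ∀ (S : Type) [CommRing S] (f : K →+* S) (c d : S) (h : IsUnit (disc c d)) (r s : ℕ),
      TRing.eval f c d h (τ r s) * disc c d ^ e =
        -(negProd c d ^ ((r + s + complResidue m r s) / m) *
          MvPolynomial.eval₂Hom f ![c, d] (Q r s (complResidue m r s))) := by
    intro S _ f c d h r s
    have h1 : TRing.eval f c d h (negProd (TRing.coord K 0) (TRing.coord K 1)) = negProd c d := by
      simp only [negProd, map_neg, map_mul, map_sub, map_one, TRing.eval_coord_zero,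
        TRing.eval_coord_one]
    have h2 : TRing.eval f c d h (disc (TRing.coord K 0) (TRing.coord K 1)) = disc c d := by
      rw [map_disc, TRing.eval_coord_zero, TRing.eval_coord_one]
    simp only [τ]
    rw [map_neg, map_mul, map_mul, map_pow, map_pow, h1, map_ringInverse _ TRing.isUnit_disc, h2,
      TRing.eval_algebraMap, neg_mul, mul_assoc, hD1 h, mul_one]
  refine ⟨τ, fun r hr s hs => ?_, fun w₁ w₂ u u' h huu' hum => ?_⟩
  · refine represents_of_eval_wSer hm hdu ((hdu.pow e).mul_left_injective ?_)
    dsimp only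
    rw [hτ]
    have h := hv r hr s hs _ (ht r s)
    rw [if_pos (hdvd r s)] at h
    have h1 : W₁ ^ r * W₂ ^ s ≠ 0 := mul_ne_zero (pow_ne_zero _ (hne 0)) (pow_ne_zero _ (hne 1))
    refine mul_left_cancel₀ h1 ?_
    have h2 : U ^ (r + s) * U' ^ (r + s) = 1 := by rw [← mul_pow, hUU, one_pow]
    have h3 : negProd (W₁ ^ m) (W₂ ^ m) ^ ((r + s + complResidue m r s) / m) =
        U ^ (r + s) * U ^ complResidue m r s := by
      rw [← hUm, ← pow_mul, Nat.mul_div_cancel' (hdvd r s), pow_add]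
    rw [h3]
    rw [mul_pow, mul_pow] at h
    rw [pow_add U'] at h2
    linear_combination -(U ^ (r + s)) * h + disc (W₁ ^ m) (W₂ ^ m) ^ e * (W₁ ^ r * W₂ ^ s) *
      arraySum (fun I J => PowerSeries.C (MvPolynomial.C (PowerSeries.coeff k
            (qSummand (expSer z) (expNegSer (z ^ (m - 1))) (m * I + r) (m * J + s)))))
            (ratA (W₁ ^ m) (W₂ ^ m)) (ratA (W₂ ^ m) (W₁ ^ m)) * h2
  · refine (h.pow e).mul_left_injective ?_
    dsimp only
    have h1 := hN K (RingHom.id K) w₁ w₂ u h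
    rw [RingHom.id_apply] at h1
    rw [h1, hQ K _ _ _ _ hum, neg_mul, Finset.sum_mul, ← Finset.sum_neg_distrib]
    refine Finset.sum_congr rfl fun r hr => ?_
    rw [Finset.sum_mul, ← Finset.sum_neg_distrib]
    refine Finset.sum_congr rfl fun s hs => ?_
    rw [Finset.sum_eq_single_of_mem _ (Finset.mem_range.2 (ht r s))]
    · have h2 := hτ K (RingHom.id K) (w₁ ^ m) (w₂ ^ m) h r s
      have h3 : negProd (w₁ ^ m) (w₂ ^ m) ^ ((r + s + complResidue m r s) / m) =
          u ^ (r + s) * u ^ complResidue m r s := by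
        rw [← hum, ← pow_mul, Nat.mul_div_cancel' (hdvd r s), pow_add]
      have h4 : u ^ (r + s) * u' ^ (r + s) = 1 := by rw [← mul_pow, huu', one_pow]
      rw [mul_assoc _ (TRing.eval _ _ _ _ _), h2, h3, mul_pow, mul_pow]
      rw [pow_add u'] at h4
      linear_combination -(w₁ ^ r * w₂ ^ s * u ^ complResidue m r s * MvPolynomial.eval₂Hom
        (RingHom.id K) ![w₁ ^ m, w₂ ^ m] (Q r s (complResidue m r s))) * h4
    · intro t htm hne'
      rw [hQ0 r (Finset.mem_range.1 hr) s (Finset.mem_range.1 hs) t (Finset.mem_range.1 htm) hne',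
        map_zero, mul_zero]

end Residues

/-! ### Expansion in `q - z` and integrality -/

section Shifted

/-- The power series `q = z + (q - z)`. -/
def shiftSer {A : Type} [CommRing A] (z : A) : A⟦X⟧ := PowerSeries.C z + PowerSeries.X

lemma isUnit_shiftSer {A : Type} [CommRing A] {z : A} (hz : IsUnit z) : IsUnit (shiftSer z) := by
  rw [PowerSeries.isUnit_iff_constantCoeff, shiftSer]
  simpa using hz

/-- The expansion of `q^{-IJ} [I + J, I]_q ^ 2` in powers of `q - z`. -/
def shiftArray {A : Type} [CommRing A] (z : A) (I J : ℕ) : A⟦X⟧ :=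
  qSummand (shiftSer z) (Ring.inverse (shiftSer z)) I J

lemma map_shiftArray {A A' : Type} [CommRing A] [CommRing A'] (f : A →+* A') {z : A}
    (hz : IsUnit z) (I J : ℕ) :
    PowerSeries.map f (shiftArray z I J) = shiftArray (f z) I J := by
  rw [shiftArray, map_qSummand, map_ringInverse _ (isUnit_shiftSer hz), shiftSer, map_add,
    PowerSeries.map_C, PowerSeries.map_X, shiftArray, shiftSer]

lemma subst_eq_evalAt {R : Type} [CommRing R] {G : R⟦X⟧} (hG : PowerSeries.X ∣ G) (f : R⟦X⟧) :
    PowerSeries.subst G f = evalAt PowerSeries.C G hG f := by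
  have h0 := PowerSeries.X_dvd_iff.1 hG
  ext n
  rw [PowerSeries.coeff_subst' (PowerSeries.HasSubst.of_constantCoeff_zero' h0), evalAt_apply,
    coeff_adicSum, finsum_eq_sum_of_support_subset (s := Finset.range (n + 1))]
  · simp
  · intro k hk
    rw [Finset.coe_range, Set.mem_Iio]
    by_contra h
    refine hk ?_
    change PowerSeries.coeff k f • PowerSeries.coeff n (G ^ k) = 0
    rw [PowerSeries.X_pow_dvd_iff.1 (pow_dvd_pow_of_dvd hG k) n (by omega), smul_zero]

variable {K : Type} [Field K] [CharZero K]

/-- The power series `z (e^ħ - 1)`. -/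
def expShift (z : K) : K⟦X⟧ := PowerSeries.C z * (PowerSeries.exp K - 1)

lemma X_dvd_expShift (z : K) : PowerSeries.X ∣ expShift z := by
  rw [PowerSeries.X_dvd_iff, expShift]
  simp

/-- The coefficient of `ħ ^ k` in `(z (e^ħ - 1)) ^ l`. -/
def expShiftCoeff (z : K) (k l : ℕ) : K := PowerSeries.coeff k (expShift z ^ l)

lemma expShiftCoeff_self (z : K) (k : ℕ) : expShiftCoeff z k k = z ^ k := by
  have h1 : expShift z = PowerSeries.X * (PowerSeries.C z * PowerSeries.mk fun n =>
      algebraMap ℚ K (1 / (n + 1).factorial)) := by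
    ext n
    rw [expShift, mul_left_comm, PowerSeries.coeff_C_mul, PowerSeries.coeff_C_mul]
    rcases n with _ | n
    · simp
    · rw [PowerSeries.coeff_succ_X_mul, PowerSeries.coeff_mk, map_sub, PowerSeries.coeff_exp,
        PowerSeries.coeff_one, if_neg n.succ_ne_zero, sub_zero]
  rw [expShiftCoeff, h1, mul_pow, PowerSeries.coeff_X_pow_mul', if_pos le_rfl, Nat.sub_self,
    PowerSeries.coeff_zero_eq_constantCoeff_apply, map_pow, map_mul, PowerSeries.constantCoeff_C,
    ← PowerSeries.coeff_zero_eq_constantCoeff_apply, PowerSeries.coeff_mk]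
  simp

lemma coeff_subst_expShift (z : K) (f : K⟦X⟧) (k : ℕ) :
    PowerSeries.coeff k (PowerSeries.subst (expShift z) f) =
      ∑ l ∈ Finset.range (k + 1), expShiftCoeff z k l * PowerSeries.coeff l f := by
  rw [subst_eq_evalAt (X_dvd_expShift z), evalAt_apply, coeff_adicSum]
  refine Finset.sum_congr rfl fun l _ => ?_
  rw [PowerSeries.coeff_C_mul, expShiftCoeff, mul_comm]

lemma coeff_qSummand_expSer {z z' : K} (hzz : z * z' = 1) (I J k : ℕ) :
    PowerSeries.coeff k (qSummand (expSer z) (expNegSer z') I J) =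
      ∑ l ∈ Finset.range (k + 1), expShiftCoeff z k l * PowerSeries.coeff l (shiftArray z I J) := by
  rw [← coeff_subst_expShift, subst_eq_evalAt (X_dvd_expShift z)]
  congr 1
  set E := evalAt PowerSeries.C (expShift z) (X_dvd_expShift z) with hE
  have h1 : E (shiftSer z) = expSer z := by
    rw [hE, shiftSer, map_add, evalAt_C, evalAt_X, expShift, expSer]
    ring
  have h2 : expSer z * expNegSer z' = 1 := by
    rw [expSer, expNegSer, mul_mul_mul_comm, ← map_mul, hzz, map_one, one_mul]
    exact PowerSeries.exp_mul_exp_neg_eq_one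
  have h3 : E (Ring.inverse (shiftSer z)) = expNegSer z' := by
    have h4 := congrArg E (Ring.inverse_mul_cancel _
      (isUnit_shiftSer (isUnit_iff_ne_zero.2 (left_ne_zero_of_mul_eq_one hzz))))
    rw [map_mul, h1, map_one] at h4
    linear_combination expNegSer z' * h4 - E (Ring.inverse (shiftSer z)) * h2
  rw [shiftArray, map_qSummand, h1, h3]

/-- The passage from powers of q - z to powers of ħ is triangular with diagonal entries z^k. It is
inverted recursively, and represented series are closed under linear combinations. -/
lemma exists_rational_shiftCoeff {m : ℕ} (hm : m ≠ 0) {z i u₀ : K} (hz : IsPrimitiveRoot z m)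
    (hi : i ^ 2 = -1) (hu : u₀ ^ m = -1) (k : ℕ) : ∃ τ : ℕ → ℕ → TRing K,
      ∀ r < m, ∀ s < m, TRing.Represents (τ r s) fun I J =>
        PowerSeries.coeff k (shiftArray z (m * I + r) (m * J + s)) := by
  have hz0 : z ^ k ≠ 0 := pow_ne_zero _ (hz.ne_zero hm)
  have hzz : z * z ^ (m - 1) = 1 := by
    rw [← pow_succ', Nat.sub_add_cancel (Nat.one_le_iff_ne_zero.2 hm), hz.pow_eq_one]
  induction k using Nat.strong_induction_on with
  | _ k ih =>
    replace ih := fun l (hl : l < k) => ih l hl (pow_ne_zero _ (hz.ne_zero hm))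
    choose! τ hτ using ih
    obtain ⟨τ', hτ', -⟩ := exists_rational_coeff hm hz hi hu k
    refine ⟨fun r s => ∑ l ∈ Finset.range (k + 1), TRing.const K (if l < k then
      -((z ^ k)⁻¹ * expShiftCoeff z k l) else (z ^ k)⁻¹) * (if l < k then τ l r s else τ' r s), ?_⟩
    intro r hr s hs
    convert TRing.Represents.sum (s := Finset.range (k + 1)) (fun l => if l < k then
      -((z ^ k)⁻¹ * expShiftCoeff z k l) else (z ^ k)⁻¹) (g := fun l I J => if l < k then
        PowerSeries.coeff l (shiftArray z (m * I + r) (m * J + s)) else PowerSeries.coeff k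
        (qSummand (expSer z) (expNegSer (z ^ (m - 1))) (m * I + r) (m * J + s))) ?_ using 1
    · ext I J
      have hY := coeff_qSummand_expSer hzz (m * I + r) (m * J + s) k
      rw [Finset.sum_range_succ, expShiftCoeff_self] at hY
      generalize PowerSeries.coeff k
        (qSummand (expSer z) (expNegSer (z ^ (m - 1))) (m * I + r) (m * J + s)) = Y at hY ⊢
      rw [Finset.sum_range_succ, if_neg (lt_irrefl k), if_neg (lt_irrefl k)]
      have : ∀ l ∈ Finset.range k, (if l < k then -((z ^ k)⁻¹ * expShiftCoeff z k l)
          else (z ^ k)⁻¹) * (if l < k then PowerSeries.coeff l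
            (shiftArray z (m * I + r) (m * J + s)) else Y) =
          -((z ^ k)⁻¹ * (expShiftCoeff z k l *
            PowerSeries.coeff l (shiftArray z (m * I + r) (m * J + s)))) := by
        intro l hl
        rw [if_pos (Finset.mem_range.1 hl), if_pos (Finset.mem_range.1 hl)]
        ring
      rw [Finset.sum_congr rfl this, Finset.sum_neg_distrib, ← Finset.mul_sum, hY]
      field_simp
      ring
    · intro l _
      split_ifs with h
      · exact hτ l h r hr s hs
      · exact hτ' r hr s hs

end Shifted

/-! ### Descent of rational functions to a ring of coefficients -/

section Integrality

variable {A A' : Type} [CommRing A] [CommRing A']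

lemma map_genSer (f : A →+* A') (t : Fin 2) :
    PowerSeries.map (MvPolynomial.map f) (TRing.genSer A t) = TRing.genSer A' t := by
  rw [TRing.genSer, map_mul, PowerSeries.map_C, PowerSeries.map_X, MvPolynomial.map_X, TRing.genSer]

/-- A rational function represents a double series with coefficients in a subring only if it is
defined over the subring. -/
lemma TRing.Represents.descend {f : A →+* A'} (hf : Function.Injective f) {τ : TRing A'}
    {g : ℕ → ℕ → A} (h : Represents τ fun i j => f (g i j)) : ∃ τ₀ : TRing A, Represents τ₀ g := by
  obtain ⟨P, e, hP⟩ := exists_mul_disc_pow τ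
  have hg : ∀ {R : Type} [CommRing R] (s t : Fin 2),
      IsUnit ((1 - genSer R s) * (1 - genSer R t)) := fun s t =>
    isUnit_of_X_dvd (X_dvd_genSer s) (X_dvd_genSer t)
  have hD : ∀ {R : Type} [CommRing R],
      gen R (disc (coord R 0) (coord R 1)) = disc (genSer R 0) (genSer R 1) := fun {R} _ => by
    rw [map_disc, gen, eval_coord_zero, eval_coord_one]
  set y₀ : (MvPolynomial (Fin 2) A)⟦X⟧ := arraySum (fun i j => PowerSeries.C (MvPolynomial.C (g i j)))
    (ratA (genSer A 0) (genSer A 1)) (ratA (genSer A 1) (genSer A 0)) with hy₀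
  set y := y₀ * disc (genSer A 0) (genSer A 1) ^ e with hy
  set M := PowerSeries.map (MvPolynomial.map (σ := Fin 2) f) with hM
  have hMX : PowerSeries.X ∣ M PowerSeries.X := X_dvd_map_X _
  have hinj : Function.Injective M := fun a b hab => by
    ext1 n
    refine MvPolynomial.map_injective f hf ?_
    have := congrArg (PowerSeries.coeff n) hab
    rwa [hM, PowerSeries.coeff_map, PowerSeries.coeff_map] at this
  have h1 : M y = MvPolynomial.eval₂Hom (PowerSeries.C.comp MvPolynomial.C)
      ![genSer A' 0, genSer A' 1] P := by
    have h2 := congrArg (gen A') hP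
    rw [map_mul, map_pow, hD, h, gen, eval_algebraMap] at h2
    rw [← h2, hy, map_mul, map_pow, hy₀, ringHom_arraySum M hMX _ (X_dvd_ratA (X_dvd_genSer _))
      (X_dvd_ratA (X_dvd_genSer _)), map_disc, map_ratA _ (hg _ _), map_ratA _ (hg _ _), hM,
      map_genSer, map_genSer]
    simp only [PowerSeries.map_C, MvPolynomial.map_C]
  obtain ⟨N, hN⟩ := exists_eq_sum_coeff P
  -- The series times the e-th power of the discriminant is expanded over A, and its image over A'
  -- is the expansion of the polynomial P. Summing its homogeneous parts gives a numerator over A.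
  set P₀ := ∑ n ∈ Finset.range N, PowerSeries.coeff n y with hP₀
  have hPP : MvPolynomial.map f P₀ = P := by
    rw [hN, ← h1, hP₀, map_sum]
    simp only [hM, PowerSeries.coeff_map]
  have h3 : MvPolynomial.eval₂Hom (PowerSeries.C.comp MvPolynomial.C)
      ![genSer A 0, genSer A 1] P₀ = y := by
    refine hinj (Eq.trans ?_ h1.symm)
    rw [← hPP, ← RingHom.comp_apply, ← RingHom.comp_apply]
    refine RingHom.congr_fun (MvPolynomial.ringHom_ext (fun x => ?_) fun t => ?_) P₀
    · simp [hM]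
    · rw [RingHom.comp_apply, RingHom.comp_apply, MvPolynomial.map_X, MvPolynomial.eval₂Hom_X',
        MvPolynomial.eval₂Hom_X']
      fin_cases t
      · exact map_genSer f 0
      · exact map_genSer f 1
  refine ⟨algebraMap _ _ P₀ * Ring.inverse (disc (coord A 0) (coord A 1)) ^ e, ?_⟩
  have hu : IsUnit (disc (genSer A 0) (genSer A 1) ^ e) :=
    (isUnit_disc_of_X_dvd (X_dvd_genSer 0) (X_dvd_genSer 1)).pow e
  refine hu.mul_left_injective ?_
  dsimp only
  rw [← hy₀, ← hy, ← h3, ← hD, ← map_pow, ← map_mul, mul_assoc, ← mul_pow,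
    Ring.inverse_mul_cancel _ isUnit_disc, one_pow, mul_one, gen, eval_algebraMap]

end Integrality

/-! ### The integral system of rational functions -/

section IntegralCoefficients

/-- `τ k r s` are the rational functions that represent the residue classes `(r, s)` modulo `m` of
the coefficients of `(q - z) ^ k` in `q^{-IJ} [I + J, I]_q ^ 2`. -/
def IsCoeffSystem {A : Type} [CommRing A] (m : ℕ) (z : A) (τ : ℕ → ℕ → ℕ → TRing A) : Prop :=
  ∀ k, ∀ r < m, ∀ s < m, TRing.Represents (τ k r s) fun I J =>
    PowerSeries.coeff k (shiftArray z (m * I + r) (m * J + s))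

lemma IsCoeffSystem.map {A A' : Type} [CommRing A] [CommRing A'] (f : A →+* A') {m : ℕ} {z : A}
    (hz : IsUnit z) {τ : ℕ → ℕ → ℕ → TRing A} (h : IsCoeffSystem m z τ) :
    IsCoeffSystem m (f z) fun k r s => TRing.map f (τ k r s) := by
  intro k r hr s hs
  have := (h k r hr s hs).map f
  simpa only [← PowerSeries.coeff_map, map_shiftArray f hz] using this

/-- Since z is a unit, q = z + (q - z) is invertible over A and the series to be represented has
coefficients in A. The rational functions exist over K, where the auxiliary roots i and u₀ of -1 are
available, and descend to A. -/
lemma exists_isCoeffSystem {A K : Type} [CommRing A] [Field K] [CharZero K] [IsAlgClosed K]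
    {f : A →+* K} (hf : Function.Injective f) {m : ℕ} (hm : m ≠ 0) {z : A} (hzu : IsUnit z)
    (hz : IsPrimitiveRoot (f z) m) : ∃ τ, IsCoeffSystem m z τ := by
  obtain ⟨i, hi⟩ := IsAlgClosed.exists_pow_nat_eq (-1 : K) (n := 2) (by norm_num)
  obtain ⟨u₀, hu⟩ := IsAlgClosed.exists_pow_nat_eq (-1 : K) (Nat.pos_of_ne_zero hm)
  have h : ∀ k r s, ∃ τ : TRing A, r < m → s < m → TRing.Represents τ fun I J =>
      PowerSeries.coeff k (shiftArray z (m * I + r) (m * J + s)) := by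
    intro k r s
    by_cases hrs : r < m ∧ s < m
    · obtain ⟨τ, hτ⟩ := exists_rational_shiftCoeff hm hz hi hu k
      have h1 := hτ r hrs.1 s hrs.2
      simp only [← map_shiftArray f hzu, PowerSeries.coeff_map] at h1
      obtain ⟨τ₀, h0⟩ := h1.descend hf
      exact ⟨τ₀, fun _ _ => h0⟩
    · exact ⟨0, fun h1 h2 => absurd ⟨h1, h2⟩ hrs⟩
  choose τ hτ using h
  exact ⟨τ, fun k r hr s hs => hτ k r s hr hs⟩

/-- The coefficients of the symmetrised integral at a point, in terms of the integral rational
functions. -/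
lemma coeff_rPsi_eq_sum {A K : Type} [CommRing A] [Field K] [CharZero K] [IsAlgClosed K]
    (f : A →+* K) {m : ℕ} (hm : m ≠ 0) {z : A} (hzu : IsUnit z) (hz : IsPrimitiveRoot (f z) m)
    {τ : ℕ → ℕ → ℕ → TRing A} (hτ : IsCoeffSystem m z τ) {w₁ w₂ u u' : K}
    (h : IsUnit (disc (w₁ ^ m) (w₂ ^ m))) (huu : u * u' = 1)
    (hu : u ^ m = negProd (w₁ ^ m) (w₂ ^ m)) (k : ℕ) :
    PowerSeries.coeff k (rPsi m (f z) w₁ w₂ u) =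
      ∑ l ∈ Finset.range (k + 1), expShiftCoeff (f z) k l *
        -∑ r ∈ Finset.range m, ∑ s ∈ Finset.range m, (w₁ * u') ^ r * (w₂ * u') ^ s *
          TRing.eval f (w₁ ^ m) (w₂ ^ m) h (τ l r s) := by
  obtain ⟨i, hi⟩ := IsAlgClosed.exists_pow_nat_eq (-1 : K) (n := 2) (by norm_num)
  obtain ⟨u₀, hu₀⟩ := IsAlgClosed.exists_pow_nat_eq (-1 : K) (Nat.pos_of_ne_zero hm)
  obtain ⟨σ, hσ, hev⟩ := exists_rational_coeff hm hz hi hu₀ k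
  have hzz : f z * f z ^ (m - 1) = 1 := by
    rw [← pow_succ', Nat.sub_add_cancel (Nat.one_le_iff_ne_zero.2 hm), hz.pow_eq_one]
  have key : ∀ r < m, ∀ s < m, σ r s = ∑ l ∈ Finset.range (k + 1),
      TRing.const K (expShiftCoeff (f z) k l) * TRing.map f (τ l r s) := by
    intro r hr s hs
    refine (hσ r hr s hs).unique ?_
    simp only [coeff_qSummand_expSer hzz]
    exact TRing.Represents.sum (g := fun l I J => PowerSeries.coeff l
      (shiftArray (f z) (m * I + r) (m * J + s))) _ fun l _ => hτ.map f hzu l r hr s hs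
  rw [hev w₁ w₂ u u' h huu hu]
  simp only [mul_neg, Finset.sum_neg_distrib, Finset.mul_sum]
  congr 1
  conv_rhs => rw [Finset.sum_comm]
  refine Finset.sum_congr rfl fun r hr => ?_
  conv_rhs => rw [Finset.sum_comm]
  refine Finset.sum_congr rfl fun s hs => ?_
  rw [key r (Finset.mem_range.1 hr) s (Finset.mem_range.1 hs), map_sum, Finset.mul_sum]
  refine Finset.sum_congr rfl fun l _ => ?_
  rw [map_mul, TRing.eval_const, TRing.eval_map, RingHom.id_apply, RingHom.id_comp]
  ring

end IntegralCoefficients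

/-! ### Frobenius lifts of points -/

section Frobenius

variable {S S' : Type} [CommRing S] [CommRing S']

/-- The `p`-th power map as a ring homomorphism to a quotient in which `p` vanishes. -/
def frobMod {p : ℕ} (hp : p.Prime) {I : Ideal S} (hI : (p : S) ∈ I) : S →+* S ⧸ I where
  toFun x := Ideal.Quotient.mk I (x ^ p)
  map_one' := by rw [one_pow, map_one]
  map_mul' x y := by rw [mul_pow, map_mul]
  map_zero' := by rw [zero_pow hp.ne_zero, map_zero]
  map_add' x y := by
    obtain ⟨r, hr⟩ := exists_add_pow_prime_eq hp x y
    have h : Ideal.Quotient.mk I (p : S) = 0 := Ideal.Quotient.eq_zero_iff_mem.2 hI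
    rw [hr, map_add, map_add, map_mul, map_mul, map_mul, h]
    ring

lemma frobMod_apply {p : ℕ} (hp : p.Prime) {I : Ideal S} (hI : (p : S) ∈ I) (x : S) :
    frobMod hp hI x = Ideal.Quotient.mk I (x ^ p) := rfl

lemma isUnit_of_isUnit_mk_nilradical {x : S}
    (h : IsUnit (Ideal.Quotient.mk (nilradical S) x)) : IsUnit x := by
  obtain ⟨y, hy⟩ := h.exists_right_inv
  obtain ⟨y, rfl⟩ := Ideal.Quotient.mk_surjective y
  rw [← map_mul, ← map_one (Ideal.Quotient.mk (nilradical S)), Ideal.Quotient.eq,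
    mem_nilradical] at hy
  refine isUnit_of_mul_isUnit_left (y := y) ?_
  have := hy.isUnit_add_one
  rwa [sub_add_cancel] at this

lemma mk_nilradical_eq {x y : S} (h : IsNilpotent (x - y)) :
    Ideal.Quotient.mk (nilradical S) x = Ideal.Quotient.mk (nilradical S) y := by
  rwa [Ideal.Quotient.eq, mem_nilradical]

/-- The point `(c', d')` lifts the Frobenius on the functions `a` and `b` at the point `(c, d)`. -/
structure IsFrobPoint (p : ℕ) (c d c' d' : S) : Prop where
  isUnit : IsUnit (disc c' d')
  ratA_left : ratA c' d' = ratA c d ^ p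
  ratA_right : ratA d' c' = ratA d c ^ p
  left : IsNilpotent (c' - c ^ p)
  right : IsNilpotent (d' - d ^ p)

lemma ratA_mul' {c d : S} (h : IsUnit ((1 - c) * (1 - d))) :
    ratA d c * ((1 - c) * (1 - d)) = -d := by
  rw [mul_comm (1 - c)]
  exact ratA_mul (by rwa [mul_comm])

lemma IsFrobPoint.map {p : ℕ} {c d c' d' : S} (h : IsFrobPoint p c d c' d')
    (hu : IsUnit (disc c d)) (f : S →+* S') : IsFrobPoint p (f c) (f d) (f c') (f d') where
  isUnit := by rw [← map_disc]; exact h.isUnit.map f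
  ratA_left := by
    rw [← map_ratA f (isUnit_of_disc h.isUnit), ← map_ratA f (isUnit_of_disc hu), h.ratA_left,
      map_pow]
  ratA_right := by
    rw [← map_ratA f (isUnit_of_disc (disc_comm c' d' ▸ h.isUnit)),
      ← map_ratA f (isUnit_of_disc (disc_comm c d ▸ hu)), h.ratA_right, map_pow]
  left := by rw [← map_pow, ← map_sub]; exact h.left.map f
  right := by rw [← map_pow, ← map_sub]; exact h.right.map f

/-- The quadratic polynomial with root `(1 - c) (1 - d)`, in terms of `a` and `b`. -/
def frobPoly (a b : S) : S[X] :=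
  Polynomial.C (a * b) * Polynomial.X ^ 2 + Polynomial.C (a + b - 1) * Polynomial.X + 1

lemma aeval_frobPoly (a b E : S) :
    Polynomial.aeval E (frobPoly a b) = a * b * E ^ 2 + (a + b - 1) * E + 1 := by
  simp [frobPoly]

lemma aeval_derivative_frobPoly (a b E : S) :
    Polynomial.aeval E (Polynomial.derivative (frobPoly a b)) = 2 * (a * b * E) + (a + b - 1) := by
  simp [frobPoly]
  ring

/-- From aE = -c and bE = -d it follows that (1 + aE)(1 + bE) = E, which is the equation `frobPoly`
for E = (1 - c)(1 - d), and E times the derivative is -(1 - cd). Modulo the nilradical the p-th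
power map is a homomorphism, so E^p is an approximate simple root of the polynomial for a^p, b^p. -/
lemma frobPoly_root {p : ℕ} (hp : p.Prime) (hpn : IsNilpotent (p : S)) {c d : S}
    (h : IsUnit (disc c d)) : IsNilpotent (Polynomial.aeval (((1 - c) * (1 - d)) ^ p)
    (frobPoly (ratA c d ^ p) (ratA d c ^ p))) ∧
    IsUnit (Polynomial.aeval (((1 - c) * (1 - d)) ^ p)
      (Polynomial.derivative (frobPoly (ratA c d ^ p) (ratA d c ^ p)))) := by
  have hI : (p : S) ∈ nilradical S := mem_nilradical.2 hpn
  have ha := ratA_mul (isUnit_of_disc h)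
  have hb := ratA_mul' (isUnit_of_disc h)
  have hE := isUnit_of_disc h
  have hcd := isUnit_of_mul_isUnit_right h
  set E := (1 - c) * (1 - d) with hEd
  set a := ratA c d
  set b := ratA d c
  have hF : ∀ x, Ideal.Quotient.mk (nilradical S) (x ^ p) = frobMod hp hI x := fun x => rfl
  rw [aeval_frobPoly, aeval_derivative_frobPoly]
  constructor
  · rw [← mem_nilradical, ← Ideal.Quotient.eq_zero_iff_mem]
    simp only [map_add, map_mul, map_sub, map_one, hF, map_pow _ (E ^ p)]
    rw [← map_one (frobMod hp hI), ← map_pow, ← map_mul, ← map_mul, ← map_add, ← map_sub, ← map_mul,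
      ← map_add, ← map_add]
    convert map_zero (frobMod hp hI) using 2
    linear_combination b * E * ha + E * hEd - c * hb + ha + hb - hEd - E * hEd
  · refine isUnit_of_isUnit_mk_nilradical ?_
    simp only [map_add, map_mul, map_sub, map_one, map_ofNat, hF]
    rw [← map_one (frobMod hp hI), ← map_ofNat (frobMod hp hI) 2, ← map_mul, ← map_mul, ← map_mul,
      ← map_add, ← map_sub, ← map_add]
    refine IsUnit.map _ (isUnit_of_mul_isUnit_left (y := E) ?_)
    convert hcd.neg using 1
    linear_combination 2 * b * E * ha + ha + hb - 2 * c * hb - hEd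

/-- Newton's method with nilpotent error lifts E^p to an exact root E'. The point is then c' = -a^p
E', d' = -b^p E', and the quadratic equation gives (1 - c')(1 - d') = E'. -/
lemma exists_isFrobPoint {p : ℕ} (hp : p.Prime) (hpn : IsNilpotent (p : S)) {c d : S}
    (h : IsUnit (disc c d)) : ∃ c' d', IsFrobPoint p c d c' d' := by
  obtain ⟨h1, h2⟩ := frobPoly_root hp hpn h
  obtain ⟨E', ⟨hn, hr⟩, -⟩ := Polynomial.existsUnique_nilpotent_sub_and_aeval_eq_zero h1 h2
  rw [aeval_frobPoly] at hr
  have hI : (p : S) ∈ nilradical S := mem_nilradical.2 hpn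
  have ha := ratA_mul (isUnit_of_disc h)
  have hb := ratA_mul' (isUnit_of_disc h)
  have hE := isUnit_of_disc h
  set E := (1 - c) * (1 - d) with hEd
  set a := ratA c d
  set b := ratA d c
  have hmE : Ideal.Quotient.mk (nilradical S) E' = frobMod hp hI E := (mk_nilradical_eq hn).symm
  have hmc : Ideal.Quotient.mk (nilradical S) (-(a ^ p * E')) = frobMod hp hI c := by
    rw [map_neg, map_mul, hmE, ← frobMod_apply hp hI, ← map_mul, ha, map_neg, neg_neg]
  have hmd : Ideal.Quotient.mk (nilradical S) (-(b ^ p * E')) = frobMod hp hI d := by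
    rw [map_neg, map_mul, hmE, ← frobMod_apply hp hI, ← map_mul, hb, map_neg, neg_neg]
  have hE' : (1 - -(a ^ p * E')) * (1 - -(b ^ p * E')) = E' := by linear_combination hr
  have hu : IsUnit (disc (-(a ^ p * E')) (-(b ^ p * E'))) := by
    refine isUnit_of_isUnit_mk_nilradical ?_
    rw [map_disc, hmc, hmd, ← map_disc]
    exact h.map _
  have huE : IsUnit E' := by rw [← hE']; exact isUnit_of_disc hu
  refine ⟨-(a ^ p * E'), -(b ^ p * E'), hu, ?_, ?_, ?_, ?_⟩
  · refine huE.mul_left_injective ?_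
    have := ratA_mul (isUnit_of_disc hu)
    rw [hE', neg_neg] at this
    exact this
  · refine huE.mul_left_injective ?_
    have := ratA_mul' (isUnit_of_disc hu)
    rw [hE', neg_neg] at this
    exact this
  · rwa [frobMod_apply, Ideal.Quotient.eq, mem_nilradical] at hmc
  · rwa [frobMod_apply, Ideal.Quotient.eq, mem_nilradical] at hmd

/-- A Frobenius point is recovered from (1 - c')(1 - d'), which is the unique root of the quadratic
polynomial at nilpotent distance from E^p. -/
lemma IsFrobPoint.unique {p : ℕ} (hp : p.Prime) (hpn : IsNilpotent (p : S)) {c d : S}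
    (h : IsUnit (disc c d))
    {c' d' c'' d'' : S} (h' : IsFrobPoint p c d c' d')
    (h'' : IsFrobPoint p c d c'' d'') : c' = c'' ∧ d' = d'' := by
  obtain ⟨h1, h2⟩ := frobPoly_root hp hpn h
  have hI : (p : S) ∈ nilradical S := mem_nilradical.2 hpn
  have key : ∀ {x y : S}, IsFrobPoint p c d x y →
      (x = -(ratA c d ^ p * ((1 - x) * (1 - y))) ∧ y = -(ratA d c ^ p * ((1 - x) * (1 - y)))) ∧
      IsNilpotent (((1 - c) * (1 - d)) ^ p - (1 - x) * (1 - y)) ∧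
      Polynomial.aeval ((1 - x) * (1 - y)) (frobPoly (ratA c d ^ p) (ratA d c ^ p)) = 0 := by
    intro x y hxy
    have e1 := ratA_mul (isUnit_of_disc hxy.isUnit)
    have e2 := ratA_mul' (isUnit_of_disc hxy.isUnit)
    rw [hxy.ratA_left] at e1
    rw [hxy.ratA_right] at e2
    refine ⟨⟨by rw [e1, neg_neg], by rw [e2, neg_neg]⟩, ?_, ?_⟩
    · rw [← mem_nilradical, ← Ideal.Quotient.eq, ← frobMod_apply hp hI]
      have m1 := mk_nilradical_eq hxy.left
      have m2 := mk_nilradical_eq hxy.right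
      rw [← frobMod_apply hp hI] at m1 m2
      rw [map_mul, map_sub, map_sub, map_one, map_mul, map_sub, map_sub, map_one, m1, m2]
    · rw [aeval_frobPoly]
      linear_combination ratA d c ^ p * ((1 - x) * (1 - y)) * e1 - x * e2 + e1 + e2
  obtain ⟨⟨a1, a2⟩, a3⟩ := key h'
  obtain ⟨⟨b1, b2⟩, b3⟩ := key h''
  have hE := (Polynomial.existsUnique_nilpotent_sub_and_aeval_eq_zero h1 h2).unique a3 b3
  exact ⟨by rw [a1, hE, ← b1], by rw [a2, hE, ← b2]⟩

end Frobenius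

/-! ### Comparison of expansions at two nearby roots of unity -/

section Gluing

variable {B : Type} [CommRing B]

/-- Both sides expand the same Laurent polynomial in q. The Taylor sum is finite because ε^{k-j} = 0
for k ≥ j + n. -/
lemma coeff_shiftArray_add {z ε : B} (hz : IsUnit z) {n : ℕ} (hε : ε ^ n = 0) (I J j : ℕ) {M : ℕ}
    (hM : j + n ≤ M) :
    PowerSeries.coeff j (shiftArray (z + ε) I J) = ∑ k ∈ Finset.range M,
      (k.choose j : B) * ε ^ (k - j) * PowerSeries.coeff k (shiftArray z I J) := by
  have hG : PowerSeries.HasSubst (PowerSeries.X + PowerSeries.C ε : B⟦X⟧) := by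
    rw [PowerSeries.HasSubst]
    refine ⟨n, ?_⟩
    change PowerSeries.constantCoeff (PowerSeries.X + PowerSeries.C ε : B⟦X⟧) ^ n = 0
    simpa using hε
  have hc : ∀ k, PowerSeries.coeff j ((PowerSeries.X + PowerSeries.C ε : B⟦X⟧) ^ k) =
      (k.choose j : B) * ε ^ (k - j) := by
    intro k
    rw [← Polynomial.coe_X, ← Polynomial.coe_C, ← Polynomial.coe_add, ← Polynomial.coe_pow,
      Polynomial.coeff_coe, Polynomial.coeff_X_add_C_pow, mul_comm]
  have h1 : ∀ f : B⟦X⟧, PowerSeries.coeff j (PowerSeries.subst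
      (PowerSeries.X + PowerSeries.C ε : B⟦X⟧) f) = ∑ k ∈ Finset.range M,
      (k.choose j : B) * ε ^ (k - j) * PowerSeries.coeff k f := by
    intro f
    rw [PowerSeries.coeff_subst' hG, finsum_eq_sum_of_support_subset (s := Finset.range M)]
    · refine Finset.sum_congr rfl fun k _ => ?_
      rw [hc, smul_eq_mul, mul_comm]
    · intro k hk
      rw [Finset.coe_range, Set.mem_Iio]
      by_contra h
      refine hk ?_
      change PowerSeries.coeff k f • PowerSeries.coeff j _ = 0
      rw [hc, pow_eq_zero_of_le (by omega : n ≤ k - j) hε, mul_zero, smul_zero]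
  rw [← h1, ← PowerSeries.coe_substAlgHom hG]
  congr 1
  set F : B⟦X⟧ →+* B⟦X⟧ := (PowerSeries.substAlgHom hG).toRingHom with hF
  change _ = F _
  have h2 : F (shiftSer z) = shiftSer (z + ε) := by
    rw [shiftSer, map_add]
    have e1 : F (PowerSeries.C z) = PowerSeries.C z := (PowerSeries.substAlgHom hG).commutes z
    have e2 : F PowerSeries.X = PowerSeries.X + PowerSeries.C ε := PowerSeries.substAlgHom_X hG
    rw [e1, e2, shiftSer, map_add]
    ring
  rw [shiftArray, shiftArray, map_qSummand, map_ringInverse _ (isUnit_shiftSer hz), h2]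

/-- The expansions at two nearby points `z₀` and `z` are related by the Frobenius. -/
theorem eval_shift_eq_sum {A₀ A : Type} [CommRing A₀] [CommRing A] (f₀ : A₀ →+* B) (f : A →+* B)
    {z₀ : A₀} {z : A} (hz₀ : IsUnit z₀) (hz : IsUnit z) {ε : B} (hzε : f z = f₀ z₀ + ε) {n : ℕ}
    (hε : ε ^ n = 0) {p m : ℕ} (hp : p.Prime) (hpn : IsNilpotent (p : B))
    {τ₀ : ℕ → ℕ → ℕ → TRing A₀} (hτ₀ : IsCoeffSystem m z₀ τ₀)
    {τ : ℕ → ℕ → ℕ → TRing A} (hτ : IsCoeffSystem (m * p) z τ) {c d c' d' : B}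
    (h : IsUnit (disc c d)) (h' : IsFrobPoint p c d c' d') {r s : ℕ} (hr : r < m) (hs : s < m)
    (j : ℕ) {M : ℕ} (hM : j + n ≤ M) :
    ∑ k ∈ Finset.range M, (k.choose j : B) * ε ^ (k - j) * TRing.eval f₀ c d h (τ₀ k r s) =
      ∑ r' ∈ Finset.range p, ∑ s' ∈ Finset.range p, ratA c d ^ r' * ratA d c ^ s' *
        TRing.eval f c' d' h'.isUnit (τ j (m * r' + r) (m * s' + s)) := by
  -- The identity is proved at the generic point, where it can be tested on expansions, and then
  -- specialised to (c, d).
  set x := TRing.coord B 0 with hx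
  set y := TRing.coord B 1 with hy
  have hu : IsUnit (disc x y) := TRing.isUnit_disc
  have hpn' : IsNilpotent (p : TRing B) := by
    have := hpn.map (TRing.const B)
    rwa [map_natCast] at this
  obtain ⟨x', y', hxy⟩ := exists_isFrobPoint hp hpn' hu
  have key : ∑ k ∈ Finset.range M, TRing.const B ((k.choose j : B) * ε ^ (k - j)) *
      TRing.map f₀ (τ₀ k r s) = ∑ r' ∈ Finset.range p, ∑ s' ∈ Finset.range p,
        ratA x y ^ r' * ratA y x ^ s' *
        TRing.eval ((TRing.const B).comp f) x' y' hxy.isUnit (τ j (m * r' + r) (m * s' + s)) := by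
    refine TRing.gen_injective ?_
    have h1 := TRing.Represents.sum (s := Finset.range M)
      (fun k => (k.choose j : B) * ε ^ (k - j)) fun k _ => hτ₀.map f₀ hz₀ k r hr s hs
    have h2 : ∀ I J : ℕ, ∑ k ∈ Finset.range M, (k.choose j : B) * ε ^ (k - j) * PowerSeries.coeff k
        (shiftArray (f₀ z₀) (m * I + r) (m * J + s)) =
        f (PowerSeries.coeff j (shiftArray z (m * I + r) (m * J + s))) := fun I J => by
      rw [← coeff_shiftArray_add (hz₀.map f₀) hε _ _ j hM, ← hzε, ← PowerSeries.coeff_map,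
        map_shiftArray f hz]
    simp only [h2] at h1
    rw [h1]
    set g := TRing.gen B with hg
    have hgx : g x = TRing.genSer B 0 := TRing.eval_coord_zero _ _ _ _
    have hgy : g y = TRing.genSer B 1 := TRing.eval_coord_one _ _ _ _
    have hgC : ∀ t, g (TRing.const B t) = PowerSeries.C (MvPolynomial.C t) := fun t =>
      TRing.eval_const _ _ _ _ t
    have hxy' := hxy.map hu g
    rw [hgx, hgy] at hxy'
    have ha : PowerSeries.X ∣ ratA (TRing.genSer B 0) (TRing.genSer B 1) :=
      TRing.X_dvd_ratA (TRing.X_dvd_genSer _)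
    have hb : PowerSeries.X ∣ ratA (TRing.genSer B 1) (TRing.genSer B 0) :=
      TRing.X_dvd_ratA (TRing.X_dvd_genSer _)
    -- The Frobenius point of the generic point is again near the origin, because x' is a multiple
    -- of a^p. The expansion of τ may therefore be evaluated there.
    have hXx : PowerSeries.X ∣ g x' := by
      have e := ratA_mul (isUnit_of_disc hxy'.isUnit)
      rw [hxy'.ratA_left] at e
      rw [← neg_neg (g x'), ← e]
      exact (dvd_neg).2 ((ha.trans (dvd_pow_self _ hp.ne_zero)).mul_right _)
    have hXy : PowerSeries.X ∣ g y' := by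
      have e := ratA_mul' (isUnit_of_disc hxy'.isUnit)
      rw [hxy'.ratA_right] at e
      rw [← neg_neg (g y'), ← e]
      exact (dvd_neg).2 ((hb.trans (dvd_pow_self _ hp.ne_zero)).mul_right _)
    rw [arraySum_interleave _ ha hb hp.ne_zero]
    simp only [map_sum, map_mul, map_pow]
    refine Finset.sum_congr rfl fun r' hr' => Finset.sum_congr rfl fun s' hs' => ?_
    rw [map_ratA g (isUnit_of_disc hu), map_ratA g (isUnit_of_disc (disc_comm x y ▸ hu)), hgx, hgy,
      TRing.map_eval]
    congr 1
    have hlt : ∀ {r r' : ℕ}, r < m → r' ∈ Finset.range p → m * r' + r < m * p := by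
      intro r r' hr hr'
      have : r' + 1 ≤ p := Finset.mem_range.1 hr'
      calc m * r' + r < m * r' + m := by omega
        _ = m * (r' + 1) := by ring
        _ ≤ m * p := Nat.mul_le_mul_left _ this
    rw [(hτ j _ (hlt hr hr') _ (hlt hs hs')).eval_eq _ hXx hXy, hxy'.ratA_left, hxy'.ratA_right]
    congr 1
    ext1 I
    ext1 J
    simp only [RingHom.comp_apply, hgC]
    rw [show m * (p * I + r') + r = m * p * I + (m * r' + r) by ring,
      show m * (p * J + s') + s = m * p * J + (m * s' + s) by ring]
  -- By uniqueness the specialisation of the generic Frobenius point is (c', d').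
  set G := TRing.eval (RingHom.id B) c d h with hG
  have hGx : G x = c := TRing.eval_coord_zero _ _ _ _
  have hGy : G y = d := TRing.eval_coord_one _ _ _ _
  have hGp := hxy.map hu G
  rw [hGx, hGy] at hGp
  obtain ⟨e1, e2⟩ := hGp.unique hp hpn h h'
  have := congrArg G key
  simp only [map_sum, map_mul, map_pow] at this
  convert this using 1
  · refine Finset.sum_congr rfl fun k _ => ?_
    simp only [hG, TRing.eval_const, TRing.eval_map, RingHom.id_comp, map_natCast]
    simp only [RingHom.id_apply]
  · refine Finset.sum_congr rfl fun r' _ => Finset.sum_congr rfl fun s' _ => ?_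
    rw [map_ratA G (isUnit_of_disc hu), map_ratA G (isUnit_of_disc (disc_comm x y ▸ hu)), hGx, hGy,
      TRing.map_eval]
    subst e1 e2
    have e3 : G.comp ((TRing.const B).comp f) = f :=
      RingHom.ext fun t => TRing.eval_const _ c d h (f t)
    simp only [e3]

end Gluing

/-! ### Points of the curve -/

section Curve

variable {S : Type} [CommRing S]

lemma laurent_ringHom_ext {f g : ℤ[T;T⁻¹] →+* S}
    (h : f (LaurentPolynomial.T 1) = g (LaurentPolynomial.T 1)) : f = g := by
  refine IsLocalization.ringHom_ext (Submonoid.powers (Polynomial.X : ℤ[X])) ?_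
  refine Polynomial.ringHom_ext (fun n => ?_) ?_
  · simp
  · simpa using h

lemma isUnit_xCoord (R : Type) [CommRing R] [Algebra ℤ[T;T⁻¹] R] : IsUnit (xCoord R) :=
  (LaurentPolynomial.isUnit_T 1).map _

lemma eval₂_curvePoly (g : ℤ[T;T⁻¹] →+* S) (y : S) : curvePoly.eval₂ g y =
    g (LaurentPolynomial.T 1) * y + (1 - g (LaurentPolynomial.T 1) ^ 2 * y) * (1 - y) := by
  have h2 : (LaurentPolynomial.T 2 : ℤ[T;T⁻¹]) = LaurentPolynomial.T 1 ^ 2 := by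
    rw [LaurentPolynomial.T_pow]; simp
  simp only [curvePoly, Polynomial.eval₂_add, Polynomial.eval₂_mul, Polynomial.eval₂_sub,
    Polynomial.eval₂_C, Polynomial.eval₂_X, Polynomial.eval₂_one, h2, map_pow,
    Polynomial.eval₂_pow]

lemma map_deltaSq (g : ℤ[T;T⁻¹] →+* S) : g deltaSq = g (LaurentPolynomial.T 1) ^ 2 -
    2 * g (LaurentPolynomial.T 1) - 1 - 2 * g (LaurentPolynomial.T (-1)) +
      g (LaurentPolynomial.T (-1)) ^ 2 := by
  have h2 : (LaurentPolynomial.T 2 : ℤ[T;T⁻¹]) = LaurentPolynomial.T 1 ^ 2 := by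
    rw [LaurentPolynomial.T_pow]; simp
  have h3 : (LaurentPolynomial.T (-2) : ℤ[T;T⁻¹]) = LaurentPolynomial.T (-1) ^ 2 := by
    rw [LaurentPolynomial.T_pow]; simp
  rw [deltaSq, h2, h3, map_add, map_sub, map_sub, map_sub, map_mul, map_mul, map_pow, map_pow,
    map_one, map_ofNat]

lemma map_T_mul (g : ℤ[T;T⁻¹] →+* S) :
    g (LaurentPolynomial.T 1) * g (LaurentPolynomial.T (-1)) = 1 := by
  rw [← map_mul, ← LaurentPolynomial.T_add]; simp

lemma xCoord_curveRing : xCoord CurveRing = algebraMap (AdjoinRoot curvePoly) CurveRing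
    (AdjoinRoot.of curvePoly (LaurentPolynomial.T 1)) := by
  rw [xCoord, IsScalarTower.algebraMap_apply ℤ[T;T⁻¹] (AdjoinRoot curvePoly) CurveRing,
    AdjoinRoot.algebraMap_eq]

/-- The discriminant of the quadratic equation for y. Together with (1 - y)(1 - x²y) = -xy it shows
that inverting y and δ is the same as inverting the discriminant at (y, x²y). -/
lemma disc_of_curve {x y : S} (h : x * y + (1 - x ^ 2 * y) * (1 - y) = 0) (x' : S)
    (hx' : x * x' = 1) : (1 - y * (x ^ 2 * y)) ^ 2 =
      (x * y) ^ 2 * (x ^ 2 - 2 * x - 1 - 2 * x' + x' ^ 2) := by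
  grind

/-- The homomorphism to `S` given by a point of the curve. -/
lemma exists_curveHom (x : S) (hx : IsUnit x) (y : S)
    (h : x * y + (1 - x ^ 2 * y) * (1 - y) = 0) (hd : IsUnit (disc y (x ^ 2 * y))) :
    ∃ f : CurveRing →+* S, f (xCoord CurveRing) = x ∧ f yCoord = y := by
  let g : ℤ[T;T⁻¹] →+* S := LaurentPolynomial.eval₂ (Int.castRingHom S) hx.unit
  have hg1 : g (LaurentPolynomial.T 1) = x := by
    exact (LaurentPolynomial.eval₂_T_n (Int.castRingHom S) hx.unit 1).trans (pow_one x)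
  have hx' := map_T_mul g
  rw [hg1] at hx'
  have he : curvePoly.eval₂ g y = 0 := by rw [eval₂_curvePoly, hg1, h]
  let g' : AdjoinRoot curvePoly →+* S := AdjoinRoot.lift g y he
  have hu : IsUnit (g' (AdjoinRoot.root curvePoly * AdjoinRoot.of curvePoly deltaSq)) := by
    rw [map_mul, AdjoinRoot.lift_root, AdjoinRoot.lift_of, map_deltaSq, hg1]
    have h1 : IsUnit ((1 - y * (x ^ 2 * y)) ^ 2) := (isUnit_of_mul_isUnit_right hd).pow 2
    rw [disc_of_curve h _ hx'] at h1
    have h2 : IsUnit (x * y) := by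
      rw [pow_two, mul_assoc] at h1
      exact isUnit_of_mul_isUnit_left h1
    exact (isUnit_of_mul_isUnit_right h2).mul (isUnit_of_mul_isUnit_right h1)
  refine ⟨IsLocalization.Away.lift _ hu, ?_, ?_⟩
  · rw [xCoord_curveRing, IsLocalization.Away.lift_eq, AdjoinRoot.lift_of, hg1]
  · rw [yCoord, IsLocalization.Away.lift_eq, AdjoinRoot.lift_root]

lemma curveHom_ext {f g : CurveRing →+* S} (hx : f (xCoord CurveRing) = g (xCoord CurveRing))
    (hy : f yCoord = g yCoord) : f = g := by
  refine IsLocalization.ringHom_ext (Submonoid.powers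
    (AdjoinRoot.root curvePoly * AdjoinRoot.of curvePoly deltaSq)) ?_
  refine AdjoinRoot.ringHom_ext (laurent_ringHom_ext ?_) hy
  rw [xCoord_curveRing] at hx
  exact hx

/-- The equation of the curve. -/
lemma curve_eq : xCoord CurveRing * yCoord +
    (1 - xCoord CurveRing ^ 2 * yCoord) * (1 - yCoord) = 0 := by
  have h := AdjoinRoot.eval₂_root curvePoly
  rw [eval₂_curvePoly] at h
  have h' := congrArg (algebraMap (AdjoinRoot curvePoly) CurveRing) h
  rw [xCoord_curveRing, yCoord]
  simpa only [map_add, map_mul, map_sub, map_pow, map_one, map_zero] using h'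

lemma isUnit_yCoord : IsUnit yCoord := by
  have hu : IsUnit (algebraMap (AdjoinRoot curvePoly) CurveRing
      (AdjoinRoot.root curvePoly * AdjoinRoot.of curvePoly deltaSq)) :=
    IsLocalization.Away.algebraMap_isUnit _
  rw [map_mul] at hu
  exact isUnit_of_mul_isUnit_left hu

lemma isUnit_disc_curve : IsUnit (disc yCoord (xCoord CurveRing ^ 2 * yCoord)) := by
  have hu : IsUnit (algebraMap (AdjoinRoot curvePoly) CurveRing
      (AdjoinRoot.root curvePoly * AdjoinRoot.of curvePoly deltaSq)) :=
    IsLocalization.Away.algebraMap_isUnit _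
  rw [map_mul] at hu
  have hx : IsUnit (xCoord CurveRing) := isUnit_xCoord _
  have hy : IsUnit yCoord := isUnit_of_mul_isUnit_left hu
  have hδ := isUnit_of_mul_isUnit_right hu
  let g : ℤ[T;T⁻¹] →+* CurveRing :=
    (algebraMap (AdjoinRoot curvePoly) CurveRing).comp (AdjoinRoot.of curvePoly)
  have hgx : g (LaurentPolynomial.T 1) = xCoord CurveRing := xCoord_curveRing.symm
  have hgd := map_deltaSq g
  have hgx' := map_T_mul g
  rw [hgx] at hgd
  rw [hgx] at hgx'
  have e := disc_of_curve curve_eq _ hgx'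
  have h4 : IsUnit ((1 - yCoord * (xCoord CurveRing ^ 2 * yCoord)) ^ 2) := by
    rw [e, ← hgd]
    exact ((hx.mul hy).pow 2).mul hδ
  have h5 := (isUnit_pow_iff two_ne_zero).1 h4
  refine IsUnit.mul ?_ h5
  have h6 : (1 - yCoord) * (1 - xCoord CurveRing ^ 2 * yCoord) = -(xCoord CurveRing * yCoord) := by
    linear_combination curve_eq
  rw [h6]
  exact (hx.mul hy).neg

/-- On the curve (1 - y)(1 - x²y) = -xy, so a = x⁻¹ and, in the next lemma, b = x. -/
lemma mul_ratA_of_curve {x y : S} (h : x * y + (1 - x ^ 2 * y) * (1 - y) = 0) (hx : IsUnit x)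
    (hy : IsUnit y) : x * ratA y (x ^ 2 * y) = 1 := by
  have h6 : (1 - y) * (1 - x ^ 2 * y) = -(x * y) := by linear_combination h
  have h7 : IsUnit ((1 - y) * (1 - x ^ 2 * y)) := by rw [h6]; exact (hx.mul hy).neg
  refine hy.mul_left_injective ?_
  have := ratA_mul h7
  rw [h6] at this
  linear_combination -this

lemma ratA_of_curve {x y : S} (h : x * y + (1 - x ^ 2 * y) * (1 - y) = 0) (hx : IsUnit x)
    (hy : IsUnit y) : ratA (x ^ 2 * y) y = x := by
  have h6 : (1 - y) * (1 - x ^ 2 * y) = -(x * y) := by linear_combination h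
  have h7 : IsUnit ((1 - y) * (1 - x ^ 2 * y)) := by rw [h6]; exact (hx.mul hy).neg
  refine (hx.mul hy).mul_left_injective ?_
  have := ratA_mul' h7
  rw [h6] at this
  linear_combination -this

/-- A point is on the curve as soon as the rational functions have the right values. -/
lemma curve_of_ratA {x x' c d : S} (hx : x * x' = 1) (hd : IsUnit (disc c d)) (h : ratA c d = x')
    (h' : ratA d c = x) : d = x ^ 2 * c ∧ x * c + (1 - x ^ 2 * c) * (1 - c) = 0 := by
  have h1 := ratA_mul (isUnit_of_disc hd)
  have h2 := ratA_mul' (isUnit_of_disc hd)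
  rw [h] at h1
  rw [h'] at h2
  have h3 : d = x ^ 2 * c := by
    linear_combination h2 - x ^ 2 * h1 + x * (1 - c) * (1 - d) * hx
  refine ⟨h3, ?_⟩
  rw [← h3]
  linear_combination x * h1 - (1 - c) * (1 - d) * hx
end Curve

/-! ### Homomorphisms from the level rings -/

section LevelHom

variable {R T : Type} [CommRing R] [Algebra ℤ[T;T⁻¹] R] [CommRing T] {m : ℕ+} {z : ℂ}

namespace LevelRing

lemma xRoot_pow : (xRoot m z : LevelRing R m z) ^ (m : ℕ) = ofBase m z (xCoord R) := by
  have h := AdjoinRoot.eval₂_root (rootPoly R m z)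
  rw [eval₂_rootPoly, sub_eq_zero] at h
  exact h

lemma ringHom_ext {F G : LevelRing R m z →+* T} (hb : ∀ r, F (ofBase m z r) = G (ofBase m z r))
    (hc : ∀ c, F (ofCyc m z c) = G (ofCyc m z c)) (hx : F (xRoot m z) = G (xRoot m z)) :
    F = G := by
  refine AdjoinRoot.ringHom_ext (RingHom.ext fun t => ?_) hx
  induction t using TensorProduct.induction_on with
  | zero => rw [map_zero, map_zero]
  | tmul r c =>
    have : r ⊗ₜ[ℤ] c = (r ⊗ₜ[ℤ] 1) * (1 ⊗ₜ[ℤ] c) := by simp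
    rw [this, map_mul, map_mul]
    exact congrArg₂ _ (hb r) (hc c)
  | add s t hs ht => rw [map_add, map_add, hs, ht]

lemma exists_hom (χ : R →+* T) (g : IntAdjoin z →+* T) (u : T)
    (hu : u ^ (m : ℕ) = χ (xCoord R)) : ∃ F : LevelRing R m z →+* T,
      (∀ r, F (ofBase m z r) = χ r) ∧ (∀ c, F (ofCyc m z c) = g c) ∧ F (xRoot m z) = u := by
  let l : R ⊗[ℤ] IntAdjoin z →+* T :=
    (Algebra.TensorProduct.lift χ.toIntAlgHom g.toIntAlgHom fun _ _ => Commute.all _ _).toRingHom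
  have hl : ∀ r c, l (r ⊗ₜ[ℤ] c) = χ r * g c := fun r c => rfl
  refine ⟨AdjoinRoot.lift l u ?_, fun r => ?_, fun c => ?_, ?_⟩
  · rw [eval₂_rootPoly, hl, map_one, mul_one, hu, sub_self]
  · refine (AdjoinRoot.lift_of _).trans ((hl r 1).trans ?_)
    rw [map_one, mul_one]
  · refine (AdjoinRoot.lift_of _).trans ((hl 1 c).trans ?_)
    rw [map_one, one_mul]
  · exact AdjoinRoot.lift_root _

end LevelRing

end LevelHom

/-! ### The Frobenius on the level rings -/

section LevelFrobenius

variable {T T' : Type} [CommRing T] [CommRing T'] {m : ℕ+} {z : ℂ}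

lemma isUnit_of_disc' {c d : T} (h : IsUnit (disc c d)) : IsUnit ((1 - d) * (1 - c)) := by
  rw [mul_comm]; exact isUnit_of_disc h

namespace LevelRing

/-- The first coordinate `c = y` of the point of `TRing`. -/
def ptLeft (m : ℕ+) (z : ℂ) : LevelRing CurveRing m z := ofBase m z yCoord

/-- The second coordinate `d = x² y` of the point of `TRing`. -/
def ptRight (m : ℕ+) (z : ℂ) : LevelRing CurveRing m z :=
  ofBase m z (xCoord CurveRing ^ 2 * yCoord)

lemma isUnit_disc_pt : IsUnit (disc (ptLeft m z) (ptRight m z)) := by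
  rw [ptLeft, ptRight, ← map_disc]
  exact isUnit_disc_curve.map _

lemma isUnit_xRoot : IsUnit (xRoot m z : LevelRing CurveRing m z) := by
  refine (isUnit_pow_iff m.ne_zero).1 ?_
  rw [xRoot_pow]
  exact (isUnit_xCoord _).map _

lemma ratA_left_pt :
    (xRoot m z : LevelRing CurveRing m z) ^ (m : ℕ) * ratA (ptLeft m z) (ptRight m z) = 1 := by
  rw [xRoot_pow, ptLeft, ptRight, ← map_ratA _ (isUnit_of_disc isUnit_disc_curve), ← map_mul,
    mul_ratA_of_curve curve_eq (isUnit_xCoord _) isUnit_yCoord, map_one]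

lemma ratA_right_pt : ratA (ptRight m z) (ptLeft m z) = xRoot m z ^ (m : ℕ) := by
  rw [xRoot_pow, ptLeft, ptRight,
    ← map_ratA _ (isUnit_of_disc' isUnit_disc_curve),
    ratA_of_curve curve_eq (isUnit_xCoord _) isUnit_yCoord]

/-- `F` is the lift of the Frobenius to a homomorphism to `T`, relative to `ρ`. -/
structure IsFrobHom (p : ℕ) (ρ F : LevelRing CurveRing m z →+* T) : Prop where
  map_xRoot : F (xRoot m z) = ρ (xRoot m z) ^ p
  map_cyc : ∀ c, F (ofCyc m z c) = ρ (ofCyc m z c)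
  point : IsFrobPoint p (ρ (ptLeft m z)) (ρ (ptRight m z)) (F (ptLeft m z)) (F (ptRight m z))

lemma isUnit_map_disc (ρ : LevelRing CurveRing m z →+* T) :
    IsUnit (disc (ρ (ptLeft m z)) (ρ (ptRight m z))) := by
  rw [← map_disc]; exact isUnit_disc_pt.map ρ

lemma IsFrobHom.comp {p : ℕ} {ρ F : LevelRing CurveRing m z →+* T} (h : IsFrobHom p ρ F)
    (σ : T →+* T') : IsFrobHom p (σ.comp ρ) (σ.comp F) where
  map_xRoot := by rw [RingHom.comp_apply, h.map_xRoot, map_pow]; rfl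
  map_cyc c := by rw [RingHom.comp_apply, h.map_cyc]; rfl
  point := h.point.map (isUnit_map_disc ρ) σ

lemma IsFrobHom.unique {p : ℕ} (hp : p.Prime) (hpn : IsNilpotent (p : T))
    {ρ F G : LevelRing CurveRing m z →+* T} (h : IsFrobHom p ρ F) (h' : IsFrobHom p ρ G) :
    F = G := by
  have hx : F (xRoot m z) = G (xRoot m z) := h.map_xRoot.trans h'.map_xRoot.symm
  refine ringHom_ext (fun r => ?_) (fun c => (h.map_cyc c).trans (h'.map_cyc c).symm) hx
  have : F.comp (ofBase m z) = G.comp (ofBase m z) := by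
    refine curveHom_ext ?_ (h.point.unique hp hpn (isUnit_map_disc ρ) h'.point).1
    rw [RingHom.comp_apply, RingHom.comp_apply, ← xRoot_pow, map_pow, map_pow, hx]
  exact RingHom.congr_fun this r

/-- At the Frobenius point of (y, x²y) the functions a and b have the values x^{-p} and x^p, so by
`curve_of_ratA` it lies on the curve again, over x^p. It therefore defines a homomorphism on
`CurveRing`, which extends to the level ring by x^{1/m} ↦ (x^{1/m})^p. -/
lemma exists_isFrobHom {p : ℕ} (hp : p.Prime) (hpn : IsNilpotent (p : T))
    (ρ : LevelRing CurveRing m z →+* T) : ∃ F, IsFrobHom p ρ F := by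
  obtain ⟨c', d', h⟩ := exists_isFrobPoint hp hpn (isUnit_map_disc ρ)
  have hl := congrArg ρ (ratA_left_pt (m := m) (z := z))
  have hr := congrArg ρ (ratA_right_pt (m := m) (z := z))
  rw [map_mul, map_pow, map_ratA ρ (isUnit_of_disc isUnit_disc_pt), map_one] at hl
  rw [map_pow, map_ratA ρ (isUnit_of_disc' isUnit_disc_pt)] at hr
  have hxx : (ρ (xRoot m z) ^ p) ^ (m : ℕ) * ratA (ρ (ptLeft m z)) (ρ (ptRight m z)) ^ p = 1 := by
    rw [pow_right_comm, ← mul_pow, hl, one_pow]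
  obtain ⟨hd, hc⟩ := curve_of_ratA hxx h.isUnit h.ratA_left
    (h.ratA_right.trans (by rw [hr, pow_right_comm]))
  obtain ⟨χ, hχx, hχy⟩ := exists_curveHom ((ρ (xRoot m z) ^ p) ^ (m : ℕ))
    ((((isUnit_xRoot (m := m) (z := z)).map ρ).pow p).pow _) c' hc (by rw [← hd]; exact h.isUnit)
  obtain ⟨F, hF1, hF2, hF3⟩ := exists_hom (m := m) χ (ρ.comp (ofCyc m z)) (ρ (xRoot m z) ^ p)
    hχx.symm
  refine ⟨F, hF3, hF2, ?_⟩
  have e1 : F (ptLeft m z) = c' := (hF1 _).trans hχy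
  have e2 : F (ptRight m z) = d' := (hF1 _).trans (by rw [map_mul, map_pow, hχx, hχy, ← hd])
  rwa [e1, e2]

/-- In characteristic `p` the lift of the Frobenius is the `p`-th power map on the base. -/
lemma IsFrobHom.map_ofBase {p : ℕ} (hp : p.Prime) {J : Ideal (LevelRing CurveRing m z)}
    (hJ : (p : LevelRing CurveRing m z) ∈ J) {F : LevelRing CurveRing m z →+* _}
    (h : IsFrobHom p (Ideal.Quotient.mk J) F) (r : CurveRing) :
    F (ofBase m z r) = Ideal.Quotient.mk J (ofBase m z r ^ p) := by
  have hpn : IsNilpotent (p : LevelRing CurveRing m z ⧸ J) := by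
    rw [← map_natCast (Ideal.Quotient.mk J), Ideal.Quotient.eq_zero_iff_mem.2 hJ]
    exact IsNilpotent.zero
  have hfp : IsFrobPoint p (Ideal.Quotient.mk J (ptLeft m z)) (Ideal.Quotient.mk J (ptRight m z))
      (frobMod hp hJ (ptLeft m z)) (frobMod hp hJ (ptRight m z)) := by
    refine ⟨?_, ?_, ?_, ?_, ?_⟩
    · rw [← map_disc]; exact (isUnit_disc_pt (m := m) (z := z)).map _
    · rw [← map_ratA _ (isUnit_of_disc isUnit_disc_pt),
        ← map_ratA _ (isUnit_of_disc isUnit_disc_pt), frobMod_apply, map_pow]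
    · rw [← map_ratA _ (isUnit_of_disc' isUnit_disc_pt),
        ← map_ratA _ (isUnit_of_disc' isUnit_disc_pt), frobMod_apply, map_pow]
    · rw [frobMod_apply, map_pow, sub_self]; exact IsNilpotent.zero
    · rw [frobMod_apply, map_pow, sub_self]; exact IsNilpotent.zero
  have : F.comp (ofBase m z) = (frobMod hp hJ).comp (ofBase m z) := by
    refine curveHom_ext ?_ (h.point.unique hp hpn (isUnit_map_disc _) hfp).1
    rw [RingHom.comp_apply, RingHom.comp_apply, ← xRoot_pow, map_pow, map_pow, h.map_xRoot,
      frobMod_apply, map_pow]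
  exact RingHom.congr_fun this r

end LevelRing

end LevelFrobenius

/-! ### The Frobenius on the p-adic completion -/

section Completion

variable {S : Type} [CommRing S]

/-- The ideal (p) is finitely generated, so the kernel of the projection modulo p^N is p^N times the
completion. -/
lemma mem_span_pow_of_evalₐ_eq_zero (p N : ℕ) {x : PadicCompletion S p}
    (h : AdicCompletion.evalₐ (Ideal.span {(p : S)}) N x = 0) :
    x ∈ Ideal.span {(p : PadicCompletion S p)} ^ N := by
  have h1 : x ∈ (AdicCompletion.eval (Ideal.span {(p : S)}) S N).ker := by
    have h2 : Ideal.span {(p : S)} ^ N ≤ Ideal.span {(p : S)} ^ N • ⊤ := by simp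
    rw [LinearMap.mem_ker, ← AdicCompletion.factor_evalₐ_eq_eval _ x h2, h, map_zero]
  rw [← AdicCompletion.pow_smul_top_eq_ker_eval ⟨{(p : S)}, by simp⟩] at h1
  refine Submodule.smul_induction_on h1 (fun r hr y _ => ?_) fun x y hx hy => add_mem hx hy
  rw [Ideal.span_singleton_pow, Ideal.mem_span_singleton] at hr
  obtain ⟨b, rfl⟩ := hr
  rw [Algebra.smul_def, map_mul, map_pow, map_natCast, mul_assoc]
  exact Ideal.mul_mem_right _ _ (Ideal.pow_mem_pow (Ideal.mem_span_singleton_self _) _)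

lemma natCast_pow_eq_zero (p N : ℕ) : (p : S ⧸ Ideal.span {(p : S)} ^ N) ^ N = 0 := by
  rw [← map_natCast (Ideal.Quotient.mk _), ← map_pow, Ideal.Quotient.eq_zero_iff_mem]
  exact Ideal.pow_mem_pow (Ideal.mem_span_singleton_self _) _

lemma evalₐ_algebraMap (I : Ideal S) (N : ℕ) (s : S) :
    AdicCompletion.evalₐ I N (algebraMap S (AdicCompletion I S) s) = Ideal.Quotient.mk _ s :=
  AdicCompletion.evalₐ_of I N s

lemma evalₐ_eq_mk_of_le {I : Ideal S} {M N : ℕ} (hle : M ≤ N) {x : AdicCompletion I S} {s : S}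
    (h : AdicCompletion.evalₐ I N x = Ideal.Quotient.mk _ s) :
    AdicCompletion.evalₐ I M x = Ideal.Quotient.mk _ s := by
  induction x using AdicCompletion.induction_on with
  | _ a =>
    rw [AdicCompletion.evalₐ_mk] at h ⊢
    rw [← AdicCompletion.Ideal.mk_eq_mk I hle a]
    rw [Ideal.Quotient.eq] at h ⊢
    exact Ideal.pow_le_pow_right hle h

/-- Compatible homomorphisms to the quotients extend to the completion. -/
lemma exists_completionHom (I : Ideal S) (F : ∀ N, S →+* S ⧸ I ^ N)
    (hF : ∀ {M N : ℕ} (hle : M ≤ N), (Ideal.Quotient.factorPow I hle).comp (F N) = F M)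
    (hker : ∀ N, ∀ a ∈ I ^ N, F N a = 0) :
    ∃ φ : AdicCompletion I S →+* AdicCompletion I S, ∀ N s,
      AdicCompletion.evalₐ I N (φ (algebraMap S _ s)) = F N s := by
  let f : ∀ N, AdicCompletion I S →+* S ⧸ I ^ N :=
    fun N => (Ideal.Quotient.lift (I ^ N) (F N) (hker N)).comp (AdicCompletion.evalₐ I N).toRingHom
  have hfm : ∀ N s x, AdicCompletion.evalₐ I N x = Ideal.Quotient.mk _ s → f N x = F N s := by
    intro N s x h
    change Ideal.Quotient.lift (I ^ N) (F N) (hker N) (AdicCompletion.evalₐ I N x) = _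
    rw [h, Ideal.Quotient.lift_mk]
  have hf : ∀ {M N : ℕ} (hle : M ≤ N), (Ideal.Quotient.factorPow I hle).comp (f N) = f M := by
    intro M N hle
    ext x
    obtain ⟨s, hs⟩ := Ideal.Quotient.mk_surjective (AdicCompletion.evalₐ I N x)
    rw [RingHom.comp_apply, hfm N s x hs.symm, hfm M s x (evalₐ_eq_mk_of_le hle hs.symm), ← hF hle]
    rfl
  refine ⟨AdicCompletion.liftRingHom I f hf, fun N s => ?_⟩
  rw [AdicCompletion.evalₐ_liftRingHom]
  exact hfm N s _ (AdicCompletion.evalₐ_of I N s)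

lemma map_eq_zero_of_mem_span_pow {T : Type} [CommRing T] {p N : ℕ} (hT : (p : T) ^ N = 0)
    (F : S →+* T) {a : S} (ha : a ∈ Ideal.span {(p : S)} ^ N) : F a = 0 := by
  rw [Ideal.span_singleton_pow, Ideal.mem_span_singleton] at ha
  obtain ⟨b, rfl⟩ := ha
  rw [map_mul, map_pow, map_natCast, hT, zero_mul]

lemma eq_algebraMap_of_evalₐ {I : Ideal S} {x : AdicCompletion I S} {t : S}
    (h : ∀ N, AdicCompletion.evalₐ I N x = Ideal.Quotient.mk _ t) :
    x = algebraMap S (AdicCompletion I S) t :=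
  AdicCompletion.ext_evalₐ fun N => (h N).trans (evalₐ_algebraMap I N t).symm

lemma sub_algebraMap_mem_of_evalₐ {p N : ℕ} {x : PadicCompletion S p} {t : S}
    (h : AdicCompletion.evalₐ (Ideal.span {(p : S)}) N x = Ideal.Quotient.mk _ t) :
    x - algebraMap S (PadicCompletion S p) t ∈ Ideal.span {(p : PadicCompletion S p)} ^ N :=
  mem_span_pow_of_evalₐ_eq_zero p N (by rw [map_sub, h, evalₐ_algebraMap, sub_self])

open LevelRing in
/-- The Frobenius of the completion. -/
lemma exists_isFrobenius (p m : ℕ+) (hp : (p : ℕ).Prime) (z : ℂ) :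
    ∃ φ : PadicCompletion (LevelRing CurveRing m z) p →+*
        PadicCompletion (LevelRing CurveRing m z) p, IsFrobenius p m z φ ∧
      ∀ N, ∃ F, IsFrobHom p (Ideal.Quotient.mk
          (Ideal.span {((p : ℕ) : LevelRing CurveRing m z)} ^ N)) F ∧ ∀ s, AdicCompletion.evalₐ
            (Ideal.span {((p : ℕ) : LevelRing CurveRing m z)}) N (φ (algebraMap _ _ s)) = F s := by
  choose F hF using fun N => exists_isFrobHom (m := m) (z := z) hp ⟨N, natCast_pow_eq_zero (p : ℕ) N⟩
    (Ideal.Quotient.mk (Ideal.span {((p : ℕ) : LevelRing CurveRing m z)} ^ N))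
  obtain ⟨φ, hφ⟩ := exists_completionHom _ F (fun {M N} hle => by
      -- The lifts modulo different powers of p are compatible because each is unique.
      refine IsFrobHom.unique hp ⟨M, natCast_pow_eq_zero _ M⟩ ?_ (hF M)
      have := (hF N).comp (Ideal.Quotient.factorPow _ hle)
      rwa [Ideal.Quotient.factor_comp_mk] at this)
    fun N a ha => map_eq_zero_of_mem_span_pow (natCast_pow_eq_zero _ N) _ ha
  refine ⟨φ, ⟨?_, ?_, ?_⟩, fun N => ⟨F N, hF N, hφ N⟩⟩
  · rw [← map_pow]
    refine eq_algebraMap_of_evalₐ fun N => ?_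
    exact (hφ N _).trans ((hF N).map_xRoot.trans (RingHom.map_pow _ _ _).symm)
  · exact fun c => eq_algebraMap_of_evalₐ fun N => (hφ N _).trans ((hF N).map_cyc c)
  · intro r
    have hJ : ((p : ℕ) : LevelRing CurveRing m z) ∈
        Ideal.span {((p : ℕ) : LevelRing CurveRing m z)} ^ 1 := by
      rw [pow_one]; exact Ideal.mem_span_singleton_self _
    have := sub_algebraMap_mem_of_evalₐ ((hφ 1 _).trans ((hF 1).map_ofBase hp hJ r))
    rwa [RingHom.map_pow, pow_one] at this

end Completion

/-! ### Compatible roots of unity -/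

section Roots

/-- Write m = p^r n with n prime to p. Then ζ_{pm} and ζ_m have the same component ζ_n, and their
p-primary components are killed by the power p^{r+1}. -/
lemma IsCompatibleRoots.exists_pow_eq {ζ : ℕ+ → ℂ} (hζ : IsCompatibleRoots ζ) (p m : ℕ+)
    (hp : (p : ℕ).Prime) : ∃ e : ℕ, ζ (p * m) ^ (p : ℕ) ^ e = ζ m ^ (p : ℕ) ^ e := by
  obtain ⟨r, n, hn, hm⟩ := Nat.exists_eq_pow_mul_and_not_dvd m.ne_zero (p : ℕ) hp.ne_one
  have hn0 : 0 < n := Nat.pos_of_ne_zero fun h => hn (h ▸ dvd_zero _)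
  lift n to ℕ+ using hn0
  have hm' : m = p ^ r * n := PNat.eq (by rw [PNat.mul_coe, PNat.pow_coe]; exact hm)
  have hco : ∀ k : ℕ, Nat.Coprime ((p ^ k : ℕ+) : ℕ) n := fun k => by
    rw [PNat.pow_coe]
    exact ((Nat.Prime.coprime_iff_not_dvd hp).2 hn).pow_left k
  have hone : ∀ k, k ≤ r + 1 → ζ (p ^ k) ^ (p : ℕ) ^ (r + 1) = 1 := fun k hk => by
    obtain ⟨j, hj⟩ := Nat.exists_eq_add_of_le hk
    have := (hζ.primitive (p ^ k)).pow_eq_one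
    rw [PNat.pow_coe] at this
    rw [hj, pow_add, pow_mul, this, one_pow]
  refine ⟨r + 1, ?_⟩
  rw [hm', ← mul_assoc, ← pow_succ', hζ.mul_coprime _ _ (hco _), hζ.mul_coprime _ _ (hco _),
    mul_pow, mul_pow, hone _ le_rfl, hone _ (Nat.le_succ r)]

/-- Modulo p the p^e-th power is additive. With the previous lemma this makes ζ_{pm} - ζ_m
topologically nilpotent, which the re-expansion requires. -/
lemma sub_pow_mem_span_of_pow_eq {S : Type} [CommRing S] {p : ℕ} (hp : p.Prime) {x y : S} {e : ℕ}
    (h : x ^ p ^ e = y ^ p ^ e) : (x - y) ^ p ^ e ∈ Ideal.span {(p : S)} := by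
  obtain ⟨r, hr⟩ := exists_add_pow_prime_pow_eq hp (x - y) y e
  rw [sub_add_cancel, h] at hr
  rw [Ideal.mem_span_singleton]
  exact ⟨-((x - y) * y * r), by linear_combination -hr⟩

/-- A nonzero ideal of a domain integral over ℤ meets ℤ nontrivially, which characteristic zero
excludes for the kernel. Hence ζ_m keeps its exact order at every geometric point. -/
lemma injective_of_isIntegral {A K : Type} [CommRing A] [IsDomain A] [Algebra.IsIntegral ℤ A]
    [Field K] [CharZero K] (f : A →+* K) : Function.Injective f := by
  rw [RingHom.injective_iff_ker_eq_bot]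
  refine Ideal.eq_bot_of_comap_eq_bot (R := ℤ) ?_
  rw [eq_bot_iff]
  intro n hn
  rw [Ideal.mem_comap, RingHom.mem_ker, eq_intCast, map_intCast, Int.cast_eq_zero] at hn
  exact hn

lemma isIntegral_intAdjoin {z : ℂ} {m : ℕ} (hm : m ≠ 0) (hz : z ^ m = 1) :
    Algebra.IsIntegral ℤ (IntAdjoin z) := by
  refine Algebra.IsIntegral.adjoin fun x hx => ?_
  rw [Set.mem_singleton_iff.1 hx]
  refine IsIntegral.of_pow (Nat.pos_of_ne_zero hm) ?_
  rw [hz]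
  exact isIntegral_one

lemma isPrimitiveRoot_gen {z : ℂ} {m : ℕ} (hz : IsPrimitiveRoot z m) :
    IsPrimitiveRoot (IntAdjoin.gen z) m :=
  IsPrimitiveRoot.of_map_of_injective (f := (IntAdjoin z).val) hz Subtype.val_injective

lemma isUnit_gen {z : ℂ} {m : ℕ} (hm : m ≠ 0) (hz : IsPrimitiveRoot z m) :
    IsUnit (IntAdjoin.gen z) :=
  (isPrimitiveRoot_gen hz).isUnit hm

end Roots

section LevelInclusion

variable {R : Type} [CommRing R] [Algebra ℤ[T;T⁻¹] R] {ζ : ℕ+ → ℂ} (hζ : IsCompatibleRoots ζ)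
  (k m : ℕ+)

lemma levelInclusion_ofBase (r : R) : levelInclusion hζ k m (LevelRing.ofBase m (ζ m) r) =
    LevelRing.ofBase (k * m) (ζ (k * m)) r := by
  refine (AdjoinRoot.lift_of _).trans ?_
  change AdjoinRoot.of _ _ = AdjoinRoot.of _ _
  congr 1

lemma levelInclusion_ofCyc (c : IntAdjoin (ζ m)) :
    (levelInclusion hζ k m (LevelRing.ofCyc m (ζ m) c) : LevelRing R (k * m) (ζ (k * m))) =
      LevelRing.ofCyc (k * m) (ζ (k * m)) (Subalgebra.inclusion (hζ.adjoin_le k m) c) :=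
  AdjoinRoot.lift_of _

lemma levelInclusion_xRoot : (levelInclusion hζ k m (LevelRing.xRoot m (ζ m)) :
    LevelRing R (k * m) (ζ (k * m))) = LevelRing.xRoot (k * m) (ζ (k * m)) ^ (k : ℕ) :=
  AdjoinRoot.lift_root _

lemma exists_zeta_sub_pow_mem (p : ℕ+) (hp : (p : ℕ).Prime) : ∃ e : ℕ,
    (LevelRing.zeta (p * m) (ζ (p * m)) - levelInclusion hζ p m (LevelRing.zeta m (ζ m)) :
      LevelRing R (p * m) (ζ (p * m))) ^ e ∈
        Ideal.span {((p : ℕ) : LevelRing R (p * m) (ζ (p * m)))} := by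
  obtain ⟨e, he⟩ := hζ.exists_pow_eq p m hp
  refine ⟨(p : ℕ) ^ e, sub_pow_mem_span_of_pow_eq hp ?_⟩
  rw [LevelRing.zeta, LevelRing.zeta, levelInclusion_ofCyc, ← RingHom.map_pow, ← RingHom.map_pow]
  refine congrArg _ (Subtype.ext ?_)
  exact he

end LevelInclusion

/-! ### Residue sums with fractional powers of x -/

section ResidueSum

variable {A A₀ B B' : Type} [CommRing A] [CommRing A₀] [CommRing B] [CommRing B']

/-- The combination of the rational functions `τ r s` with the fractional powers `x^{(s-r)/m}`,
where `X` is an `m`-th root of `x` with inverse `X'`. -/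
def residueSum (m : ℕ) (f : A →+* B) (X X' c d : B) (h : IsUnit (disc c d))
    (τ : ℕ → ℕ → TRing A) : B :=
  -∑ r ∈ Finset.range m, ∑ s ∈ Finset.range m, X' ^ r * X ^ s * TRing.eval f c d h (τ r s)

lemma map_residueSum (g : B →+* B') (m : ℕ) (f : A →+* B) (X X' c d : B) (h : IsUnit (disc c d))
    (τ : ℕ → ℕ → TRing A) : g (residueSum m f X X' c d h τ) =
      residueSum m (g.comp f) (g X) (g X') (g c) (g d) (by rw [← map_disc]; exact h.map g) τ := by
  simp only [residueSum, map_neg, map_sum, map_mul, map_pow, TRing.map_eval]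

/-- The re-expansion of the residue sums at a nearby point. -/
theorem residueSum_shift (f₀ : A₀ →+* B) (f : A →+* B)
    {z₀ : A₀} {z : A} (hz₀ : IsUnit z₀) (hz : IsUnit z) {ε : B} (hzε : f z = f₀ z₀ + ε) {n : ℕ}
    (hε : ε ^ n = 0) {p m : ℕ} (hp : p.Prime) (hpn : IsNilpotent (p : B))
    {τ₀ : ℕ → ℕ → ℕ → TRing A₀} (hτ₀ : IsCoeffSystem m z₀ τ₀)
    {τ : ℕ → ℕ → ℕ → TRing A} (hτ : IsCoeffSystem (m * p) z τ) {c d c' d' : B}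
    (h : IsUnit (disc c d)) (h' : IsFrobPoint p c d c' d') {X X' : B}
    (hX' : ratA c d = (X' ^ p) ^ m) (hX : ratA d c = (X ^ p) ^ m)
    (j : ℕ) {M : ℕ} (hM : j + n ≤ M) :
    ∑ k ∈ Finset.range M, (k.choose j : B) * ε ^ (k - j) *
        residueSum m f₀ (X ^ p) (X' ^ p) c d h (τ₀ k) =
      residueSum (m * p) f (X ^ p) (X' ^ p) c' d' h'.isUnit (τ j) := by
  simp only [residueSum, sum_range_mul, mul_neg, Finset.sum_neg_distrib, Finset.mul_sum]
  congr 1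
  rw [Finset.sum_comm]
  refine Finset.sum_congr rfl fun r hr => ?_
  -- Since a = (X'^p)^m, the factor a^{r'} combines with (X'^p)^r to the exponent m r' + r, a
  -- residue modulo mp; similarly for b and s.
  have key : ∀ s ∈ Finset.range m, ∑ k ∈ Finset.range M, (k.choose j : B) * ε ^ (k - j) *
      ((X' ^ p) ^ r * (X ^ p) ^ s * TRing.eval f₀ c d h (τ₀ k r s)) =
      ∑ r' ∈ Finset.range p, ∑ s' ∈ Finset.range p,
        (X' ^ p) ^ (m * r' + r) * (X ^ p) ^ (m * s' + s) *
          TRing.eval f c' d' h'.isUnit (τ j (m * r' + r) (m * s' + s)) := by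
    intro s hs
    have := congrArg ((X' ^ p) ^ r * (X ^ p) ^ s * ·) (eval_shift_eq_sum f₀ f hz₀ hz hzε hε hp
      hpn hτ₀ hτ h h' (Finset.mem_range.1 hr) (Finset.mem_range.1 hs) j hM)
    simp only [Finset.mul_sum, hX', hX] at this
    refine (Finset.sum_congr rfl fun k _ => ?_).trans (this.trans ?_)
    · ring
    · refine Finset.sum_congr rfl fun r' _ => Finset.sum_congr rfl fun s' _ => ?_
      rw [pow_add _ (m * r'), pow_add _ (m * s'), pow_mul _ m r', pow_mul _ m s']
      ring
  rw [Finset.sum_comm, Finset.sum_congr rfl key, Finset.sum_comm]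

end ResidueSum

/-! ### The collection of power series -/

section Collection

open LevelRing

/-- The inverse of `x^{1/m}`. -/
def xRootInv (m : ℕ+) (z : ℂ) : LevelRing CurveRing m z := Ring.inverse (xRoot m z)

lemma xRoot_mul_xRootInv (m : ℕ+) (z : ℂ) :
    (xRoot m z : LevelRing CurveRing m z) * xRootInv m z = 1 :=
  Ring.mul_inverse_cancel _ isUnit_xRoot

/-- The power series in `q - z` with coefficients the residue sums. -/
def residueSeries (m : ℕ+) (z : ℂ) (τ : ℕ → ℕ → ℕ → TRing (IntAdjoin z)) :
    (LevelRing CurveRing m z)⟦X⟧ :=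
  PowerSeries.mk fun k => residueSum m (ofCyc m z) (xRoot m z) (xRootInv m z) (ptLeft m z)
    (ptRight m z) isUnit_disc_pt (τ k)

lemma coeff_map_residueSeries {B : Type} [CommRing B] (m : ℕ+) (z : ℂ)
    (g : LevelRing CurveRing m z →+* B) (τ : ℕ → ℕ → ℕ → TRing (IntAdjoin z)) (k : ℕ) :
    g (PowerSeries.coeff k (residueSeries m z τ)) =
      residueSum m (g.comp (ofCyc m z)) (g (xRoot m z)) (g (xRootInv m z)) (g (ptLeft m z))
        (g (ptRight m z)) (isUnit_map_disc g) (τ k) := by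
  rw [residueSeries, PowerSeries.coeff_mk, map_residueSum]

lemma residueSum_congr {A B : Type} [CommRing A] [CommRing B] (m : ℕ) (f : A →+* B)
    {X₁ X₁' c₁ d₁ X₂ X₂' c₂ d₂ : B} (h₁ : IsUnit (disc c₁ d₁)) (h₂ : IsUnit (disc c₂ d₂))
    (hX : X₁ = X₂) (hX' : X₁' = X₂') (hc : c₁ = c₂) (hd : d₁ = d₂) (τ : ℕ → ℕ → TRing A) :
    residueSum m f X₁ X₁' c₁ d₁ h₁ τ = residueSum m f X₂ X₂' c₂ d₂ h₂ τ := by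
  subst hX hX' hc hd
  rfl

variable {ζ : ℕ+ → ℂ}

/-- The gluing of the expansions, modulo a power of `p`. -/
lemma sum_residueSeries_eq (hζ : IsCompatibleRoots ζ) (p m : ℕ+) (hp : (p : ℕ).Prime)
    {τ₀ : ℕ → ℕ → ℕ → TRing (IntAdjoin (ζ m))} (hτ₀ : IsCoeffSystem m (IntAdjoin.gen (ζ m)) τ₀)
    {τ : ℕ → ℕ → ℕ → TRing (IntAdjoin (ζ (p * m)))}
    (hτ : IsCoeffSystem ((p * m : ℕ+) : ℕ) (IntAdjoin.gen (ζ (p * m))) τ)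
    {B : Type} [CommRing B] (hpn : IsNilpotent ((p : ℕ) : B))
    {ρ F : LevelRing CurveRing (p * m) (ζ (p * m)) →+* B} (hF : IsFrobHom p ρ F) {n : ℕ}
    (hn : ρ (zeta (p * m) (ζ (p * m)) - levelInclusion hζ p m (zeta m (ζ m))) ^ n = 0)
    (j : ℕ) {M : ℕ} (hM : j + n ≤ M) :
    ∑ k ∈ Finset.range M, (k.choose j : B) *
        ρ (zeta (p * m) (ζ (p * m)) - levelInclusion hζ p m (zeta m (ζ m))) ^ (k - j) *
        ρ (levelInclusion hζ p m (PowerSeries.coeff k (residueSeries m (ζ m) τ₀))) =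
      F (PowerSeries.coeff j (residueSeries (p * m) (ζ (p * m)) τ)) := by
  have hpm : ((p * m : ℕ+) : ℕ) = m * p := by rw [PNat.mul_coe, mul_comm]
  rw [hpm] at hτ
  set σ := ρ.comp (levelInclusion hζ p m) with hσ
  set X := ρ (xRoot (p * m) (ζ (p * m))) with hX
  set X' := ρ (xRootInv (p * m) (ζ (p * m))) with hX'
  have hXX : X * X' = 1 := by rw [hX, hX', ← map_mul, xRoot_mul_xRootInv, map_one]
  have inv_eq : ∀ {a b c : B}, a * b = 1 → a * c = 1 → b = c := fun {a b c} h1 h2 => by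
    linear_combination c * h1 - b * h2
  have e1 : σ (xRoot m (ζ m)) = X ^ (p : ℕ) := by
    rw [hσ, RingHom.comp_apply, levelInclusion_xRoot, RingHom.map_pow]
  have e1' : σ (xRootInv m (ζ m)) = X' ^ (p : ℕ) := by
    refine inv_eq (a := σ (xRoot m (ζ m))) ?_ ?_
    · rw [← RingHom.map_mul, xRoot_mul_xRootInv, RingHom.map_one]
    · rw [e1, ← mul_pow, hXX, one_pow]
  have e2 : σ (ptLeft m (ζ m)) = ρ (ptLeft (p * m) (ζ (p * m))) :=
    congrArg ρ (levelInclusion_ofBase hζ p m _)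
  have e3 : σ (ptRight m (ζ m)) = ρ (ptRight (p * m) (ζ (p * m))) :=
    congrArg ρ (levelInclusion_ofBase hζ p m _)
  have e4 : F (xRootInv (p * m) (ζ (p * m))) = X' ^ (p : ℕ) := by
    refine inv_eq (a := F (xRoot (p * m) (ζ (p * m)))) ?_ ?_
    · rw [← RingHom.map_mul, xRoot_mul_xRootInv, RingHom.map_one]
    · rw [hF.map_xRoot, ← mul_pow, hXX, one_pow]
  have e5 : F.comp (ofCyc (p * m) (ζ (p * m))) = ρ.comp (ofCyc (p * m) (ζ (p * m))) :=
    RingHom.ext hF.map_cyc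
  have hl := congrArg ρ (ratA_left_pt (m := p * m) (z := ζ (p * m)))
  have hr := congrArg ρ (ratA_right_pt (m := p * m) (z := ζ (p * m)))
  rw [RingHom.map_mul, RingHom.map_pow, map_ratA ρ (isUnit_of_disc isUnit_disc_pt),
    RingHom.map_one] at hl
  rw [RingHom.map_pow, map_ratA ρ (isUnit_of_disc' isUnit_disc_pt)] at hr
  have hA : ratA (ρ (ptLeft (p * m) (ζ (p * m)))) (ρ (ptRight (p * m) (ζ (p * m)))) =
      (X' ^ (p : ℕ)) ^ (m : ℕ) := by
    refine inv_eq hl ?_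
    rw [hpm, pow_mul', ← mul_pow, ← mul_pow, hXX, one_pow, one_pow]
  have hB : ratA (ρ (ptRight (p * m) (ζ (p * m)))) (ρ (ptLeft (p * m) (ζ (p * m)))) =
      (X ^ (p : ℕ)) ^ (m : ℕ) := by rw [hr, hpm, pow_mul']
  have key := residueSum_shift (σ.comp (ofCyc m (ζ m))) (ρ.comp (ofCyc (p * m) (ζ (p * m))))
    (isUnit_gen m.ne_zero (hζ.primitive m)) (isUnit_gen (p * m).ne_zero (hζ.primitive _))
    (ε := ρ (zeta (p * m) (ζ (p * m)) - levelInclusion hζ p m (zeta m (ζ m))))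
    (by rw [RingHom.map_sub]; exact (add_sub_cancel _ _).symm) hn hp hpn hτ₀ hτ
    (isUnit_map_disc ρ) hF.point hA hB j hM
  refine Eq.trans (Finset.sum_congr rfl fun k _ => congrArg _ ?_) (key.trans ?_)
  · exact (coeff_map_residueSeries m (ζ m) σ τ₀ k).trans (residueSum_congr _ _ _ _ e1 e1' e2 e3 _)
  · rw [coeff_map_residueSeries, e5, hpm]
    exact (residueSum_congr _ _ _ _ hF.map_xRoot e4 rfl rfl _).symm

lemma map_reexpansion {S S' : Type} [CommRing S] [CommRing S'] (g : S →+* S') (ε : S) (a : ℕ → S)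
    (j K : ℕ) : g (∑ k ∈ Finset.range K, (k.choose j : S) * ε ^ (k - j) * a k) =
      ∑ k ∈ Finset.range K, (k.choose j : S') * g ε ^ (k - j) * g (a k) := by
  simp only [map_sum, map_mul, map_pow, map_natCast]

/-- The collection of residue series is in the Habiro ring. -/
lemma residueSeries_mem_habiroRing (hζ : IsCompatibleRoots ζ)
    {τ : ∀ m : ℕ+, ℕ → ℕ → ℕ → TRing (IntAdjoin (ζ m))}
    (hτ : ∀ m : ℕ+, IsCoeffSystem m (IntAdjoin.gen (ζ m)) (τ m)) :
    (fun m => residueSeries m (ζ m) (τ m)) ∈ HabiroRing CurveRing hζ := by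
  intro m p hp
  obtain ⟨φ, hφ, hφF⟩ := exists_isFrobenius p (p * m) hp (ζ (p * m))
  refine ⟨φ, hφ, fun j N => ?_⟩
  obtain ⟨F, hF, hev⟩ := hφF N
  obtain ⟨e, he⟩ := exists_zeta_sub_pow_mem (R := CurveRing) hζ m p hp
  -- If ε^e lies in (p), then ε^{eN} vanishes modulo p^N, so the terms with k ≥ j + eN do not
  -- contribute.
  refine ⟨j + e * N, fun K hK => ?_⟩
  have hn : Ideal.Quotient.mk (Ideal.span {((p : ℕ) :
      LevelRing CurveRing (p * m) (ζ (p * m)))} ^ N) (zeta (p * m) (ζ (p * m)) -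
        levelInclusion hζ p m (zeta m (ζ m))) ^ (e * N) = 0 := by
    rw [← RingHom.map_pow, pow_mul, Ideal.Quotient.eq_zero_iff_mem]
    exact Ideal.pow_mem_pow he N
  have key := sum_residueSeries_eq hζ p m hp (hτ m) (hτ (p * m))
    ⟨N, natCast_pow_eq_zero _ N⟩ hF hn j hK
  have h1 := sub_algebraMap_mem_of_evalₐ (t := ∑ k ∈ Finset.range K,
    (k.choose j : LevelRing CurveRing (p * m) (ζ (p * m))) *
      (zeta (p * m) (ζ (p * m)) - levelInclusion hζ p m (zeta m (ζ m))) ^ (k - j) *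
        levelInclusion hζ p m (PowerSeries.coeff k (residueSeries m (ζ m) (τ m))))
    ((hev (PowerSeries.coeff j (residueSeries (p * m) (ζ (p * m)) (τ (p * m))))).trans
      (key.symm.trans ?_))
  · rw [← neg_mem_iff, neg_sub] at h1
    refine Eq.mp (congrArg (· ∈ _) (congrArg₂ _ ?_ ?_)) h1
    · refine (map_reexpansion _ _ _ _ _).trans (Finset.sum_congr rfl fun k _ => congrArg _ ?_)
      rw [PowerSeries.coeff_map]
      rfl
    · rw [PowerSeries.coeff_map]
      rfl
  · exact (map_reexpansion _ _ _ _ _).symm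

/-- The residue series are the symmetrised perturbative series. -/
lemma isSymSeries_residueSeries (hζ : IsCompatibleRoots ζ)
    {τ : ∀ m : ℕ+, ℕ → ℕ → ℕ → TRing (IntAdjoin (ζ m))}
    (hτ : ∀ m : ℕ+, IsCoeffSystem m (IntAdjoin.gen (ζ m)) (τ m)) :
    IsSymSeries fun m => residueSeries m (ζ m) (τ m) := by
  intro m K _ _ _ ψ w root hw hroot
  have hm : (m : ℕ) ≠ 0 := m.ne_zero
  have := isIntegral_intAdjoin hm (hζ.primitive m).pow_eq_one
  have hz : IsPrimitiveRoot (ψ.comp (ofCyc m (ζ m)) (IntAdjoin.gen (ζ m))) m :=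
    (isPrimitiveRoot_gen (hζ.primitive m)).map_of_injective (injective_of_isIntegral _)
  have hX := isUnit_xRoot.map ψ
  set X := ψ (xRoot m (ζ m)) with hXdef
  have hXm : X ^ (m : ℕ) = ψ (ofBase m (ζ m) (xCoord CurveRing)) := by
    rw [hXdef, ← RingHom.map_pow, xRoot_pow]
  have hc : w ^ (m : ℕ) = ψ (ptLeft m (ζ m)) := hw
  have hd : (w * X ^ 2) ^ (m : ℕ) = ψ (ptRight m (ζ m)) := by
    rw [ptRight, RingHom.map_mul, RingHom.map_mul, RingHom.map_pow, RingHom.map_pow, ← hXm, ← hw]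
    ring
  have hdisc : IsUnit (disc (w ^ (m : ℕ)) ((w * X ^ 2) ^ (m : ℕ))) := by
    rw [hc, hd]; exact isUnit_map_disc ψ
  have hw0 : w ≠ 0 := by
    rintro rfl
    rw [zero_pow hm] at hw
    exact ((isUnit_yCoord.map (ofBase m (ζ m))).map ψ).ne_zero hw.symm
  have hX0 : X ≠ 0 := hX.ne_zero
  have h1 := isUnit_of_mul_isUnit_left (isUnit_of_disc hdisc)
  have h2 := isUnit_of_mul_isUnit_right (isUnit_of_disc hdisc)
  -- With w₂ = wX² and u = wX the critical point equation is the equation of the curve.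
  have hu : (w * X) ^ (m : ℕ) = negProd (w ^ (m : ℕ)) ((w * X ^ 2) ^ (m : ℕ)) := by
    have := congrArg (fun t => ψ (ofBase m (ζ m) t)) curve_eq
    simp only [RingHom.map_add, RingHom.map_mul, RingHom.map_sub, RingHom.map_pow, RingHom.map_one,
      RingHom.map_zero] at this
    rw [← hXm, ← hw] at this
    rw [negProd]
    linear_combination this
  change PowerSeries.subst (expShift (ψ.comp (ofCyc m (ζ m)) (IntAdjoin.gen (ζ m)))) _ =
    symSeries m root (ψ.comp (ofCyc m (ζ m)) (IntAdjoin.gen (ζ m))) X w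
  rw [symSeries_eq_rPsi hm root hroot hz.pow_eq_one
    (fun j => (isUnit_one_sub_mul_of_pow hz.pow_eq_one h1 j).ne_zero)
    (fun j => (isUnit_one_sub_mul_of_pow hz.pow_eq_one h2 j).ne_zero) h1.ne_zero h2.ne_zero]
  ext k
  rw [coeff_subst_expShift, coeff_rPsi_eq_sum (ψ.comp (ofCyc m (ζ m))) hm
    (isUnit_gen hm (hζ.primitive m)) hz (hτ m) hdisc (mul_inv_cancel₀ (mul_ne_zero hw0 hX0)) hu k]
  refine Finset.sum_congr rfl fun l _ => congrArg _ ?_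
  rw [PowerSeries.coeff_map, coeff_map_residueSeries]
  -- The arguments w₁/u and w₂/u of the closed formula are X⁻¹ and X, so the choice of w drops out.
  have e1 : w * (w * X)⁻¹ = ψ (xRootInv m (ζ m)) := by
    have : X * ψ (xRootInv m (ζ m)) = 1 := by
      rw [hXdef, ← RingHom.map_mul, xRoot_mul_xRootInv, RingHom.map_one]
    rw [mul_inv, mul_inv_cancel_left₀ hw0]
    exact inv_eq_of_mul_eq_one_right this
  have e2 : w * X ^ 2 * (w * X)⁻¹ = X := by field_simp
  rw [e1, e2]
  exact residueSum_congr _ _ _ _ rfl rfl hc.symm hd.symm _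

end Collection

end HabiroKnot

end

theorem theorem4p1 (ζ : ℕ+ → ℂ) (hζ : HabiroKnot.IsCompatibleRoots ζ) :
    ∃ f ∈ HabiroKnot.HabiroRing HabiroKnot.CurveRing hζ, HabiroKnot.IsSymSeries f := by
  choose τ hτ using fun m : ℕ+ => HabiroKnot.exists_isCoeffSystem
    (f := (HabiroKnot.IntAdjoin (ζ m)).val.toRingHom) Subtype.val_injective m.ne_zero
    (HabiroKnot.isUnit_gen m.ne_zero (hζ.primitive m)) (hζ.primitive m)
  exact ⟨fun m => HabiroKnot.residueSeries m (ζ m) (τ m),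
    HabiroKnot.residueSeries_mem_habiroRing hζ hτ, HabiroKnot.isSymSeries_residueSeries hζ hτ⟩
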